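/- Let $d\in\{1,2\}$ and let $\Omega=\prod_{i=1}^d(a_i,b_i)\subset\mathbb R^d$ be an open interval ($d=1$) or rectangle ($d=2$) with boundary $\Gamma$, outward unit normal $\mathbf n$ and diameter $L$. Suppose that $\Omega$ is star-shaped with respect to a ball centred at the origin: there is $\gamma>0$ with $\mathbf x\cdot\mathbf n(\mathbf x)\ge\gamma L$ for almost every $\mathbf x\in\Gamma$. For $k>0$, $f\in L^2(\Omega)$, $g\in L^2(\Gamma)$, let $u\in H^1(\Omega)$ solve the interior impedance problem $\mathcal Lu:=\Delta u+k^2u=-f$ in $\Omega$, $\partial_nu-\mathrm iku=g$ on $\Gamma$. Let $\nabla_\Gamma$ be the surface gradient and put $$\|v\|_{H^1_k}^2=\|\nabla v\|_{L^2(\Omega)}^2+k^2\|v\|_{L^2(\Omega)}^2,\qquad |v|_\Gamma^2=\|\partial_nv\|_{L^2(\Gamma)}^2+\|\nabla_\Gamma v\|_{L^2(\Gamma)}^2+k^2\|v\|_{L^2(\Gamma)}^2,$$ $$\|v\|_{V_1}^2=k^{-2}\|\Delta v\|_{L^2(\Omega)}^2+\|v\|_{H^1_k}^2+|v|_\Gamma^2,\qquad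 \|v\|_{V_2}^2=\|\mathcal Lv\|_{L^2(\Omega)}^2+\|v\|_{H^1_k}^2+|v|_\Gamma^2 .$$ With $\mathcal Mv=\mathbf x\cdot\nabla v-\mathrm ik\beta v+\frac{d-1}2v$ and $A=k^2$, the MS formulation has the sesquilinear form and functional $$b(u,v)=\int_\Omega\Big(\nabla u\cdot\overline{\nabla v}+k^2u\overline v+\big(\mathcal Mu+\tfrac A{k^2}\mathcal Lu\big)\overline{\mathcal Lv}\Big)\,d\mathbf x-\int_\Gamma\Big(\mathrm iku\,\overline{\mathcal Mv}+\big(\mathbf x\cdot\nabla_\Gamma u-\mathrm ik\beta u+\tfrac{d-1}2u\big)\overline{\partial_nv}+(\mathbf x\cdot\mathbf n)\big(k^2u\overline v-\nabla_\Gamma u\cdot\overline{\nabla_\Gamma v}\big)\Big)\,ds,$$ $$G(v)=\int_\Omega\big(\overline{\mathcal Mv}-\tfrac A{k^2}\overline{\mathcal Lv}\big)f\,d\mathbf x+\int_\Gamma\overline{\mathcal Mv}\,g\,ds .$$ For a tensor-product mesh of $\Omega$, let $h$ be the largest diameter of an element and let $V_N$ be the space of $C^1$ functions on $\Omega$ that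 are on each element polynomials of degree at most $p$ in each variable, with $p\ge3$ fixed. For any real basis $\phi_1,\dots,\phi_N$ of $V_N$ let $\mathsf B_{ij}=b(\phi_j,\phi_i)$, $\mathbf g_i=G(\phi_i)$, and $$(\mathsf D_k^{(2)})_{ij}=\int_\Omega\big(\mathcal L\phi_i\,\mathcal L\phi_j+\nabla\phi_i\cdot\nabla\phi_j+k^2\phi_i\phi_j\big)\,d\mathbf x+\int_\Gamma\big(k^2\phi_i\phi_j+\nabla_\Gamma\phi_i\cdot\nabla_\Gamma\phi_j+\partial_n\phi_i\,\partial_n\phi_j\big)\,ds .$$ Write $\mathsf D=\mathsf D_k^{(2)}$, $\mathsf C=\mathsf D^{-1}\mathsf B$, $\mathbf d=\mathsf D^{-1}\mathbf g$ and $\|\mathbf v\|_{\mathsf D}^2=\mathbf v^*\mathsf D\mathbf v$. Let $\mathbf u^m$ be the $m$-th iterate of weighted GMRES with zero initial guess for the left-preconditioned system $\mathsf C\mathbf u=\mathbf d$, i.e. the element $\mathbf x$ of $\mathrm{span}\{\mathsf C^j\mathbf d:0\le j<m\}$ that minimises $\|\mathbf d-\mathsf C\mathbf x\|_{\mathsf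 D}$, and let $u_N^m=\sum_j\mathbf u^m_j\phi_j$. Let constants $K_\beta,K_1,K_2$ be given. For every $0<\varepsilon<1$ and $k_0>0$ there are $C>0$ and $m_0\in\mathbb N$, depending only on $\varepsilon$, $k_0$, $\Omega$, $\gamma$, $p$, $K_\beta$, $K_1$, $K_2$ (and not on $h$, $k$), such that the following holds for all $k\ge k_0$, all $\beta$ with $\frac L2\big(1+\frac4\gamma+\frac\gamma2\big)\le\beta\le K_\beta L$, and all data $f,g$ whose solution $u$ satisfies - $u\in H^4(\Omega)$ and $\|u\|_{H^{j+1}(\Omega)}\le K_1k\|u\|_{H^j(\Omega)}$ for $j=0,1,2,3$; - $\|u\|_{V_1}\sim\|u\|_{V_2}\sim\|u\|_{H^1_k}$ with equivalence constant $K_2$. If $hk^{3/2}\le C$, then $\mathsf D_k^{(2)}$ is positive definite, the Galerkin system $\mathsf B\mathbf u=\mathbf g$ has a unique solution, and for every $m\ge m_0$ the iterate $\mathbf u^m$ exists, is unique and satisfies $$\|u-u_N^m\|_{H^1_k}\le\varepsilon\,\|u\|_{H^1_k}.$$ -/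

import Mathlib

open MeasureTheory Complex
open scoped ContDiff ComplexConjugate Matrix

noncomputable section

namespace HelmholtzMS

/-- An axis-parallel open box `∏ᵢ (loᵢ, hiᵢ)` in `ℝᵈ`, `d = n + 1`: an interval for `n = 0`, a
rectangle for `n = 1`. Euclidean lengths are written out, since `Fin (n + 1) → ℝ` carries the
sup norm. -/
structure Box (n : ℕ) where
  lo : Fin (n + 1) → ℝ
  hi : Fin (n + 1) → ℝ
  lt : ∀ i, lo i < hi i

variable {n : ℕ}

namespace Box

/-- The domain `Ω`. -/
def dom (Q : Box n) : Set (Fin (n + 1) → ℝ) := Set.univ.pi fun i => Set.Ioo (Q.lo i) (Q.hi i)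

/-- Lebesgue measure on `Ω`. -/
def vol (Q : Box n) : Measure (Fin (n + 1) → ℝ) := volume.restrict Q.dom

/-- The face of `∂Ω` on which the `i`-th coordinate equals `c`, with its `(d-1)`-dimensional
Lebesgue measure (a unit point mass if `d = 1`). -/
def faceMeasure (Q : Box n) (i : Fin (n + 1)) (c : ℝ) : Measure (Fin (n + 1) → ℝ) :=
  (volume.restrict (Set.Icc (Q.lo ∘ i.succAbove) (Q.hi ∘ i.succAbove))).map
    (fun y : Fin n → ℝ => (i.insertNth c y : Fin (n + 1) → ℝ))

/-- The surface measure of `Γ = ∂Ω`. -/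
def surf (Q : Box n) : Measure (Fin (n + 1) → ℝ) :=
  ∑ i, (Q.faceMeasure i (Q.lo i) + Q.faceMeasure i (Q.hi i))

/-- The outward unit normal on `Γ` (the corners, where it does not exist, are a null set
for `Q.surf`). -/
def normal (Q : Box n) (x : Fin (n + 1) → ℝ) (i : Fin (n + 1)) : ℝ :=
  if x i = Q.hi i then 1 else if x i = Q.lo i then -1 else 0

/-- The Euclidean diameter `L` of `Ω`. -/
def diameter (Q : Box n) : ℝ := √(∑ i, (Q.hi i - Q.lo i) ^ 2)

/-- `x · n(x) ≥ r` at almost every point of `Γ`, that is, `Ω` is star-shaped with respect to the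
ball of radius `r` centred at the origin. -/
def StarShapedBall (Q : Box n) (r : ℝ) : Prop :=
  ∀ᵐ x ∂Q.surf, r ≤ ∑ i, x i * Q.normal x i

end Box

/-! ### Derivatives, Sobolev spaces, traces -/

/-- Classical partial derivative of a (smooth, real) test function. -/
def pderiv (i : Fin (n + 1)) (φ : (Fin (n + 1) → ℝ) → ℝ) : (Fin (n + 1) → ℝ) → ℝ :=
  fun x => fderiv ℝ φ x (Pi.single i 1)

/-- Classical derivative `∂^α` of a test function for a multi-index `α`. -/
def mderiv (α : Fin (n + 1) → ℕ) (φ : (Fin (n + 1) → ℝ) → ℝ) : (Fin (n + 1) → ℝ) → ℝ :=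
  (List.finRange (n + 1)).foldr (fun i ψ => (pderiv i)^[α i] ψ) φ

/-- Test functions: smooth, with compact support inside `Ω`. -/
def IsTestFun (Q : Box n) (φ : (Fin (n + 1) → ℝ) → ℝ) : Prop :=
  ContDiff ℝ ∞ φ ∧ HasCompactSupport φ ∧ tsupport φ ⊆ Q.dom

/-- `w = ∂^α u` in `Ω` in the weak sense. -/
def IsWeakDeriv (Q : Box n) (α : Fin (n + 1) → ℕ) (u w : (Fin (n + 1) → ℝ) → ℂ) : Prop :=
  ∀ φ, IsTestFun Q φ →
    ∫ x, u x * (mderiv α φ x : ℂ) ∂Q.vol = (-1) ^ (∑ i, α i) * ∫ x, w x * (φ x : ℂ) ∂Q.vol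

/-- `w = Δ u` in `Ω` in the weak sense. -/
def IsWeakLaplacian (Q : Box n) (u w : (Fin (n + 1) → ℝ) → ℂ) : Prop :=
  ∀ φ, IsTestFun Q φ →
    ∫ x, u x * ((∑ i, pderiv i (pderiv i φ) x : ℝ) : ℂ) ∂Q.vol = ∫ x, w x * (φ x : ℂ) ∂Q.vol

/-- An object with property `P` if there is one, and `0` otherwise. It is used for weak
derivatives and traces, which are unique almost everywhere when they exist. -/
def pick {X : Type*} [Zero X] (P : X → Prop) : X :=
  open Classical in if h : ∃ w, P w then h.choose else 0

/-- The weak derivative `∂^α u ∈ L²(Ω)`. -/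
def weakDeriv (Q : Box n) (α : Fin (n + 1) → ℕ) (u : (Fin (n + 1) → ℝ) → ℂ) :
    (Fin (n + 1) → ℝ) → ℂ :=
  pick fun w => MemLp w 2 Q.vol ∧ IsWeakDeriv Q α u w

/-- The component `∂ᵢ u` of the weak gradient. -/
def grad (Q : Box n) (u : (Fin (n + 1) → ℝ) → ℂ) (i : Fin (n + 1)) : (Fin (n + 1) → ℝ) → ℂ :=
  weakDeriv Q (Pi.single i 1) u

/-- The weak Laplacian `Δ u ∈ L²(Ω)`. -/
def lap (Q : Box n) (u : (Fin (n + 1) → ℝ) → ℂ) : (Fin (n + 1) → ℝ) → ℂ :=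
  pick fun w => MemLp w 2 Q.vol ∧ IsWeakLaplacian Q u w

/-- `u ∈ H^m(Ω)`. -/
def MemH (Q : Box n) (m : ℕ) (u : (Fin (n + 1) → ℝ) → ℂ) : Prop :=
  MemLp u 2 Q.vol ∧ ∀ α : Fin (n + 1) → ℕ, ∑ i, α i ≤ m →
    ∃ w, MemLp w 2 Q.vol ∧ IsWeakDeriv Q α u w

/-- The norm of `H^m(Ω)`: `‖u‖² = ∑_{|α| ≤ m} ‖∂^α u‖²`. -/
def normH (Q : Box n) (m : ℕ) (u : (Fin (n + 1) → ℝ) → ℂ) : ℝ :=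
  √(∑ α : Fin (n + 1) → Fin (m + 1), if ∑ i, (α i : ℕ) ≤ m then
      ∫ x, ‖weakDeriv Q (fun i => (α i : ℕ)) u x‖ ^ 2 ∂Q.vol else 0)

/-- `t` is the trace on `Γ` of `u ∈ H¹(Ω)`:
`∫_Ω (u ∂ᵢφ + ∂ᵢu φ) = ∫_Γ t φ nᵢ` for all smooth `φ` and all `i`. -/
def IsTrace (Q : Box n) (u t : (Fin (n + 1) → ℝ) → ℂ) : Prop :=
  ∀ φ : (Fin (n + 1) → ℝ) → ℝ, ContDiff ℝ ∞ φ → ∀ i,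
    ∫ x, (u x * (pderiv i φ x : ℂ) + grad Q u i x * (φ x : ℂ)) ∂Q.vol =
      ∫ x, t x * (φ x : ℂ) * (Q.normal x i : ℂ) ∂Q.surf

/-- The trace of `u` in `L²(Γ)`. -/
def trace (Q : Box n) (u : (Fin (n + 1) → ℝ) → ℂ) : (Fin (n + 1) → ℝ) → ℂ :=
  pick fun t => MemLp t 2 Q.surf ∧ IsTrace Q u t

/-- `ψ` is the normal derivative on `Γ` of `u ∈ H¹(Ω)` with `Δu ∈ L²(Ω)`, defined by Green's
identity `∫_Γ ψ φ = ∫_Ω (∇u · ∇φ + Δu φ)` for all smooth `φ`. -/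
def IsNormalDeriv (Q : Box n) (u ψ : (Fin (n + 1) → ℝ) → ℂ) : Prop :=
  ∀ φ : (Fin (n + 1) → ℝ) → ℝ, ContDiff ℝ ∞ φ →
    ∫ x, ψ x * (φ x : ℂ) ∂Q.surf =
      ∫ x, ((∑ i, grad Q u i x * (pderiv i φ x : ℂ)) + lap Q u x * (φ x : ℂ)) ∂Q.vol

/-- The normal derivative `∂ₙ u ∈ L²(Γ)`. -/
def normalDeriv (Q : Box n) (u : (Fin (n + 1) → ℝ) → ℂ) : (Fin (n + 1) → ℝ) → ℂ :=
  pick fun ψ => MemLp ψ 2 Q.surf ∧ IsNormalDeriv Q u ψ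

/-- `w` is the weak surface gradient on `Γ` of `t`: it is tangential, and
`∫_Γ t (nᵢ ∂ⱼφ - nⱼ ∂ᵢφ) = - ∫_Γ (nᵢ wⱼ - nⱼ wᵢ) φ` for all smooth `φ` and all `i, j`. -/
def IsSurfGrad (Q : Box n) (t : (Fin (n + 1) → ℝ) → ℂ)
    (w : Fin (n + 1) → (Fin (n + 1) → ℝ) → ℂ) : Prop :=
  (∀ᵐ x ∂Q.surf, ∑ i, w i x * (Q.normal x i : ℂ) = 0) ∧
  ∀ φ : (Fin (n + 1) → ℝ) → ℝ, ContDiff ℝ ∞ φ → ∀ i j,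
    ∫ x, t x * ((Q.normal x i * pderiv j φ x - Q.normal x j * pderiv i φ x : ℝ) : ℂ) ∂Q.surf =
      - ∫ x, ((Q.normal x i : ℂ) * w j x - (Q.normal x j : ℂ) * w i x) * (φ x : ℂ) ∂Q.surf

/-- The surface gradient `∇_Γ u ∈ L²(Γ)` of the trace of `u`. -/
def surfGrad (Q : Box n) (u : (Fin (n + 1) → ℝ) → ℂ) :
    Fin (n + 1) → (Fin (n + 1) → ℝ) → ℂ :=
  pick fun w => (∀ i, MemLp (w i) 2 Q.surf) ∧ IsSurfGrad Q (trace Q u) w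

/-! ### The interior impedance problem and the norms -/

/-- `u ∈ H¹(Ω)` solves `Δu + k²u = -f` in `Ω`, `∂ₙu - iku = g` on `Γ`. -/
def IsIIPSolution (Q : Box n) (k : ℝ) (f g u : (Fin (n + 1) → ℝ) → ℂ) : Prop :=
  MemH Q 1 u ∧ IsWeakLaplacian Q u (fun x => -f x - (k : ℂ) ^ 2 * u x) ∧
    ∃ t, MemLp t 2 Q.surf ∧ IsTrace Q u t ∧ IsNormalDeriv Q u (fun x => g x + I * k * t x)

/-- The Helmholtz operator `ℒu = Δu + k²u`. -/
def helm (Q : Box n) (k : ℝ) (u : (Fin (n + 1) → ℝ) → ℂ) (x : Fin (n + 1) → ℝ) : ℂ :=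
  lap Q u x + (k : ℂ) ^ 2 * u x

/-- `‖v‖²_{H¹_k(Ω)} = ‖∇v‖² + k²‖v‖²`. -/
def normH1k (Q : Box n) (k : ℝ) (v : (Fin (n + 1) → ℝ) → ℂ) : ℝ :=
  √((∑ i, ∫ x, ‖grad Q v i x‖ ^ 2 ∂Q.vol) + k ^ 2 * ∫ x, ‖v x‖ ^ 2 ∂Q.vol)

/-- The boundary part `‖∂ₙv‖² + ‖∇_Γ v‖² + k²‖v‖²` (norms of `L²(Γ)`). -/
def bdrySq (Q : Box n) (k : ℝ) (v : (Fin (n + 1) → ℝ) → ℂ) : ℝ :=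
  (∫ x, ‖normalDeriv Q v x‖ ^ 2 ∂Q.surf) + (∑ i, ∫ x, ‖surfGrad Q v i x‖ ^ 2 ∂Q.surf) +
    k ^ 2 * ∫ x, ‖trace Q v x‖ ^ 2 ∂Q.surf

/-- The norm `‖·‖_{V₁}` (with length scale `1` in front of the boundary terms). -/
def normV1 (Q : Box n) (k : ℝ) (v : (Fin (n + 1) → ℝ) → ℂ) : ℝ :=
  √((k ^ 2)⁻¹ * (∫ x, ‖lap Q v x‖ ^ 2 ∂Q.vol) + normH1k Q k v ^ 2 + bdrySq Q k v)

/-- The norm `‖·‖_{V₂}` (with length scale `1` in front of the boundary terms). -/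
def normV2 (Q : Box n) (k : ℝ) (v : (Fin (n + 1) → ℝ) → ℂ) : ℝ :=
  √((∫ x, ‖helm Q k v x‖ ^ 2 ∂Q.vol) + normH1k Q k v ^ 2 + bdrySq Q k v)

/-- Oscillatory behaviour: `u ∈ H⁴(Ω)` and `‖u‖_{H^{m+1}} ≤ K k ‖u‖_{H^m}`, `m = 0, 1, 2, 3`. -/
def Oscillatory (Q : Box n) (K k : ℝ) (u : (Fin (n + 1) → ℝ) → ℂ) : Prop :=
  MemH Q 4 u ∧ ∀ m : ℕ, m ≤ 3 → normH Q (m + 1) u ≤ K * k * normH Q m u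

/-- `‖u‖_{V₁} ∼ ‖u‖_{V₂} ∼ ‖u‖_{H¹_k(Ω)}` with equivalence constant `K`. -/
def NormsComparable (Q : Box n) (K k : ℝ) (u : (Fin (n + 1) → ℝ) → ℂ) : Prop :=
  normV1 Q k u ≤ K * normV2 Q k u ∧ normV2 Q k u ≤ K * normV1 Q k u ∧
    normV2 Q k u ≤ K * normH1k Q k u ∧ normH1k Q k u ≤ K * normV2 Q k u

/-! ### The MS formulation -/

/-- `ℳu = x·∇u - ikβu + (d-1)/2 u` in `Ω` (here `d - 1 = n`). -/
def mult (Q : Box n) (k β : ℝ) (u : (Fin (n + 1) → ℝ) → ℂ) (x : Fin (n + 1) → ℝ) : ℂ :=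
  (∑ i, (x i : ℂ) * grad Q u i x) - I * k * β * u x + (n : ℂ) / 2 * u x

/-- `x·∇_Γ u - ikβu + (d-1)/2 u` on `Γ`. -/
def multTan (Q : Box n) (k β : ℝ) (u : (Fin (n + 1) → ℝ) → ℂ) (x : Fin (n + 1) → ℝ) : ℂ :=
  (∑ i, (x i : ℂ) * surfGrad Q u i x) - I * k * β * trace Q u x + (n : ℂ) / 2 * trace Q u x

/-- `x · n(x)` on `Γ`. -/
def xDotN (Q : Box n) (x : Fin (n + 1) → ℝ) : ℂ := ((∑ i, x i * Q.normal x i : ℝ) : ℂ)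

/-- `ℳu` on `Γ`, where `∇u = ∇_Γ u + n ∂ₙu`. -/
def multBdry (Q : Box n) (k β : ℝ) (u : (Fin (n + 1) → ℝ) → ℂ) (x : Fin (n + 1) → ℝ) : ℂ :=
  xDotN Q x * normalDeriv Q u x + multTan Q k β u x

/-- The sesquilinear form `b(u, v)`. -/
def formB (Q : Box n) (k A β : ℝ) (u v : (Fin (n + 1) → ℝ) → ℂ) : ℂ :=
  (∫ x, ((∑ i, grad Q u i x * conj (grad Q v i x)) + (k : ℂ) ^ 2 * u x * conj (v x) +
      (mult Q k β u x + (A : ℂ) / (k : ℂ) ^ 2 * helm Q k u x) * conj (helm Q k v x)) ∂Q.vol) -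
  ∫ x, (I * k * trace Q u x * conj (multBdry Q k β v x) +
      multTan Q k β u x * conj (normalDeriv Q v x) +
      xDotN Q x * ((k : ℂ) ^ 2 * trace Q u x * conj (trace Q v x) -
        ∑ i, surfGrad Q u i x * conj (surfGrad Q v i x))) ∂Q.surf

/-- The antilinear functional `G(v)`. -/
def formG (Q : Box n) (k A β : ℝ) (f g v : (Fin (n + 1) → ℝ) → ℂ) : ℂ :=
  (∫ x, (conj (mult Q k β v x) - (A : ℂ) / (k : ℂ) ^ 2 * conj (helm Q k v x)) * f x ∂Q.vol) +
    ∫ x, conj (multBdry Q k β v x) * g x ∂Q.surf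

/-! ### The discrete space -/

/-- A tensor-product mesh of the box: nodes `lo i = t₀ < t₁ < ⋯ < t_M = hi i` in direction `i`. -/
structure Mesh (Q : Box n) where
  num : Fin (n + 1) → ℕ
  node : (i : Fin (n + 1)) → Fin (num i + 1) → ℝ
  strictMono : ∀ i, StrictMono (node i)
  first : ∀ i, node i 0 = Q.lo i
  last : ∀ i, node i (Fin.last (num i)) = Q.hi i

namespace Mesh

variable {Q : Box n}

/-- The open element with index `j`. -/
def cell (T : Mesh Q) (j : (i : Fin (n + 1)) → Fin (T.num i)) : Set (Fin (n + 1) → ℝ) :=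
  Set.univ.pi fun i => Set.Ioo (T.node i (j i).castSucc) (T.node i (j i).succ)

/-- The mesh width: the largest Euclidean diameter of an element. -/
def width (T : Mesh Q) : ℝ :=
  ⨆ j : (i : Fin (n + 1)) → Fin (T.num i),
    √(∑ i, (T.node i (j i).succ - T.node i (j i).castSucc) ^ 2)

/-- The real finite element space: `C¹` functions on `Ω` (extended by zero outside `Ω`) whose
restriction to each element is a polynomial of degree at most `p` in each variable. -/
def space (T : Mesh Q) (p : ℕ) : Submodule ℝ ((Fin (n + 1) → ℝ) → ℝ) where
  carrier := {v | (∀ x, x ∉ Q.dom → v x = 0) ∧ ContDiffOn ℝ 1 v Q.dom ∧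
    ∀ j, ∃ P : MvPolynomial (Fin (n + 1)) ℝ, (∀ i, P.degreeOf i ≤ p) ∧
      ∀ x ∈ T.cell j, v x = MvPolynomial.eval x P}
  zero_mem' := ⟨fun _ _ => rfl, contDiffOn_const, fun _ => ⟨0, by simp, by simp⟩⟩
  add_mem' := by
    rintro v w ⟨hv0, hv1, hv2⟩ ⟨hw0, hw1, hw2⟩
    refine ⟨fun x hx => by simp [hv0 x hx, hw0 x hx], hv1.add hw1, fun j => ?_⟩
    obtain ⟨P, hP, hPv⟩ := hv2 j
    obtain ⟨R, hR, hRw⟩ := hw2 j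
    exact ⟨P + R, fun i => (MvPolynomial.degreeOf_add_le i P R).trans (max_le (hP i) (hR i)),
      fun x hx => by simp [hPv x hx, hRw x hx]⟩
  smul_mem' := by
    rintro c v ⟨hv0, hv1, hv2⟩
    refine ⟨fun x hx => by simp [hv0 x hx], contDiffOn_const.smul hv1, fun j => ?_⟩
    obtain ⟨P, hP, hPv⟩ := hv2 j
    exact ⟨MvPolynomial.C c * P,
      fun i => (MvPolynomial.degreeOf_C_mul_le P i c).trans (hP i),
      fun x hx => by simp [hPv x hx]⟩

end Mesh

/-! ### Galerkin matrices -/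

section matrices

variable {N : ℕ} (Q : Box n) (k : ℝ) (φ : Fin N → (Fin (n + 1) → ℝ) → ℂ)

/-- `S`. -/
def stiffMat : Matrix (Fin N) (Fin N) ℂ :=
  Matrix.of fun l m => ∫ x, ∑ i, grad Q (φ l) i x * grad Q (φ m) i x ∂Q.vol

/-- `M`. -/
def massMat : Matrix (Fin N) (Fin N) ℂ :=
  Matrix.of fun l m => ∫ x, φ l x * φ m x ∂Q.vol

/-- `L⁽²⁾`. -/
def helmMat : Matrix (Fin N) (Fin N) ℂ :=
  Matrix.of fun l m => ∫ x, helm Q k (φ l) x * helm Q k (φ m) x ∂Q.vol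

/-- `N⁽⁰⁾`. -/
def bdryMassMat : Matrix (Fin N) (Fin N) ℂ :=
  Matrix.of fun l m => ∫ x, trace Q (φ l) x * trace Q (φ m) x ∂Q.surf

/-- `N⁽¹⁾`. -/
def bdryStiffMat : Matrix (Fin N) (Fin N) ℂ :=
  Matrix.of fun l m => ∫ x, ∑ i, surfGrad Q (φ l) i x * surfGrad Q (φ m) i x ∂Q.surf

/-- `N⁽²⁾`. -/
def bdryNormalMat : Matrix (Fin N) (Fin N) ℂ :=
  Matrix.of fun l m => ∫ x, normalDeriv Q (φ l) x * normalDeriv Q (φ m) x ∂Q.surf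

/-- `D_k⁽²⁾ = L⁽²⁾ + S + k² M + k² N⁽⁰⁾ + N⁽¹⁾ + N⁽²⁾`. -/
def precond : Matrix (Fin N) (Fin N) ℂ :=
  helmMat Q k φ + stiffMat Q φ + (k : ℂ) ^ 2 • massMat Q φ + (k : ℂ) ^ 2 • bdryMassMat Q φ +
    bdryStiffMat Q φ + bdryNormalMat Q φ

/-- The Galerkin matrix `B_{ij} = b(φ_j, φ_i)`. -/
def galerkinMat (A β : ℝ) : Matrix (Fin N) (Fin N) ℂ :=
  Matrix.of fun i j => formB Q k A β (φ j) (φ i)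

/-- The load vector `g_i = G(φ_i)`. -/
def loadVec (A β : ℝ) (f g : (Fin (n + 1) → ℝ) → ℂ) : Fin N → ℂ :=
  fun i => formG Q k A β f g (φ i)

/-- The finite element function with coefficient vector `c`. -/
def feFun (c : Fin N → ℂ) : (Fin (n + 1) → ℝ) → ℂ := fun x => ∑ j, c j * φ j x

end matrices

/-- The basis functions of the real finite element space, as complex-valued functions. -/
def basisFun {Q : Box n} {T : Mesh Q} {p N : ℕ} (φ : Module.Basis (Fin N) ℝ (T.space p)) :
    Fin N → (Fin (n + 1) → ℝ) → ℂ :=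
  fun j x => (((φ j : (Fin (n + 1) → ℝ) → ℝ) x : ℝ) : ℂ)

/-! ### Weighted GMRES -/

/-- `‖v‖_D = (v* D v)^{1/2}`. -/
def weightedNorm {N : ℕ} (D : Matrix (Fin N) (Fin N) ℂ) (v : Fin N → ℂ) : ℝ :=
  √(star v ⬝ᵥ (D *ᵥ v)).re

/-- The Krylov space `span {C^j r : j = 0, …, m - 1}`. -/
def krylov {N : ℕ} (C : Matrix (Fin N) (Fin N) ℂ) (r : Fin N → ℂ) (m : ℕ) :
    Submodule ℂ (Fin N → ℂ) :=
  Submodule.span ℂ (Set.range fun j : Fin m => (C ^ (j : ℕ)) *ᵥ r)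

/-- `x` is the `m`-th iterate of GMRES with weight `D` and zero initial guess for `C x = r`. -/
def IsGMRESIterate {N : ℕ} (D C : Matrix (Fin N) (Fin N) ℂ) (r : Fin N → ℂ) (m : ℕ)
    (x : Fin N → ℂ) : Prop :=
  x ∈ krylov C r m ∧
    ∀ y ∈ krylov C r m, weightedNorm D (r - C *ᵥ x) ≤ weightedNorm D (r - C *ᵥ y)

end HelmholtzMS

end

open HelmholtzMS MeasureTheory
open scoped Matrix ComplexOrder

/-! The theorem rests on one fact: in the norm of V₂ the sesquilinear form b is bounded by M and
coercive with constant α, and neither constant depends on the mesh or on k ≥ k₀. Coercivity comes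
from the multiplier ℳ. The Rellich–Morawetz identity (`rellich_sameIntegral`, `rellich_identity`)
expresses a sum of divergences built from x·∇u, u and their conjugate counterparts for v. It gives
b(u,v) a second expression, through the residuals ℒu and ∂ₙu − iku alone (`msForm_eq_residual`). For
the solution of the impedance problem this second expression is G(v), so the formulation is
consistent (`formG_eq_msForm`). Averaging the two expressions at v = u removes the indefinite
product of ℳu and ℒu from the real part. What is left is ½‖u‖²_{H¹_k} + ‖ℒu‖² and a boundary
integral whose density is a quadratic form in ∂ₙu, ∇_Γu and ku. That form is positive definite
because x·n ≥ γL and β is large (`bdry_coercive`, `msForm_coercive`). Boundedness (`norm_msForm_le`)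
is the Cauchy–Schwarz inequality; k ≥ k₀ is used there to absorb the zero-order term (d−1)u/2.

On the discrete side, D is the Gram matrix of the basis in the V₂ inner product, because the basis
is real (`precond_eq_gram`). Hence ‖·‖_D of a coefficient vector is the V₂ norm of the finite
element function, and C = D⁻¹B represents b in this inner product: ‖C‖ ≤ M and Re⟨v, Cv⟩ ≥ α‖v‖².
Céa's lemma bounds the Galerkin error by 1 + M/α times the best approximation error. The Richardson
iteration with step α/M² contracts residuals by √(1 − (α/M)²) and stays in the Krylov spaces, so
GMRES does at least as well (`galerkin_gmres_error`). The number of steps needed for a fixed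
accuracy is therefore independent of h and k.

For the best approximation error, C¹ cubic Hermite interpolation of a smooth function has L² errors
h⁴, h³, h² in the derivatives of order 0, 1, 2, times fourth derivatives. The V₂ norm is controlled
by derivatives up to order two with powers of k (`exists_energy_bound`), and oscillation turns
‖u‖_{H⁴} into k³‖u‖_{H¹_k}. The dominant product is h²k³ = (hk^{3/2})², which explains the mesh
condition (`exists_energy_approx`, `sqrt_approx_mul_le`).

All derivatives and traces here are weak, so H¹ functions are handled as limits of smooth functions
with converging boundary values (`IsH1`). The trace inequality follows from the vector field x and
star-shapedness. Density of smooth functions follows from convexity, by a dilation combined with a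
convolution that only samples Ω and commutes with weak derivatives up to a power of the dilation
factor. -/

namespace HelmholtzMS

/-! ### Galerkin and weighted GMRES for coercive sesquilinear forms -/

section AbstractGMRES

open scoped InnerProductSpace

variable {E V : Type*} [NormedAddCommGroup E] [InnerProductSpace ℂ E] [AddCommGroup V] [Module ℂ V]
  {N : ℕ}

/-- The synthesis map `c ↦ ∑ⱼ cⱼ φⱼ`. -/
noncomputable def synth (φ : Fin N → V) : (Fin N → ℂ) →ₗ[ℂ] V := Fintype.linearCombination ℂ φ

lemma synth_apply (φ : Fin N → V) (c : Fin N → ℂ) : synth φ c = ∑ j, c j • φ j :=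
  Fintype.linearCombination_apply ℂ φ c

/-- With the Gram version that follows, this lets the GMRES argument be carried out for the form and
the inner product at finite element functions instead of for matrices. -/
lemma star_dotProduct_mulVec_eq (φ : Fin N → V) (b : V →ₗ⋆[ℂ] V →ₗ[ℂ] ℂ)
    (c c' : Fin N → ℂ) :
    star c ⬝ᵥ ((Matrix.of fun i j => b (φ i) (φ j)) *ᵥ c') = b (synth φ c) (synth φ c') := by
  simp only [synth_apply, map_sum, LinearMap.sum_apply, LinearMap.map_smulₛₗ, LinearMap.smul_apply,
    dotProduct, Matrix.mulVec, Matrix.of_apply, Finset.mul_sum, Pi.star_apply, smul_eq_mul,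
    RingHom.id_apply, starRingEnd_apply]
  rw [Finset.sum_comm]
  refine Finset.sum_congr rfl fun j _ => Finset.sum_congr rfl fun i _ => ?_
  ring

lemma star_dotProduct_gram_mulVec_eq (φ : Fin N → V) (Φ : V →ₗ[ℂ] E) (c c' : Fin N → ℂ) :
    star c ⬝ᵥ ((Matrix.of fun i j => ⟪Φ (φ i), Φ (φ j)⟫_ℂ) *ᵥ c') =
      ⟪Φ (synth φ c), Φ (synth φ c')⟫_ℂ := by
  simp only [synth_apply, map_sum, map_smul, sum_inner, inner_sum, inner_smul_left,
    inner_smul_right, dotProduct, Matrix.mulVec, Matrix.of_apply, Finset.mul_sum, Pi.star_apply,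
    starRingEnd_apply]
  rw [Finset.sum_comm]
  refine Finset.sum_congr rfl fun j _ => Finset.sum_congr rfl fun i _ => ?_
  ring

/-- In a Krylov space `K_m(C, r)`, the Richardson iteration with factor `τ` produces an element
whose residual is `(1 - τ C)^m r`. -/
lemma exists_krylov_residual (C : Matrix (Fin N) (Fin N) ℂ) (r : Fin N → ℂ) (τ : ℂ) (m : ℕ) :
    ∃ x ∈ krylov C r m, r - C *ᵥ x = ((1 - τ • C) ^ m) *ᵥ r := by
  have hmono : ∀ m, krylov C r m ≤ krylov C r (m + 1) := fun m => by
    apply Submodule.span_mono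
    rintro _ ⟨j, rfl⟩
    exact ⟨j.castSucc, rfl⟩
  have hmap : ∀ m, ∀ x ∈ krylov C r m, C *ᵥ x ∈ krylov C r (m + 1) := fun m x hx => by
    induction hx using Submodule.span_induction with
    | mem y hy =>
      obtain ⟨j, rfl⟩ := hy
      apply Submodule.subset_span
      exact ⟨j.succ, by simp [pow_succ', Matrix.mulVec_mulVec]⟩
    | zero => simp
    | add y z _ _ hy hz => rw [Matrix.mulVec_add]; exact Submodule.add_mem _ hy hz
    | smul a y _ hy => rw [Matrix.mulVec_smul]; exact Submodule.smul_mem _ a hy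
  have hr : ∀ m, r ∈ krylov C r (m + 1) := fun m =>
    Submodule.subset_span ⟨0, by simp⟩
  induction m with
  | zero => exact ⟨0, Submodule.zero_mem _, by simp⟩
  | succ m ih =>
    obtain ⟨x, hx, hxr⟩ := ih
    refine ⟨x + τ • (r - C *ᵥ x), Submodule.add_mem _ (hmono m hx) (Submodule.smul_mem _ _
      (Submodule.sub_mem _ (hr m) (hmap m x hx))), ?_⟩
    rw [pow_succ', ← Matrix.mulVec_mulVec, ← hxr, Matrix.sub_mulVec, Matrix.one_mulVec,
      Matrix.mulVec_add, Matrix.smul_mulVec, Matrix.mulVec_smul]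
    abel

/-- Uniform convergence of the Galerkin method with weighted GMRES for a bounded and coercive
sesquilinear form. -/
theorem galerkin_gmres_error (Φ : V →ₗ[ℂ] E) (b : V →ₗ⋆[ℂ] V →ₗ[ℂ] ℂ) {M α : ℝ} (hα : 0 < α)
    (hM : 0 < M)
    (hbdd : ∀ v u, ‖b v u‖ ≤ M * ‖Φ u‖ * ‖Φ v‖) (hcoer : ∀ v, α * ‖Φ v‖ ^ 2 ≤ (b v v).re)
    (φ : Fin N → V) (hind : ∀ c, Φ (synth φ c) = 0 → c = 0) (u : V)
    (B D : Matrix (Fin N) (Fin N) ℂ) (G : Fin N → ℂ)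
    (hB : B = Matrix.of fun i j => b (φ i) (φ j))
    (hD : D = Matrix.of fun i j => ⟪Φ (φ i), Φ (φ j)⟫_ℂ) (hG : G = fun i => b (φ i) u) :
    D.PosDef ∧ (∃! c, B *ᵥ c = G) ∧
      ∀ m : ℕ, (∃! c, IsGMRESIterate D (D⁻¹ * B) (D⁻¹ *ᵥ G) m c) ∧
        ∀ c, IsGMRESIterate D (D⁻¹ * B) (D⁻¹ *ᵥ G) m c → ∀ a : Fin N → ℂ,
          ‖Φ (u - synth φ c)‖ ≤ (1 + M / α) * ‖Φ (u - synth φ a)‖ +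
            (M / α) ^ 2 * √(1 - (α / M) ^ 2) ^ m * ‖Φ u‖ := by
  have hαM : ∀ x : V, ‖Φ x‖ ≠ 0 → α ≤ M := fun x hx => by
    have h1 := (hcoer x).trans ((Complex.re_le_norm _).trans (hbdd x x))
    have : 0 < ‖Φ x‖ ^ 2 := by positivity
    nlinarith
  have hDip : ∀ c c', star c ⬝ᵥ (D *ᵥ c') = ⟪Φ (synth φ c), Φ (synth φ c')⟫_ℂ := fun c c' => by
    rw [hD, star_dotProduct_gram_mulVec_eq]
  have hBip : ∀ c c', star c ⬝ᵥ (B *ᵥ c') = b (synth φ c) (synth φ c') := fun c c' => by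
    rw [hB, star_dotProduct_mulVec_eq]
  have hGip : ∀ c, star c ⬝ᵥ G = b (synth φ c) u := fun c => by
    simp only [hG, synth_apply, map_sum, LinearMap.sum_apply, LinearMap.map_smulₛₗ,
      LinearMap.smul_apply, dotProduct, Pi.star_apply, smul_eq_mul, starRingEnd_apply]
  have hPD : D.PosDef := by
    apply Matrix.PosDef.of_dotProduct_mulVec_pos
    · ext i j
      simp [hD, Matrix.conjTranspose_apply, inner_conj_symm, ← starRingEnd_apply]
    · intro x hx
      rw [hDip, inner_self_eq_norm_sq_to_K]
      have : Φ (synth φ x) ≠ 0 := fun h => hx (hind x h)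
      have h2 : (0:ℝ) < ‖Φ (synth φ x)‖ ^ 2 := by positivity
      rw [← RCLike.ofReal_pow]
      exact RCLike.ofReal_pos.2 h2
  have hDu : IsUnit D.det := (Matrix.isUnit_iff_isUnit_det D).1 hPD.isUnit
  have hwn : ∀ v, weightedNorm D v = ‖Φ (synth φ v)‖ := fun v => by
    rw [weightedNorm, hDip, ← RCLike.re_eq_complex_re, inner_self_eq_norm_sq,
      Real.sqrt_sq (norm_nonneg _)]
  have hBinj : ∀ c, B *ᵥ c = 0 → c = 0 := fun c hc => by
    apply hind
    have h1 := hcoer (synth φ c)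
    rw [← hBip, hc] at h1
    simp only [dotProduct_zero, Complex.zero_re] at h1
    have : ‖Φ (synth φ c)‖ ^ 2 ≤ 0 := by nlinarith [sq_nonneg ‖Φ (synth φ c)‖]
    have h3 : ‖Φ (synth φ c)‖ = 0 := by nlinarith [norm_nonneg (Φ (synth φ c))]
    exact norm_eq_zero.1 h3
  have hBu : IsUnit B.det := by
    rw [← Matrix.isUnit_iff_isUnit_det, ← Matrix.mulVec_injective_iff_isUnit]
    intro x y hxy
    have := hBinj (x - y) (by rw [Matrix.mulVec_sub]; exact sub_eq_zero.2 hxy)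
    exact sub_eq_zero.1 this
  set C := D⁻¹ * B with hC
  have hDC : ∀ v, D *ᵥ (C *ᵥ v) = B *ᵥ v := fun v => by
    rw [Matrix.mulVec_mulVec, hC, ← mul_assoc, Matrix.mul_nonsing_inv D hDu, one_mul]
  -- C represents b in the energy inner product, so bounds on b become bounds on C.
  have hCip : ∀ w v, ⟪Φ (synth φ w), Φ (synth φ (C *ᵥ v))⟫_ℂ = b (synth φ w) (synth φ v) :=
    fun w v => by rw [← hDip, hDC, hBip]
  have hCb : ∀ v, ‖Φ (synth φ (C *ᵥ v))‖ ≤ M * ‖Φ (synth φ v)‖ := fun v => by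
    have h1 : ‖Φ (synth φ (C *ᵥ v))‖ ^ 2 ≤
        M * ‖Φ (synth φ v)‖ * ‖Φ (synth φ (C *ᵥ v))‖ := by
      have h2 := hCip (C *ᵥ v) v
      rw [inner_self_eq_norm_sq_to_K] at h2
      have h3 := hbdd (synth φ (C *ᵥ v)) (synth φ v)
      rw [← h2] at h3
      simpa using h3
    rcases eq_or_lt_of_le (norm_nonneg (Φ (synth φ (C *ᵥ v)))) with h0 | h0
    · rw [← h0]; positivity
    · nlinarith
  have hCc : ∀ v, α * ‖Φ (synth φ v)‖ ≤ ‖Φ (synth φ (C *ᵥ v))‖ := fun v => by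
    have h1 := hcoer (synth φ v)
    rw [← hCip] at h1
    have h2 := h1.trans ((Complex.re_le_norm _).trans (norm_inner_le_norm _ _))
    rcases eq_or_lt_of_le (norm_nonneg (Φ (synth φ v))) with h0 | h0
    · rw [← h0]; simp
    · nlinarith
  -- the Galerkin solution
  have hex : B *ᵥ (B⁻¹ *ᵥ G) = G := by
    rw [Matrix.mulVec_mulVec, Matrix.mul_nonsing_inv B hBu, Matrix.one_mulVec]
  set cs := B⁻¹ *ᵥ G with hcs
  have horth : ∀ w, b (synth φ w) (u - synth φ cs) = 0 := fun w => by
    rw [map_sub, ← hGip, ← hBip, hex, sub_self]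
  have hcsn : ‖Φ (synth φ cs)‖ ≤ M / α * ‖Φ u‖ := by
    have h1 := hcoer (synth φ cs)
    have h2 := horth cs
    rw [map_sub, sub_eq_zero] at h2
    rw [← h2] at h1
    have h3 := h1.trans ((Complex.re_le_norm _).trans (hbdd _ _))
    rw [div_mul_eq_mul_div, le_div_iff₀ hα]
    rcases eq_or_lt_of_le (norm_nonneg (Φ (synth φ cs))) with h0 | h0
    · rw [← h0]; simp; positivity
    · nlinarith
  -- Coercivity is applied only to the discrete difference of the Galerkin solution and the
  -- competitor. Galerkin orthogonality and the triangle inequality then give 1 + M/α.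
  have hcea : ∀ a, ‖Φ (u - synth φ cs)‖ ≤ (1 + M / α) * ‖Φ (u - synth φ a)‖ := fun a => by
    have e1 : synth φ (cs - a) = (u - synth φ a) - (u - synth φ cs) := by
      rw [map_sub]; abel
    have h1 := hcoer (synth φ (cs - a))
    have h2 : b (synth φ (cs - a)) (synth φ (cs - a)) = b (synth φ (cs - a)) (u - synth φ a) := by
      conv_lhs => rw [e1, map_sub (b _), ← e1, horth, sub_zero]
    rw [h2] at h1
    have h3 := h1.trans ((Complex.re_le_norm _).trans (hbdd _ _))
    have h4 : ‖Φ (synth φ (cs - a))‖ ≤ M / α * ‖Φ (u - synth φ a)‖ := by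
      rw [div_mul_eq_mul_div, le_div_iff₀ hα]
      rcases eq_or_lt_of_le (norm_nonneg (Φ (synth φ (cs - a)))) with h0 | h0
      · rw [← h0]; simp; positivity
      · nlinarith
    have e2 : u - synth φ cs = (u - synth φ a) - synth φ (cs - a) := by rw [e1]; abel
    rw [e2, map_sub]
    refine (norm_sub_le _ _).trans ?_
    linarith
  refine ⟨hPD, ⟨cs, hex, fun y hy => ?_⟩, fun m => ⟨?_, ?_⟩⟩
  · have hy' : B *ᵥ y = G := hy
    rw [hcs, ← hy', Matrix.mulVec_mulVec, Matrix.nonsing_inv_mul B hBu, Matrix.one_mulVec]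
  · -- existence and uniqueness of the minimiser
    -- The residual of x is mapped to F(D⁻¹G) − FC x, so minimising it means projecting F(D⁻¹G)
    -- orthogonally onto the image K' of the Krylov space. The projection exists by finite
    -- dimension, and FC is injective by coercivity, so the minimising coefficient vector is unique.
    let F : (Fin N → ℂ) →ₗ[ℂ] E := Φ ∘ₗ synth φ
    let FC : (Fin N → ℂ) →ₗ[ℂ] E := F ∘ₗ C.mulVecLin
    let K' : Submodule ℂ E := (krylov C (D⁻¹ *ᵥ G) m).map FC
    have : FiniteDimensional ℂ K' := inferInstance
    have hFC : ∀ x, FC x = Φ (synth φ (C *ᵥ x)) := fun x => rfl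
    have hres : ∀ x, Φ (synth φ (D⁻¹ *ᵥ G - C *ᵥ x)) = F (D⁻¹ *ᵥ G) - FC x := fun x => by
      simp [F, FC]
    have hFCinj : Function.Injective FC := by
      rw [← LinearMap.ker_eq_bot, LinearMap.ker_eq_bot']
      intro x hx
      rw [hFC] at hx
      have := hCc x
      rw [hx, norm_zero] at this
      exact hind x (norm_eq_zero.1 (by nlinarith [norm_nonneg (Φ (synth φ x))]))
    have hpyth : ∀ x ∈ krylov C (D⁻¹ *ᵥ G) m, ‖F (D⁻¹ *ᵥ G) - FC x‖ ^ 2 =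
        ‖F (D⁻¹ *ᵥ G) - K'.starProjection (F (D⁻¹ *ᵥ G))‖ ^ 2 +
          ‖K'.starProjection (F (D⁻¹ *ᵥ G)) - FC x‖ ^ 2 := fun x hx => by
      have e : F (D⁻¹ *ᵥ G) - FC x = (F (D⁻¹ *ᵥ G) - K'.starProjection (F (D⁻¹ *ᵥ G))) +
        (K'.starProjection (F (D⁻¹ *ᵥ G)) - FC x) := by abel
      rw [e]
      have := norm_add_sq_eq_norm_sq_add_norm_sq_of_inner_eq_zero (𝕜 := ℂ)
        (F (D⁻¹ *ᵥ G) - K'.starProjection (F (D⁻¹ *ᵥ G)))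
        (K'.starProjection (F (D⁻¹ *ᵥ G)) - FC x) ?_
      · simpa [sq] using this
      · apply Submodule.inner_left_of_mem_orthogonal (K := K')
        · exact Submodule.sub_mem _ (Submodule.starProjection_apply_mem _ _)
            (Submodule.mem_map_of_mem hx)
        · exact Submodule.sub_starProjection_mem_orthogonal _
    obtain ⟨x0, hx0, hx0'⟩ := Submodule.mem_map.1
      (Submodule.starProjection_apply_mem K' (F (D⁻¹ *ᵥ G)))
    have h0 := hpyth x0 hx0
    rw [← hx0', sub_self, norm_zero] at h0
    refine ⟨x0, ⟨hx0, fun y hy => ?_⟩, fun y hy => ?_⟩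
    · rw [hwn, hwn, hres, hres]
      have h1 := hpyth y hy
      refine le_of_sq_le_sq ?_ (norm_nonneg _)
      rw [h1, hx0']
      nlinarith [sq_nonneg ‖K'.starProjection (F (D⁻¹ *ᵥ G)) - FC y‖]
    · obtain ⟨hy1, hy2⟩ := hy
      have h2 := hy2 x0 hx0
      rw [hwn, hwn, hres, hres] at h2
      have h1 := hpyth y hy1
      rw [← hx0'] at h1
      have h3 : ‖FC x0 - FC y‖ ^ 2 ≤ 0 := by
        nlinarith [norm_nonneg (F (D⁻¹ *ᵥ G) - FC y), norm_nonneg (F (D⁻¹ *ᵥ G) - FC x0)]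
      have h4 : ‖FC x0 - FC y‖ = 0 := by nlinarith [norm_nonneg (FC x0 - FC y)]
      exact hFCinj (sub_eq_zero.1 (norm_eq_zero.1 h4)).symm
  · -- the error of the iterate
    rintro c ⟨hc1, hc2⟩ a
    have hd : D⁻¹ *ᵥ G = C *ᵥ cs := by
      rw [← hex, Matrix.mulVec_mulVec]
    -- This step minimises the bound 1 − 2τα + τ²M² for the squared contraction factor; the minimum
    -- is 1 − (α/M)².
    set τ : ℝ := α / M ^ 2 with hτ
    have hstep : ∀ v, ‖Φ (synth φ ((1 - (τ : ℂ) • C) *ᵥ v))‖ ≤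
        √(1 - (α / M) ^ 2) * ‖Φ (synth φ v)‖ := fun v => by
      have hsq : ‖Φ (synth φ ((1 - (τ : ℂ) • C) *ᵥ v))‖ ^ 2 ≤
          (1 - (α / M) ^ 2) * ‖Φ (synth φ v)‖ ^ 2 := by
        rw [Matrix.sub_mulVec, Matrix.one_mulVec, Matrix.smul_mulVec, map_sub, map_smul, map_sub,
          map_smul, @norm_sub_sq ℂ, inner_smul_right, hCip, norm_smul]
        have h1 := hcoer (synth φ v)
        have h2 := hCb v
        have h3 : ‖Φ (synth φ (C *ᵥ v))‖ ^ 2 ≤ M ^ 2 * ‖Φ (synth φ v)‖ ^ 2 := by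
          rw [← mul_pow]; gcongr
        have hτ0 : 0 < τ := by positivity
        have e1 : RCLike.re ((τ : ℂ) * b (synth φ v) (synth φ v)) =
            τ * (b (synth φ v) (synth φ v)).re := by simp
        rw [e1]
        have e2 : (‖(τ : ℂ)‖ * ‖Φ (synth φ (C *ᵥ v))‖) ^ 2 =
            τ ^ 2 * ‖Φ (synth φ (C *ᵥ v))‖ ^ 2 := by
          rw [Complex.norm_real, Real.norm_of_nonneg hτ0.le]; ring
        rw [e2]
        have e3 : (1 - (α / M) ^ 2) * ‖Φ (synth φ v)‖ ^ 2 =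
            ‖Φ (synth φ v)‖ ^ 2 - 2 * (τ * (α * ‖Φ (synth φ v)‖ ^ 2)) +
              τ ^ 2 * (M ^ 2 * ‖Φ (synth φ v)‖ ^ 2) := by
          rw [hτ]; field_simp; ring
        rw [e3]
        gcongr
      -- For a vector of norm zero the claim is trivial; otherwise α ≤ M, so the square root is
      -- applied to a nonnegative number.
      rcases eq_or_ne ‖Φ (synth φ v)‖ 0 with h0 | h0
      · rw [h0] at hsq ⊢
        nlinarith [norm_nonneg (Φ (synth φ ((1 - (τ : ℂ) • C) *ᵥ v)))]
      · have hle := hαM _ h0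
        have h1 : 0 ≤ 1 - (α / M) ^ 2 := by
          have : α / M ≤ 1 := (div_le_one hM).2 hle
          nlinarith [div_pos hα hM]
        refine le_of_sq_le_sq ?_ (by positivity)
        rw [mul_pow, Real.sq_sqrt h1]
        exact hsq
    have hpow : ∀ m v, ‖Φ (synth φ (((1 - (τ : ℂ) • C) ^ m) *ᵥ v))‖ ≤
        √(1 - (α / M) ^ 2) ^ m * ‖Φ (synth φ v)‖ := fun m => by
      induction m with
      | zero => intro v; simp
      | succ m ih =>
        intro v
        rw [pow_succ', ← Matrix.mulVec_mulVec]
        refine (hstep _).trans ?_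
        rw [pow_succ' (√(1 - (α / M) ^ 2)), mul_assoc]
        exact mul_le_mul_of_nonneg_left (ih v) (Real.sqrt_nonneg _)
    -- The Richardson iterate competes in the minimisation, so its residual bounds that of GMRES.
    obtain ⟨x, hx, hxr⟩ := exists_krylov_residual C (D⁻¹ *ᵥ G) (τ : ℂ) m
    have h1 := hc2 x hx
    rw [hwn, hwn, hxr] at h1
    have h2 := h1.trans (hpow m _)
    have e1 : D⁻¹ *ᵥ G - C *ᵥ c = C *ᵥ (cs - c) := by rw [hd, Matrix.mulVec_sub]
    rw [e1] at h2
    have h3 := (hCc (cs - c)).trans h2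
    -- The initial residual is C applied to the Galerkin solution: a factor M for C and M/α for the
    -- stability of the Galerkin solution. Passing from residual to error costs another 1/α, which
    -- makes (M/α)².
    have h4 : ‖Φ (synth φ (D⁻¹ *ᵥ G))‖ ≤ M * (M / α * ‖Φ u‖) := by
      rw [hd]; exact (hCb cs).trans (by gcongr)
    have h5 : ‖Φ (synth φ (cs - c))‖ ≤ (M / α) ^ 2 * √(1 - (α / M) ^ 2) ^ m * ‖Φ u‖ := by
      have : α * ‖Φ (synth φ (cs - c))‖ ≤ √(1 - (α / M) ^ 2) ^ m * (M * (M / α * ‖Φ u‖)) :=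
        h3.trans (by gcongr)
      rw [← mul_le_mul_iff_right₀ hα]
      refine this.trans (le_of_eq ?_)
      field_simp
    have e2 : u - synth φ c = (u - synth φ cs) + synth φ (cs - c) := by rw [map_sub]; abel
    rw [e2, map_add]
    exact (norm_add_le _ _).trans (add_le_add (hcea a) h5)

end AbstractGMRES

end HelmholtzMS

namespace HelmholtzMS

/-! ### Measures on the box and its boundary, the divergence theorem -/

section Measures

open Set Filter

variable {n : ℕ} (Q : Box n)

lemma Box.isOpen_dom : IsOpen Q.dom := isOpen_set_pi finite_univ fun _ _ => isOpen_Ioo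

lemma Box.measurableSet_dom : MeasurableSet Q.dom := Q.isOpen_dom.measurableSet

lemma Box.dom_subset_Icc : Q.dom ⊆ Icc Q.lo Q.hi := fun _ hx =>
  ⟨fun i => (hx i (mem_univ i)).1.le, fun i => (hx i (mem_univ i)).2.le⟩

lemma Box.vol_eq_restrict_Icc : Q.vol = volume.restrict (Icc Q.lo Q.hi) :=
  Measure.restrict_congr_set Measure.univ_pi_Ioo_ae_eq_Icc

lemma Box.ae_mem_dom : ∀ᵐ x ∂Q.vol, x ∈ Q.dom := ae_restrict_mem Q.measurableSet_dom

instance Box.isFiniteMeasure_vol : IsFiniteMeasure Q.vol := by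
  rw [Q.vol_eq_restrict_Icc]
  exact ⟨by simpa using isCompact_Icc.measure_lt_top⟩

lemma measurableEmbedding_insertNth (i : Fin (n + 1)) (c : ℝ) :
    MeasurableEmbedding (fun y : Fin n → ℝ => (i.insertNth c y : Fin (n + 1) → ℝ)) := by
  refine Continuous.measurableEmbedding ?_ (Fin.insertNth_right_injective (α := fun _ => ℝ) c)
  exact Continuous.finInsertNth (A := fun _ => ℝ) i continuous_const continuous_id

instance Box.isFiniteMeasure_faceMeasure (i : Fin (n + 1)) (c : ℝ) :
    IsFiniteMeasure (Q.faceMeasure i c) := by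
  have : IsFiniteMeasure
      (volume.restrict (Set.Icc (Q.lo ∘ i.succAbove) (Q.hi ∘ i.succAbove))) :=
    ⟨by simpa using isCompact_Icc.measure_lt_top⟩
  exact Measure.isFiniteMeasure_map _ _

instance Box.isFiniteMeasure_surf : IsFiniteMeasure Q.surf := by
  unfold Box.surf; infer_instance

lemma Box.ae_faceMeasure_iff (i : Fin (n + 1)) (c : ℝ) {P : (Fin (n + 1) → ℝ) → Prop} :
    (∀ᵐ x ∂Q.faceMeasure i c, P x) ↔
      ∀ᵐ y ∂volume.restrict (Icc (Q.lo ∘ i.succAbove) (Q.hi ∘ i.succAbove)),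
        P (i.insertNth c y) :=
  (measurableEmbedding_insertNth i c).ae_map_iff

lemma Box.integral_faceMeasure (i : Fin (n + 1)) (c : ℝ) (F : (Fin (n + 1) → ℝ) → ℂ) :
    ∫ x, F x ∂Q.faceMeasure i c =
      ∫ y in Icc (Q.lo ∘ i.succAbove) (Q.hi ∘ i.succAbove), F (i.insertNth c y) :=
  (measurableEmbedding_insertNth i c).integral_map F

lemma Box.ae_surf_iff {P : (Fin (n + 1) → ℝ) → Prop} :
    (∀ᵐ x ∂Q.surf, P x) ↔
      ∀ i, (∀ᵐ x ∂Q.faceMeasure i (Q.lo i), P x) ∧ ∀ᵐ x ∂Q.faceMeasure i (Q.hi i), P x := by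
  simp [Box.surf]

/-- Almost every point of a face avoids all other faces. -/
lemma Box.ae_faceMeasure_off_corners (i : Fin (n + 1)) (c : ℝ) :
    ∀ᵐ x ∂Q.faceMeasure i c, x i = c ∧ ∀ j, j ≠ i →
      x j ∈ Icc (Q.lo j) (Q.hi j) ∧ x j ≠ Q.lo j ∧ x j ≠ Q.hi j := by
  rw [Q.ae_faceMeasure_iff]
  have h1 : ∀ᵐ y : Fin n → ℝ, ∀ j, y j ≠ Q.lo (i.succAbove j) ∧ y j ≠ Q.hi (i.succAbove j) := by
    rw [ae_all_iff]
    intro j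
    exact (Measure.ae_eval_ne (fun _ => volume) j _).and (Measure.ae_eval_ne (fun _ => volume) j _)
  filter_upwards [ae_restrict_of_ae h1, ae_restrict_mem measurableSet_Icc] with y hy hy'
  refine ⟨by simp, fun j hj => ?_⟩
  obtain ⟨j, rfl⟩ := Fin.exists_succAbove_eq hj
  simp only [Fin.insertNth_apply_succAbove]
  exact ⟨⟨hy'.1 j, hy'.2 j⟩, hy j⟩

lemma Box.ae_faceMeasure_hi (i : Fin (n + 1)) :
    ∀ᵐ x ∂Q.faceMeasure i (Q.hi i), x ∈ Icc Q.lo Q.hi ∧ x i = Q.hi i ∧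
      Q.normal x = Pi.single i 1 := by
  filter_upwards [Q.ae_faceMeasure_off_corners i (Q.hi i)] with x hx
  have hIcc : ∀ j, x j ∈ Icc (Q.lo j) (Q.hi j) := fun j => by
    rcases eq_or_ne j i with rfl | h
    · rw [hx.1]; exact ⟨(Q.lt _).le, le_rfl⟩
    · exact (hx.2 j h).1
  refine ⟨⟨fun j => (hIcc j).1, fun j => (hIcc j).2⟩, hx.1, ?_⟩
  funext j
  rcases eq_or_ne j i with rfl | h
  · simp [Box.normal, hx.1]
  · simp [Box.normal, hx.2 j h, h]

lemma Box.ae_faceMeasure_lo (i : Fin (n + 1)) :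
    ∀ᵐ x ∂Q.faceMeasure i (Q.lo i), x ∈ Icc Q.lo Q.hi ∧ x i = Q.lo i ∧
      Q.normal x = Pi.single i (-1) := by
  filter_upwards [Q.ae_faceMeasure_off_corners i (Q.lo i)] with x hx
  have hIcc : ∀ j, x j ∈ Icc (Q.lo j) (Q.hi j) := fun j => by
    rcases eq_or_ne j i with rfl | h
    · rw [hx.1]; exact ⟨le_rfl, (Q.lt _).le⟩
    · exact (hx.2 j h).1
  refine ⟨⟨fun j => (hIcc j).1, fun j => (hIcc j).2⟩, hx.1, ?_⟩
  funext j
  rcases eq_or_ne j i with rfl | h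
  · simp [Box.normal, hx.1, (Q.lt j).ne]
  · simp [Box.normal, hx.2 j h, h]

/-- Almost everywhere on `Γ`, the normal is `± eᵢ` for some `i`. -/
lemma Box.ae_surf_normal :
    ∀ᵐ x ∂Q.surf, x ∈ Icc Q.lo Q.hi ∧ ∃ i,
      (x i = Q.hi i ∧ Q.normal x = Pi.single i 1) ∨
      (x i = Q.lo i ∧ Q.normal x = Pi.single i (-1)) := by
  rw [Q.ae_surf_iff]
  intro i
  constructor
  · filter_upwards [Q.ae_faceMeasure_lo i] with x hx
    exact ⟨hx.1, i, Or.inr hx.2⟩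
  · filter_upwards [Q.ae_faceMeasure_hi i] with x hx
    exact ⟨hx.1, i, Or.inl hx.2⟩

lemma Box.ae_surf_sum_normal_sq : ∀ᵐ x ∂Q.surf, ∑ i, Q.normal x i ^ 2 = 1 := by
  filter_upwards [Q.ae_surf_normal] with x hx
  obtain ⟨-, i, ⟨-, h⟩ | ⟨-, h⟩⟩ := hx
  · rw [h, Finset.sum_eq_single i] <;> simp +contextual
  · rw [h, Finset.sum_eq_single i] <;> simp +contextual

lemma Box.measurable_normal (i : Fin (n + 1)) : Measurable fun x => Q.normal x i := by
  unfold Box.normal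
  refine Measurable.ite ?_ measurable_const (Measurable.ite ?_ measurable_const measurable_const)
  · exact measurableSet_eq_fun (measurable_pi_apply i) measurable_const
  · exact measurableSet_eq_fun (measurable_pi_apply i) measurable_const

lemma Box.abs_normal_le (x : Fin (n + 1) → ℝ) (i : Fin (n + 1)) : |Q.normal x i| ≤ 1 := by
  unfold Box.normal; split_ifs <;> simp

lemma Box.integrable_mul_normal {F : (Fin (n + 1) → ℝ) → ℂ} (hF : Integrable F Q.surf)
    (i : Fin (n + 1)) : Integrable (fun x => F x * (Q.normal x i : ℂ)) Q.surf :=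
  hF.mul_bdd (c := 1) (Complex.measurable_ofReal.comp (Q.measurable_normal i)).aestronglyMeasurable
    (Eventually.of_forall fun x => by simpa using Q.abs_normal_le x i)

/-- Almost everywhere on a face orthogonal to another axis the i-th normal component is zero, since
corners are null sets; only the two faces orthogonal to eᵢ remain. -/
lemma Box.integral_mul_normal {F : (Fin (n + 1) → ℝ) → ℂ} (hF : Integrable F Q.surf)
    (i : Fin (n + 1)) :
    ∫ x, F x * (Q.normal x i : ℂ) ∂Q.surf =
      (∫ y in Icc (Q.lo ∘ i.succAbove) (Q.hi ∘ i.succAbove), F (i.insertNth (Q.hi i) y)) -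
      ∫ y in Icc (Q.lo ∘ i.succAbove) (Q.hi ∘ i.succAbove), F (i.insertNth (Q.lo i) y) := by
  have hInt := Q.integrable_mul_normal hF i
  rw [Box.surf, integrable_finsetSum_measure] at hInt
  have hInt' : ∀ j, _ := fun j => integrable_add_measure.1 (hInt j (Finset.mem_univ j))
  rw [Box.surf, integral_finsetSum_measure hInt, Finset.sum_eq_single i]
  · rw [integral_add_measure (hInt' i).1 (hInt' i).2, ← Q.integral_faceMeasure,
      ← Q.integral_faceMeasure, add_comm, sub_eq_add_neg, ← integral_neg]
    congr 1
    · refine integral_congr_ae ?_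
      filter_upwards [Q.ae_faceMeasure_hi i] with x hx
      simp [hx.2.2]
    · refine integral_congr_ae ?_
      filter_upwards [Q.ae_faceMeasure_lo i] with x hx
      simp [hx.2.2]
  · intro j _ hj
    rw [integral_add_measure (hInt' j).1 (hInt' j).2]
    have h1 : ∫ x, F x * (Q.normal x i : ℂ) ∂Q.faceMeasure j (Q.lo j) = 0 := by
      refine integral_eq_zero_of_ae ?_
      filter_upwards [Q.ae_faceMeasure_lo j] with x hx
      simp [hx.2.2, hj.symm]
    have h2 : ∫ x, F x * (Q.normal x i : ℂ) ∂Q.faceMeasure j (Q.hi j) = 0 := by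
      refine integral_eq_zero_of_ae ?_
      filter_upwards [Q.ae_faceMeasure_hi j] with x hx
      simp [hx.2.2, hj.symm]
    rw [h1, h2, add_zero]
  · simp

/-- Continuous functions are bounded almost everywhere on `Ω` and on `Γ`. -/
lemma Box.exists_bound_of_continuous {E : Type*} [NormedAddCommGroup E]
    {F : (Fin (n + 1) → ℝ) → E} (hF : Continuous F) :
    ∃ C, (∀ᵐ x ∂Q.vol, ‖F x‖ ≤ C) ∧ ∀ᵐ x ∂Q.surf, ‖F x‖ ≤ C := by
  obtain ⟨C, hC⟩ := (isCompact_Icc (a := Q.lo) (b := Q.hi)).exists_bound_of_continuousOn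
    hF.continuousOn
  refine ⟨C, ?_, ?_⟩
  · filter_upwards [Q.ae_mem_dom] with x hx using hC x (Q.dom_subset_Icc hx)
  · filter_upwards [Q.ae_surf_normal] with x hx using hC x hx.1

lemma Box.memLp_vol_of_continuous {E : Type*} [NormedAddCommGroup E]
    [SecondCountableTopologyEither (Fin (n + 1) → ℝ) E]
    {F : (Fin (n + 1) → ℝ) → E} (hF : Continuous F) (p : ENNReal) : MemLp F p Q.vol := by
  obtain ⟨C, hC, -⟩ := Q.exists_bound_of_continuous hF
  exact MemLp.of_bound hF.aestronglyMeasurable C hC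

lemma Box.memLp_surf_of_continuous {E : Type*} [NormedAddCommGroup E]
    [SecondCountableTopologyEither (Fin (n + 1) → ℝ) E]
    {F : (Fin (n + 1) → ℝ) → E} (hF : Continuous F) (p : ENNReal) : MemLp F p Q.surf := by
  obtain ⟨C, -, hC⟩ := Q.exists_bound_of_continuous hF
  exact MemLp.of_bound hF.aestronglyMeasurable C hC

/-- Classical partial derivative of a complex-valued function. -/
noncomputable def cderiv (i : Fin (n + 1)) (w : (Fin (n + 1) → ℝ) → ℂ) :
    (Fin (n + 1) → ℝ) → ℂ := fun x => fderiv ℝ w x (Pi.single i 1)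

lemma continuous_cderiv {w : (Fin (n + 1) → ℝ) → ℂ} (hw : ContDiff ℝ 1 w) (i : Fin (n + 1)) :
    Continuous (cderiv i w) :=
  (hw.continuous_fderiv one_ne_zero).clm_apply continuous_const

lemma contDiff_cderiv {w : (Fin (n + 1) → ℝ) → ℂ} (hw : ContDiff ℝ ∞ w) (i : Fin (n + 1)) :
    ContDiff ℝ ∞ (cderiv i w) := by
  have h : ContDiff ℝ ∞ (fderiv ℝ w) := hw.fderiv_right (by simp)
  exact h.clm_apply contDiff_const

/-- The divergence theorem on the box for a field in direction `i`. -/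
theorem Box.integral_cderiv {w : (Fin (n + 1) → ℝ) → ℂ} (hw : ContDiff ℝ 1 w)
    (i : Fin (n + 1)) :
    ∫ x, cderiv i w x ∂Q.vol = ∫ x, w x * (Q.normal x i : ℂ) ∂Q.surf := by
  have hc := hw.continuous
  rw [Q.integral_mul_normal ((Q.memLp_surf_of_continuous hc 1).integrable le_rfl),
    Q.vol_eq_restrict_Icc]
  have hInt : IntegrableOn (cderiv i w) (Icc Q.lo Q.hi) :=
    (continuous_cderiv hw i).continuousOn.integrableOn_compact isCompact_Icc
  have hsum : ∀ x, ∑ j, (if j = i then fderiv ℝ w x else 0) (Pi.single j 1) = cderiv i w x := by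
    intro x
    rw [Finset.sum_eq_single i] <;> simp +contextual [cderiv]
  -- The field is w eᵢ, so a single pair of faces contributes to the flux.
  have := integral_divergence_of_hasFDerivAt_off_countable' Q.lo Q.hi (fun j => (Q.lt j).le)
    (fun j => if j = i then w else 0) (fun j x => if j = i then fderiv ℝ w x else 0) ∅
    countable_empty (fun j => by split_ifs <;> [exact hc.continuousOn; exact continuousOn_const])
    (fun x _ j => by
      by_cases h : j = i
      · simp only [h, if_true]
        exact (hw.differentiable one_ne_zero x).hasFDerivAt
      · simp only [h, if_false]
        exact hasFDerivAt_const 0 x)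
    (by simpa only [hsum] using hInt)
  simp only [hsum] at this
  rw [this, Finset.sum_eq_single i]
  · simp
  · intro j _ hj; simp [hj]
  · simp

end Measures

end HelmholtzMS

namespace HelmholtzMS

/-! ### Convergence in `L²` -/

section L2

open Set Filter Topology
open scoped InnerProductSpace

variable {α : Type*} [MeasurableSpace α] {μ : Measure α} {F G : α → ℂ}

lemma inner_toLp_toLp (hF : MemLp F 2 μ) (hG : MemLp G 2 μ) :
    ⟪hG.toLp G, hF.toLp F⟫_ℂ = ∫ x, F x * conj (G x) ∂μ := by
  rw [L2.inner_def]
  refine integral_congr_ae ?_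
  filter_upwards [hF.coeFn_toLp, hG.coeFn_toLp] with x h1 h2
  rw [h1, h2, RCLike.inner_apply]

lemma integral_mul_conj_self (F : α → ℂ) :
    ∫ x, F x * conj (F x) ∂μ = ((∫ x, ‖F x‖ ^ 2 ∂μ : ℝ) : ℂ) := by
  rw [← integral_complex_ofReal]
  simp_rw [Complex.mul_conj, Complex.normSq_eq_norm_sq]

lemma norm_toLp_sq (hF : MemLp F 2 μ) : ‖hF.toLp F‖ ^ 2 = ∫ x, ‖F x‖ ^ 2 ∂μ := by
  have h := inner_toLp_toLp hF hF
  rw [integral_mul_conj_self, inner_self_eq_norm_sq_to_K] at h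
  exact Complex.ofReal_injective (by simpa using h)

lemma integrable_mul_conj (hF : MemLp F 2 μ) (hG : MemLp G 2 μ) :
    Integrable (fun x => F x * conj (G x)) μ :=
  hF.integrable_mul hG.star

lemma integrable_norm_sq (hF : MemLp F 2 μ) : Integrable (fun x => ‖F x‖ ^ 2) μ :=
  (memLp_two_iff_integrable_sq_norm hF.1).1 hF

lemma MemLp.bdd_mul_left (hF : MemLp F 2 μ) {g : α → ℂ} {C : ℝ} (hg : AEStronglyMeasurable g μ)
    (hC : ∀ᵐ x ∂μ, ‖g x‖ ≤ C) : MemLp (fun x => g x * F x) 2 μ := by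
  refine hF.of_le_mul (c := C) (hg.mul hF.1) ?_
  filter_upwards [hC] with x hx
  rw [norm_mul]
  exact mul_le_mul_of_nonneg_right hx (norm_nonneg _)

/-- Convergence of a sequence of square-integrable functions. -/
def L2Tendsto (μ : Measure α) (w : ℕ → α → ℂ) (F : α → ℂ) : Prop :=
  (∀ m, MemLp (w m) 2 μ) ∧ MemLp F 2 μ ∧
    Tendsto (fun m => eLpNorm (w m - F) 2 μ) atTop (𝓝 0)

namespace L2Tendsto

variable {w z : ℕ → α → ℂ}

lemma tendsto_toLp (h : L2Tendsto μ w F) :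
    Tendsto (fun m => (h.1 m).toLp (w m)) atTop (𝓝 (h.2.1.toLp F)) :=
  (Lp.tendsto_Lp_iff_tendsto_eLpNorm'' w h.1 F h.2.1).2 h.2.2

lemma of_tendsto_toLp (hw : ∀ m, MemLp (w m) 2 μ) (hF : MemLp F 2 μ)
    (h : Tendsto (fun m => (hw m).toLp (w m)) atTop (𝓝 (hF.toLp F))) : L2Tendsto μ w F :=
  ⟨hw, hF, (Lp.tendsto_Lp_iff_tendsto_eLpNorm'' w hw F hF).1 h⟩

lemma const (hF : MemLp F 2 μ) : L2Tendsto μ (fun _ => F) F := ⟨fun _ => hF, hF, by simp⟩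

lemma add (h : L2Tendsto μ w F) (h' : L2Tendsto μ z G) :
    L2Tendsto μ (fun m => w m + z m) (F + G) :=
  of_tendsto_toLp (fun m => (h.1 m).add (h'.1 m)) (h.2.1.add h'.2.1)
    (by
      have := h.tendsto_toLp.add h'.tendsto_toLp
      simp only [← MemLp.toLp_add] at this
      exact this)

lemma mul_left (h : L2Tendsto μ w F) {g : α → ℂ} {C : ℝ} (hg : AEStronglyMeasurable g μ)
    (hC : ∀ᵐ x ∂μ, ‖g x‖ ≤ C) :
    L2Tendsto μ (fun m x => g x * w m x) (fun x => g x * F x) := by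
  refine ⟨fun m => MemLp.bdd_mul_left (h.1 m) hg hC, MemLp.bdd_mul_left h.2.1 hg hC, ?_⟩
  have hlim : Tendsto (fun m => ENNReal.ofReal C * eLpNorm (w m - F) 2 μ) atTop (𝓝 0) := by
    have := ENNReal.Tendsto.const_mul (a := ENNReal.ofReal C) h.2.2 (Or.inr ENNReal.ofReal_ne_top)
    simpa using this
  refine tendsto_of_tendsto_of_tendsto_of_le_of_le tendsto_const_nhds hlim (fun _ => zero_le)
    fun m => ?_
  refine eLpNorm_le_mul_eLpNorm_of_ae_le_mul ?_ 2
  filter_upwards [hC] with x hx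
  simp only [Pi.sub_apply, ← mul_sub, norm_mul]
  exact mul_le_mul_of_nonneg_right hx (norm_nonneg _)

lemma conjugate (h : L2Tendsto μ w F) :
    L2Tendsto μ (fun m x => conj (w m x)) (fun x => conj (F x)) := by
  refine ⟨fun m => (h.1 m).star, h.2.1.star, ?_⟩
  refine h.2.2.congr fun m => ?_
  refine eLpNorm_congr_norm_ae (Eventually.of_forall fun x => ?_)
  simp only [Pi.sub_apply, ← map_sub, RCLike.norm_conj]

lemma congr_right (h : L2Tendsto μ w F) (hFG : F =ᵐ[μ] G) : L2Tendsto μ w G :=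
  ⟨h.1, h.2.1.ae_eq hFG, h.2.2.congr fun _ => eLpNorm_congr_ae (by
    filter_upwards [hFG] with x hx
    simp [hx])⟩

lemma congr_left (h : L2Tendsto μ w F) (hwz : ∀ m, w m =ᵐ[μ] z m) : L2Tendsto μ z F :=
  ⟨fun m => (h.1 m).ae_eq (hwz m), h.2.1, h.2.2.congr fun m => eLpNorm_congr_ae (by
    filter_upwards [hwz m] with x hx
    simp [hx])⟩

lemma tendsto_integral (h : L2Tendsto μ w F) (h' : L2Tendsto μ z G) :
    Tendsto (fun m => ∫ x, w m x * (starRingEnd ℂ) (z m x) ∂μ) atTop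
      (𝓝 (∫ x, F x * (starRingEnd ℂ) (G x) ∂μ)) := by
  have := h'.tendsto_toLp.inner (𝕜 := ℂ) h.tendsto_toLp
  simpa only [inner_toLp_toLp] using this

end L2Tendsto

end L2

/-! ### Functions in `H¹(Ω)` with their gradients and traces -/

section H1

open Set Filter Topology

variable {n : ℕ} {Q : Box n}

lemma cderiv_conj (i : Fin (n + 1)) {z : (Fin (n + 1) → ℝ) → ℂ} (hz : Differentiable ℝ z) :
    cderiv i (fun x => conj (z x)) = fun x => conj (cderiv i z x) := by
  funext x
  have h : HasFDerivAt (fun x => conj (z x))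
      ((Complex.conjCLE : ℂ →L[ℝ] ℂ).comp (fderiv ℝ z x)) x :=
    (Complex.conjCLE : ℂ →L[ℝ] ℂ).hasFDerivAt.comp x (hz x).hasFDerivAt
  simp [cderiv, h.fderiv]

lemma cderiv_mul (i : Fin (n + 1)) {w z : (Fin (n + 1) → ℝ) → ℂ} (hw : Differentiable ℝ w)
    (hz : Differentiable ℝ z) :
    cderiv i (fun x => w x * z x) = fun x => cderiv i w x * z x + w x * cderiv i z x := by
  funext x
  simp only [cderiv]
  rw [fderiv_fun_mul (hw x) (hz x)]
  simp only [add_apply, smul_apply, smul_eq_mul]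
  ring

lemma cderiv_add (i : Fin (n + 1)) {w z : (Fin (n + 1) → ℝ) → ℂ} (hw : Differentiable ℝ w)
    (hz : Differentiable ℝ z) : cderiv i (w + z) = cderiv i w + cderiv i z := by
  funext x
  simp [cderiv, fderiv_add (hw x) (hz x)]

lemma cderiv_ofReal (i : Fin (n + 1)) {φ : (Fin (n + 1) → ℝ) → ℝ} (hφ : Differentiable ℝ φ) :
    cderiv i (fun x => (φ x : ℂ)) = fun x => (pderiv i φ x : ℂ) := by
  funext x
  have h : HasFDerivAt (fun x => (φ x : ℂ)) (Complex.ofRealCLM.comp (fderiv ℝ φ x)) x :=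
    Complex.ofRealCLM.hasFDerivAt.comp x (hφ x).hasFDerivAt
  simp [cderiv, h.fderiv, pderiv]

lemma cderiv_coord (i j : Fin (n + 1)) :
    cderiv i (fun x : Fin (n + 1) → ℝ => (x j : ℂ)) = fun _ => if j = i then 1 else 0 := by
  rw [cderiv_ofReal i (by fun_prop)]
  funext x
  have : fderiv ℝ (fun x : Fin (n + 1) → ℝ => x j) x =
    ContinuousLinearMap.proj (R := ℝ) (φ := fun _ : Fin (n + 1) => ℝ) j :=
    (ContinuousLinearMap.proj (R := ℝ) (φ := fun _ : Fin (n + 1) => ℝ) j).hasFDerivAt.fderiv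
  simp only [pderiv, this, ContinuousLinearMap.proj_apply, Pi.single_apply]
  split_ifs <;> simp

/-- `F` is a limit of smooth functions in `H¹(Ω)` with gradient `dF`, whose boundary values
converge to `t` in `L²(Γ)`. -/
def IsH1 (Q : Box n) (F : (Fin (n + 1) → ℝ) → ℂ) (dF : Fin (n + 1) → (Fin (n + 1) → ℝ) → ℂ)
    (t : (Fin (n + 1) → ℝ) → ℂ) : Prop :=
  ∃ w : ℕ → (Fin (n + 1) → ℝ) → ℂ, (∀ m, ContDiff ℝ ∞ (w m)) ∧ L2Tendsto Q.vol w F ∧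
    (∀ i, L2Tendsto Q.vol (fun m => cderiv i (w m)) (dF i)) ∧ L2Tendsto Q.surf w t

namespace IsH1

variable {F G : (Fin (n + 1) → ℝ) → ℂ} {dF dG : Fin (n + 1) → (Fin (n + 1) → ℝ) → ℂ}
  {t s : (Fin (n + 1) → ℝ) → ℂ}

lemma memLp (h : IsH1 Q F dF t) : MemLp F 2 Q.vol := by
  obtain ⟨w, -, h, -, -⟩ := h; exact h.2.1

lemma memLp_deriv (h : IsH1 Q F dF t) (i : Fin (n + 1)) : MemLp (dF i) 2 Q.vol := by
  obtain ⟨w, -, -, h, -⟩ := h; exact (h i).2.1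

lemma memLp_trace (h : IsH1 Q F dF t) : MemLp t 2 Q.surf := by
  obtain ⟨w, -, -, -, h⟩ := h; exact h.2.1

lemma of_contDiff {w : (Fin (n + 1) → ℝ) → ℂ} (hw : ContDiff ℝ ∞ w) :
    IsH1 Q w (fun i => cderiv i w) w :=
  ⟨fun _ => w, fun _ => hw, L2Tendsto.const (Q.memLp_vol_of_continuous hw.continuous 2),
    fun i => L2Tendsto.const (Q.memLp_vol_of_continuous (contDiff_cderiv hw i).continuous 2),
    L2Tendsto.const (Q.memLp_surf_of_continuous hw.continuous 2)⟩

lemma congr (h : IsH1 Q F dF t) (hF : F =ᵐ[Q.vol] G) (hd : ∀ i, dF i =ᵐ[Q.vol] dG i)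
    (ht : t =ᵐ[Q.surf] s) : IsH1 Q G dG s := by
  obtain ⟨w, h0, h1, h2, h3⟩ := h
  exact ⟨w, h0, h1.congr_right hF, fun i => (h2 i).congr_right (hd i), h3.congr_right ht⟩

lemma add (h : IsH1 Q F dF t) (h' : IsH1 Q G dG s) :
    IsH1 Q (F + G) (fun i => dF i + dG i) (t + s) := by
  obtain ⟨w, h0, h1, h2, h3⟩ := h
  obtain ⟨z, h0', h1', h2', h3'⟩ := h'
  refine ⟨fun m => w m + z m, fun m => (h0 m).add (h0' m), h1.add h1', fun i => ?_, h3.add h3'⟩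
  refine ((h2 i).add (h2' i)).congr_left fun m => Eventually.of_forall fun x => ?_
  simp only
  rw [cderiv_add i ((h0 m).differentiable (by simp)) ((h0' m).differentiable (by simp))]

lemma mul_left (h : IsH1 Q F dF t) {ψ : (Fin (n + 1) → ℝ) → ℂ} (hψ : ContDiff ℝ ∞ ψ) :
    IsH1 Q (fun x => ψ x * F x) (fun i x => cderiv i ψ x * F x + ψ x * dF i x)
      (fun x => ψ x * t x) := by
  obtain ⟨w, h0, h1, h2, h3⟩ := h
  obtain ⟨C, hC, hC'⟩ := Q.exists_bound_of_continuous hψ.continuous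
  refine ⟨fun m x => ψ x * w m x, fun m => hψ.mul (h0 m),
    h1.mul_left hψ.continuous.aestronglyMeasurable hC, fun i => ?_,
    h3.mul_left hψ.continuous.aestronglyMeasurable hC'⟩
  have hc := (contDiff_cderiv hψ i).continuous
  obtain ⟨K, hK, -⟩ := Q.exists_bound_of_continuous hc
  refine ((h1.mul_left hc.aestronglyMeasurable hK).add
    ((h2 i).mul_left hψ.continuous.aestronglyMeasurable hC)).congr_left
    fun m => Eventually.of_forall fun x => ?_
  rw [cderiv_mul i (hψ.differentiable (by simp)) ((h0 m).differentiable (by simp))]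
  rfl

lemma const_mul (h : IsH1 Q F dF t) (c : ℂ) :
    IsH1 Q (fun x => c * F x) (fun i x => c * dF i x) (fun x => c * t x) :=
  (h.mul_left (ψ := fun _ => c) contDiff_const).congr (ae_eq_refl _)
    (fun i => Eventually.of_forall fun x => by simp [cderiv]) (ae_eq_refl _)

lemma coord_mul (h : IsH1 Q F dF t) (j : Fin (n + 1)) :
    IsH1 Q (fun x => (x j : ℂ) * F x) (fun i x => (if j = i then 1 else 0) * F x + x j * dF i x)
      (fun x => (x j : ℂ) * t x) :=
  (h.mul_left (ψ := fun x => (x j : ℂ))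
    (Complex.ofRealCLM.contDiff.comp (contDiff_apply ℝ ℝ j))).congr
    (ae_eq_refl _) (fun i => Eventually.of_forall fun x => by simp only [cderiv_coord])
    (ae_eq_refl _)

lemma conjugate (h : IsH1 Q F dF t) :
    IsH1 Q (fun x => conj (F x)) (fun i x => conj (dF i x)) (fun x => conj (t x)) := by
  obtain ⟨w, h0, h1, h2, h3⟩ := h
  refine ⟨fun m x => (starRingEnd ℂ) (w m x), fun m => Complex.conjCLE.contDiff.comp (h0 m),
    h1.conjugate, fun i => ?_, h3.conjugate⟩
  refine (h2 i).conjugate.congr_left fun m => Eventually.of_forall fun x => ?_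
  rw [cderiv_conj i ((h0 m).differentiable (by simp))]

lemma sub (h : IsH1 Q F dF t) (h' : IsH1 Q G dG s) :
    IsH1 Q (fun x => F x - G x) (fun i x => dF i x - dG i x) (fun x => t x - s x) :=
  (h.add (h'.const_mul (-1))).congr (Eventually.of_forall fun x => by simp [sub_eq_add_neg])
    (fun i => Eventually.of_forall fun x => by simp [sub_eq_add_neg])
    (Eventually.of_forall fun x => by simp [sub_eq_add_neg])

lemma sum {ι : Type*} (S : Finset ι) {F : ι → (Fin (n + 1) → ℝ) → ℂ}
    {dF : ι → Fin (n + 1) → (Fin (n + 1) → ℝ) → ℂ} {t : ι → (Fin (n + 1) → ℝ) → ℂ}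
    (h : ∀ j, IsH1 Q (F j) (dF j) (t j)) :
    IsH1 Q (fun x => ∑ j ∈ S, F j x) (fun i x => ∑ j ∈ S, dF j i x)
      (fun x => ∑ j ∈ S, t j x) := by
  classical
  induction S using Finset.induction_on with
  | empty =>
    exact (of_contDiff (Q := Q) (w := fun _ => 0) contDiff_const).congr (by simp)
      (fun i => Eventually.of_forall fun x => by simp [cderiv]) (by simp)
  | insert a S ha ih =>
    exact ((h a).add ih).congr (Eventually.of_forall fun x => by simp [ha])
      (fun i => Eventually.of_forall fun x => by simp [ha])
      (Eventually.of_forall fun x => by simp [ha])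

lemma memLp_trace_mul_normal (h : IsH1 Q F dF t) (i : Fin (n + 1)) :
    MemLp (fun x => (Q.normal x i : ℂ) * t x) 2 Q.surf :=
  MemLp.bdd_mul_left h.memLp_trace (C := 1)
    (Complex.measurable_ofReal.comp (Q.measurable_normal i)).aestronglyMeasurable
    (Eventually.of_forall fun x => by simpa using Q.abs_normal_le x i)

/-- Integration by parts in `H¹(Ω)`. -/
theorem integral_by_parts (h : IsH1 Q F dF t) (h' : IsH1 Q G dG s) (i : Fin (n + 1)) :
    ∫ x, dF i x * (starRingEnd ℂ) (G x) ∂Q.vol + ∫ x, F x * (starRingEnd ℂ) (dG i x) ∂Q.vol =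
      ∫ x, (Q.normal x i : ℂ) * t x * (starRingEnd ℂ) (s x) ∂Q.surf := by
  obtain ⟨w, h0, h1, h2, h3⟩ := h
  obtain ⟨z, h0', h1', h2', h3'⟩ := h'
  -- Both sides are continuous under L² convergence on Ω and Γ, so it is enough to treat smooth
  -- functions, where the identity is the divergence theorem for the product of one with the
  -- conjugate of the other.
  have hL := ((h2 i).tendsto_integral h1').add (h1.tendsto_integral (h2' i))
  have hR := (h3.mul_left (g := fun x => (Q.normal x i : ℂ)) (C := 1)
    (Complex.measurable_ofReal.comp (Q.measurable_normal i)).aestronglyMeasurable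
    (Eventually.of_forall fun x => by simpa using Q.abs_normal_le x i)).tendsto_integral h3'
  refine tendsto_nhds_unique hL (hR.congr fun m => ?_)
  have hw := (h0 m).differentiable (n := ∞) (by simp)
  have hz := (h0' m).differentiable (n := ∞) (by simp)
  have hcz : ContDiff ℝ ∞ (fun x => (starRingEnd ℂ) (z m x)) :=
    Complex.conjCLE.contDiff.comp (h0' m)
  have key := Q.integral_cderiv (((h0 m).mul hcz).of_le (m := 1) (by norm_num)) i
  rw [cderiv_mul i hw (hcz.differentiable (by simp)), cderiv_conj i hz,
    integral_add (integrable_mul_conj ((h2 i).1 m) (h1'.1 m))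
      (integrable_mul_conj (h1.1 m) ((h2' i).1 m))] at key
  rw [key]
  refine integral_congr_ae (Eventually.of_forall fun x => ?_)
  simp only
  ring

end IsH1

lemma Box.exists_coord_bound (Q : Box n) :
    ∃ R : ℝ, 0 ≤ R ∧ ∀ x ∈ Icc Q.lo Q.hi, ∀ i, |x i| ≤ R := by
  obtain ⟨R, hR⟩ := (isCompact_Icc (a := Q.lo) (b := Q.hi)).isBounded.exists_norm_le
  exact ⟨R, (norm_nonneg _).trans (hR Q.lo ⟨le_rfl, fun i => (Q.lt i).le⟩),
    fun x hx i => (norm_le_pi_norm x i).trans (hR x hx)⟩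

/-- The trace inequality on a box that is star-shaped with respect to a ball. -/
theorem exists_trace_bound (Q : Box n) {r : ℝ} (hr : 0 < r) (hQ : Q.StarShapedBall r) :
    ∃ C : ℝ, 0 ≤ C ∧ ∀ F dF t, IsH1 Q F dF t →
      ∫ x, ‖t x‖ ^ 2 ∂Q.surf ≤
        C * (∫ x, ‖F x‖ ^ 2 ∂Q.vol + ∑ i, ∫ x, ‖dF i x‖ ^ 2 ∂Q.vol) := by
  obtain ⟨R, hR0, hR⟩ := Q.exists_coord_bound
  refine ⟨(n + 1) * (1 + R) / r, by positivity, fun F dF t h => ?_⟩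
  rw [div_mul_eq_mul_div, le_div_iff₀ hr]
  have hF := h.memLp
  have hF2 := integrable_norm_sq hF
  have hd2 := fun i => integrable_norm_sq (h.memLp_deriv i)
  have hx : ∀ i, MemLp (fun x => (x i : ℂ) * t x) 2 Q.surf := fun i =>
    (h.coord_mul i).memLp_trace
  -- Integrate xᵢF by parts against F. Summed over i, the boundary terms give the integral of
  -- (x·n)|t|², which is at least r times that of |t|² (`hlow`); the volume terms contain only F and
  -- its gradient (`hb`).
  have key : ∀ i, ∫ x, (Q.normal x i : ℂ) * ((x i : ℂ) * t x) * conj (t x) ∂Q.surf = _ := fun i =>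
    ((h.coord_mul i).integral_by_parts h i).symm
  have hb : ∀ i, (∫ x, (Q.normal x i : ℂ) * ((x i : ℂ) * t x) * conj (t x) ∂Q.surf).re ≤
      (1 + R) * ∫ x, ‖F x‖ ^ 2 ∂Q.vol + R * ∫ x, ‖dF i x‖ ^ 2 ∂Q.vol := fun i => by
    have hm1 := integrable_mul_conj ((h.coord_mul i).memLp_deriv i) hF
    have hm2 := integrable_mul_conj ((h.coord_mul i).memLp) (h.memLp_deriv i)
    rw [key i, ← integral_add hm1 hm2, ← integral_const_mul, ← integral_const_mul,
      ← integral_add (hF2.const_mul _) ((hd2 i).const_mul _)]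
    refine (Complex.re_le_norm _).trans ((norm_integral_le_integral_norm _).trans ?_)
    refine integral_mono_ae (hm1.add hm2).norm ((hF2.const_mul _).add ((hd2 i).const_mul _)) ?_
    filter_upwards [Q.ae_mem_dom] with x hx
    have hxR := hR x (Q.dom_subset_Icc hx) i
    simp only [if_true, one_mul]
    refine (norm_add_le _ _).trans ?_
    simp only [norm_mul, RCLike.norm_conj, Complex.norm_real, Real.norm_eq_abs]
    have h1 : ‖F x + x i * dF i x‖ ≤ ‖F x‖ + R * ‖dF i x‖ := by
      refine (norm_add_le _ _).trans ?_
      rw [norm_mul, Complex.norm_real, Real.norm_eq_abs]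
      gcongr
    have h2 : |x i| * ‖F x‖ * ‖dF i x‖ ≤ R * ‖F x‖ * ‖dF i x‖ := by gcongr
    nlinarith [norm_nonneg (F x), norm_nonneg (dF i x),
      mul_le_mul_of_nonneg_right h1 (norm_nonneg (F x)), mul_nonneg hR0 (sq_nonneg (‖F x‖ - ‖dF i x‖))]
  have ht2 := integrable_norm_sq h.memLp_trace
  have hInt : ∀ i, Integrable
      (fun x => (Q.normal x i : ℂ) * ((x i : ℂ) * t x) * conj (t x)) Q.surf := fun i =>
    integrable_mul_conj ((h.coord_mul i).memLp_trace_mul_normal i) h.memLp_trace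
  have hlow : (∫ x, ‖t x‖ ^ 2 ∂Q.surf) * r ≤
      ∑ i, (∫ x, (Q.normal x i : ℂ) * ((x i : ℂ) * t x) * conj (t x) ∂Q.surf).re := by
    rw [← Complex.re_sum, ← integral_finsetSum _ (fun i _ => hInt i), ← integral_mul_const]
    have e : ∀ x, ∑ i, (Q.normal x i : ℂ) * ((x i : ℂ) * t x) * conj (t x) =
        (((∑ i, x i * Q.normal x i) * ‖t x‖ ^ 2 : ℝ) : ℂ) := fun x => by
      push_cast
      rw [Finset.sum_mul]
      refine Finset.sum_congr rfl fun i _ => ?_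
      rw [← Complex.mul_conj']
      ring
    have hInt' := integrable_finsetSum Finset.univ (fun i _ => hInt i)
    simp_rw [e] at hInt' ⊢
    rw [integral_complex_ofReal, Complex.ofReal_re]
    refine integral_mono_ae (ht2.mul_const _) ?_ ?_
    · exact hInt'.re
    · filter_upwards [hQ] with x hx
      rw [mul_comm]
      exact mul_le_mul_of_nonneg_right hx (by positivity)
  refine hlow.trans ((Finset.sum_le_sum fun i _ => hb i).trans ?_)
  rw [Finset.sum_add_distrib, Finset.sum_const, Finset.card_univ, Fintype.card_fin, nsmul_eq_mul,
    ← Finset.mul_sum]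
  have h0 : 0 ≤ ∑ i, ∫ x, ‖dF i x‖ ^ 2 ∂Q.vol :=
    Finset.sum_nonneg fun i _ => integral_nonneg fun x => by positivity
  have hn : (0 : ℝ) ≤ n := n.cast_nonneg
  push_cast
  nlinarith [mul_nonneg hn h0, mul_nonneg (mul_nonneg hn hR0) h0]

/-- A function that is approximated in `H¹(Ω)` by smooth functions has a trace. -/
theorem exists_isH1 {r : ℝ} (hr : 0 < r) (hQ : Q.StarShapedBall r)
    {F : (Fin (n + 1) → ℝ) → ℂ} {dF : Fin (n + 1) → (Fin (n + 1) → ℝ) → ℂ}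
    (w : ℕ → (Fin (n + 1) → ℝ) → ℂ) (hw : ∀ m, ContDiff ℝ ∞ (w m)) (hF : L2Tendsto Q.vol w F)
    (hd : ∀ i, L2Tendsto Q.vol (fun m => cderiv i (w m)) (dF i)) : ∃ t, IsH1 Q F dF t := by
  obtain ⟨C, hC0, hC⟩ := exists_trace_bound Q hr hQ
  have hwS : ∀ m, MemLp (w m) 2 Q.surf := fun m =>
    Q.memLp_surf_of_continuous (hw m).continuous 2
  -- The trace inequality for differences makes the boundary values a Cauchy sequence in L²(Γ);
  -- completeness supplies the trace.
  have hcau : CauchySeq fun m => (hwS m).toLp (w m) := by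
    rw [cauchySeq_iff_tendsto_dist_atTop_0]
    have hlim : Tendsto (fun p : ℕ × ℕ => √(C *
        (dist ((hF.1 p.1).toLp (w p.1)) ((hF.1 p.2).toLp (w p.2)) ^ 2 +
        ∑ i, dist (((hd i).1 p.1).toLp (cderiv i (w p.1)))
          (((hd i).1 p.2).toLp (cderiv i (w p.2))) ^ 2))) atTop (𝓝 0) := by
      have h0 := (cauchySeq_iff_tendsto_dist_atTop_0.1 hF.tendsto_toLp.cauchySeq).pow 2
      have h1 := tendsto_finsetSum Finset.univ fun i (_ : i ∈ Finset.univ) =>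
        (cauchySeq_iff_tendsto_dist_atTop_0.1 (hd i).tendsto_toLp.cauchySeq).pow 2
      simpa using ((h0.add h1).const_mul C).sqrt
    refine squeeze_zero (fun _ => dist_nonneg) (fun p => ?_) hlim
    refine Real.le_sqrt_of_sq_le ?_
    have h1 := hC _ _ _ ((IsH1.of_contDiff (Q := Q) (hw p.1)).sub (IsH1.of_contDiff (hw p.2)))
    rw [dist_eq_norm, ← MemLp.toLp_sub, norm_toLp_sq, dist_eq_norm, ← MemLp.toLp_sub, norm_toLp_sq]
    simp_rw [dist_eq_norm, ← MemLp.toLp_sub, norm_toLp_sq]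
    exact h1
  obtain ⟨t, ht⟩ := cauchySeq_tendsto_of_complete hcau
  refine ⟨t, w, hw, hF, hd, L2Tendsto.of_tendsto_toLp hwS (Lp.memLp t) ?_⟩
  simpa using ht

end H1

end HelmholtzMS

namespace HelmholtzMS

/-! ### Approximation by smooth functions up to the boundary -/

section Smoothing

open Set Filter Topology
open scoped Convolution

variable {n : ℕ} {Q : Box n}

/-- Weak partial derivative in direction `i`. -/
def WeakPartial (Q : Box n) (i : Fin (n + 1)) (u d : (Fin (n + 1) → ℝ) → ℂ) : Prop :=
  ∀ φ, IsTestFun Q φ →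
    ∫ x, u x * (pderiv i φ x : ℂ) ∂Q.vol = -∫ x, d x * (φ x : ℂ) ∂Q.vol

/-- A mollifier that, combined with the dilation by `s`, only looks inside `Ω`. -/
structure IsSmoothingKernel (Q : Box n) (s : ℝ) (κ : (Fin (n + 1) → ℝ) → ℝ) : Prop where
  smooth : ContDiff ℝ ∞ κ
  compact : HasCompactSupport κ
  nonneg : ∀ x, 0 ≤ κ x
  integral_one : ∫ x, κ x = 1
  mem_dom : ∀ x ∈ Q.dom, ∀ z ∈ tsupport κ, s • x - z ∈ Q.dom

/-- The smoothing operator `u ↦ (u * κ)(s ·)`. -/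
noncomputable def smoothing (Q : Box n) (s : ℝ) (κ : (Fin (n + 1) → ℝ) → ℝ)
    (u : (Fin (n + 1) → ℝ) → ℂ) : (Fin (n + 1) → ℝ) → ℂ :=
  fun x => ∫ y, u y * (κ (s • x - y) : ℂ) ∂Q.vol

/-- The bilinear map `(z, r) ↦ r z`. -/
noncomputable def smulPairing : ℂ →L[ℝ] ℝ →L[ℝ] ℂ := (ContinuousLinearMap.lsmul ℝ ℝ).flip

lemma smulPairing_apply (z : ℂ) (r : ℝ) : smulPairing z r = z * r := by
  simp [smulPairing, mul_comm]

variable {s : ℝ} {κ : (Fin (n + 1) → ℝ) → ℝ}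

lemma convolution_indicator_eq (κ : (Fin (n + 1) → ℝ) → ℝ) (u : (Fin (n + 1) → ℝ) → ℂ)
    (x : Fin (n + 1) → ℝ) :
    (Q.dom.indicator u ⋆[smulPairing, volume] κ) x = ∫ y, u y * (κ (x - y) : ℂ) ∂Q.vol := by
  rw [convolution_def, Box.vol, ← integral_indicator Q.measurableSet_dom]
  refine integral_congr_ae (Eventually.of_forall fun y => ?_)
  by_cases hy : y ∈ Q.dom <;> simp [hy, smulPairing_apply]

lemma smoothing_eq_convolution (s : ℝ) (κ : (Fin (n + 1) → ℝ) → ℝ)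
    (u : (Fin (n + 1) → ℝ) → ℂ) :
    smoothing Q s κ u =
      (Q.dom.indicator u ⋆[smulPairing, volume] κ) ∘ fun x => s • x := by
  funext x
  rw [Function.comp_apply, convolution_indicator_eq]
  rfl

lemma locallyIntegrable_indicator {u : (Fin (n + 1) → ℝ) → ℂ} (hu : MemLp u 2 Q.vol) :
    LocallyIntegrable (Q.dom.indicator u) volume :=
  ((integrable_indicator_iff Q.measurableSet_dom).2
    (hu.integrable (by norm_num))).locallyIntegrable

lemma contDiff_smoothing (hκ : IsSmoothingKernel Q s κ) {u : (Fin (n + 1) → ℝ) → ℂ}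
    (hu : MemLp u 2 Q.vol) : ContDiff ℝ ∞ (smoothing Q s κ u) := by
  rw [smoothing_eq_convolution]
  exact (hκ.compact.contDiff_convolution_right (n := ⊤) smulPairing
    (locallyIntegrable_indicator hu) hκ.smooth).comp (contDiff_const_smul s)

/-- On `Ω`, smoothing commutes with weak differentiation up to the dilation factor. -/
lemma cderiv_smoothing (hκ : IsSmoothingKernel Q s κ) {i : Fin (n + 1)}
    {u d : (Fin (n + 1) → ℝ) → ℂ} (hu : MemLp u 2 Q.vol) (h : WeakPartial Q i u d)
    {x : Fin (n + 1) → ℝ} (hx : x ∈ Q.dom) :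
    cderiv i (smoothing Q s κ u) x = s * smoothing Q s κ d x := by
  have hκ1 : ContDiff ℝ 1 κ := hκ.smooth.of_le (by norm_num)
  have h1 := hκ.compact.hasFDerivAt_convolution_right smulPairing
    (locallyIntegrable_indicator hu) hκ1 (s • x)
  have h2 : HasFDerivAt (smoothing Q s κ u) _ x :=
    smoothing_eq_convolution (Q := Q) s κ u ▸ h1.comp x ((hasFDerivAt_id x).const_smul s)
  rw [cderiv, h2.fderiv]
  simp only [ContinuousLinearMap.comp_apply, smul_apply, ContinuousLinearMap.id_apply, map_smul,
    Complex.real_smul]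
  congr 1
  rw [convolution_precompR_apply smulPairing (locallyIntegrable_indicator hu)
    (hκ.compact.fderiv ℝ) (hκ1.continuous_fderiv one_ne_zero), convolution_indicator_eq]
  -- For x in Ω the reflected kernel is supported inside Ω by `mem_dom`, so it is an admissible test
  -- function and no boundary term appears.
  set φ : (Fin (n + 1) → ℝ) → ℝ := fun y => κ (s • x - y) with hφ
  have hts : tsupport φ ⊆ (fun y => s • x - y) ⁻¹' tsupport κ :=
    tsupport_comp_subset_preimage κ (by fun_prop)
  have hφt : IsTestFun Q φ := by
    refine ⟨hκ.smooth.comp (contDiff_const.sub contDiff_id), ?_, fun y hy => ?_⟩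
    · exact hκ.compact.comp_homeomorph (Homeomorph.subLeft (s • x))
    · have := hκ.mem_dom x hx _ (hts hy)
      simpa using this
  have hpd : ∀ y, pderiv i φ y = -fderiv ℝ κ (s • x - y) (Pi.single i 1) := fun y => by
    have h3 : HasFDerivAt φ ((fderiv ℝ κ (s • x - y)).comp
        (-ContinuousLinearMap.id ℝ (Fin (n + 1) → ℝ))) y :=
      HasFDerivAt.comp y (hκ1.differentiable one_ne_zero _).hasFDerivAt
        ((hasFDerivAt_id y).const_sub _)
    simp [pderiv, h3.fderiv]
  have h4 := h φ hφt
  simp only [hpd, ofReal_neg, mul_neg, integral_neg, neg_inj] at h4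
  rw [h4]
  rfl

lemma smoothing_sub (hκ : IsSmoothingKernel Q s κ) {u v : (Fin (n + 1) → ℝ) → ℂ}
    (hu : MemLp u 2 Q.vol) (hv : MemLp v 2 Q.vol) :
    smoothing Q s κ (u - v) = smoothing Q s κ u - smoothing Q s κ v := by
  funext x
  have hc : Continuous fun y => (κ (s • x - y) : ℂ) := by
    have := hκ.smooth.continuous
    fun_prop
  obtain ⟨C, hC, -⟩ := Q.exists_bound_of_continuous hc
  have hInt : ∀ u : (Fin (n + 1) → ℝ) → ℂ, MemLp u 2 Q.vol →
      Integrable (fun y => u y * (κ (s • x - y) : ℂ)) Q.vol := fun u hu =>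
    (hu.integrable (by norm_num)).mul_bdd hc.aestronglyMeasurable hC
  simp only [smoothing, Pi.sub_apply, sub_mul]
  exact integral_sub (hInt u hu) (hInt v hv)

/-- The kernel κ(sx − y) has mass s^{−(n+1)} in x and, by the next lemma, mass at most one in y over
Ω. These are the two marginal bounds of the Schur test for the smoothing operator. -/
lemma lintegral_kernel (hκ : IsSmoothingKernel Q s κ) (hs : 0 < s) (y : Fin (n + 1) → ℝ) :
    ∫⁻ x, ENNReal.ofReal (κ (s • x - y)) = ENNReal.ofReal ((s ^ (n + 1))⁻¹) := by
  have hInt : Integrable κ volume := hκ.smooth.continuous.integrable_of_hasCompactSupport hκ.compact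
  have hInt' : Integrable (fun x => κ (s • x - y)) volume :=
    (hInt.comp_sub_right y).comp_smul hs.ne'
  rw [← ofReal_integral_eq_lintegral_ofReal hInt' (Eventually.of_forall fun x => hκ.nonneg _),
    Measure.integral_comp_smul volume (fun x => κ (x - y)) s, integral_sub_right_eq_self κ y,
    hκ.integral_one]
  simp [abs_of_pos (inv_pos.2 (pow_pos hs (n + 1)))]

lemma lintegral_kernel_le_one (hκ : IsSmoothingKernel Q s κ) (x : Fin (n + 1) → ℝ) :
    ∫⁻ y, ENNReal.ofReal (κ (s • x - y)) ∂Q.vol ≤ 1 := by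
  refine (setLIntegral_le_lintegral _ _).trans (le_of_eq ?_)
  have hInt : Integrable κ volume := hκ.smooth.continuous.integrable_of_hasCompactSupport hκ.compact
  rw [lintegral_sub_left_eq_self (fun y => ENNReal.ofReal (κ y)) (s • x),
    ← ofReal_integral_eq_lintegral_ofReal hInt (Eventually.of_forall fun x => hκ.nonneg _),
    hκ.integral_one, ENNReal.ofReal_one]

/-- The smoothing operator is bounded on `L²(Ω)`. -/
lemma eLpNorm_smoothing_le (hκ : IsSmoothingKernel Q s κ) (hs : 0 < s)
    {u : (Fin (n + 1) → ℝ) → ℂ} (hu : MemLp u 2 Q.vol) :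
    eLpNorm (smoothing Q s κ u) 2 Q.vol ≤
      ENNReal.ofReal ((s ^ (n + 1))⁻¹) ^ (1 / 2 : ℝ) * eLpNorm u 2 Q.vol := by
  have hκc := hκ.smooth.continuous
  -- Cauchy–Schwarz after writing κ as the product of two square roots; the factor without u has
  -- mass at most one. Integrating in x and exchanging the integrals then uses the other marginal.
  have hpt : ∀ x, ‖smoothing Q s κ u x‖ₑ ^ (2 : ℝ) ≤
      ∫⁻ y, ‖u y‖ₑ ^ (2 : ℝ) * ENNReal.ofReal (κ (s • x - y)) ∂Q.vol := fun x => by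
    have hk : AEMeasurable (fun y => ENNReal.ofReal (κ (s • x - y))) Q.vol := by
      have : Measurable fun y => κ (s • x - y) := by fun_prop
      exact this.ennreal_ofReal.aemeasurable
    have h1 : ‖smoothing Q s κ u x‖ₑ ≤
        ∫⁻ y, (‖u y‖ₑ ^ (2 : ℝ) * ENNReal.ofReal (κ (s • x - y))) ^ (1 / 2 : ℝ) *
          ENNReal.ofReal (κ (s • x - y)) ^ (1 / 2 : ℝ) ∂Q.vol := by
      refine (enorm_integral_le_lintegral_enorm _).trans (le_of_eq ?_)
      refine lintegral_congr fun y => ?_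
      rw [ENNReal.mul_rpow_of_nonneg _ _ (by norm_num), ← ENNReal.rpow_mul, mul_assoc,
        ← ENNReal.rpow_add_of_nonneg _ _ (by norm_num) (by norm_num), enorm_mul]
      norm_num
      rw [← ofReal_norm (κ (s • x - y) : ℂ), Complex.norm_real, Real.norm_of_nonneg (hκ.nonneg _)]
    have h2 := h1.trans (ENNReal.lintegral_mul_norm_pow_le
      ((hu.1.enorm.pow_const (2 : ℝ)).mul hk) hk (by norm_num) (by norm_num) (by norm_num))
    have h3 : ‖smoothing Q s κ u x‖ₑ ≤
        (∫⁻ y, ‖u y‖ₑ ^ (2 : ℝ) * ENNReal.ofReal (κ (s • x - y)) ∂Q.vol) ^ (1 / 2 : ℝ) := by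
      exact h2.trans (mul_le_of_le_one_right'
        (ENNReal.rpow_le_one (lintegral_kernel_le_one hκ x) (by norm_num)))
    calc _ ≤ ((∫⁻ y, ‖u y‖ₑ ^ (2 : ℝ) * ENNReal.ofReal (κ (s • x - y)) ∂Q.vol) ^ (1 / 2 : ℝ)) ^
          (2 : ℝ) := by gcongr
      _ = _ := by rw [← ENNReal.rpow_mul]; norm_num
  rw [eLpNorm_eq_lintegral_rpow_enorm_toReal two_ne_zero ENNReal.ofNat_ne_top,
    eLpNorm_eq_lintegral_rpow_enorm_toReal two_ne_zero ENNReal.ofNat_ne_top]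
  simp only [ENNReal.toReal_ofNat]
  rw [← ENNReal.mul_rpow_of_nonneg _ _ (by norm_num)]
  refine ENNReal.rpow_le_rpow ?_ (by norm_num)
  refine (lintegral_mono hpt).trans ?_
  rw [lintegral_lintegral_swap]
  · rw [← lintegral_const_mul'' _ (hu.1.enorm.pow_const (2 : ℝ))]
    refine lintegral_mono fun y => ?_
    have hk : Measurable fun x => ENNReal.ofReal (κ (s • x - y)) := by
      have : Measurable fun x => κ (s • x - y) := by fun_prop
      exact this.ennreal_ofReal
    rw [lintegral_const_mul _ hk, mul_comm]
    gcongr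
    exact (setLIntegral_le_lintegral _ _).trans (lintegral_kernel hκ hs y).le
  · refine AEMeasurable.mul ?_ ?_
    · exact (hu.1.comp_snd (μ := Q.vol)).enorm.pow_const (2 : ℝ)
    · have : Measurable fun p : (Fin (n + 1) → ℝ) × (Fin (n + 1) → ℝ) => κ (s • p.1 - p.2) := by
        fun_prop
      exact this.ennreal_ofReal.aemeasurable

/-- Smoothing changes a continuous function by at most its oscillation. -/
lemma norm_smoothing_sub_le (hκ : IsSmoothingKernel Q s κ) {ψ : (Fin (n + 1) → ℝ) → ℂ}
    (hψ : Continuous ψ) {x : Fin (n + 1) → ℝ} (hx : x ∈ Q.dom) {ε : ℝ}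
    (hosc : ∀ z ∈ tsupport κ, ‖ψ (s • x - z) - ψ x‖ ≤ ε) :
    ‖smoothing Q s κ ψ x - ψ x‖ ≤ ε := by
  have hκc := hκ.smooth.continuous
  have hInt : Integrable (fun y => κ (s • x - y)) volume := by
    have hInt : Integrable κ volume := hκc.integrable_of_hasCompactSupport hκ.compact
    exact hInt.comp_sub_left (s • x)
  have hone : ∫ y, κ (s • x - y) = 1 := by
    rw [integral_sub_left_eq_self κ volume (s • x), hκ.integral_one]
  -- For x in Ω the kernel vanishes outside Ω, so restricting to Ω loses no mass and constants are
  -- preserved.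
  have hzero : ∀ y, y ∉ Q.dom → κ (s • x - y) = 0 := fun y hy => by
    by_contra h
    have := hκ.mem_dom x hx _ (subset_tsupport κ h)
    simp at this
    exact hy this
  have hone' : ∫ y, κ (s • x - y) ∂Q.vol = 1 := by
    rw [← hone, Box.vol]
    exact setIntegral_eq_integral_of_forall_compl_eq_zero hzero
  have hc : Continuous fun y => ψ y * (κ (s • x - y) : ℂ) := by fun_prop
  have hc' : Continuous fun y => ψ x * (κ (s • x - y) : ℂ) := by fun_prop
  have e : smoothing Q s κ ψ x - ψ x = ∫ y, (ψ y - ψ x) * (κ (s • x - y) : ℂ) ∂Q.vol := by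
    simp_rw [sub_mul]
    rw [integral_sub ((Q.memLp_vol_of_continuous hc 1).integrable le_rfl)
      ((Q.memLp_vol_of_continuous hc' 1).integrable le_rfl), integral_const_mul,
      integral_complex_ofReal, hone']
    simp [smoothing]
  rw [e]
  have hb : ∫ y, ε * κ (s • x - y) ∂Q.vol = ε := by rw [integral_const_mul, hone', mul_one]
  conv_rhs => rw [← hb]
  refine norm_integral_le_of_norm_le (hInt.restrict.const_mul ε) (Eventually.of_forall fun y => ?_)
  rw [norm_mul, Complex.norm_real, Real.norm_of_nonneg (hκ.nonneg _)]
  by_cases h : κ (s • x - y) = 0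
  · simp [h]
  · have := hosc _ (subset_tsupport κ h)
    simp only [sub_sub_cancel] at this
    exact mul_le_mul_of_nonneg_right this (hκ.nonneg _)

lemma Box.convex_dom (Q : Box n) : Convex ℝ Q.dom := convex_pi fun _ _ => convex_Ioo _ _

lemma Box.dom_nonempty (Q : Box n) : Q.dom.Nonempty :=
  ⟨fun i => (Q.lo i + Q.hi i) / 2, fun i _ => by
    have := Q.lt i
    constructor <;> simp <;> linarith⟩

lemma Box.isBounded_dom (Q : Box n) : Bornology.IsBounded Q.dom :=
  isCompact_Icc.isBounded.subset Q.dom_subset_Icc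

variable (Q) in
/-- Smoothing kernels of arbitrarily small displacement exist. -/
lemma exists_smoothingKernels :
    ∃ (s : ℕ → ℝ) (κ : ℕ → (Fin (n + 1) → ℝ) → ℝ) (δ : ℕ → ℝ),
      (∀ m, IsSmoothingKernel Q (s m) (κ m)) ∧ (∀ m, 1 / 2 ≤ s m ∧ s m ≤ 1) ∧
      Tendsto s atTop (𝓝 1) ∧ Tendsto δ atTop (𝓝 0) ∧
      ∀ m, ∀ x ∈ Q.dom, ∀ z ∈ tsupport (κ m), dist (s m • x - z) x ≤ δ m := by
  obtain ⟨c, hc⟩ := Q.dom_nonempty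
  obtain ⟨r, hr, hball⟩ := Metric.nhds_basis_closedBall.mem_iff.1 (Q.isOpen_dom.mem_nhds hc)
  have ht0 : ∀ m : ℕ, (0 : ℝ) < 1 / ((m : ℝ) + 2) := fun m => by positivity
  have ht1 : ∀ m : ℕ, 1 / ((m : ℝ) + 2) ≤ 1 / 2 := fun m => by
    apply one_div_le_one_div_of_le <;> linarith [(m.cast_nonneg : (0 : ℝ) ≤ m)]
  have htl : Tendsto (fun m : ℕ => 1 / ((m : ℝ) + 2)) atTop (𝓝 0) := by
    have := (tendsto_one_div_add_atTop_nhds_zero_nat (𝕜 := ℝ)).comp (tendsto_add_atTop_nat 1)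
    refine this.congr fun m => ?_
    simp [add_assoc]
    norm_num
  set t : ℕ → ℝ := fun m => 1 / ((m : ℝ) + 2) with ht
  -- The bump is centred at −tc with radius tr, where the ball of radius r about c lies in Ω. Every
  -- point of its support is thus −tz' with z' in Ω, and with s = 1 − t the point sx − z = (1 − t)x
  -- + tz' lies in Ω by convexity.
  let f : ∀ m, ContDiffBump (-(t m) • c : Fin (n + 1) → ℝ) := fun m =>
    ⟨t m * r / 2, t m * r, by have := ht0 m; positivity, by have := mul_pos (ht0 m) hr; linarith⟩
  have hpt : ∀ m, ∀ z ∈ tsupport ((f m).normed volume), ∃ z' ∈ Q.dom, z = -(t m) • z' := by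
    intro m z hz
    rw [ContDiffBump.tsupport_normed_eq] at hz
    refine ⟨-(t m)⁻¹ • z, hball ?_, ?_⟩
    · have hz' : dist z (-(t m) • c) ≤ t m * r := hz
      rw [Metric.mem_closedBall]
      have e : -(t m)⁻¹ • z - c = -(t m)⁻¹ • (z - -(t m) • c) := by
        rw [smul_sub, smul_smul, neg_mul_neg, inv_mul_cancel₀ (ht0 m).ne', one_smul]
      rw [dist_eq_norm, e, norm_smul, norm_neg, norm_inv, Real.norm_of_nonneg (ht0 m).le,
        ← dist_eq_norm, inv_mul_le_iff₀ (ht0 m)]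
      exact hz'
    · rw [smul_smul, neg_mul_neg, mul_inv_cancel₀ (ht0 m).ne', one_smul]
  refine ⟨fun m => 1 - t m, fun m => (f m).normed volume,
    fun m => t m * Metric.diam Q.dom, fun m => ?_, fun m => ?_, ?_, ?_, ?_⟩
  · refine ⟨(f m).contDiff_normed, (f m).hasCompactSupport_normed, (f m).nonneg_normed,
      (f m).integral_normed, fun x hx z hz => ?_⟩
    obtain ⟨z', hz', rfl⟩ := hpt m z hz
    have := Q.convex_dom hx hz' (a := 1 - t m) (b := t m) (by linarith [ht1 m]) (ht0 m).le (by ring)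
    rwa [neg_smul, sub_neg_eq_add]
  · constructor <;> linarith [ht1 m, ht0 m]
  · simpa using (tendsto_const_nhds (x := (1 : ℝ))).sub htl
  · simpa using htl.mul_const (Metric.diam Q.dom)
  · intro m x hx z hz
    obtain ⟨z', hz', rfl⟩ := hpt m z hz
    have e : (1 - t m) • x - -(t m) • z' - x = t m • (z' - x) := by module
    simp only
    rw [dist_eq_norm, e, norm_smul, Real.norm_of_nonneg (ht0 m).le, ← dist_eq_norm]
    exact mul_le_mul_of_nonneg_left (Metric.dist_le_diam_of_mem Q.isBounded_dom hz' hx) (ht0 m).le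

lemma L2Tendsto.smul_tendsto {α : Type*} [MeasurableSpace α] {μ : Measure α} {w : ℕ → α → ℂ}
    {F : α → ℂ} (h : L2Tendsto μ w F) {c : ℕ → ℂ} {a : ℂ} (hc : Tendsto c atTop (𝓝 a)) :
    L2Tendsto μ (fun m => c m • w m) (a • F) :=
  of_tendsto_toLp (fun m => (h.1 m).const_smul (c m)) (h.2.1.const_smul a) (by
    have := hc.smul h.tendsto_toLp
    simp only [← MemLp.toLp_const_smul] at this
    exact this)

/-- Smoothing converges to the identity in `L²(Ω)`. -/
theorem l2Tendsto_smoothing {s : ℕ → ℝ} {κ : ℕ → (Fin (n + 1) → ℝ) → ℝ} {δ : ℕ → ℝ}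
    (hκ : ∀ m, IsSmoothingKernel Q (s m) (κ m)) (hs : ∀ m, 1 / 2 ≤ s m ∧ s m ≤ 1)
    (hδ : Tendsto δ atTop (𝓝 0))
    (hd : ∀ m, ∀ x ∈ Q.dom, ∀ z ∈ tsupport (κ m), dist (s m • x - z) x ≤ δ m)
    {g : (Fin (n + 1) → ℝ) → ℂ} (hg : MemLp g 2 Q.vol) :
    L2Tendsto Q.vol (fun m => smoothing Q (s m) (κ m) g) g := by
  have hmem : ∀ m, ∀ g, MemLp g 2 Q.vol → MemLp (smoothing Q (s m) (κ m) g) 2 Q.vol :=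
    fun m g hg => Q.memLp_vol_of_continuous (contDiff_smoothing (hκ m) hg).continuous 2
  refine ⟨fun m => hmem m g hg, hg, ?_⟩
  set K : ENNReal := ENNReal.ofReal (2 ^ (n + 1)) ^ (1 / 2 : ℝ) with hK
  set V : ENNReal := Q.vol univ ^ (1 / 2 : ℝ) with hV
  have hKt : K ≠ ⊤ := ENNReal.rpow_ne_top_of_nonneg (by norm_num) ENNReal.ofReal_ne_top
  have hVt : V ≠ ⊤ := ENNReal.rpow_ne_top_of_nonneg (by norm_num) (measure_ne_top _ _)
  have hCt : K + V + 1 ≠ ⊤ := by finiteness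
  -- Approximate g by a compactly supported continuous ψ. The constant K bounds the smoothing of g −
  -- ψ (here s ≥ 1/2 enters), V turns the uniform bound on the smoothing error of ψ into an L²
  -- bound, and 1 accounts for ψ − g.
  have hsmall : ∀ ε : ℝ, 0 < ε → ∀ᶠ m in atTop,
      eLpNorm (smoothing Q (s m) (κ m) g - g) 2 Q.vol ≤ (K + V + 1) * ENNReal.ofReal ε := by
    intro ε hε
    have : Q.vol.Regular := Measure.Regular.restrict_of_measure_ne_top (by
      have := measure_ne_top Q.vol univ
      simpa [Box.vol] using this)
    obtain ⟨ψ, hψs, hψ, hψc, hψm⟩ := hg.exists_hasCompactSupport_eLpNorm_sub_le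
      ENNReal.ofNat_ne_top (ε := ENNReal.ofReal ε) (by simpa using hε)
    obtain ⟨η, hη, huc⟩ := Metric.uniformContinuous_iff.1
      (hψs.uniformContinuous_of_continuous hψc) ε hε
    filter_upwards [hδ.eventually (gt_mem_nhds hη)] with m hm
    have hs0 : 0 < s m := by linarith [(hs m).1]
    have h1 : eLpNorm (smoothing Q (s m) (κ m) (g - ψ)) 2 Q.vol ≤ K * ENNReal.ofReal ε := by
      refine (eLpNorm_smoothing_le (hκ m) hs0 (hg.sub hψm)).trans ?_
      have h2 : (s m)⁻¹ ≤ 2 := by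
        rw [inv_le_comm₀ hs0 (by norm_num)]; linarith [(hs m).1]
      refine mul_le_mul' ?_ hψ
      rw [hK, ← inv_pow]
      gcongr
    have h2 : eLpNorm (smoothing Q (s m) (κ m) ψ - ψ) 2 Q.vol ≤ V * ENNReal.ofReal ε := by
      refine (eLpNorm_le_of_ae_bound (C := ε) ?_).trans (le_of_eq ?_)
      · filter_upwards [Q.ae_mem_dom] with x hx
        refine norm_smoothing_sub_le (hκ m) hψc hx fun z hz => ?_
        have := huc (lt_of_le_of_lt (hd m x hx z hz) hm)
        rw [← dist_eq_norm]
        exact this.le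
      · rw [hV]; norm_num
    have e : smoothing Q (s m) (κ m) g - g = smoothing Q (s m) (κ m) (g - ψ) +
        (smoothing Q (s m) (κ m) ψ - ψ) + (ψ - g) := by
      rw [smoothing_sub (hκ m) hg hψm]; abel
    have hm1 := (hmem m _ (hg.sub hψm)).1
    have hm2 := ((hmem m _ hψm).sub hψm).1
    rw [e]
    refine (eLpNorm_add_le (hm1.add hm2) (hψm.sub hg).1 (by norm_num)).trans ?_
    refine (add_le_add_left (eLpNorm_add_le hm1 hm2 (by norm_num)) _).trans ?_
    rw [add_mul, add_mul, one_mul]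
    rw [eLpNorm_sub_comm ψ g]
    gcongr
  rw [ENNReal.tendsto_nhds_zero]
  intro η hη
  have hlim : Tendsto (fun ε : ℝ => (K + V + 1) * ENNReal.ofReal ε) (𝓝[>] 0) (𝓝 0) := by
    have h1 : Tendsto (fun ε : ℝ => ENNReal.ofReal ε) (𝓝[>] 0) (𝓝 0) := by
      have := (ENNReal.continuous_ofReal.tendsto 0).mono_left (nhdsWithin_le_nhds (s := Ioi 0))
      simpa using this
    simpa using ENNReal.Tendsto.const_mul h1 (Or.inr hCt)
  obtain ⟨ε, hε1, hε2⟩ := ((hlim.eventually (gt_mem_nhds hη)).and self_mem_nhdsWithin).exists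
  filter_upwards [hsmall ε hε2] with m hm using hm.trans hε1.le

/-- A function in `L²(Ω)` with weak gradient in `L²(Ω)` has a trace. -/
theorem exists_isH1_of_weakPartial {r : ℝ} (hr : 0 < r) (hQ : Q.StarShapedBall r)
    {u : (Fin (n + 1) → ℝ) → ℂ} {d : Fin (n + 1) → (Fin (n + 1) → ℝ) → ℂ}
    (hu : MemLp u 2 Q.vol) (hd : ∀ i, MemLp (d i) 2 Q.vol)
    (hw : ∀ i, WeakPartial Q i u (d i)) : ∃ t, IsH1 Q u d t := by
  obtain ⟨s, κ, δ, hκ, hs, hs1, hδ, hdist⟩ := exists_smoothingKernels Q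
  refine exists_isH1 hr hQ (fun m => smoothing Q (s m) (κ m) u)
    (fun m => contDiff_smoothing (hκ m) hu) (l2Tendsto_smoothing hκ hs hδ hdist hu) fun i => ?_
  have h1 := (l2Tendsto_smoothing hκ hs hδ hdist (hd i)).smul_tendsto
    (Complex.continuous_ofReal.tendsto 1 |>.comp hs1)
  rw [Complex.ofReal_one, one_smul] at h1
  refine h1.congr_left fun m => ?_
  filter_upwards [Q.ae_mem_dom] with x hx
  rw [cderiv_smoothing (hκ m) hu (hw i) hx]
  rfl

end Smoothing

end HelmholtzMS

namespace HelmholtzMS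

/-! ### Multi-indices -/

section MultiIndex

variable {n : ℕ}

lemma contDiff_pderiv {φ : (Fin (n + 1) → ℝ) → ℝ} (hφ : ContDiff ℝ ∞ φ) (i : Fin (n + 1)) :
    ContDiff ℝ ∞ (pderiv i φ) := by
  have h : ContDiff ℝ ∞ (fderiv ℝ φ) := hφ.fderiv_right (by simp)
  exact h.clm_apply contDiff_const

lemma pderiv_comm {φ : (Fin (n + 1) → ℝ) → ℝ} (hφ : ContDiff ℝ ∞ φ) (i j : Fin (n + 1)) :
    pderiv i (pderiv j φ) = pderiv j (pderiv i φ) := by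
  funext x
  have hd : DifferentiableAt ℝ (fderiv ℝ φ) x :=
    (hφ.fderiv_right (m := ∞) (by simp)).differentiable (by simp) x
  have h : ∀ a b : Fin (n + 1), pderiv a (pderiv b φ) x =
      fderiv ℝ (fderiv ℝ φ) x (Pi.single a 1) (Pi.single b 1) := fun a b => by
    have := (hd.hasFDerivAt.clm_apply (hasFDerivAt_const (Pi.single b 1 : Fin (n + 1) → ℝ) x)).fderiv
    change fderiv ℝ (fun y => fderiv ℝ φ y (Pi.single b 1)) x (Pi.single a 1) = _
    rw [this]
    simp
  rw [h, h]
  exact (hφ.contDiffAt.isSymmSndFDerivAt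
    (by simp only [minSmoothness_of_isRCLikeNormedField]; exact WithTop.coe_le_coe.2 le_top)).eq _ _

lemma contDiff_iterate_pderiv {φ : (Fin (n + 1) → ℝ) → ℝ} (hφ : ContDiff ℝ ∞ φ)
    (i : Fin (n + 1)) (k : ℕ) : ContDiff ℝ ∞ ((pderiv i)^[k] φ) := by
  induction k with
  | zero => exact hφ
  | succ k ih => rw [Function.iterate_succ_apply']; exact contDiff_pderiv ih i

lemma pderiv_iterate_comm {φ : (Fin (n + 1) → ℝ) → ℝ} (hφ : ContDiff ℝ ∞ φ)
    (i j : Fin (n + 1)) (k : ℕ) :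
    pderiv j ((pderiv i)^[k] φ) = (pderiv i)^[k] (pderiv j φ) := by
  induction k with
  | zero => rfl
  | succ k ih =>
    rw [Function.iterate_succ_apply', Function.iterate_succ_apply', ← ih,
      pderiv_comm (contDiff_iterate_pderiv hφ i k)]

/-- `mderiv` composes the partial derivatives in list order. Since they commute, an extra derivative
in direction j can be moved to the innermost position; the assertions are proved jointly because the
induction for a list containing j needs the others for its tail. -/
lemma mderiv_foldr_add_single (α : Fin (n + 1) → ℕ) (j : Fin (n + 1)) (l : List (Fin (n + 1)))
    (hl : l.Nodup) {φ : (Fin (n + 1) → ℝ) → ℝ} (hφ : ContDiff ℝ ∞ φ) :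
    ContDiff ℝ ∞ (l.foldr (fun i ψ => (pderiv i)^[α i] ψ) φ) ∧
    pderiv j (l.foldr (fun i ψ => (pderiv i)^[α i] ψ) φ) =
      l.foldr (fun i ψ => (pderiv i)^[α i] ψ) (pderiv j φ) ∧
    (j ∉ l → l.foldr (fun i ψ => (pderiv i)^[(α + Pi.single j 1 : Fin (n + 1) → ℕ) i] ψ) φ =
      l.foldr (fun i ψ => (pderiv i)^[α i] ψ) φ) ∧
    (j ∈ l → l.foldr (fun i ψ => (pderiv i)^[(α + Pi.single j 1 : Fin (n + 1) → ℕ) i] ψ) φ =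
      l.foldr (fun i ψ => (pderiv i)^[α i] ψ) (pderiv j φ)) := by
  induction l with
  | nil => exact ⟨hφ, rfl, fun _ => rfl, fun h => by simp at h⟩
  | cons a l ih =>
    obtain ⟨ha, hl'⟩ := List.nodup_cons.1 hl
    obtain ⟨h1, h2, h3, h4⟩ := ih hl'
    simp only [List.foldr_cons]
    refine ⟨contDiff_iterate_pderiv h1 a _, ?_, fun hj => ?_, fun hj => ?_⟩
    · rw [pderiv_iterate_comm h1, h2]
    · rw [List.mem_cons, not_or] at hj
      rw [h3 hj.2]
      simp [Ne.symm hj.1]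
    · rcases eq_or_ne j a with rfl | hja
      · rw [h3 ha, ← h2]
        simp
      · rw [h4 ((List.mem_cons.1 hj).resolve_left hja)]
        simp [hja.symm]

lemma mderiv_add_single (α : Fin (n + 1) → ℕ) (j : Fin (n + 1)) {φ : (Fin (n + 1) → ℝ) → ℝ}
    (hφ : ContDiff ℝ ∞ φ) : mderiv (α + Pi.single j 1) φ = mderiv α (pderiv j φ) :=
  (mderiv_foldr_add_single α j _ (List.nodup_finRange _) hφ).2.2.2 (List.mem_finRange j)

lemma mderiv_zero (φ : (Fin (n + 1) → ℝ) → ℝ) : mderiv (0 : Fin (n + 1) → ℕ) φ = φ := by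
  unfold mderiv
  induction List.finRange (n + 1) with
  | nil => rfl
  | cons a l ih => simp

lemma mderiv_single (j : Fin (n + 1)) {φ : (Fin (n + 1) → ℝ) → ℝ} (hφ : ContDiff ℝ ∞ φ) :
    mderiv (Pi.single j 1) φ = pderiv j φ := by
  rw [← zero_add (Pi.single j 1), mderiv_add_single 0 j hφ, mderiv_zero]

variable {Q : Box n}

lemma tsupport_pderiv_subset (i : Fin (n + 1)) (φ : (Fin (n + 1) → ℝ) → ℝ) :
    tsupport (pderiv i φ) ⊆ tsupport φ := by
  refine closure_minimal (fun x hx => ?_) (isClosed_tsupport φ)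
  refine support_fderiv_subset ℝ (f := φ) fun h => hx ?_
  simp [pderiv, h]

lemma IsTestFun.pderiv {φ : (Fin (n + 1) → ℝ) → ℝ} (hφ : IsTestFun Q φ) (i : Fin (n + 1)) :
    IsTestFun Q (pderiv i φ) :=
  ⟨contDiff_pderiv hφ.1 i, hφ.2.1.of_isClosed_subset (isClosed_tsupport _)
    (tsupport_pderiv_subset i φ), (tsupport_pderiv_subset i φ).trans hφ.2.2⟩

lemma isWeakDeriv_single_iff (i : Fin (n + 1)) (u w : (Fin (n + 1) → ℝ) → ℂ) :
    IsWeakDeriv Q (Pi.single i 1) u w ↔ WeakPartial Q i u w := by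
  refine forall₂_congr fun φ hφ => ?_
  rw [mderiv_single i hφ.1]
  simp

/-- Weak derivatives of order `|α| + 1` are weak partial derivatives of those of order `|α|`. -/
lemma IsWeakDeriv.weakPartial {α : Fin (n + 1) → ℕ} {j : Fin (n + 1)}
    {u w w' : (Fin (n + 1) → ℝ) → ℂ} (h : IsWeakDeriv Q α u w)
    (h' : IsWeakDeriv Q (α + Pi.single j 1) u w') : WeakPartial Q j w w' := by
  intro φ hφ
  have h1 := h _ (hφ.pderiv j)
  have h2 := h' φ hφ
  rw [mderiv_add_single α j hφ.1, h1] at h2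
  have e : ∑ i, (α + Pi.single j 1 : Fin (n + 1) → ℕ) i = ∑ i, α i + 1 := by simp [Finset.sum_add_distrib]
  rw [e, pow_succ, mul_assoc, mul_right_inj' (by simp)] at h2
  simpa using h2

end MultiIndex

/-! ### Uniqueness of weak derivatives and traces -/

section Uniqueness

open Set Filter Topology

variable {n : ℕ} {Q : Box n}

/-- The fundamental lemma of the calculus of variations on Ω, from which uniqueness of weak
derivatives and Laplacians follows. -/
lemma ae_eq_of_forall_testFun {f g : (Fin (n + 1) → ℝ) → ℂ} (hf : MemLp f 2 Q.vol)
    (hg : MemLp g 2 Q.vol)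
    (h : ∀ φ, IsTestFun Q φ → ∫ x, f x * (φ x : ℂ) ∂Q.vol = ∫ x, g x * (φ x : ℂ) ∂Q.vol) :
    f =ᵐ[Q.vol] g := by
  have hInt : ∀ f : (Fin (n + 1) → ℝ) → ℂ, MemLp f 2 Q.vol → ∀ φ : (Fin (n + 1) → ℝ) → ℝ,
      Continuous φ → Integrable (fun x => f x * (φ x : ℂ)) Q.vol := fun f hf φ hφ => by
    obtain ⟨C, hC, -⟩ := Q.exists_bound_of_continuous (Complex.continuous_ofReal.comp hφ)
    exact (hf.integrable (by norm_num)).mul_bdd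
      (Complex.continuous_ofReal.comp hφ).aestronglyMeasurable hC
  have key := Q.isOpen_dom.ae_eq_zero_of_integral_contDiff_smul_eq_zero (μ := Q.vol)
    (f := fun x => f x - g x)
    (((hf.sub hg).integrable (by norm_num)).locallyIntegrable.locallyIntegrableOn _)
    (fun φ h1 h2 h3 => by
      have := h φ ⟨h1, h2, h3⟩
      rw [← sub_eq_zero, ← integral_sub (hInt f hf φ h1.continuous) (hInt g hg φ h1.continuous)]
        at this
      rw [← this]
      refine integral_congr_ae (Eventually.of_forall fun x => ?_)
      simp only [Complex.real_smul]
      ring)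
  filter_upwards [key, Q.ae_mem_dom] with x hx hx'
  exact sub_eq_zero.1 (hx hx')

/-- The same principle for the finite measure on Γ, regarded as a measure on the whole space; the
test functions need not vanish anywhere. -/
lemma ae_eq_surf_of_forall_contDiff {f g : (Fin (n + 1) → ℝ) → ℂ} (hf : MemLp f 2 Q.surf)
    (hg : MemLp g 2 Q.surf)
    (h : ∀ φ : (Fin (n + 1) → ℝ) → ℝ, ContDiff ℝ ∞ φ →
      ∫ x, f x * (φ x : ℂ) ∂Q.surf = ∫ x, g x * (φ x : ℂ) ∂Q.surf) :
    f =ᵐ[Q.surf] g := by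
  have hInt : ∀ f : (Fin (n + 1) → ℝ) → ℂ, MemLp f 2 Q.surf → ∀ φ : (Fin (n + 1) → ℝ) → ℝ,
      Continuous φ → Integrable (fun x => f x * (φ x : ℂ)) Q.surf := fun f hf φ hφ => by
    obtain ⟨C, -, hC⟩ := Q.exists_bound_of_continuous (Complex.continuous_ofReal.comp hφ)
    exact (hf.integrable (by norm_num)).mul_bdd
      (Complex.continuous_ofReal.comp hφ).aestronglyMeasurable hC
  have key := ae_eq_zero_of_integral_contDiff_smul_eq_zero (μ := Q.surf)
    (f := fun x => f x - g x) ((hf.sub hg).integrable (by norm_num)).locallyIntegrable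
    (fun φ h1 h2 => by
      have := h φ h1
      rw [← sub_eq_zero, ← integral_sub (hInt f hf φ h1.continuous) (hInt g hg φ h1.continuous)]
        at this
      rw [← this]
      refine integral_congr_ae (Eventually.of_forall fun x => ?_)
      simp only [Complex.real_smul]
      ring)
  filter_upwards [key] with x hx
  exact sub_eq_zero.1 hx

lemma pick_spec {X : Type*} [Zero X] {P : X → Prop} (h : ∃ w, P w) : P (pick P) := by
  unfold pick
  rw [dif_pos h]
  exact h.choose_spec

lemma weakPartial_unique {i : Fin (n + 1)} {u d d' : (Fin (n + 1) → ℝ) → ℂ}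
    (hd : MemLp d 2 Q.vol) (hd' : MemLp d' 2 Q.vol) (h : WeakPartial Q i u d)
    (h' : WeakPartial Q i u d') : d =ᵐ[Q.vol] d' :=
  ae_eq_of_forall_testFun hd hd' fun φ hφ => by
    rw [← neg_inj, ← h φ hφ, ← h' φ hφ]

/-- `pick` selects an unspecified admissible function, so a concrete weak derivative can replace it
only through uniqueness, almost everywhere. The same pattern is used for `lap`, `trace`,
`normalDeriv` and `surfGrad`. -/
lemma grad_ae_eq {i : Fin (n + 1)} {u d : (Fin (n + 1) → ℝ) → ℂ} (hd : MemLp d 2 Q.vol)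
    (h : WeakPartial Q i u d) : grad Q u i =ᵐ[Q.vol] d := by
  have hs := pick_spec (P := fun w => MemLp w 2 Q.vol ∧ IsWeakDeriv Q (Pi.single i 1) u w)
    ⟨d, hd, (isWeakDeriv_single_iff i u d).2 h⟩
  exact weakPartial_unique hs.1 hd ((isWeakDeriv_single_iff i u _).1 hs.2) h

lemma lap_ae_eq {u w : (Fin (n + 1) → ℝ) → ℂ} (hw : MemLp w 2 Q.vol)
    (h : IsWeakLaplacian Q u w) : lap Q u =ᵐ[Q.vol] w := by
  have hs := pick_spec (P := fun w => MemLp w 2 Q.vol ∧ IsWeakLaplacian Q u w) ⟨w, hw, h⟩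
  exact ae_eq_of_forall_testFun hs.1 hw fun φ hφ => by
    exact (hs.2 φ hφ).symm.trans (h φ hφ)

lemma Box.memLp_mul_normal {f : (Fin (n + 1) → ℝ) → ℂ} (hf : MemLp f 2 Q.surf)
    (i : Fin (n + 1)) : MemLp (fun x => f x * (Q.normal x i : ℂ)) 2 Q.surf := by
  refine (MemLp.bdd_mul_left hf (C := 1) (g := fun x => (Q.normal x i : ℂ))
    (Complex.measurable_ofReal.comp (Q.measurable_normal i)).aestronglyMeasurable
    (Eventually.of_forall fun x => by simpa using Q.abs_normal_le x i)).ae_eq ?_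
  exact Eventually.of_forall fun x => mul_comm _ _

/-- Testing determines only the products of the trace with the normal components, but almost
everywhere one of these components is ±1. -/
lemma isTrace_unique {u t t' : (Fin (n + 1) → ℝ) → ℂ} (ht : MemLp t 2 Q.surf)
    (ht' : MemLp t' 2 Q.surf) (h : IsTrace Q u t) (h' : IsTrace Q u t') : t =ᵐ[Q.surf] t' := by
  have h1 : ∀ i, (fun x => t x * (Q.normal x i : ℂ)) =ᵐ[Q.surf]
      fun x => t' x * (Q.normal x i : ℂ) := fun i =>
    ae_eq_surf_of_forall_contDiff (Box.memLp_mul_normal ht i) (Box.memLp_mul_normal ht' i)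
      fun φ hφ => by
        have := (h φ hφ i).symm.trans (h' φ hφ i)
        simpa only [mul_right_comm] using this
  filter_upwards [ae_all_iff.2 h1, Q.ae_surf_normal] with x hx hn
  obtain ⟨-, i, ⟨-, hi⟩ | ⟨-, hi⟩⟩ := hn
  · simpa [hi] using hx i
  · simpa [hi] using hx i

lemma trace_ae_eq {u t : (Fin (n + 1) → ℝ) → ℂ} (ht : MemLp t 2 Q.surf) (h : IsTrace Q u t) :
    trace Q u =ᵐ[Q.surf] t := by
  have hs := pick_spec (P := fun t => MemLp t 2 Q.surf ∧ IsTrace Q u t) ⟨t, ht, h⟩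
  exact isTrace_unique hs.1 ht hs.2 h

lemma normalDeriv_ae_eq {u ψ : (Fin (n + 1) → ℝ) → ℂ} (hψ : MemLp ψ 2 Q.surf)
    (h : IsNormalDeriv Q u ψ) : normalDeriv Q u =ᵐ[Q.surf] ψ := by
  have hs := pick_spec (P := fun ψ => MemLp ψ 2 Q.surf ∧ IsNormalDeriv Q u ψ) ⟨ψ, hψ, h⟩
  exact ae_eq_surf_of_forall_contDiff hs.1 hψ fun φ hφ => by
    exact (hs.2 φ hφ).trans (h φ hφ).symm

/-- Where the normal is ±eⱼ, the antisymmetric relations for the pairs (j, i) determine the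
components i ≠ j, and tangentiality forces the j-th component to be zero. -/
lemma surfGrad_ae_eq {u : (Fin (n + 1) → ℝ) → ℂ} {w : Fin (n + 1) → (Fin (n + 1) → ℝ) → ℂ}
    (hw : ∀ i, MemLp (w i) 2 Q.surf) (h : IsSurfGrad Q (trace Q u) w) (i : Fin (n + 1)) :
    surfGrad Q u i =ᵐ[Q.surf] w i := by
  have hs := pick_spec (P := fun w : Fin (n + 1) → (Fin (n + 1) → ℝ) → ℂ =>
    (∀ i, MemLp (w i) 2 Q.surf) ∧ IsSurfGrad Q (trace Q u) w) ⟨w, hw, h⟩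
  change (pick (X := Fin (n + 1) → (Fin (n + 1) → ℝ) → ℂ) _) i =ᵐ[Q.surf] w i
  generalize pick (X := Fin (n + 1) → (Fin (n + 1) → ℝ) → ℂ) _ = w' at hs ⊢
  obtain ⟨hw', htan', hs'⟩ := hs
  obtain ⟨htan, h'⟩ := h
  have hm : ∀ w : Fin (n + 1) → (Fin (n + 1) → ℝ) → ℂ, (∀ i, MemLp (w i) 2 Q.surf) → ∀ i j,
      MemLp (fun x => (Q.normal x i : ℂ) * w j x - (Q.normal x j : ℂ) * w i x) 2 Q.surf :=
    fun w hw i j => by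
      have := (Box.memLp_mul_normal (hw j) i).sub (Box.memLp_mul_normal (hw i) j)
      refine this.ae_eq (Eventually.of_forall fun x => ?_)
      simp [mul_comm]
  have h1 : ∀ i j, (fun x => (Q.normal x i : ℂ) * w' j x - (Q.normal x j : ℂ) * w' i x)
      =ᵐ[Q.surf] fun x => (Q.normal x i : ℂ) * w j x - (Q.normal x j : ℂ) * w i x := fun i j =>
    ae_eq_surf_of_forall_contDiff (hm w' hw' i j) (hm w hw i j) fun φ hφ => by
      rw [← neg_inj, ← hs' φ hφ i j, h' φ hφ i j]
  filter_upwards [ae_all_iff.2 fun i => ae_all_iff.2 (h1 i), Q.ae_surf_normal, htan, htan'] with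
    x hx hn ht ht'
  obtain ⟨-, j, ⟨-, hj⟩ | ⟨-, hj⟩⟩ := hn
  · rcases eq_or_ne i j with rfl | hij
    · have e : ∀ w : Fin (n + 1) → (Fin (n + 1) → ℝ) → ℂ,
          ∑ l, w l x * (Q.normal x l : ℂ) = w i x := fun w => by
        rw [Finset.sum_eq_single i] <;> simp +contextual [hj]
      rw [e] at ht ht'
      rw [ht, ht']
    · simpa [hj, hij] using hx j i
  · rcases eq_or_ne i j with rfl | hij
    · have e : ∀ w : Fin (n + 1) → (Fin (n + 1) → ℝ) → ℂ,
          ∑ l, w l x * (Q.normal x l : ℂ) = -w i x := fun w => by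
        rw [Finset.sum_eq_single i] <;> simp +contextual [hj]
      rw [e, neg_eq_zero] at ht ht'
      rw [ht, ht']
    · simpa [hj, hij] using hx j i

end Uniqueness

end HelmholtzMS

namespace HelmholtzMS

/-! ### Functions in `H²(Ω)` and their boundary values -/

section H2

open Set Filter Topology

variable {n : ℕ} {Q : Box n}

namespace IsH1

variable {F : (Fin (n + 1) → ℝ) → ℂ} {dF : Fin (n + 1) → (Fin (n + 1) → ℝ) → ℂ}
  {t : (Fin (n + 1) → ℝ) → ℂ}

/-- Integration by parts against a smooth real function. -/
lemma integral_by_parts_smooth (h : IsH1 Q F dF t) {φ : (Fin (n + 1) → ℝ) → ℝ}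
    (hφ : ContDiff ℝ ∞ φ) (i : Fin (n + 1)) :
    ∫ x, dF i x * (φ x : ℂ) ∂Q.vol + ∫ x, F x * (pderiv i φ x : ℂ) ∂Q.vol =
      ∫ x, t x * (φ x : ℂ) * (Q.normal x i : ℂ) ∂Q.surf := by
  have hφ' : ContDiff ℝ ∞ fun x => (φ x : ℂ) := Complex.ofRealCLM.contDiff.comp hφ
  have := h.integral_by_parts (IsH1.of_contDiff hφ') i
  simp only [cderiv_ofReal i (hφ.differentiable (by simp)), Complex.conj_ofReal] at this
  rw [this]
  refine integral_congr_ae (Eventually.of_forall fun x => ?_)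
  simp only
  ring

lemma integrable_mul_smooth (h : IsH1 Q F dF t) {φ : (Fin (n + 1) → ℝ) → ℝ}
    (hφ : Continuous φ) : Integrable (fun x => F x * (φ x : ℂ)) Q.vol := by
  obtain ⟨C, hC, -⟩ := Q.exists_bound_of_continuous (Complex.continuous_ofReal.comp hφ)
  exact (h.memLp.integrable (by norm_num)).mul_bdd
    (Complex.continuous_ofReal.comp hφ).aestronglyMeasurable hC

lemma integrable_deriv_mul_smooth (h : IsH1 Q F dF t) {φ : (Fin (n + 1) → ℝ) → ℝ}
    (hφ : Continuous φ) (i : Fin (n + 1)) : Integrable (fun x => dF i x * (φ x : ℂ)) Q.vol := by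
  obtain ⟨C, hC, -⟩ := Q.exists_bound_of_continuous (Complex.continuous_ofReal.comp hφ)
  exact ((h.memLp_deriv i).integrable (by norm_num)).mul_bdd
    (Complex.continuous_ofReal.comp hφ).aestronglyMeasurable hC

lemma integrable_trace_mul_smooth (h : IsH1 Q F dF t) {φ : (Fin (n + 1) → ℝ) → ℝ}
    (hφ : Continuous φ) : Integrable (fun x => t x * (φ x : ℂ)) Q.surf := by
  obtain ⟨C, -, hC⟩ := Q.exists_bound_of_continuous (Complex.continuous_ofReal.comp hφ)
  exact (h.memLp_trace.integrable (by norm_num)).mul_bdd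
    (Complex.continuous_ofReal.comp hφ).aestronglyMeasurable hC

lemma weakPartial (h : IsH1 Q F dF t) (i : Fin (n + 1)) : WeakPartial Q i F (dF i) := by
  intro φ hφ
  have h1 := h.integral_by_parts_smooth hφ.1 i
  have h2 : ∫ x, t x * (φ x : ℂ) * (Q.normal x i : ℂ) ∂Q.surf = 0 := by
    refine integral_eq_zero_of_ae ?_
    filter_upwards [Q.ae_surf_normal] with x hx
    have : x ∉ Q.dom := fun hd => by
      obtain ⟨-, j, ⟨hj, -⟩ | ⟨hj, -⟩⟩ := hx
      · exact absurd hj (hd j (mem_univ j)).2.ne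
      · exact absurd hj (hd j (mem_univ j)).1.ne'
    have h0 : φ x = 0 := image_eq_zero_of_notMem_tsupport fun hx' => this (hφ.2.2 hx')
    simp [h0]
  rw [h2] at h1
  exact eq_neg_of_add_eq_zero_right h1

lemma grad_ae_eq (h : IsH1 Q F dF t) (i : Fin (n + 1)) : grad Q F i =ᵐ[Q.vol] dF i :=
  HelmholtzMS.grad_ae_eq (h.memLp_deriv i) (h.weakPartial i)

lemma isTrace (h : IsH1 Q F dF t) : IsTrace Q F t := by
  intro φ hφ i
  rw [← h.integral_by_parts_smooth hφ i, add_comm (integral _ _), ← integral_add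
    (h.integrable_mul_smooth (contDiff_pderiv hφ i).continuous)
    (h.integrable_deriv_mul_smooth hφ.continuous i)]
  refine integral_congr_ae ?_
  filter_upwards [h.grad_ae_eq i] with x hx
  rw [hx]

lemma trace_ae_eq (h : IsH1 Q F dF t) : trace Q F =ᵐ[Q.surf] t :=
  HelmholtzMS.trace_ae_eq h.memLp_trace h.isTrace

end IsH1

/-- `u ∈ H²(Ω)` with gradient `d`, Hessian `dd`, trace `t` and trace `tg` of the gradient. -/
structure IsH2 (Q : Box n) (u : (Fin (n + 1) → ℝ) → ℂ)
    (d : Fin (n + 1) → (Fin (n + 1) → ℝ) → ℂ)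
    (dd : Fin (n + 1) → Fin (n + 1) → (Fin (n + 1) → ℝ) → ℂ) (t : (Fin (n + 1) → ℝ) → ℂ)
    (tg : Fin (n + 1) → (Fin (n + 1) → ℝ) → ℂ) : Prop where
  isH1 : IsH1 Q u d t
  isH1_deriv : ∀ i, IsH1 Q (d i) (dd i) (tg i)

/-- The normal component of a vector field on `Γ`. -/
noncomputable def normalPart (Q : Box n) (tg : Fin (n + 1) → (Fin (n + 1) → ℝ) → ℂ)
    (x : Fin (n + 1) → ℝ) : ℂ := ∑ i, tg i x * (Q.normal x i : ℂ)

/-- The tangential component of a vector field on `Γ`. -/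
noncomputable def tanPart (Q : Box n) (tg : Fin (n + 1) → (Fin (n + 1) → ℝ) → ℂ)
    (i : Fin (n + 1)) (x : Fin (n + 1) → ℝ) : ℂ := tg i x - (Q.normal x i : ℂ) * normalPart Q tg x

namespace IsH2

variable {u v : (Fin (n + 1) → ℝ) → ℂ} {d d' : Fin (n + 1) → (Fin (n + 1) → ℝ) → ℂ}
  {dd dd' : Fin (n + 1) → Fin (n + 1) → (Fin (n + 1) → ℝ) → ℂ} {t t' : (Fin (n + 1) → ℝ) → ℂ}
  {tg tg' : Fin (n + 1) → (Fin (n + 1) → ℝ) → ℂ}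

lemma add (h : IsH2 Q u d dd t tg) (h' : IsH2 Q v d' dd' t' tg') :
    IsH2 Q (u + v) (fun i => d i + d' i) (fun i j => dd i j + dd' i j) (t + t')
      (fun i => tg i + tg' i) :=
  ⟨h.isH1.add h'.isH1, fun i => (h.isH1_deriv i).add (h'.isH1_deriv i)⟩

lemma const_mul (h : IsH2 Q u d dd t tg) (c : ℂ) :
    IsH2 Q (fun x => c * u x) (fun i x => c * d i x) (fun i j x => c * dd i j x)
      (fun x => c * t x) (fun i x => c * tg i x) :=
  ⟨h.isH1.const_mul c, fun i => (h.isH1_deriv i).const_mul c⟩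

/-- Mixed classical derivatives of a test function commute, and duality carries this over to the
weak Hessian. -/
lemma symm (h : IsH2 Q u d dd t tg) (i j : Fin (n + 1)) : dd i j =ᵐ[Q.vol] dd j i := by
  refine ae_eq_of_forall_testFun ((h.isH1_deriv i).memLp_deriv j) ((h.isH1_deriv j).memLp_deriv i)
    fun φ hφ => ?_
  rw [← neg_inj, ← (h.isH1_deriv i).weakPartial j φ hφ, ← (h.isH1_deriv j).weakPartial i φ hφ,
    ← neg_inj, ← h.isH1.weakPartial i _ (hφ.pderiv j), ← h.isH1.weakPartial j _ (hφ.pderiv i),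
    pderiv_comm hφ.1]

lemma memLp_laplacian (h : IsH2 Q u d dd t tg) : MemLp (fun x => ∑ i, dd i i x) 2 Q.vol :=
  memLp_finsetSum _ fun i _ => (h.isH1_deriv i).memLp_deriv i

lemma lap_ae_eq (h : IsH2 Q u d dd t tg) : lap Q u =ᵐ[Q.vol] fun x => ∑ i, dd i i x := by
  refine HelmholtzMS.lap_ae_eq h.memLp_laplacian fun φ hφ => ?_
  have h1 : ∀ i, ∫ x, u x * (pderiv i (pderiv i φ) x : ℂ) ∂Q.vol =
      ∫ x, dd i i x * (φ x : ℂ) ∂Q.vol := fun i => by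
    rw [h.isH1.weakPartial i _ (hφ.pderiv i), (h.isH1_deriv i).weakPartial i φ hφ, neg_neg]
  simp only [Complex.ofReal_sum, Finset.mul_sum, Finset.sum_mul]
  rw [integral_finsetSum _ fun i _ => h.isH1.integrable_mul_smooth
      (contDiff_pderiv (contDiff_pderiv hφ.1 i) i).continuous,
    integral_finsetSum _ fun i _ => (h.isH1_deriv i).integrable_deriv_mul_smooth
      hφ.1.continuous i]
  exact Finset.sum_congr rfl fun i _ => h1 i

lemma memLp_normalPart (h : IsH2 Q u d dd t tg) : MemLp (normalPart Q tg) 2 Q.surf :=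
  memLp_finsetSum _ fun i _ => Box.memLp_mul_normal (h.isH1_deriv i).memLp_trace i

lemma memLp_tanPart (h : IsH2 Q u d dd t tg) (i : Fin (n + 1)) :
    MemLp (tanPart Q tg i) 2 Q.surf := by
  have := (h.isH1_deriv i).memLp_trace.sub (Box.memLp_mul_normal h.memLp_normalPart i)
  refine this.ae_eq (Eventually.of_forall fun x => ?_)
  simp [tanPart, mul_comm]

/-- Integrating ∂ᵢu φ by parts in direction i and summing over i is Green's identity, so the normal
part of the trace of ∇u satisfies the defining relation. -/
lemma normalDeriv_ae_eq (h : IsH2 Q u d dd t tg) :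
    normalDeriv Q u =ᵐ[Q.surf] normalPart Q tg := by
  refine HelmholtzMS.normalDeriv_ae_eq h.memLp_normalPart fun φ hφ => ?_
  have h1 : ∀ᵐ x ∂Q.vol, (∑ i, grad Q u i x * (pderiv i φ x : ℂ)) + lap Q u x * (φ x : ℂ) =
      ∑ i, (dd i i x * (φ x : ℂ) + d i x * (pderiv i φ x : ℂ)) := by
    filter_upwards [ae_all_iff.2 h.isH1.grad_ae_eq, h.lap_ae_eq] with x h1 h2
    simp only [h1, h2, Finset.sum_mul, Finset.sum_add_distrib]
    rw [add_comm]
  have hi : ∀ i, Integrable (fun x => dd i i x * (φ x : ℂ) + d i x * (pderiv i φ x : ℂ)) Q.vol :=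
    fun i => ((h.isH1_deriv i).integrable_deriv_mul_smooth hφ.continuous i).add
      ((h.isH1_deriv i).integrable_mul_smooth (contDiff_pderiv hφ i).continuous)
  rw [integral_congr_ae h1, integral_finsetSum _ fun i _ => hi i]
  simp only [normalPart, Finset.sum_mul]
  rw [integral_finsetSum]
  · refine Finset.sum_congr rfl fun i _ => ?_
    rw [integral_add ((h.isH1_deriv i).integrable_deriv_mul_smooth hφ.continuous i)
      ((h.isH1_deriv i).integrable_mul_smooth (contDiff_pderiv hφ i).continuous),
      (h.isH1_deriv i).integral_by_parts_smooth hφ i]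
    refine integral_congr_ae (Eventually.of_forall fun x => ?_)
    simp only
    ring
  · intro i _
    refine (Q.integrable_mul_normal
      ((h.isH1_deriv i).integrable_trace_mul_smooth hφ.continuous) i).congr
      (Eventually.of_forall fun x => ?_)
    simp only
    ring

/-- Both sides of the defining relation are converted to volume integrals. Those containing second
derivatives cancel, by symmetry of the Hessian of φ on one side and of u on the other; the remaining
first-order terms agree. -/
lemma surfGrad_ae_eq (h : IsH2 Q u d dd t tg) (i : Fin (n + 1)) :
    surfGrad Q u i =ᵐ[Q.surf] tanPart Q tg i := by
  refine HelmholtzMS.surfGrad_ae_eq h.memLp_tanPart ⟨?_, fun φ hφ i j => ?_⟩ i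
  · filter_upwards [Q.ae_surf_sum_normal_sq] with x hx
    have hx' : ∑ i, (Q.normal x i : ℂ) ^ 2 = 1 := by exact_mod_cast hx
    simp only [tanPart, sub_mul, Finset.sum_sub_distrib]
    have : ∑ i, (Q.normal x i : ℂ) * normalPart Q tg x * (Q.normal x i : ℂ) =
        normalPart Q tg x * ∑ i, (Q.normal x i : ℂ) ^ 2 := by
      rw [Finset.mul_sum]
      exact Finset.sum_congr rfl fun i _ => by ring
    rw [this, hx', mul_one]
    exact sub_self _
  · have hpi := contDiff_pderiv hφ i
    have hpj := contDiff_pderiv hφ j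
    have e1 : ∫ x, trace Q u x *
        ((Q.normal x i * pderiv j φ x - Q.normal x j * pderiv i φ x : ℝ) : ℂ) ∂Q.surf =
        (∫ x, t x * (pderiv j φ x : ℂ) * (Q.normal x i : ℂ) ∂Q.surf) -
        ∫ x, t x * (pderiv i φ x : ℂ) * (Q.normal x j : ℂ) ∂Q.surf := by
      rw [← integral_sub
        (Q.integrable_mul_normal (h.isH1.integrable_trace_mul_smooth hpj.continuous) i)
        (Q.integrable_mul_normal (h.isH1.integrable_trace_mul_smooth hpi.continuous) j)]
      refine integral_congr_ae ?_
      filter_upwards [h.isH1.trace_ae_eq] with x hx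
      rw [hx]
      push_cast
      ring
    have e2 : ∫ x, ((Q.normal x i : ℂ) * tanPart Q tg j x - (Q.normal x j : ℂ) * tanPart Q tg i x) *
        (φ x : ℂ) ∂Q.surf =
        (∫ x, tg j x * (φ x : ℂ) * (Q.normal x i : ℂ) ∂Q.surf) -
        ∫ x, tg i x * (φ x : ℂ) * (Q.normal x j : ℂ) ∂Q.surf := by
      rw [← integral_sub
        (Q.integrable_mul_normal ((h.isH1_deriv j).integrable_trace_mul_smooth hφ.continuous) i)
        (Q.integrable_mul_normal ((h.isH1_deriv i).integrable_trace_mul_smooth hφ.continuous) j)]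
      refine integral_congr_ae (Eventually.of_forall fun x => ?_)
      simp only [tanPart]
      ring
    rw [e1, e2, ← h.isH1.integral_by_parts_smooth hpj i, ← h.isH1.integral_by_parts_smooth hpi j,
      ← (h.isH1_deriv j).integral_by_parts_smooth hφ i,
      ← (h.isH1_deriv i).integral_by_parts_smooth hφ j, pderiv_comm hφ i j]
    have e3 : ∫ x, dd j i x * (φ x : ℂ) ∂Q.vol = ∫ x, dd i j x * (φ x : ℂ) ∂Q.vol := by
      refine integral_congr_ae ?_
      filter_upwards [h.symm i j] with x hx
      rw [hx]
    rw [e3]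
    ring

end IsH2

end H2

end HelmholtzMS

namespace HelmholtzMS

/-! ### The Rellich–Morawetz identity in `H²(Ω)` -/

section Rellich

open Set Filter Topology

variable {n : ℕ} {Q : Box n}

/-- `f` on `Ω` and `g` on `Γ` are integrable with equal integrals. -/
def SameIntegral (Q : Box n) (f g : (Fin (n + 1) → ℝ) → ℂ) : Prop :=
  Integrable f Q.vol ∧ Integrable g Q.surf ∧ ∫ x, f x ∂Q.vol = ∫ x, g x ∂Q.surf

namespace SameIntegral

variable {f g f' g' : (Fin (n + 1) → ℝ) → ℂ}

lemma add (h : SameIntegral Q f g) (h' : SameIntegral Q f' g') :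
    SameIntegral Q (fun x => f x + f' x) (fun x => g x + g' x) :=
  ⟨h.1.add h'.1, h.2.1.add h'.2.1, by
    rw [integral_add h.1 h'.1, integral_add h.2.1 h'.2.1, h.2.2, h'.2.2]⟩

lemma const_mul (h : SameIntegral Q f g) (c : ℂ) :
    SameIntegral Q (fun x => c * f x) (fun x => c * g x) :=
  ⟨h.1.const_mul c, h.2.1.const_mul c, by rw [integral_const_mul, integral_const_mul, h.2.2]⟩

lemma sum {ι : Type*} (S : Finset ι) {f g : ι → (Fin (n + 1) → ℝ) → ℂ}
    (h : ∀ i, SameIntegral Q (f i) (g i)) :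
    SameIntegral Q (fun x => ∑ i ∈ S, f i x) (fun x => ∑ i ∈ S, g i x) :=
  ⟨integrable_finsetSum _ fun i _ => (h i).1, integrable_finsetSum _ fun i _ => (h i).2.1, by
    rw [integral_finsetSum _ fun i _ => (h i).1, integral_finsetSum _ fun i _ => (h i).2.1]
    exact Finset.sum_congr rfl fun i _ => (h i).2.2⟩

lemma congr (h : SameIntegral Q f g) (hf : f =ᵐ[Q.vol] f') (hg : g =ᵐ[Q.surf] g') :
    SameIntegral Q f' g' :=
  ⟨h.1.congr hf, h.2.1.congr hg, by rw [← integral_congr_ae hf, ← integral_congr_ae hg, h.2.2]⟩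

end SameIntegral

lemma IsH1.sameIntegral {F G : (Fin (n + 1) → ℝ) → ℂ}
    {dF dG : Fin (n + 1) → (Fin (n + 1) → ℝ) → ℂ} {t s : (Fin (n + 1) → ℝ) → ℂ}
    (h : IsH1 Q F dF t) (h' : IsH1 Q G dG s) (i : Fin (n + 1)) :
    SameIntegral Q (fun x => dF i x * conj (G x) + F x * conj (dG i x))
      (fun x => (Q.normal x i : ℂ) * t x * conj (s x)) :=
  ⟨(integrable_mul_conj (h.memLp_deriv i) h'.memLp).add
      (integrable_mul_conj h.memLp (h'.memLp_deriv i)),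
    integrable_mul_conj (h.memLp_trace_mul_normal i) h'.memLp_trace, by
      rw [integral_add (integrable_mul_conj (h.memLp_deriv i) h'.memLp)
        (integrable_mul_conj h.memLp (h'.memLp_deriv i))]
      exact h.integral_by_parts h' i⟩

/-- The multiplier `x · ∇u + c u` of an `H²` function is in `H¹`. -/
lemma IsH2.isH1_mult {u : (Fin (n + 1) → ℝ) → ℂ} {d : Fin (n + 1) → (Fin (n + 1) → ℝ) → ℂ}
    {dd : Fin (n + 1) → Fin (n + 1) → (Fin (n + 1) → ℝ) → ℂ} {t : (Fin (n + 1) → ℝ) → ℂ}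
    {tg : Fin (n + 1) → (Fin (n + 1) → ℝ) → ℂ} (h : IsH2 Q u d dd t tg) (c : ℂ) :
    IsH1 Q (fun x => ∑ j, (x j : ℂ) * d j x + c * u x)
      (fun i x => ∑ j, ((if j = i then 1 else 0) * d j x + x j * dd j i x) + c * d i x)
      (fun x => ∑ j, (x j : ℂ) * tg j x + c * t x) :=
  (IsH1.sum Finset.univ fun j => (h.isH1_deriv j).coord_mul j).add (h.isH1.const_mul c)

/-- The pointwise algebra behind the Rellich–Morawetz identity. -/
lemma rellich_algebra (x : Fin (n + 1) → ℝ) (K c u v : ℂ) (d e : Fin (n + 1) → ℂ)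
    (dd ee : Fin (n + 1) → Fin (n + 1) → ℂ) (hc : c + conj c = n)
    (hdd : ∀ i j, dd i j = dd j i) (hee : ∀ i j, ee i j = ee j i) :
    (∑ i, (dd i i * conj (∑ j, (x j : ℂ) * e j + c * v) +
        d i * conj (∑ j, ((if j = i then 1 else 0) * e j + x j * ee j i) + c * e i))) +
      (∑ i, ((∑ j, ((if j = i then 1 else 0) * d j + x j * dd j i) + c * d i) * conj (e i) +
        (∑ j, (x j : ℂ) * d j + c * u) * conj (ee i i))) +
      K * (∑ i, (((if i = i then 1 else 0) * u + x i * d i) * conj v + x i * u * conj (e i))) +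
      (-1) * (∑ i, ∑ j, (((if i = i then 1 else 0) * d j + x i * dd j i) * conj (e j) +
        x i * d j * conj (ee j i))) =
    ∑ i, d i * conj (e i) + K * u * conj v +
      (∑ j, (x j : ℂ) * d j + c * u) * (conj (∑ i, ee i i) + K * conj v) +
      (∑ i, dd i i + K * u) * conj (∑ j, (x j : ℂ) * e j + c * v) := by
  have hcn : (n : ℂ) = c + conj c := hc.symm
  -- The product of the gradients occurs with total coefficient (1 + conj c) + (1 + c) − (n + 1),
  -- which is 1 by `hc`. The sums of x times a second derivative times a first derivative cancel
  -- against the last divergence, once the Hessians are known to be symmetric.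
  have s1 : ∑ i, d i * conj (∑ j, ((if j = i then 1 else 0) * e j + x j * ee j i) + c * e i) =
      (1 + conj c) * ∑ i, d i * conj (e i) + ∑ i, ∑ j, x i * d j * conj (ee j i) := by
    rw [Finset.sum_comm, Finset.mul_sum, ← Finset.sum_add_distrib]
    refine Finset.sum_congr rfl fun i _ => ?_
    simp only [Finset.sum_add_distrib, ite_mul, one_mul, zero_mul, Finset.sum_ite_eq',
      Finset.mem_univ, if_true, map_add, map_sum, map_mul, Complex.conj_ofReal, mul_add,
      Finset.mul_sum]
    have : ∀ j, d i * (x j * conj (ee j i)) = x j * d i * conj (ee i j) := fun j => by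
      rw [hee j i]; ring
    simp only [this]
    ring
  have s2 : ∑ i, (∑ j, ((if j = i then 1 else 0) * d j + x j * dd j i) + c * d i) * conj (e i) =
      (1 + c) * ∑ i, d i * conj (e i) + ∑ i, ∑ j, x i * dd j i * conj (e j) := by
    rw [Finset.sum_comm, Finset.mul_sum, ← Finset.sum_add_distrib]
    refine Finset.sum_congr rfl fun i _ => ?_
    simp only [Finset.sum_add_distrib, ite_mul, one_mul, zero_mul, Finset.sum_ite_eq',
      Finset.mem_univ, if_true, add_mul, Finset.sum_mul]
    have : ∀ j, x j * dd j i * conj (e i) = x j * dd i j * conj (e i) := fun j => by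
      rw [hdd j i]
    simp only [this]
    ring
  have s3 : ∑ i, ∑ j, (((if i = i then (1 : ℂ) else 0) * d j + x i * dd j i) * conj (e j) +
        x i * d j * conj (ee j i)) =
      (n + 1) * ∑ i, d i * conj (e i) + (∑ i, ∑ j, x i * dd j i * conj (e j)) +
        ∑ i, ∑ j, x i * d j * conj (ee j i) := by
    simp only [if_true, one_mul, add_mul, Finset.sum_add_distrib, Finset.sum_const,
      Finset.card_univ, Fintype.card_fin, nsmul_eq_mul]
    push_cast
    ring
  have s4 : ∑ i, (((if i = i then (1 : ℂ) else 0) * u + x i * d i) * conj v + x i * u * conj (e i)) =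
      (n + 1) * (u * conj v) + (∑ i, (x i : ℂ) * d i) * conj v +
        u * ∑ i, (x i : ℂ) * conj (e i) := by
    simp only [if_true, one_mul, add_mul, Finset.sum_add_distrib, Finset.sum_const,
      Finset.card_univ, Fintype.card_fin, nsmul_eq_mul, Finset.sum_mul, Finset.mul_sum]
    push_cast
    have : ∀ i, (x i : ℂ) * u * conj (e i) = u * (x i * conj (e i)) := fun i => by ring
    simp only [this]
    ring
  rw [Finset.sum_add_distrib, Finset.sum_add_distrib, s1, s2, s3, s4, ← Finset.sum_mul,
    ← Finset.mul_sum]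
  simp only [map_add, map_sum, map_mul, Complex.conj_ofReal]
  rw [hcn]
  ring

/-- The Rellich–Morawetz identity for two functions in `H²(Ω)`. -/
theorem rellich_sameIntegral {u v : (Fin (n + 1) → ℝ) → ℂ}
    {d e : Fin (n + 1) → (Fin (n + 1) → ℝ) → ℂ}
    {dd ee : Fin (n + 1) → Fin (n + 1) → (Fin (n + 1) → ℝ) → ℂ} {t s : (Fin (n + 1) → ℝ) → ℂ}
    {tg sg : Fin (n + 1) → (Fin (n + 1) → ℝ) → ℂ}
    (h : IsH2 Q u d dd t tg) (h' : IsH2 Q v e ee s sg) (K c : ℂ) (hc : c + conj c = n) :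
    SameIntegral Q
      (fun x => ∑ i, d i x * conj (e i x) + K * u x * conj (v x) +
        (∑ j, (x j : ℂ) * d j x + c * u x) * (conj (∑ i, ee i i x) + K * conj (v x)) +
        (∑ i, dd i i x + K * u x) * conj (∑ j, (x j : ℂ) * e j x + c * v x))
      (fun x => normalPart Q tg x * conj (∑ j, (x j : ℂ) * sg j x + c * s x) +
        (∑ j, (x j : ℂ) * tg j x + c * t x) * conj (normalPart Q sg x) +
        xDotN Q x * (K * t x * conj (s x) - ∑ j, tg j x * conj (sg j x))) := by
  -- The four divergences are those of ∇u times the conjugate multiplier of v, of the multiplier of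
  -- u times the conjugate of ∇v, of K x u times the conjugate of v, and of −x times the product of
  -- ∇u with the conjugate of ∇v.
  have b1 := SameIntegral.sum Finset.univ fun i =>
    (h.isH1_deriv i).sameIntegral (h'.isH1_mult c) i
  have b2 := SameIntegral.sum Finset.univ fun i =>
    (h.isH1_mult c).sameIntegral (h'.isH1_deriv i) i
  have b3 := (SameIntegral.sum Finset.univ fun i =>
    (h.isH1.coord_mul i).sameIntegral h'.isH1 i).const_mul K
  have b4 := (SameIntegral.sum Finset.univ fun i => SameIntegral.sum Finset.univ fun j =>
    ((h.isH1_deriv j).coord_mul i).sameIntegral (h'.isH1_deriv j) i).const_mul (-1)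
  refine (((b1.add b2).add b3).add b4).congr ?_ (Eventually.of_forall fun x => ?_)
  · filter_upwards [ae_all_iff.2 fun i => ae_all_iff.2 fun j => h.symm i j,
      ae_all_iff.2 fun i => ae_all_iff.2 fun j => h'.symm i j] with x hx hx'
    exact rellich_algebra x K c (u x) (v x) (fun i => d i x) (fun i => e i x)
      (fun i j => dd i j x) (fun i j => ee i j x) hc hx hx'
  · have e1 : ∀ A : ℂ, ∑ i, (Q.normal x i : ℂ) * tg i x * A = normalPart Q tg x * A := fun A => by
      rw [normalPart, Finset.sum_mul]
      exact Finset.sum_congr rfl fun i _ => by ring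
    have e2 : ∀ A : ℂ, ∑ i, (Q.normal x i : ℂ) * A * conj (sg i x) =
        A * conj (normalPart Q sg x) := fun A => by
      rw [normalPart, map_sum, Finset.mul_sum]
      exact Finset.sum_congr rfl fun i _ => by rw [map_mul, Complex.conj_ofReal]; ring
    have e3 : ∀ A B : ℂ, ∑ i, (Q.normal x i : ℂ) * (x i * A) * B = xDotN Q x * (A * B) :=
      fun A B => by
        rw [xDotN, Complex.ofReal_sum, Finset.sum_mul]
        exact Finset.sum_congr rfl fun i _ => by push_cast; ring
    simp only
    rw [e1, e2, e3, Finset.sum_comm]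
    simp only [e3]
    rw [← Finset.mul_sum]
    ring

end Rellich

end HelmholtzMS

namespace HelmholtzMS

/-! ### The space `H²(Ω)` and its operators into `L²(Ω)` and `L²(Γ)` -/

section Operators

open Set Filter Topology
open scoped InnerProductSpace

variable {n : ℕ} {Q : Box n}

/-- The space `H²(Ω)`. -/
def H2space (Q : Box n) : Submodule ℂ ((Fin (n + 1) → ℝ) → ℂ) where
  carrier := {u | ∃ d dd t tg, IsH2 Q u d dd t tg}
  zero_mem' := ⟨_, _, _, _, ⟨IsH1.of_contDiff contDiff_const, fun i =>
    IsH1.of_contDiff (contDiff_cderiv contDiff_const i)⟩⟩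
  add_mem' := by
    rintro u v ⟨d, dd, t, tg, h⟩ ⟨d', dd', t', tg', h'⟩
    exact ⟨_, _, _, _, h.add h'⟩
  smul_mem' := by
    rintro c u ⟨d, dd, t, tg, h⟩
    exact ⟨_, _, _, _, h.const_mul c⟩

/-- `P` is a linear operator from `H²(Ω)` to `L²(μ)`, up to null sets. -/
structure IsL2Op (Q : Box n) (μ : Measure (Fin (n + 1) → ℝ))
    (P : ((Fin (n + 1) → ℝ) → ℂ) → (Fin (n + 1) → ℝ) → ℂ) : Prop where
  memLp : ∀ u ∈ H2space Q, MemLp (P u) 2 μ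
  map_add : ∀ u ∈ H2space Q, ∀ v ∈ H2space Q, P (u + v) =ᵐ[μ] P u + P v
  map_smul : ∀ c : ℂ, ∀ u ∈ H2space Q, P (c • u) =ᵐ[μ] c • P u

namespace IsL2Op

variable {μ : Measure (Fin (n + 1) → ℝ)}
  {P P' : ((Fin (n + 1) → ℝ) → ℂ) → (Fin (n + 1) → ℝ) → ℂ}

/-- The linear map into `Lp` of an `L²` operator. -/
noncomputable def toLin (h : IsL2Op Q μ P) : H2space Q →ₗ[ℂ] Lp ℂ 2 μ where
  toFun u := (h.memLp u u.2).toLp (P u)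
  map_add' u v := by
    rw [← MemLp.toLp_add, MemLp.toLp_eq_toLp_iff]
    exact h.map_add u u.2 v v.2
  map_smul' c u := by
    rw [RingHom.id_apply, ← MemLp.toLp_const_smul, MemLp.toLp_eq_toLp_iff]
    exact h.map_smul c u u.2

lemma inner_toLin (h : IsL2Op Q μ P) (h' : IsL2Op Q μ P') (u v : H2space Q) :
    ⟪h'.toLin v, h.toLin u⟫_ℂ = ∫ x, P u x * conj (P' v x) ∂μ :=
  inner_toLp_toLp (h.memLp u u.2) (h'.memLp v v.2)

lemma integrable (h : IsL2Op Q μ P) (h' : IsL2Op Q μ P') (u v : H2space Q) :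
    Integrable (fun x => P u x * conj (P' v x)) μ :=
  integrable_mul_conj (h.memLp u u.2) (h'.memLp v v.2)

lemma norm_sq_toLin (h : IsL2Op Q μ P) (u : H2space Q) :
    ‖h.toLin u‖ ^ 2 = ∫ x, ‖P u x‖ ^ 2 ∂μ :=
  norm_toLp_sq (h.memLp u u.2)

lemma add (h : IsL2Op Q μ P) (h' : IsL2Op Q μ P') : IsL2Op Q μ (fun u x => P u x + P' u x) where
  memLp u hu := (h.memLp u hu).add (h'.memLp u hu)
  map_add u hu v hv := by
    filter_upwards [h.map_add u hu v hv, h'.map_add u hu v hv] with x h1 h2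
    simp only [h1, h2, Pi.add_apply]
    ring
  map_smul c u hu := by
    filter_upwards [h.map_smul c u hu, h'.map_smul c u hu] with x h1 h2
    simp only [h1, h2, Pi.smul_apply, smul_add]

lemma mul_bdd (h : IsL2Op Q μ P) {g : (Fin (n + 1) → ℝ) → ℂ} {C : ℝ}
    (hg : AEStronglyMeasurable g μ) (hC : ∀ᵐ x ∂μ, ‖g x‖ ≤ C) :
    IsL2Op Q μ (fun u x => g x * P u x) where
  memLp u hu := MemLp.bdd_mul_left (h.memLp u hu) hg hC
  map_add u hu v hv := by
    filter_upwards [h.map_add u hu v hv] with x h1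
    simp only [h1, Pi.add_apply, mul_add]
  map_smul c u hu := by
    filter_upwards [h.map_smul c u hu] with x h1
    simp only [h1, Pi.smul_apply, smul_eq_mul]
    ring

lemma const_mul (h : IsL2Op Q μ P) (c : ℂ) : IsL2Op Q μ (fun u x => c * P u x) :=
  h.mul_bdd aestronglyMeasurable_const (Eventually.of_forall fun _ => le_rfl)

lemma sum {P : Fin (n + 1) → ((Fin (n + 1) → ℝ) → ℂ) → (Fin (n + 1) → ℝ) → ℂ}
    (h : ∀ i, IsL2Op Q μ (P i)) : IsL2Op Q μ (fun u x => ∑ i, P i u x) where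
  memLp u hu := memLp_finsetSum _ fun i _ => (h i).memLp u hu
  map_add u hu v hv := by
    filter_upwards [ae_all_iff.2 fun i => (h i).map_add u hu v hv] with x h1
    simp only [h1, Pi.add_apply, Finset.sum_add_distrib]
  map_smul c u hu := by
    filter_upwards [ae_all_iff.2 fun i => (h i).map_smul c u hu] with x h1
    simp only [h1, Pi.smul_apply, Finset.smul_sum]

/-- A bound for a multiplication operator. -/
lemma norm_toLin_mul_le (h : IsL2Op Q μ P) {g : (Fin (n + 1) → ℝ) → ℂ} {C : ℝ}
    (hC : ∀ᵐ x ∂μ, ‖g x‖ ≤ C) (h' : IsL2Op Q μ (fun u x => g x * P u x)) (u : H2space Q) :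
    ‖h'.toLin u‖ ≤ C * ‖h.toLin u‖ := by
  refine Lp.norm_le_mul_norm_of_ae_le_mul ?_
  filter_upwards [(h.memLp u u.2).coeFn_toLp, (h'.memLp u u.2).coeFn_toLp, hC] with x h1 h2 h3
  simp only [toLin, LinearMap.coe_mk, AddHom.coe_mk]
  rw [h1, h2, norm_mul]
  gcongr

lemma toLin_add (h : IsL2Op Q μ P) (h' : IsL2Op Q μ P')
    (h'' : IsL2Op Q μ (fun u x => P u x + P' u x)) (u : H2space Q) :
    h''.toLin u = h.toLin u + h'.toLin u :=
  MemLp.toLp_add (h.memLp u u.2) (h'.memLp u u.2)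

lemma norm_toLin_sum_le {P : Fin (n + 1) → ((Fin (n + 1) → ℝ) → ℂ) → (Fin (n + 1) → ℝ) → ℂ}
    (h : ∀ i, IsL2Op Q μ (P i)) (h' : IsL2Op Q μ (fun u x => ∑ i, P i u x)) (u : H2space Q) :
    ‖h'.toLin u‖ ≤ ∑ i, ‖(h i).toLin u‖ := by
  have : h'.toLin u = ∑ i, (h i).toLin u := by
    refine Lp.ext ((h'.memLp u u.2).coeFn_toLp.trans ?_)
    filter_upwards [Lp.coeFn_finsetSum Finset.univ fun i => (h i).toLin u,
      ae_all_iff.2 fun i => ((h i).memLp u u.2).coeFn_toLp] with x h1 h2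
    rw [h1, Finset.sum_apply]
    exact Finset.sum_congr rfl fun i _ => (h2 i).symm
  rw [this]
  exact norm_sum_le _ _

end IsL2Op

lemma isL2Op_id : IsL2Op Q Q.vol (fun u => u) where
  memLp := by rintro u ⟨d, dd, t, tg, h⟩; exact h.isH1.memLp
  map_add _ _ _ _ := ae_eq_refl _
  map_smul _ _ _ := ae_eq_refl _

lemma isL2Op_grad (i : Fin (n + 1)) : IsL2Op Q Q.vol (fun u => grad Q u i) where
  memLp := by
    rintro u ⟨d, dd, t, tg, h⟩
    exact (h.isH1.memLp_deriv i).ae_eq (h.isH1.grad_ae_eq i).symm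
  map_add := by
    rintro u ⟨d, dd, t, tg, h⟩ v ⟨d', dd', t', tg', h'⟩
    exact ((h.add h').isH1.grad_ae_eq i).trans
      ((h.isH1.grad_ae_eq i).add (h'.isH1.grad_ae_eq i)).symm
  map_smul := by
    rintro c u ⟨d, dd, t, tg, h⟩
    exact ((h.const_mul c).isH1.grad_ae_eq i).trans ((h.isH1.grad_ae_eq i).const_smul c).symm

lemma isL2Op_lap : IsL2Op Q Q.vol (lap Q) where
  memLp := by
    rintro u ⟨d, dd, t, tg, h⟩
    exact h.memLp_laplacian.ae_eq h.lap_ae_eq.symm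
  map_add := by
    rintro u ⟨d, dd, t, tg, h⟩ v ⟨d', dd', t', tg', h'⟩
    filter_upwards [(h.add h').lap_ae_eq, h.lap_ae_eq, h'.lap_ae_eq] with x h1 h2 h3
    simp [h1, h2, h3, Finset.sum_add_distrib]
  map_smul := by
    rintro c u ⟨d, dd, t, tg, h⟩
    filter_upwards [(h.const_mul c).lap_ae_eq, h.lap_ae_eq] with x h1 h2
    rw [Pi.smul_apply, h2, smul_eq_mul, Finset.mul_sum, ← h1]
    rfl

lemma isL2Op_trace : IsL2Op Q Q.surf (trace Q) where
  memLp := by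
    rintro u ⟨d, dd, t, tg, h⟩
    exact h.isH1.memLp_trace.ae_eq h.isH1.trace_ae_eq.symm
  map_add := by
    rintro u ⟨d, dd, t, tg, h⟩ v ⟨d', dd', t', tg', h'⟩
    exact (h.add h').isH1.trace_ae_eq.trans (h.isH1.trace_ae_eq.add h'.isH1.trace_ae_eq).symm
  map_smul := by
    rintro c u ⟨d, dd, t, tg, h⟩
    exact (h.const_mul c).isH1.trace_ae_eq.trans (h.isH1.trace_ae_eq.const_smul c).symm

lemma normalPart_add (tg tg' : Fin (n + 1) → (Fin (n + 1) → ℝ) → ℂ) (x : Fin (n + 1) → ℝ) :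
    normalPart Q (fun i => tg i + tg' i) x = normalPart Q tg x + normalPart Q tg' x := by
  simp [normalPart, add_mul, Finset.sum_add_distrib]

lemma normalPart_const_mul (c : ℂ) (tg : Fin (n + 1) → (Fin (n + 1) → ℝ) → ℂ)
    (x : Fin (n + 1) → ℝ) :
    normalPart Q (fun i x => c * tg i x) x = c * normalPart Q tg x := by
  simp [normalPart, Finset.mul_sum, mul_assoc]

lemma isL2Op_normalDeriv : IsL2Op Q Q.surf (normalDeriv Q) where
  memLp := by
    rintro u ⟨d, dd, t, tg, h⟩
    exact h.memLp_normalPart.ae_eq h.normalDeriv_ae_eq.symm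
  map_add := by
    rintro u ⟨d, dd, t, tg, h⟩ v ⟨d', dd', t', tg', h'⟩
    filter_upwards [(h.add h').normalDeriv_ae_eq, h.normalDeriv_ae_eq, h'.normalDeriv_ae_eq] with
      x h1 h2 h3
    rw [h1, normalPart_add, Pi.add_apply, h2, h3]
  map_smul := by
    rintro c u ⟨d, dd, t, tg, h⟩
    filter_upwards [(h.const_mul c).normalDeriv_ae_eq, h.normalDeriv_ae_eq] with x h1 h2
    rw [Pi.smul_apply, h2, smul_eq_mul, ← normalPart_const_mul, ← h1]
    rfl

lemma isL2Op_surfGrad (i : Fin (n + 1)) : IsL2Op Q Q.surf (fun u => surfGrad Q u i) where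
  memLp := by
    rintro u ⟨d, dd, t, tg, h⟩
    exact (h.memLp_tanPart i).ae_eq (h.surfGrad_ae_eq i).symm
  map_add := by
    rintro u ⟨d, dd, t, tg, h⟩ v ⟨d', dd', t', tg', h'⟩
    filter_upwards [(h.add h').surfGrad_ae_eq i, h.surfGrad_ae_eq i, h'.surfGrad_ae_eq i] with
      x h1 h2 h3
    rw [h1, Pi.add_apply, h2, h3]
    simp only [tanPart, normalPart_add, Pi.add_apply]
    ring
  map_smul := by
    rintro c u ⟨d, dd, t, tg, h⟩
    filter_upwards [(h.const_mul c).surfGrad_ae_eq i, h.surfGrad_ae_eq i] with x h1 h2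
    change surfGrad Q (c • u) i x = c • surfGrad Q u i x
    rw [h2]
    refine h1.trans ?_
    simp only [tanPart, normalPart_const_mul, smul_eq_mul]
    ring

lemma isL2Op_helm (k : ℝ) : IsL2Op Q Q.vol (helm Q k) :=
  isL2Op_lap.add (isL2Op_id.const_mul ((k : ℂ) ^ 2))

lemma Box.aestronglyMeasurable_coord (μ : Measure (Fin (n + 1) → ℝ)) (i : Fin (n + 1)) :
    AEStronglyMeasurable (fun x : Fin (n + 1) → ℝ => (x i : ℂ)) μ :=
  (Complex.continuous_ofReal.comp (continuous_apply i)).aestronglyMeasurable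

lemma isL2Op_coord_grad (i : Fin (n + 1)) :
    IsL2Op Q Q.vol (fun u x => (x i : ℂ) * grad Q u i x) := by
  obtain ⟨C, hC, -⟩ := Q.exists_bound_of_continuous
    (F := fun x : Fin (n + 1) → ℝ => (x i : ℂ)) (by fun_prop)
  exact (isL2Op_grad i).mul_bdd (Box.aestronglyMeasurable_coord _ i) hC

lemma isL2Op_coord_surfGrad (i : Fin (n + 1)) :
    IsL2Op Q Q.surf (fun u x => (x i : ℂ) * surfGrad Q u i x) := by
  obtain ⟨C, -, hC⟩ := Q.exists_bound_of_continuous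
    (F := fun x : Fin (n + 1) → ℝ => (x i : ℂ)) (by fun_prop)
  exact (isL2Op_surfGrad i).mul_bdd (Box.aestronglyMeasurable_coord _ i) hC

lemma mult_eq (k β : ℝ) (u : (Fin (n + 1) → ℝ) → ℂ) (x : Fin (n + 1) → ℝ) :
    mult Q k β u x = ∑ i, (x i : ℂ) * grad Q u i x + (n / 2 - I * k * β) * u x := by
  rw [mult]; ring

lemma multTan_eq (k β : ℝ) (u : (Fin (n + 1) → ℝ) → ℂ) (x : Fin (n + 1) → ℝ) :
    multTan Q k β u x =
      ∑ i, (x i : ℂ) * surfGrad Q u i x + (n / 2 - I * k * β) * trace Q u x := by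
  rw [multTan]; ring

lemma isL2Op_mult (k β : ℝ) : IsL2Op Q Q.vol (mult Q k β) := by
  have := (IsL2Op.sum isL2Op_coord_grad).add
    (isL2Op_id (Q := Q).const_mul ((n : ℂ) / 2 - I * k * β))
  convert this using 3
  exact mult_eq k β _ _

lemma isL2Op_multTan (k β : ℝ) : IsL2Op Q Q.surf (multTan Q k β) := by
  have := (IsL2Op.sum isL2Op_coord_surfGrad).add
    (isL2Op_trace (Q := Q).const_mul ((n : ℂ) / 2 - I * k * β))
  convert this using 3
  exact multTan_eq k β _ _

lemma measurable_xDotN : Measurable (xDotN Q) := by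
  have : Measurable fun x : Fin (n + 1) → ℝ => ∑ i, x i * Q.normal x i :=
    Finset.measurable_sum _ fun i _ => (measurable_pi_apply i).mul (Q.measurable_normal i)
  exact Complex.measurable_ofReal.comp this

lemma ae_norm_xDotN_le {R : ℝ} (hR : ∀ x ∈ Icc Q.lo Q.hi, ∀ i, |x i| ≤ R) :
    ∀ᵐ x ∂Q.surf, ‖xDotN Q x‖ ≤ R := by
  filter_upwards [Q.ae_surf_normal] with x hx
  obtain ⟨hx, i, ⟨-, hi⟩ | ⟨-, hi⟩⟩ := hx
  · rw [xDotN, hi, Finset.sum_eq_single i (by simp +contextual) (by simp), Complex.norm_real]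
    simpa using hR x hx i
  · rw [xDotN, hi, Finset.sum_eq_single i (by simp +contextual) (by simp), Complex.norm_real]
    simpa using hR x hx i

lemma isL2Op_xDotN_mul {P : ((Fin (n + 1) → ℝ) → ℂ) → (Fin (n + 1) → ℝ) → ℂ}
    (h : IsL2Op Q Q.surf P) : IsL2Op Q Q.surf (fun u x => xDotN Q x * P u x) := by
  obtain ⟨R, -, hR⟩ := Q.exists_coord_bound
  exact h.mul_bdd measurable_xDotN.aestronglyMeasurable (ae_norm_xDotN_le hR)

lemma isL2Op_multBdry (k β : ℝ) : IsL2Op Q Q.surf (multBdry Q k β) :=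
  (isL2Op_xDotN_mul isL2Op_normalDeriv).add (isL2Op_multTan k β)

end Operators

end HelmholtzMS

namespace HelmholtzMS

/-! ### The sesquilinear form on `H²(Ω)`: identity, boundedness, coercivity -/

section Form

open Set Filter Topology
open scoped InnerProductSpace

variable {n : ℕ} {Q : Box n}

lemma integral_add_add_add {α : Type*} [MeasurableSpace α] {μ : Measure α} {f g h l : α → ℂ}
    (hf : Integrable f μ) (hg : Integrable g μ) (hh : Integrable h μ) (hl : Integrable l μ) :
    ∫ x, (f x + g x + h x + l x) ∂μ = ∫ x, f x ∂μ + ∫ x, g x ∂μ + ∫ x, h x ∂μ + ∫ x, l x ∂μ := by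
  rw [integral_add (f := fun x => f x + g x + h x) ((hf.add hg).add hh) hl,
    integral_add (f := fun x => f x + g x) (hf.add hg) hh, integral_add hf hg]

/-- The Rellich–Morawetz identity in terms of the operators of the formulation. -/
theorem rellich_identity (k β : ℝ) (u v : H2space Q) :
    ∫ x, (∑ i, grad Q u i x * conj (grad Q v i x) + (k : ℂ) ^ 2 * u.1 x * conj (v.1 x) +
        mult Q k β u x * conj (helm Q k v x) + helm Q k u x * conj (mult Q k β v x)) ∂Q.vol =
      ∫ x, (normalDeriv Q u x * conj (multBdry Q k β v x) +
        multTan Q k β u x * conj (normalDeriv Q v x) +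
        xDotN Q x * ((k : ℂ) ^ 2 * trace Q u x * conj (trace Q v x) -
          ∑ i, surfGrad Q u i x * conj (surfGrad Q v i x))) ∂Q.surf := by
  obtain ⟨u, d, dd, t, tg, h⟩ := u
  obtain ⟨v, e, ee, s, sg, h'⟩ := v
  have key := (rellich_sameIntegral h h' ((k : ℂ) ^ 2) ((n : ℂ) / 2 - I * k * β) (by
    simp only [map_sub, map_div₀, map_mul, Complex.conj_I, Complex.conj_ofReal, map_natCast,
      map_ofNat]; ring)).2.2
  refine Eq.trans (integral_congr_ae ?_) (key.trans (integral_congr_ae ?_))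
  · filter_upwards [ae_all_iff.2 h.isH1.grad_ae_eq, ae_all_iff.2 h'.isH1.grad_ae_eq, h.lap_ae_eq,
      h'.lap_ae_eq] with x h1 h2 h3 h4
    simp only [mult_eq, helm, h1, h2, h3, h4, map_add, map_mul, map_pow, Complex.conj_ofReal]
  · filter_upwards [h.isH1.trace_ae_eq, h'.isH1.trace_ae_eq, h.normalDeriv_ae_eq,
      h'.normalDeriv_ae_eq, ae_all_iff.2 h.surfGrad_ae_eq, ae_all_iff.2 h'.surfGrad_ae_eq,
      Q.ae_surf_sum_normal_sq] with x h1 h2 h3 h4 h5 h6 h7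
    have h7' : ∑ i, (Q.normal x i : ℂ) ^ 2 = 1 := by exact_mod_cast h7
    -- Split the boundary gradient into normal and tangential parts. The product (x·n)∂ₙu times the
    -- conjugate of ∂ₙv arises three times, with signs +, + and −; the copy that survives is the one
    -- inside `multBdry`.
    have hs : ∀ tg : Fin (n + 1) → (Fin (n + 1) → ℝ) → ℂ, ∑ j, (x j : ℂ) * tg j x =
        xDotN Q x * normalPart Q tg x + ∑ j, (x j : ℂ) * tanPart Q tg j x := fun tg => by
      simp only [tanPart, mul_sub, Finset.sum_sub_distrib, xDotN, Complex.ofReal_sum,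
        Finset.sum_mul, Complex.ofReal_mul, mul_assoc]
      ring
    have hq : ∑ j, tg j x * conj (sg j x) = ∑ j, tanPart Q tg j x * conj (tanPart Q sg j x) +
        normalPart Q tg x * conj (normalPart Q sg x) := by
      have e1 : ∑ j, tg j x * ((Q.normal x j : ℂ) * conj (normalPart Q sg x)) =
          normalPart Q tg x * conj (normalPart Q sg x) := by
        rw [show normalPart Q tg x = ∑ i, tg i x * (Q.normal x i : ℂ) from rfl, Finset.sum_mul]
        exact Finset.sum_congr rfl fun i _ => by ring
      have e2 : ∑ j, (Q.normal x j : ℂ) * normalPart Q tg x * conj (sg j x) =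
          normalPart Q tg x * conj (normalPart Q sg x) := by
        rw [normalPart, normalPart, map_sum, Finset.mul_sum]
        exact Finset.sum_congr rfl fun i _ => by rw [map_mul, Complex.conj_ofReal]; ring
      have e3 : ∑ j, (Q.normal x j : ℂ) * normalPart Q tg x *
          ((Q.normal x j : ℂ) * conj (normalPart Q sg x)) =
          normalPart Q tg x * conj (normalPart Q sg x) := by
        calc _ = (∑ j, (Q.normal x j : ℂ) ^ 2) *
              (normalPart Q tg x * conj (normalPart Q sg x)) := by
              rw [Finset.sum_mul]; exact Finset.sum_congr rfl fun i _ => by ring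
          _ = _ := by rw [h7', one_mul]
      simp only [tanPart, map_sub, map_mul, Complex.conj_ofReal, sub_mul, mul_sub,
        Finset.sum_sub_distrib, e1, e2, e3]
      ring
    simp only [multBdry, multTan_eq, h1, h2, h3, h4, h5, h6, hs tg, hs sg, hq, map_add, map_mul]
    ring

/-- The sesquilinear form of the formulation with `A = k²`, antilinear in its first argument. -/
noncomputable def msForm (Q : Box n) (k β : ℝ) : H2space Q →ₗ⋆[ℂ] H2space Q →ₗ[ℂ] ℂ :=
  LinearMap.mk₂'ₛₗ (starRingEnd ℂ) (RingHom.id ℂ)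
    (fun v u => ∑ i, ⟪(isL2Op_grad i).toLin v, (isL2Op_grad i).toLin u⟫_ℂ +
      (k : ℂ) ^ 2 * ⟪isL2Op_id.toLin v, isL2Op_id.toLin u⟫_ℂ +
      ⟪(isL2Op_helm k).toLin v, (isL2Op_mult k β).toLin u⟫_ℂ +
      ⟪(isL2Op_helm k).toLin v, (isL2Op_helm k).toLin u⟫_ℂ -
      (I * k * ⟪(isL2Op_multBdry k β).toLin v, isL2Op_trace.toLin u⟫_ℂ +
        ⟪isL2Op_normalDeriv.toLin v, (isL2Op_multTan k β).toLin u⟫_ℂ +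
        (k : ℂ) ^ 2 * ⟪isL2Op_trace.toLin v, (isL2Op_xDotN_mul isL2Op_trace).toLin u⟫_ℂ -
        ∑ i, ⟪(isL2Op_surfGrad i).toLin v, (isL2Op_xDotN_mul (isL2Op_surfGrad i)).toLin u⟫_ℂ))
    (fun v v' u => by
      simp only [map_add, inner_add_left, Finset.sum_add_distrib]; ring)
    (fun c v u => by
      simp only [map_smul, inner_smul_left, smul_eq_mul, ← Finset.mul_sum]; ring)
    (fun v u u' => by
      simp only [map_add, inner_add_right, Finset.sum_add_distrib]; ring)
    (fun c v u => by
      simp only [map_smul, inner_smul_right, smul_eq_mul, ← Finset.mul_sum, RingHom.id_apply]; ring)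

lemma msForm_apply (k β : ℝ) (u v : H2space Q) :
    msForm Q k β v u = ∑ i, ⟪(isL2Op_grad i).toLin v, (isL2Op_grad i).toLin u⟫_ℂ +
      (k : ℂ) ^ 2 * ⟪isL2Op_id.toLin v, isL2Op_id.toLin u⟫_ℂ +
      ⟪(isL2Op_helm k).toLin v, (isL2Op_mult k β).toLin u⟫_ℂ +
      ⟪(isL2Op_helm k).toLin v, (isL2Op_helm k).toLin u⟫_ℂ -
      (I * k * ⟪(isL2Op_multBdry k β).toLin v, isL2Op_trace.toLin u⟫_ℂ +
        ⟪isL2Op_normalDeriv.toLin v, (isL2Op_multTan k β).toLin u⟫_ℂ +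
        (k : ℂ) ^ 2 * ⟪isL2Op_trace.toLin v, (isL2Op_xDotN_mul isL2Op_trace).toLin u⟫_ℂ -
        ∑ i, ⟪(isL2Op_surfGrad i).toLin v,
          (isL2Op_xDotN_mul (isL2Op_surfGrad i)).toLin u⟫_ℂ) := rfl

/-- The boundary integrals in the definition of b and in the Rellich identity differ only in their
first product, so P is left free: ik times the trace in one case, the normal derivative in the
other. -/
lemma integral_bdry_eq (k β : ℝ) (u v : H2space Q)
    {P P' : ((Fin (n + 1) → ℝ) → ℂ) → (Fin (n + 1) → ℝ) → ℂ}
    (hP : IsL2Op Q Q.surf P) (hP' : IsL2Op Q Q.surf P') :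
    ∫ x, (P u x * conj (P' v x) + multTan Q k β u x * conj (normalDeriv Q v x) +
        xDotN Q x * ((k : ℂ) ^ 2 * trace Q u x * conj (trace Q v x) -
          ∑ i, surfGrad Q u i x * conj (surfGrad Q v i x))) ∂Q.surf =
      ⟪hP'.toLin v, hP.toLin u⟫_ℂ +
        ⟪isL2Op_normalDeriv.toLin v, (isL2Op_multTan k β).toLin u⟫_ℂ +
        (k : ℂ) ^ 2 * ⟪isL2Op_trace.toLin v, (isL2Op_xDotN_mul isL2Op_trace).toLin u⟫_ℂ -
        ∑ i, ⟪(isL2Op_surfGrad i).toLin v,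
          (isL2Op_xDotN_mul (isL2Op_surfGrad i)).toLin u⟫_ℂ := by
  have i1 := hP.integrable hP' u v
  have i2 := (isL2Op_multTan k β).integrable isL2Op_normalDeriv u v
  have i3 := ((isL2Op_xDotN_mul isL2Op_trace).integrable isL2Op_trace u v).const_mul ((k : ℂ) ^ 2)
  have i4 := fun i => (isL2Op_xDotN_mul (isL2Op_surfGrad i)).integrable (isL2Op_surfGrad i) u v
  simp only [IsL2Op.inner_toLin]
  rw [← integral_finsetSum _ fun i _ => i4 i, ← integral_const_mul, sub_eq_add_neg,
    ← integral_neg, ← integral_add_add_add i1 i2 i3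
    (l := fun x => -∑ i, xDotN Q x * surfGrad Q u i x * conj (surfGrad Q v i x))
    (integrable_finsetSum _ fun i _ => i4 i).neg]
  refine integral_congr_ae (Eventually.of_forall fun x => ?_)
  simp only [mul_sub, Finset.mul_sum, mul_assoc]
  ring

lemma formB_eq_msForm {k : ℝ} (hk : k ≠ 0) (β : ℝ) (u v : H2space Q) :
    formB Q k (k ^ 2) β u v = msForm Q k β v u := by
  have hk2 : ((k ^ 2 : ℝ) : ℂ) / (k : ℂ) ^ 2 = 1 := by
    push_cast; exact div_self (pow_ne_zero 2 (by exact_mod_cast hk))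
  have i1 := fun i => (isL2Op_grad i).integrable (isL2Op_grad i) u v
  have i2 := ((isL2Op_id (Q := Q)).integrable isL2Op_id u v).const_mul ((k : ℂ) ^ 2)
  have i3 := (isL2Op_mult k β).integrable (isL2Op_helm k) u v
  have i4 := (isL2Op_helm k).integrable (isL2Op_helm k) u v
  have e1 := integral_bdry_eq k β u v (isL2Op_trace.const_mul (I * k)) (isL2Op_multBdry k β)
  have e2 : ⟪(isL2Op_multBdry k β).toLin v, (isL2Op_trace.const_mul (I * k)).toLin u⟫_ℂ =
      I * k * ⟪(isL2Op_multBdry k β).toLin v, isL2Op_trace.toLin u⟫_ℂ := by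
    simp only [IsL2Op.inner_toLin, mul_assoc]
    rw [← integral_const_mul, ← integral_const_mul]
  rw [e2] at e1
  rw [formB, msForm_apply, ← e1, hk2]
  congr 1
  simp only [IsL2Op.inner_toLin]
  rw [← integral_finsetSum _ fun i _ => i1 i, ← integral_const_mul,
    ← integral_add_add_add (integrable_finsetSum _ fun i _ => i1 i) i2 i3 i4]
  refine integral_congr_ae (Eventually.of_forall fun x => ?_)
  simp only
  ring

/-- The form in terms of the residuals of the impedance problem. -/
theorem msForm_eq_residual (k β : ℝ) (u v : H2space Q) :
    msForm Q k β v u =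
      ⟪(isL2Op_helm k).toLin v, (isL2Op_helm k).toLin u⟫_ℂ -
      ⟪(isL2Op_mult k β).toLin v, (isL2Op_helm k).toLin u⟫_ℂ +
      (⟪(isL2Op_multBdry k β).toLin v, isL2Op_normalDeriv.toLin u⟫_ℂ -
        I * k * ⟪(isL2Op_multBdry k β).toLin v, isL2Op_trace.toLin u⟫_ℂ) := by
  have i1 := fun i => (isL2Op_grad i).integrable (isL2Op_grad i) u v
  have i2 := ((isL2Op_id (Q := Q)).integrable isL2Op_id u v).const_mul ((k : ℂ) ^ 2)
  have i3 := (isL2Op_mult k β).integrable (isL2Op_helm k) u v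
  have i4 := (isL2Op_helm k).integrable (isL2Op_mult k β) u v
  have e1 := rellich_identity k β u v
  rw [integral_bdry_eq k β u v isL2Op_normalDeriv (isL2Op_multBdry k β)] at e1
  have e2 : ∫ x, (∑ i, grad Q u i x * conj (grad Q v i x) + (k : ℂ) ^ 2 * u.1 x * conj (v.1 x) +
        mult Q k β u x * conj (helm Q k v x) + helm Q k u x * conj (mult Q k β v x)) ∂Q.vol =
      ∑ i, ⟪(isL2Op_grad i).toLin v, (isL2Op_grad i).toLin u⟫_ℂ +
      (k : ℂ) ^ 2 * ⟪isL2Op_id.toLin v, isL2Op_id.toLin u⟫_ℂ +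
      ⟪(isL2Op_helm k).toLin v, (isL2Op_mult k β).toLin u⟫_ℂ +
      ⟪(isL2Op_mult k β).toLin v, (isL2Op_helm k).toLin u⟫_ℂ := by
    simp only [IsL2Op.inner_toLin]
    rw [← integral_finsetSum _ fun i _ => i1 i, ← integral_const_mul,
      ← integral_add_add_add (integrable_finsetSum _ fun i _ => i1 i) i2 i3 i4]
    refine integral_congr_ae (Eventually.of_forall fun x => ?_)
    simp only
    ring
  rw [msForm_apply]
  -- Inserting the Rellich identity into the definition of b trades the gradient, mass and ℳu terms
  -- for minus the product of ℒu with the conjugate of ℳv. On Γ everything cancels except ∂ₙu − iku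
  -- against the conjugate of ℳv.
  linear_combination e1 - e2

/-- The formulation is consistent. -/
theorem formG_eq_msForm {k : ℝ} (hk : k ≠ 0) (β : ℝ) {f g : (Fin (n + 1) → ℝ) → ℂ}
    (hf : MemLp f 2 Q.vol) (hg : MemLp g 2 Q.surf) (u v : H2space Q)
    (hu : IsIIPSolution Q k f g u) : formG Q k (k ^ 2) β f g v = msForm Q k β v u := by
  have hk2 : ((k ^ 2 : ℝ) : ℂ) / (k : ℂ) ^ 2 = 1 := by
    push_cast; exact div_self (pow_ne_zero 2 (by exact_mod_cast hk))
  obtain ⟨⟨hm, -⟩, hl, t, ht, htr, hnd⟩ := hu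
  -- The weak equations identify the residuals: ℒu = −f in Ω and ∂ₙu − iku = g on Γ.
  have h1 : lap Q u =ᵐ[Q.vol] fun x => -f x - (k : ℂ) ^ 2 * u.1 x :=
    lap_ae_eq (hf.neg.sub (hm.const_mul _)) hl
  have h2 := trace_ae_eq ht htr
  have h3 : normalDeriv Q u =ᵐ[Q.surf] fun x => g x + I * k * t x :=
    normalDeriv_ae_eq (hg.add (ht.const_mul _)) hnd
  have i1 := (isL2Op_helm k).integrable (isL2Op_helm k) u v
  have i2 := (isL2Op_helm k).integrable (isL2Op_mult k β) u v
  have i3 := isL2Op_normalDeriv.integrable (isL2Op_multBdry k β) u v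
  have i4 := (isL2Op_trace.integrable (isL2Op_multBdry k β) u v).const_mul (I * k)
  rw [msForm_eq_residual, formG, hk2]
  simp only [IsL2Op.inner_toLin]
  rw [← integral_const_mul, ← integral_sub i1 i2, ← integral_sub i3 i4]
  congr 1
  · refine integral_congr_ae ?_
    filter_upwards [h1] with x hx
    simp only [helm, hx]
    ring
  · refine integral_congr_ae ?_
    filter_upwards [h2, h3] with x hx hx'
    simp only [hx, hx']
    ring

end Form

end HelmholtzMS

namespace HelmholtzMS

/-! ### The energy norm, boundedness and coercivity of the form -/

section Energy

open Set Filter Topology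
open scoped InnerProductSpace

variable {n : ℕ} {Q : Box n}

/-- The index set of the components of the energy norm: the components of the gradient, `ℒu` and
`ku` in `Ω`; the components of the surface gradient, `∂ₙu` and `ku` on `Γ`. -/
abbrev EnergyIndex (n : ℕ) := (Fin (n + 1) ⊕ Fin 2) ⊕ (Fin (n + 1) ⊕ Fin 2)

/-- The measure of a component of the energy norm. -/
noncomputable def energyMeasure (Q : Box n) : EnergyIndex n → Measure (Fin (n + 1) → ℝ) :=
  Sum.elim (fun _ => Q.vol) (fun _ => Q.surf)

/-- A component of the energy norm. -/
noncomputable def energyOp (Q : Box n) (k : ℝ) :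
    EnergyIndex n → ((Fin (n + 1) → ℝ) → ℂ) → (Fin (n + 1) → ℝ) → ℂ
  | .inl (.inl i) => fun u => grad Q u i
  | .inl (.inr 0) => helm Q k
  | .inl (.inr 1) => fun u x => (k : ℂ) * u x
  | .inr (.inl i) => fun u => surfGrad Q u i
  | .inr (.inr 0) => normalDeriv Q
  | .inr (.inr 1) => fun u x => (k : ℂ) * trace Q u x

lemma isL2Op_energyOp (Q : Box n) (k : ℝ) :
    ∀ a, IsL2Op Q (energyMeasure Q a) (energyOp Q k a)
  | .inl (.inl i) => isL2Op_grad i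
  | .inl (.inr 0) => isL2Op_helm k
  | .inl (.inr 1) => isL2Op_id.const_mul _
  | .inr (.inl i) => isL2Op_surfGrad i
  | .inr (.inr 0) => isL2Op_normalDeriv
  | .inr (.inr 1) => isL2Op_trace.const_mul _

/-- The Hilbert space that carries the energy norm. -/
abbrev EnergySpace (Q : Box n) := PiLp 2 fun a : EnergyIndex n => Lp ℂ 2 (energyMeasure Q a)

/-- The embedding of `H²(Ω)` that induces the norm `‖·‖_{V₂}`. -/
noncomputable def energyMap (Q : Box n) (k : ℝ) : H2space Q →ₗ[ℂ] EnergySpace Q :=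
  (WithLp.linearEquiv 2 ℂ (∀ a : EnergyIndex n, Lp ℂ 2 (energyMeasure Q a))).symm.toLinearMap ∘ₗ
    LinearMap.pi fun a => (isL2Op_energyOp Q k a).toLin

lemma energyMap_apply (k : ℝ) (u : H2space Q) (a : EnergyIndex n) :
    energyMap Q k u a = (isL2Op_energyOp Q k a).toLin u := rfl

lemma inner_energyMap (k : ℝ) (u v : H2space Q) :
    ⟪energyMap Q k v, energyMap Q k u⟫_ℂ =
      ∑ a, ∫ x, energyOp Q k a u x * conj (energyOp Q k a v x) ∂energyMeasure Q a := by
  rw [PiLp.inner_apply]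
  exact Finset.sum_congr rfl fun a _ => IsL2Op.inner_toLin (isL2Op_energyOp Q k a) (isL2Op_energyOp Q k a) u v

lemma norm_sq_energyMap (k : ℝ) (u : H2space Q) :
    ‖energyMap Q k u‖ ^ 2 = ∑ a, ∫ x, ‖energyOp Q k a u x‖ ^ 2 ∂energyMeasure Q a := by
  rw [PiLp.norm_sq_eq_of_L2]
  exact Finset.sum_congr rfl fun a _ => IsL2Op.norm_sq_toLin (isL2Op_energyOp Q k a) u

lemma norm_toLin_le_energy (k : ℝ) (u : H2space Q) (a : EnergyIndex n) :
    ‖(isL2Op_energyOp Q k a).toLin u‖ ≤ ‖energyMap Q k u‖ :=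
  PiLp.norm_apply_le (energyMap Q k u) a

lemma norm_sq_energyMap_eq (k : ℝ) (u : H2space Q) :
    ‖energyMap Q k u‖ ^ 2 = ∑ i, ∫ x, ‖grad Q u i x‖ ^ 2 ∂Q.vol +
      ∫ x, ‖helm Q k u x‖ ^ 2 ∂Q.vol + k ^ 2 * ∫ x, ‖u.1 x‖ ^ 2 ∂Q.vol +
      (∑ i, ∫ x, ‖surfGrad Q u i x‖ ^ 2 ∂Q.surf + ∫ x, ‖normalDeriv Q u x‖ ^ 2 ∂Q.surf +
        k ^ 2 * ∫ x, ‖trace Q u x‖ ^ 2 ∂Q.surf) := by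
  rw [norm_sq_energyMap]
  simp only [Fintype.sum_sum_type, Fin.sum_univ_two, energyOp, energyMeasure, Sum.elim_inl,
    Sum.elim_inr, norm_mul, mul_pow, Complex.norm_real, Real.norm_eq_abs, sq_abs,
    integral_const_mul]
  ring

lemma norm_energyMap_eq (k : ℝ) (u : H2space Q) : ‖energyMap Q k u‖ = normV2 Q k u := by
  rw [normV2, normH1k, Real.sq_sqrt (by positivity), bdrySq, eq_comm,
    Real.sqrt_eq_iff_eq_sq (by positivity) (norm_nonneg _), norm_sq_energyMap_eq]
  ring

lemma normH1k_le_energy (k : ℝ) (u : H2space Q) : normH1k Q k u ≤ ‖energyMap Q k u‖ := by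
  rw [norm_energyMap_eq, normV2]
  refine Real.le_sqrt_of_sq_le ?_
  have h1 : 0 ≤ ∫ x, ‖helm Q k u x‖ ^ 2 ∂Q.vol := by positivity
  have h2 : 0 ≤ bdrySq Q k u := by unfold bdrySq; positivity
  linarith

/-! ### Boundedness of the operators and of the form in the energy norm -/

section bound

variable (k β : ℝ) (u : H2space Q)

lemma norm_grad_le_energy (i : Fin (n + 1)) :
    ‖(isL2Op_grad i).toLin u‖ ≤ ‖energyMap Q k u‖ :=
  norm_toLin_le_energy k u (.inl (.inl i))

lemma norm_helm_le_energy : ‖(isL2Op_helm k).toLin u‖ ≤ ‖energyMap Q k u‖ :=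
  norm_toLin_le_energy k u (.inl (.inr 0))

lemma norm_surfGrad_le_energy (i : Fin (n + 1)) :
    ‖(isL2Op_surfGrad i).toLin u‖ ≤ ‖energyMap Q k u‖ :=
  norm_toLin_le_energy k u (.inr (.inl i))

lemma norm_normalDeriv_le_energy : ‖isL2Op_normalDeriv.toLin u‖ ≤ ‖energyMap Q k u‖ :=
  norm_toLin_le_energy k u (.inr (.inr 0))

lemma IsL2Op.norm_toLin_const_mul {μ : Measure (Fin (n + 1) → ℝ)}
    {P : ((Fin (n + 1) → ℝ) → ℂ) → (Fin (n + 1) → ℝ) → ℂ} (h : IsL2Op Q μ P) (c : ℂ) :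
    ‖(h.const_mul c).toLin u‖ = ‖c‖ * ‖h.toLin u‖ := by
  rw [← norm_smul]
  rfl

variable {k}

lemma norm_id_le_energy (hk : 0 < k) : k * ‖isL2Op_id.toLin u‖ ≤ ‖energyMap Q k u‖ := by
  have h : ‖(isL2Op_id.const_mul (k : ℂ)).toLin u‖ ≤ ‖energyMap Q k u‖ :=
    norm_toLin_le_energy k u (.inl (.inr 1))
  rwa [IsL2Op.norm_toLin_const_mul, Complex.norm_real, Real.norm_of_nonneg hk.le] at h

lemma norm_trace_le_energy (hk : 0 < k) : k * ‖isL2Op_trace.toLin u‖ ≤ ‖energyMap Q k u‖ := by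
  have h : ‖(isL2Op_trace.const_mul (k : ℂ)).toLin u‖ ≤ ‖energyMap Q k u‖ :=
    norm_toLin_le_energy k u (.inr (.inr 1))
  rwa [IsL2Op.norm_toLin_const_mul, Complex.norm_real, Real.norm_of_nonneg hk.le] at h

/-- The factor k of the term ikβ is paid for by the weight k in the energy norm; the constant n/2 is
paid for by k ≥ k₀. -/
lemma norm_multiplier_le {k₀ b : ℝ} (hk₀ : 0 < k₀) (hk : k₀ ≤ k) (hβ : |β| ≤ b) {y E : ℝ}
    (hy : 0 ≤ y) (hyE : k * y ≤ E) :
    ‖(n : ℂ) / 2 - I * k * β‖ * y ≤ (n / (2 * k₀) + b) * E := by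
  have hk' : 0 < k := hk₀.trans_le hk
  have hb : 0 ≤ b := (abs_nonneg _).trans hβ
  have h1 : ‖(n : ℂ) / 2 - I * k * β‖ ≤ n / 2 + k * b := by
    refine (norm_sub_le _ _).trans ?_
    simp only [norm_div, norm_mul, Complex.norm_I, Complex.norm_real, Real.norm_eq_abs,
      Complex.norm_natCast, Complex.norm_ofNat, one_mul, abs_of_pos hk']
    gcongr
  have h2 : (n : ℝ) / 2 + k * b ≤ (n / (2 * k₀) + b) * k := by
    have : (n : ℝ) / 2 ≤ n / (2 * k₀) * k := by
      rw [div_mul_eq_mul_div, div_le_div_iff₀ (by norm_num) (by positivity)]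
      have : (n : ℝ) * k₀ ≤ n * k := by gcongr
      linarith
    linarith
  calc _ ≤ ((n / (2 * k₀) + b) * k) * y := by gcongr; exact h1.trans h2
    _ = (n / (2 * k₀) + b) * (k * y) := by ring
    _ ≤ _ := by gcongr

variable {k₀ b R : ℝ}

lemma norm_mult_le_energy (hk₀ : 0 < k₀) (hk : k₀ ≤ k) (hβ : |β| ≤ b)
    (hR : ∀ x ∈ Icc Q.lo Q.hi, ∀ i, |x i| ≤ R) :
    ‖(isL2Op_mult k β).toLin u‖ ≤ ((n + 1) * R + (n / (2 * k₀) + b)) * ‖energyMap Q k u‖ := by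
  have e : (isL2Op_mult k β).toLin u = (IsL2Op.sum isL2Op_coord_grad).toLin u +
      (isL2Op_id.const_mul ((n : ℂ) / 2 - I * k * β)).toLin u := by
    rw [← IsL2Op.toLin_add _ _ ((IsL2Op.sum isL2Op_coord_grad).add (isL2Op_id.const_mul _))]
    simp only [IsL2Op.toLin, LinearMap.coe_mk, AddHom.coe_mk]
    congr 1
    exact funext fun x => mult_eq k β _ x
  rw [e]
  refine (norm_add_le _ _).trans ?_
  rw [add_mul]
  refine add_le_add ((IsL2Op.norm_toLin_sum_le isL2Op_coord_grad _ u).trans ?_) ?_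
  · have : ∀ i ∈ Finset.univ, ‖(isL2Op_coord_grad i).toLin u‖ ≤ R * ‖energyMap Q k u‖ :=
      fun i _ => by
        have hx : ∀ᵐ x ∂Q.vol, ‖(x i : ℂ)‖ ≤ R := by
          filter_upwards [Q.ae_mem_dom] with x hx
          simpa using hR x (Q.dom_subset_Icc hx) i
        have hR0 : 0 ≤ R := (abs_nonneg _).trans (hR Q.lo ⟨le_rfl, fun i => (Q.lt i).le⟩ 0)
        refine (IsL2Op.norm_toLin_mul_le (isL2Op_grad i) hx _ u).trans ?_
        gcongr
        exact norm_grad_le_energy k u i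
    refine (Finset.sum_le_sum this).trans (le_of_eq ?_)
    simp
    ring
  · rw [IsL2Op.norm_toLin_const_mul u isL2Op_id]
    exact norm_multiplier_le β hk₀ hk hβ (norm_nonneg _) (norm_id_le_energy u (hk₀.trans_le hk))

lemma norm_multTan_le_energy (hk₀ : 0 < k₀) (hk : k₀ ≤ k) (hβ : |β| ≤ b)
    (hR : ∀ x ∈ Icc Q.lo Q.hi, ∀ i, |x i| ≤ R) :
    ‖(isL2Op_multTan k β).toLin u‖ ≤ ((n + 1) * R + (n / (2 * k₀) + b)) * ‖energyMap Q k u‖ := by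
  have e : (isL2Op_multTan k β).toLin u = (IsL2Op.sum isL2Op_coord_surfGrad).toLin u +
      (isL2Op_trace.const_mul ((n : ℂ) / 2 - I * k * β)).toLin u := by
    rw [← IsL2Op.toLin_add _ _ ((IsL2Op.sum isL2Op_coord_surfGrad).add (isL2Op_trace.const_mul _))]
    simp only [IsL2Op.toLin, LinearMap.coe_mk, AddHom.coe_mk]
    congr 1
    exact funext fun x => multTan_eq k β _ x
  rw [e]
  refine (norm_add_le _ _).trans ?_
  rw [add_mul]
  refine add_le_add ((IsL2Op.norm_toLin_sum_le isL2Op_coord_surfGrad _ u).trans ?_) ?_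
  · have : ∀ i ∈ Finset.univ, ‖(isL2Op_coord_surfGrad i).toLin u‖ ≤ R * ‖energyMap Q k u‖ :=
      fun i _ => by
        have hx : ∀ᵐ x ∂Q.surf, ‖(x i : ℂ)‖ ≤ R := by
          filter_upwards [Q.ae_surf_normal] with x hx
          simpa using hR x hx.1 i
        have hR0 : 0 ≤ R := (abs_nonneg _).trans (hR Q.lo ⟨le_rfl, fun i => (Q.lt i).le⟩ 0)
        refine (IsL2Op.norm_toLin_mul_le (isL2Op_surfGrad i) hx _ u).trans ?_
        gcongr
        exact norm_surfGrad_le_energy k u i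
    refine (Finset.sum_le_sum this).trans (le_of_eq ?_)
    simp
    ring
  · rw [IsL2Op.norm_toLin_const_mul u isL2Op_trace]
    exact norm_multiplier_le β hk₀ hk hβ (norm_nonneg _) (norm_trace_le_energy u (hk₀.trans_le hk))

lemma norm_multBdry_le_energy (hk₀ : 0 < k₀) (hk : k₀ ≤ k) (hβ : |β| ≤ b)
    (hR : ∀ x ∈ Icc Q.lo Q.hi, ∀ i, |x i| ≤ R) :
    ‖(isL2Op_multBdry k β).toLin u‖ ≤
      (R + ((n + 1) * R + (n / (2 * k₀) + b))) * ‖energyMap Q k u‖ := by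
  have hR0 : 0 ≤ R := (abs_nonneg _).trans (hR Q.lo ⟨le_rfl, fun i => (Q.lt i).le⟩ 0)
  have e : (isL2Op_multBdry k β).toLin u = _ := IsL2Op.toLin_add (isL2Op_xDotN_mul isL2Op_normalDeriv) (isL2Op_multTan k β)
    (isL2Op_multBdry k β) u
  rw [e, add_mul]
  refine (norm_add_le _ _).trans (add_le_add ?_ (norm_multTan_le_energy β u hk₀ hk hβ hR))
  refine (IsL2Op.norm_toLin_mul_le isL2Op_normalDeriv (ae_norm_xDotN_le hR) _ u).trans ?_
  gcongr
  exact norm_normalDeriv_le_energy k u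

/-- Boundedness of the form in the energy norm. -/
theorem norm_msForm_le (v : H2space Q) (hk₀ : 0 < k₀) (hk : k₀ ≤ k) (hβ : |β| ≤ b)
    (hR : ∀ x ∈ Icc Q.lo Q.hi, ∀ i, |x i| ≤ R) {C₁ : ℝ}
    (hC₁ : C₁ = (n + 1) * R + (n / (2 * k₀) + b)) :
    ‖msForm Q k β v u‖ ≤ ((n + 1) + 1 + C₁ + 1 + ((R + C₁) + C₁ + R + (n + 1) * R)) *
      ‖energyMap Q k u‖ * ‖energyMap Q k v‖ := by
  have hk' : 0 < k := hk₀.trans_le hk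
  have hR0 : 0 ≤ R := (abs_nonneg _).trans (hR Q.lo ⟨le_rfl, fun i => (Q.lt i).le⟩ 0)
  have hb : 0 ≤ b := (abs_nonneg _).trans hβ
  have hC : 0 ≤ C₁ := by rw [hC₁]; positivity
  set E := ‖energyMap Q k u‖
  set F := ‖energyMap Q k v‖
  have hE : 0 ≤ E := norm_nonneg _
  have hF : 0 ≤ F := norm_nonneg _
  have key : ∀ {μ : Measure (Fin (n + 1) → ℝ)} (y z : Lp ℂ 2 μ) (a c : ℝ), 0 ≤ a →
      ‖y‖ ≤ a * F → ‖z‖ ≤ c * E → ‖⟪y, z⟫_ℂ‖ ≤ a * c * (E * F) := fun y z a c ha hy hz =>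
    calc ‖⟪y, z⟫_ℂ‖ ≤ ‖y‖ * ‖z‖ := norm_inner_le_norm y z
      _ ≤ (a * F) * (c * E) := by gcongr
      _ = a * c * (E * F) := by ring
  have t1 : ‖∑ i, ⟪(isL2Op_grad i).toLin v, (isL2Op_grad i).toLin u⟫_ℂ‖ ≤ (n + 1) * (E * F) := by
    refine (norm_sum_le _ _).trans ((Finset.sum_le_sum fun i _ => key _ _ 1 1 zero_le_one
      (by simpa using norm_grad_le_energy k v i)
      (by simpa using norm_grad_le_energy k u i)).trans (le_of_eq ?_))
    simp
  -- The factor k² is shared equally between the two arguments, as in the energy norm.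
  have ksq : ∀ {μ : Measure (Fin (n + 1) → ℝ)} (y z : Lp ℂ 2 μ) (c : ℝ), 
      k * ‖y‖ ≤ F → k * ‖z‖ ≤ c * E → ‖(k : ℂ) ^ 2 * ⟪y, z⟫_ℂ‖ ≤ c * (E * F) :=
    fun y z c hy hz => by
      have hk2 : ‖(k : ℂ) ^ 2‖ = k ^ 2 := by simp
      rw [norm_mul, hk2]
      calc k ^ 2 * ‖⟪y, z⟫_ℂ‖ ≤ k ^ 2 * (‖y‖ * ‖z‖) := by gcongr; exact norm_inner_le_norm y z
        _ = (k * ‖y‖) * (k * ‖z‖) := by ring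
        _ ≤ F * (c * E) := by gcongr
        _ = _ := by ring
  have t2 : ‖(k : ℂ) ^ 2 * ⟪isL2Op_id.toLin v, isL2Op_id.toLin u⟫_ℂ‖ ≤ 1 * (E * F) :=
    ksq _ _ 1 (norm_id_le_energy v hk') (by simpa using norm_id_le_energy u hk')
  have t3 : ‖⟪(isL2Op_helm k).toLin v, (isL2Op_mult k β).toLin u⟫_ℂ‖ ≤ 1 * C₁ * (E * F) :=
    key _ _ 1 C₁ zero_le_one (by simpa using norm_helm_le_energy k v)
      (hC₁ ▸ norm_mult_le_energy β u hk₀ hk hβ hR)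
  have t4 : ‖⟪(isL2Op_helm k).toLin v, (isL2Op_helm k).toLin u⟫_ℂ‖ ≤ 1 * 1 * (E * F) :=
    key _ _ 1 1 zero_le_one (by simpa using norm_helm_le_energy k v)
      (by simpa using norm_helm_le_energy k u)
  have t5 : ‖I * k * ⟪(isL2Op_multBdry k β).toLin v, isL2Op_trace.toLin u⟫_ℂ‖ ≤
      (R + C₁) * (E * F) := by
    have hv := norm_multBdry_le_energy β v hk₀ hk hβ hR
    rw [← hC₁] at hv
    rw [norm_mul, norm_mul, Complex.norm_I, one_mul, Complex.norm_real, Real.norm_of_nonneg hk'.le]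
    calc _ ≤ k * (‖(isL2Op_multBdry k β).toLin v‖ * ‖isL2Op_trace.toLin u‖) := by
          gcongr; exact norm_inner_le_norm _ _
      _ = ‖(isL2Op_multBdry k β).toLin v‖ * (k * ‖isL2Op_trace.toLin u‖) := by ring
      _ ≤ ((R + C₁) * F) * E := by gcongr; exact norm_trace_le_energy u hk'
      _ = _ := by ring
  have t6 : ‖⟪isL2Op_normalDeriv.toLin v, (isL2Op_multTan k β).toLin u⟫_ℂ‖ ≤ 1 * C₁ * (E * F) :=
    key _ _ 1 C₁ zero_le_one (by simpa using norm_normalDeriv_le_energy k v)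
      (hC₁ ▸ norm_multTan_le_energy β u hk₀ hk hβ hR)
  have t7 : ‖(k : ℂ) ^ 2 * ⟪isL2Op_trace.toLin v, (isL2Op_xDotN_mul isL2Op_trace).toLin u⟫_ℂ‖ ≤
      R * (E * F) := by
    refine ksq _ _ R (norm_trace_le_energy v hk') ?_
    have := IsL2Op.norm_toLin_mul_le isL2Op_trace (ae_norm_xDotN_le hR)
      (isL2Op_xDotN_mul isL2Op_trace) u
    calc _ ≤ k * (R * ‖isL2Op_trace.toLin u‖) := by gcongr
      _ = R * (k * ‖isL2Op_trace.toLin u‖) := by ring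
      _ ≤ _ := by gcongr; exact norm_trace_le_energy u hk'
  have t8 : ‖∑ i, ⟪(isL2Op_surfGrad i).toLin v,
      (isL2Op_xDotN_mul (isL2Op_surfGrad i)).toLin u⟫_ℂ‖ ≤ (n + 1) * R * (E * F) := by
    refine (norm_sum_le _ _).trans ((Finset.sum_le_sum fun i _ => key _ _ 1 R zero_le_one
      (by simpa using norm_surfGrad_le_energy k v i) ?_).trans (le_of_eq ?_))
    · refine (IsL2Op.norm_toLin_mul_le (isL2Op_surfGrad i) (ae_norm_xDotN_le hR) _ u).trans ?_
      gcongr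
      exact norm_surfGrad_le_energy k u i
    · simp; ring
  rw [msForm_apply]
  refine (norm_sub_le _ _).trans ?_
  have s1 := norm_add₃_le (a := ∑ i, ⟪(isL2Op_grad i).toLin v, (isL2Op_grad i).toLin u⟫_ℂ)
    (b := (k : ℂ) ^ 2 * ⟪isL2Op_id.toLin v, isL2Op_id.toLin u⟫_ℂ)
    (c := ⟪(isL2Op_helm k).toLin v, (isL2Op_mult k β).toLin u⟫_ℂ)
  have s2 := norm_add_le (∑ i, ⟪(isL2Op_grad i).toLin v, (isL2Op_grad i).toLin u⟫_ℂ +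
    (k : ℂ) ^ 2 * ⟪isL2Op_id.toLin v, isL2Op_id.toLin u⟫_ℂ +
    ⟪(isL2Op_helm k).toLin v, (isL2Op_mult k β).toLin u⟫_ℂ)
    ⟪(isL2Op_helm k).toLin v, (isL2Op_helm k).toLin u⟫_ℂ
  have s3 := norm_add₃_le
    (a := I * k * ⟪(isL2Op_multBdry k β).toLin v, isL2Op_trace.toLin u⟫_ℂ)
    (b := ⟪isL2Op_normalDeriv.toLin v, (isL2Op_multTan k β).toLin u⟫_ℂ)
    (c := (k : ℂ) ^ 2 * ⟪isL2Op_trace.toLin v, (isL2Op_xDotN_mul isL2Op_trace).toLin u⟫_ℂ)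
  have s4 := norm_sub_le (I * k * ⟪(isL2Op_multBdry k β).toLin v, isL2Op_trace.toLin u⟫_ℂ +
      ⟪isL2Op_normalDeriv.toLin v, (isL2Op_multTan k β).toLin u⟫_ℂ +
      (k : ℂ) ^ 2 * ⟪isL2Op_trace.toLin v, (isL2Op_xDotN_mul isL2Op_trace).toLin u⟫_ℂ)
    (∑ i, ⟪(isL2Op_surfGrad i).toLin v, (isL2Op_xDotN_mul (isL2Op_surfGrad i)).toLin u⟫_ℂ)
  linarith

end bound

end Energy

end HelmholtzMS

namespace HelmholtzMS

/-! ### Coercivity -/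

section Coercivity

open Set Filter Topology
open scoped InnerProductSpace

variable {n : ℕ} {Q : Box n}

/-- Each face has positive measure, so a property that holds almost everywhere on it holds at some
point of it. -/
instance Box.neBot_ae_faceMeasure (i : Fin (n + 1)) (c : ℝ) : (ae (Q.faceMeasure i c)).NeBot := by
  rw [ae_neBot]
  intro h
  have h0 : Q.faceMeasure i c univ = 0 := by rw [h]; rfl
  rw [Box.faceMeasure, Measure.map_apply (measurableEmbedding_insertNth i c).measurable
    MeasurableSet.univ, preimage_univ, Measure.restrict_apply_univ, Real.volume_Icc_pi,
    Finset.prod_eq_zero_iff] at h0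
  obtain ⟨j, -, hj⟩ := h0
  exact absurd (ENNReal.ofReal_eq_zero.1 hj) (by simpa using Q.lt (i.succAbove j))

/-- At a suitable point of the upper face x·n equals the constant `Q.hi i`. With the analogous bound
for the lower face, the almost-everywhere condition becomes the statement that the origin is at
distance at least r from every face. -/
lemma Box.StarShapedBall.le_hi {r : ℝ} (h : Q.StarShapedBall r) (i : Fin (n + 1)) :
    r ≤ Q.hi i := by
  obtain ⟨x, hx, hx'⟩ := ((Q.ae_faceMeasure_hi i).and (Q.ae_surf_iff.1 h i).2).exists
  rw [hx.2.2, Finset.sum_eq_single i (by simp +contextual) (by simp), hx.2.1] at hx'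
  simpa using hx'

lemma Box.StarShapedBall.le_neg_lo {r : ℝ} (h : Q.StarShapedBall r) (i : Fin (n + 1)) :
    r ≤ -Q.lo i := by
  obtain ⟨x, hx, hx'⟩ := ((Q.ae_faceMeasure_lo i).and (Q.ae_surf_iff.1 h i).1).exists
  rw [hx.2.2, Finset.sum_eq_single i (by simp +contextual) (by simp), hx.2.1] at hx'
  simpa using hx'

lemma Box.diameter_pos : 0 < Q.diameter := by
  refine Real.sqrt_pos.2 (Finset.sum_pos (fun i _ => ?_) Finset.univ_nonempty)
  have := Q.lt i
  exact pow_pos (by linarith) 2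

lemma Box.side_le_diameter (i : Fin (n + 1)) : Q.hi i - Q.lo i ≤ Q.diameter :=
  Real.le_sqrt_of_sq_le (Finset.single_le_sum (f := fun i => (Q.hi i - Q.lo i) ^ 2)
    (fun _ _ => sq_nonneg _) (Finset.mem_univ i))

/-- The origin lies in the box, so |xᵢ| is at most the length of the i-th side. -/
lemma Box.StarShapedBall.sum_sq_le {r : ℝ} (hr : 0 < r) (h : Q.StarShapedBall r)
    {x : Fin (n + 1) → ℝ} (hx : x ∈ Icc Q.lo Q.hi) : ∑ i, x i ^ 2 ≤ Q.diameter ^ 2 := by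
  rw [Box.diameter, Real.sq_sqrt (by positivity)]
  refine Finset.sum_le_sum fun i _ => ?_
  have h1 := h.le_hi i
  have h2 := h.le_neg_lo i
  have h3 := hx.1 i
  have h4 := hx.2 i
  exact sq_le_sq' (by linarith) (by linarith)

lemma Box.StarShapedBall.ae_xDotN_le {r : ℝ} (hr : 0 < r) (h : Q.StarShapedBall r) :
    ∀ᵐ x ∂Q.surf, ∑ i, x i * Q.normal x i ≤ Q.diameter := by
  filter_upwards [Q.ae_surf_normal] with x hx
  obtain ⟨hx, i, ⟨hi, hn⟩ | ⟨hi, hn⟩⟩ := hx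
  all_goals
    rw [hn, Finset.sum_eq_single i (by simp +contextual) (by simp), hi]
    have h1 := h.le_hi i
    have h2 := h.le_neg_lo i
    have h3 := Q.side_le_diameter i
    simp only [Pi.single_eq_same]
    linarith

lemma norm_sum_coord_mul_le {x : Fin (n + 1) → ℝ} {L : ℝ} (hL : 0 ≤ L) (hx : ∑ i, x i ^ 2 ≤ L ^ 2)
    (w : Fin (n + 1) → ℂ) : ‖∑ i, (x i : ℂ) * w i‖ ≤ L * √(∑ i, ‖w i‖ ^ 2) := by
  calc ‖∑ i, (x i : ℂ) * w i‖ ≤ ∑ i, |x i| * ‖w i‖ := by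
        refine (norm_sum_le _ _).trans (le_of_eq ?_)
        simp
    _ ≤ √(∑ i, |x i| ^ 2) * √(∑ i, ‖w i‖ ^ 2) := Real.sum_mul_le_sqrt_mul_sqrt _ _ _
    _ ≤ L * √(∑ i, ‖w i‖ ^ 2) := by
        gcongr
        simp only [sq_abs]
        exact Real.sqrt_le_iff.2 ⟨hL, hx⟩

/-- The pointwise estimate on `Γ` behind coercivity. -/
lemma bdry_coercive {L γ k β X : ℝ} (hL : 0 < L) (hγ : 0 < γ) (hk : 0 < k)
    (hβ : L / 2 * (1 + 4 / γ + γ / 2) ≤ β) (hX1 : γ * L ≤ X) (hX2 : X ≤ L) {s : ℝ}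
    (ν t y : ℂ) (hy : ‖y‖ ≤ L * s) :
    γ * L / 4 * (‖ν‖ ^ 2 + s ^ 2 + k ^ 2 * ‖t‖ ^ 2) ≤
      (ν * conj (X * ν + (y + (n / 2 - I * k * β) * t)) / 2 -
        (y + (n / 2 - I * k * β) * t) * conj ν / 2 -
        X * ((k : ℂ) ^ 2 * t * conj t - (s : ℂ) ^ 2) / 2 -
        I * k * t * conj (X * ν + (y + (n / 2 - I * k * β) * t))).re := by
  -- γL ≤ X ≤ L at the point considered.
  have hγ1 : γ ≤ 1 := by
    by_contra hc
    push Not at hc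
    nlinarith
  have hX : 0 < X := lt_of_lt_of_le (by positivity) hX1
  have e1 : (ν * conj (X * ν + (y + (n / 2 - I * k * β) * t)) / 2 -
        (y + (n / 2 - I * k * β) * t) * conj ν / 2 -
        X * ((k : ℂ) ^ 2 * t * conj t - (s : ℂ) ^ 2) / 2 -
        I * k * t * conj (X * ν + (y + (n / 2 - I * k * β) * t))).re =
      X / 2 * ‖ν‖ ^ 2 + X / 2 * s ^ 2 + (β - X / 2) * (k ^ 2 * ‖t‖ ^ 2) -
        (I * k * t * conj (X * ν)).re - (I * k * t * conj y).re := by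
    simp only [← Complex.normSq_eq_norm_sq, Complex.normSq_apply]
    have hn : ((n : ℂ) / 2) = ((n / 2 : ℝ) : ℂ) := by push_cast; rfl
    rw [hn]
    generalize (n / 2 : ℝ) = c
    simp [pow_two]
    ring
  have e2 : (I * k * t * conj (X * ν)).re ≤ k * ‖t‖ * (X * ‖ν‖) := by
    refine (Complex.re_le_norm _).trans (le_of_eq ?_)
    simp [abs_of_pos hk, abs_of_pos hX]
  have e3 : (I * k * t * conj y).re ≤ k * ‖t‖ * (L * s) := by
    refine (Complex.re_le_norm _).trans ?_
    simp only [norm_mul, Complex.norm_I, one_mul, Complex.norm_real, Real.norm_eq_abs,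
      abs_of_pos hk, RCLike.norm_conj]
    gcongr
  set T := k * ‖t‖ with hT
  have hT0 : 0 ≤ T := by positivity
  have hT2 : k ^ 2 * ‖t‖ ^ 2 = T ^ 2 := by rw [hT]; ring
  -- Young's inequality for the two cross terms with T = k|t|. The weights leave at least X/4 ≥ γL/4
  -- of the coefficient of |ν|² and X/2 − γL/4 ≥ γL/4 of that of s².
  have f1 : T * (X * ‖ν‖) ≤ X / 4 * ‖ν‖ ^ 2 + X * T ^ 2 := by
    nlinarith [mul_nonneg hX.le (sq_nonneg (‖ν‖ / 2 - T))]
  have f2 : T * (L * s) ≤ γ * L / 4 * s ^ 2 + L / γ * T ^ 2 := by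
    have : γ * L / 4 * s ^ 2 + L / γ * T ^ 2 - T * (L * s) = L / γ * (γ * s / 2 - T) ^ 2 := by
      field_simp
      ring
    have h2 : 0 ≤ L / γ * (γ * s / 2 - T) ^ 2 := by positivity
    linarith
  -- The lower bound on β equals L/2 + 2L/γ + γL/4. With X ≤ L and L ≤ L/γ this is enough for T² to
  -- keep the coefficient γL/4.
  have f3 : γ * L / 4 ≤ β - X / 2 - X - L / γ := by
    have g1 : L ≤ L / γ := by rw [le_div_iff₀ hγ]; nlinarith
    have g2 : L / 2 * (1 + 4 / γ + γ / 2) = L / 2 + 2 * (L / γ) + γ * L / 4 := by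
      field_simp
      ring
    linarith
  rw [e1, hT2]
  nlinarith [mul_le_mul_of_nonneg_right f3 (sq_nonneg T), sq_nonneg ‖ν‖, sq_nonneg s,
    mul_le_mul_of_nonneg_right hX1 (sq_nonneg ‖ν‖), mul_le_mul_of_nonneg_right hX1 (sq_nonneg s)]

lemma integral_sub_sub_add_sub {α : Type*} [MeasurableSpace α] {μ : Measure α}
    {f g h s l : α → ℂ} (hf : Integrable f μ) (hg : Integrable g μ) (hh : Integrable h μ)
    (hs : Integrable s μ) (hl : Integrable l μ) :
    ∫ x, (f x - g x - h x + s x - l x) ∂μ =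
      ∫ x, f x ∂μ - ∫ x, g x ∂μ - ∫ x, h x ∂μ + ∫ x, s x ∂μ - ∫ x, l x ∂μ := by
  rw [integral_sub (f := fun x => f x - g x - h x + s x) (((hf.sub hg).sub hh).add hs) hl,
    integral_add (f := fun x => f x - g x - h x) ((hf.sub hg).sub hh) hs,
    integral_sub (f := fun x => f x - g x) (hf.sub hg) hh, integral_sub hf hg]

/-- Coercivity of the form in the energy norm. -/
theorem msForm_coercive {γ k β : ℝ} (hγ : 0 < γ) (hQ : Q.StarShapedBall (γ * Q.diameter))
    (hk : 0 < k) (hβ : Q.diameter / 2 * (1 + 4 / γ + γ / 2) ≤ β) (u : H2space Q) :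
    min (1 / 2) (γ * Q.diameter / 4) * ‖energyMap Q k u‖ ^ 2 ≤ (msForm Q k β u u).re := by
  set L := Q.diameter with hLdef
  have hL : 0 < L := Q.diameter_pos
  have hr : 0 < γ * L := by positivity
  set α := min (1 / 2) (γ * L / 4) with hα
  have hi1 : IsL2Op Q Q.surf fun u x => I * k * trace Q u x := isL2Op_trace.const_mul (I * k)
  have hi2 := isL2Op_normalDeriv (Q := Q)
  have c1 := (hi2.integrable (isL2Op_multBdry k β) u u).div_const 2
  have c2 := ((isL2Op_multTan k β).integrable hi2 u u).div_const 2
  have c3 := ((isL2Op_xDotN_mul isL2Op_trace).integrable isL2Op_trace u u).const_mul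
    ((k : ℂ) ^ 2 / 2)
  have c4 := fun i => ((isL2Op_xDotN_mul (isL2Op_surfGrad i)).integrable
    (isL2Op_surfGrad i) u u).div_const 2
  have c5 := hi1.integrable (isL2Op_multBdry k β) u u
  -- the boundary density
  set P : (Fin (n + 1) → ℝ) → ℂ := fun x =>
    normalDeriv Q u x * conj (multBdry Q k β u x) / 2 -
      multTan Q k β u x * conj (normalDeriv Q u x) / 2 -
      (k : ℂ) ^ 2 / 2 * (xDotN Q x * trace Q u x * conj (trace Q u x)) +
      ∑ i, xDotN Q x * surfGrad Q u i x * conj (surfGrad Q u i x) / 2 -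
      I * k * trace Q u x * conj (multBdry Q k β u x) with hP
  have hPi : Integrable P Q.surf :=
    (((c1.sub c2).sub c3).add (integrable_finsetSum _ fun i _ => c4 i)).sub c5
  have hPe : ∫ x, P x ∂Q.surf =
      ⟪(isL2Op_multBdry k β).toLin u, isL2Op_normalDeriv.toLin u⟫_ℂ / 2 -
      ⟪isL2Op_normalDeriv.toLin u, (isL2Op_multTan k β).toLin u⟫_ℂ / 2 -
      (k : ℂ) ^ 2 / 2 * ⟪isL2Op_trace.toLin u, (isL2Op_xDotN_mul isL2Op_trace).toLin u⟫_ℂ +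
      (∑ i, ⟪(isL2Op_surfGrad i).toLin u,
        (isL2Op_xDotN_mul (isL2Op_surfGrad i)).toLin u⟫_ℂ) / 2 -
      I * k * ⟪(isL2Op_multBdry k β).toLin u, isL2Op_trace.toLin u⟫_ℂ := by
    have e5 : I * k * ⟪(isL2Op_multBdry k β).toLin u, isL2Op_trace.toLin u⟫_ℂ =
        ∫ x, I * k * trace Q u x * conj (multBdry Q k β u x) ∂Q.surf := by
      rw [IsL2Op.inner_toLin, ← integral_const_mul]
      simp only [mul_assoc]
    rw [e5]
    simp only [IsL2Op.inner_toLin]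
    rw [hP, integral_sub_sub_add_sub c1 c2 c3 (integrable_finsetSum _ fun i _ => c4 i) c5,
      integral_finsetSum _ fun i _ => c4 i, integral_const_mul, Finset.sum_div]
    simp only [integral_div]
  -- Half the sum of the defining expression of b(u,u) and its residual form. The products of ℳu and
  -- ℒu enter with opposite signs and have equal real parts, so they disappear.
  have hsplit : (msForm Q k β u u).re = (∑ i, ‖(isL2Op_grad i).toLin u‖ ^ 2 +
      k ^ 2 * ‖isL2Op_id.toLin u‖ ^ 2) / 2 + ‖(isL2Op_helm k).toLin u‖ ^ 2 +
      (∫ x, P x ∂Q.surf).re := by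
    have e1 := congrArg Complex.re (msForm_apply k β u u)
    have e2 := congrArg Complex.re (msForm_eq_residual k β u u)
    have e3 : (⟪(isL2Op_mult k β).toLin u, (isL2Op_helm k).toLin u⟫_ℂ).re =
        (⟪(isL2Op_helm k).toLin u, (isL2Op_mult k β).toLin u⟫_ℂ).re := inner_re_symm (𝕜 := ℂ) _ _
    have hsq : ∀ {μ : Measure (Fin (n + 1) → ℝ)} (y : Lp ℂ 2 μ), (⟪y, y⟫_ℂ).re = ‖y‖ ^ 2 :=
      fun y => inner_self_eq_norm_sq (𝕜 := ℂ) y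
    have hk2 : ((k : ℂ) ^ 2) = ((k ^ 2 : ℝ) : ℂ) := by push_cast; rfl
    have hk3 : ((k : ℂ) ^ 2 / 2) = ((k ^ 2 / 2 : ℝ) : ℂ) := by push_cast; rfl
    rw [hPe, hk3]
    rw [hk2] at e1
    simp only [Complex.add_re, Complex.sub_re, Complex.re_sum, Complex.re_ofReal_mul, hsq,
      Complex.div_ofNat_re, e3] at e1 e2 ⊢
    linarith
  have hB : γ * L / 4 * (∑ i, ∫ x, ‖surfGrad Q u i x‖ ^ 2 ∂Q.surf +
      ∫ x, ‖normalDeriv Q u x‖ ^ 2 ∂Q.surf + k ^ 2 * ∫ x, ‖trace Q u x‖ ^ 2 ∂Q.surf) ≤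
      (∫ x, P x ∂Q.surf).re := by
    have j1 := fun i => integrable_norm_sq ((isL2Op_surfGrad (Q := Q) i).memLp u u.2)
    have j2 := integrable_norm_sq (hi2.memLp u u.2)
    have j3 := (integrable_norm_sq ((isL2Op_trace (Q := Q)).memLp u u.2)).const_mul (k ^ 2)
    have e0 : (∫ x, P x ∂Q.surf).re = ∫ x, (P x).re ∂Q.surf := (integral_re hPi).symm
    rw [e0, ← integral_const_mul, ← integral_finsetSum _ fun i _ => j1 i,
      ← integral_add (integrable_finsetSum _ fun i _ => j1 i) j2,
      ← integral_add (f := fun x => ∑ i, ‖surfGrad Q u i x‖ ^ 2 + ‖normalDeriv Q u x‖ ^ 2)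
        ((integrable_finsetSum _ fun i _ => j1 i).add j2) j3, ← integral_const_mul]
    refine integral_mono_ae ((((integrable_finsetSum _ fun i _ => j1 i).add j2).add j3).const_mul _)
      hPi.re ?_
    filter_upwards [hQ, hQ.ae_xDotN_le hr, Q.ae_surf_normal] with x h1 h2 h3
    have key := bdry_coercive (n := n) hL hγ hk hβ h1 h2
      (s := √(∑ i, ‖surfGrad Q u i x‖ ^ 2)) (normalDeriv Q u x) (trace Q u x)
      (∑ i, (x i : ℂ) * surfGrad Q u i x) (norm_sum_coord_mul_le hL.le (hQ.sum_sq_le hr h3.1) _)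
    rw [Real.sq_sqrt (by positivity)] at key
    have hss : ((√(∑ i, ‖surfGrad Q u i x‖ ^ 2) : ℝ) : ℂ) ^ 2 =
        ∑ i, surfGrad Q u i x * conj (surfGrad Q u i x) := by
      rw [← Complex.ofReal_pow, Real.sq_sqrt (by positivity), Complex.ofReal_sum]
      refine Finset.sum_congr rfl fun i _ => ?_
      rw [Complex.mul_conj, Complex.normSq_eq_norm_sq]
    rw [hss] at key
    refine le_trans (le_of_eq ?_) (key.trans (le_of_eq ?_))
    · ring
    · simp only [hP, multBdry, multTan_eq]
      congr 1
      simp only [mul_assoc, ← Finset.mul_sum, ← Finset.sum_div, xDotN]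
      ring
  have hα1 : α ≤ 1 / 2 := min_le_left _ _
  have hα2 : α ≤ γ * L / 4 := min_le_right _ _
  rw [norm_sq_energyMap_eq, hsplit]
  simp only [IsL2Op.norm_sq_toLin]
  have p1 : 0 ≤ ∑ i, ∫ x, ‖grad Q u i x‖ ^ 2 ∂Q.vol + k ^ 2 * ∫ x, ‖u.1 x‖ ^ 2 ∂Q.vol := by
    positivity
  have p2 : 0 ≤ ∫ x, ‖helm Q k u x‖ ^ 2 ∂Q.vol := by positivity
  have p3 : 0 ≤ ∑ i, ∫ x, ‖surfGrad Q u i x‖ ^ 2 ∂Q.surf +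
      ∫ x, ‖normalDeriv Q u x‖ ^ 2 ∂Q.surf + k ^ 2 * ∫ x, ‖trace Q u x‖ ^ 2 ∂Q.surf := by
    positivity
  have q1 := mul_le_mul_of_nonneg_right hα1 p1
  have q2 := mul_le_mul_of_nonneg_right hα1 p2
  have q3 := mul_le_mul_of_nonneg_right hα2 p3
  linarith

end Coercivity

end HelmholtzMS

namespace HelmholtzMS

/-! ### Weak derivatives of piecewise smooth functions -/

section Piecewise

open Set Filter Topology

variable {n : ℕ} {Q : Box n}

lemma hasDerivAt_insertNth (i : Fin (n + 1)) (y : Fin n → ℝ) (s : ℝ) :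
    HasDerivAt (fun s : ℝ => (i.insertNth s y : Fin (n + 1) → ℝ)) (Pi.single i 1) s := by
  rw [hasDerivAt_pi]
  intro j
  refine Fin.succAboveCases i ?_ (fun j => ?_) j
  · simpa using hasDerivAt_id' s
  · simpa using hasDerivAt_const s (y j)

lemma IsTestFun.eq_zero {φ : (Fin (n + 1) → ℝ) → ℝ} (hφ : IsTestFun Q φ) {x : Fin (n + 1) → ℝ}
    (hx : x ∉ Q.dom) : φ x = 0 :=
  image_eq_zero_of_notMem_tsupport fun h => hx (hφ.2.2 h)

lemma pderiv_eq_zero_of_notMem_tsupport {φ : (Fin (n + 1) → ℝ) → ℝ} {x : Fin (n + 1) → ℝ}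
    (hx : x ∉ tsupport φ) (i : Fin (n + 1)) : pderiv i φ x = 0 := by
  rw [pderiv, fderiv_of_notMem_tsupport ℝ hx]
  rfl

/-- A continuous function that is differentiable in direction `i` off a grid has the classical
derivative as weak derivative. -/
theorem weakPartial_of_hasDerivAt {i : Fin (n + 1)} {F G : (Fin (n + 1) → ℝ) → ℂ}
    {Z : Fin (n + 1) → Set ℝ} (hZ : ∀ i, (Z i).Countable) (hF : ContinuousOn F Q.dom)
    (hFm : MemLp F 2 Q.vol) (hGm : MemLp G 2 Q.vol)
    (hd : ∀ x ∈ Q.dom, (∀ j, x j ∉ Z j) →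
      HasDerivAt (fun s => F (Function.update x i s)) (G x) (x i)) : WeakPartial Q i F G := by
  intro φ hφ
  have hφc : Continuous φ := hφ.1.continuous
  have hpc : Continuous (pderiv i φ) := (contDiff_pderiv hφ.1 i).continuous
  have i1 : Integrable (fun x => F x * (pderiv i φ x : ℂ)) Q.vol := by
    have := integrable_mul_conj hFm (Q.memLp_vol_of_continuous
      (Complex.continuous_ofReal.comp hpc) (p := 2))
    simpa using this
  have i2 : Integrable (fun x => G x * (φ x : ℂ)) Q.vol := by
    have := integrable_mul_conj hGm (Q.memLp_vol_of_continuous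
      (Complex.continuous_ofReal.comp hφc) (p := 2))
    simpa using this
  rw [← add_eq_zero_iff_eq_neg, ← integral_add i1 i2]
  set H : (Fin (n + 1) → ℝ) → ℂ := fun x => F x * (pderiv i φ x : ℂ) + G x * (φ x : ℂ) with hH
  have hH0 : ∀ x, x ∉ tsupport φ → H x = 0 := fun x hx => by
    simp [hH, pderiv_eq_zero_of_notMem_tsupport hx, image_eq_zero_of_notMem_tsupport hx]
  have hHd : ∀ x, x ∉ Q.dom → H x = 0 := fun x hx => hH0 x fun h => hx (hφ.2.2 h)
  have hHi : Integrable H volume := by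
    have : IntegrableOn H Q.dom volume := i1.add i2
    refine (integrableOn_iff_integrable_of_support_subset fun x hx => ?_).1 this
    by_contra h
    exact hx (hHd x h)
  have e0 : ∫ x, H x ∂Q.vol = ∫ x, H x := setIntegral_eq_integral_of_forall_compl_eq_zero hHd
  have hmp := (volume_preserving_piFinSuccAbove (fun _ : Fin (n + 1) => ℝ) i).symm
  have hHi' : Integrable (fun z : ℝ × (Fin n → ℝ) => H (i.insertNth z.1 z.2))
      (volume.prod volume) :=
    (hmp.integrable_comp_emb (MeasurableEquiv.measurableEmbedding _)).2 hHi
  have e1 : ∫ x, H x = ∫ z : ℝ × (Fin n → ℝ), H (i.insertNth z.1 z.2) ∂(volume.prod volume) :=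
    (hmp.integral_comp (MeasurableEquiv.measurableEmbedding _) H).symm
  rw [e0, e1, integral_prod_symm _ hHi']
  refine integral_eq_zero_of_ae ?_
  -- After Fubini the integral over almost every line parallel to eᵢ is shown to vanish. On such a
  -- line the other coordinates avoid the grid, so the exceptional points form a countable set.
  have hyZ : ∀ᵐ y : Fin n → ℝ, ∀ j, y j ∉ Z (i.succAbove j) := by
    rw [ae_all_iff]
    intro j
    have : ∀ z ∈ Z (i.succAbove j), ∀ᵐ y : Fin n → ℝ, y j ≠ z := fun z _ =>
      Measure.ae_eval_ne (fun _ => volume) j _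
    filter_upwards [(ae_ball_iff (hZ _)).2 this] with y hy hy'
    exact hy _ hy' rfl
  filter_upwards [hyZ, hHi'.prod_left_ae] with y hy hyi
  set c : ℝ → Fin (n + 1) → ℝ := fun s => i.insertNth s y with hc
  have hcc : Continuous c := continuous_iff_continuousAt.2 fun s =>
    (hasDerivAt_insertNth i y s).continuousAt
  have hci : ∀ s, c s i = s := fun s => by simp [hc]
  have hdomi : ∀ s, c s ∈ Q.dom → s ∈ Ioo (Q.lo i) (Q.hi i) := fun s hs => by
    have := hs i (mem_univ i)
    rwa [hci] at this
  -- F is continuous only on Ω, but φ vanishes near every point outside its support, which lies in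
  -- Ω.
  have hcont : Continuous fun x => F x * (φ x : ℂ) := by
    rw [continuous_iff_continuousAt]
    intro x
    by_cases hx : x ∈ tsupport φ
    · exact (hF.continuousAt (Q.isOpen_dom.mem_nhds (hφ.2.2 hx))).mul
        (Complex.continuous_ofReal.comp hφc).continuousAt
    · have : (fun x => F x * (φ x : ℂ)) =ᶠ[𝓝 x] fun _ => 0 := by
        filter_upwards [notMem_tsupport_iff_eventuallyEq.1 hx] with z hz
        simp [hz]
      exact this.continuousAt
  have hder : ∀ s, s ∉ Z i → HasDerivAt (fun s => F (c s) * (φ (c s) : ℂ)) (H (c s)) s := by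
    intro s hs
    by_cases hx : c s ∈ tsupport φ
    · have h1 := hd (c s) (hφ.2.2 hx) fun j => by
        refine Fin.succAboveCases i ?_ (fun j => ?_) j
        · rwa [hci]
        · simpa [hc] using hy j
      have hup : ∀ s', Function.update (c s) i s' = c s' := fun s' => by
        simp [hc]
      simp only [hup, hci] at h1
      have h2 : HasDerivAt (fun s => φ (c s)) (pderiv i φ (c s)) s :=
        (hφ.1.differentiable (by simp) (c s)).hasFDerivAt.comp_hasDerivAt s
          (hasDerivAt_insertNth i y s)
      have h3 := h1.mul h2.ofReal_comp
      refine h3.congr_deriv ?_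
      simp only [hH]
      ring
    · rw [hH0 _ hx]
      refine (hasDerivAt_const s (0 : ℂ)).congr_of_eventuallyEq ?_
      filter_upwards [hcc.continuousAt.eventually (notMem_tsupport_iff_eventuallyEq.1 hx)] with z hz
      simp only [Pi.zero_apply] at hz
      simp [hz]
  have hz : ∀ s, s ∉ Ioo (Q.lo i) (Q.hi i) → H (c s) = 0 := fun s hs =>
    hHd _ fun h => hs (hdomi s h)
  have hInt : ∫ s, H (c s) = ∫ s in Q.lo i..Q.hi i, H (c s) := by
    rw [intervalIntegral.integral_of_le (Q.lt i).le]
    refine (setIntegral_eq_integral_of_forall_compl_eq_zero fun s hs => hz s fun h => hs ?_).symm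
    exact Ioo_subset_Ioc_self h
  change ∫ s, H (c s) = 0
  -- The integrand is the derivative of Fφ along the line off a countable set, and φ is zero at both
  -- ends.
  rw [hInt, integral_eq_of_hasDerivAt_off_countable_of_le
    (fun s => F (c s) * (φ (c s) : ℂ)) _ (Q.lt i).le (hZ i) (hcont.comp hcc).continuousOn
    (fun s hs => hder s hs.2) hyi.intervalIntegrable]
  have hb : ∀ s, s ∉ Ioo (Q.lo i) (Q.hi i) → φ (c s) = 0 := fun s hs =>
    hφ.eq_zero fun h => hs (hdomi s h)
  simp [hb]

/-- If x lay in no open subinterval, induction over the nodes would place every node, including the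
last one, to its left. -/
lemma exists_mem_Ioo_of_notMem {M : ℕ} {t : Fin (M + 1) → ℝ} {x : ℝ}
    (hx : x ∈ Ioo (t 0) (t (Fin.last M))) (hx' : x ∉ range t) :
    ∃ j : Fin M, x ∈ Ioo (t j.castSucc) (t j.succ) := by
  by_contra! h
  have key : ∀ j, t j < x := by
    intro j
    induction j using Fin.induction with
    | zero => exact hx.1
    | succ j ih =>
      rcases lt_trichotomy x (t j.succ) with h1 | h1 | h1
      · exact absurd ⟨ih, h1⟩ (h j)
      · exact absurd ⟨_, h1.symm⟩ hx'
      · exact h1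
  exact lt_asymm (key (Fin.last _)) hx.2

/-! ### Grids, elements and piecewise smooth functions -/

namespace Mesh

variable (T : Mesh Q)

/-- The grid points of the mesh in direction `i`. -/
def grid (i : Fin (n + 1)) : Set ℝ := range (T.node i)

lemma countable_grid (i : Fin (n + 1)) : (T.grid i).Countable := countable_range _

lemma exists_interval (i : Fin (n + 1)) {s : ℝ} (hs : s ∈ Ioo (Q.lo i) (Q.hi i))
    (hs' : s ∉ T.grid i) :
    ∃ j : Fin (T.num i), s ∈ Ioo (T.node i j.castSucc) (T.node i j.succ) := by
  rw [← T.first, ← T.last] at hs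
  exact exists_mem_Ioo_of_notMem hs hs'

lemma exists_mem_cell {x : Fin (n + 1) → ℝ} (hx : x ∈ Q.dom) (hx' : ∀ i, x i ∉ T.grid i) :
    ∃ j, x ∈ T.cell j := by
  choose j hj using fun i => T.exists_interval i (hx i (mem_univ i)) (hx' i)
  exact ⟨j, fun i _ => hj i⟩

lemma ae_off_grid : ∀ᵐ x ∂Q.vol, ∀ i, x i ∉ T.grid i := by
  refine ae_restrict_of_ae (ae_all_iff.2 fun i => ?_)
  have : ∀ z ∈ T.grid i, ∀ᵐ x : Fin (n + 1) → ℝ, x i ≠ z := fun z _ =>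
    Measure.ae_eval_ne (fun _ => volume) i _
  filter_upwards [(ae_ball_iff (T.countable_grid i)).2 this] with x hx hx'
  exact hx _ hx' rfl

lemma ae_mem_cell : ∀ᵐ x ∂Q.vol, ∃ j, x ∈ T.cell j := by
  filter_upwards [T.ae_off_grid, Q.ae_mem_dom] with x hx hx'
  exact T.exists_mem_cell hx' hx

lemma isOpen_cell (j) : IsOpen (T.cell j) := isOpen_set_pi finite_univ fun _ _ => isOpen_Ioo

lemma node_mem_Icc (i : Fin (n + 1)) (m) : T.node i m ∈ Icc (Q.lo i) (Q.hi i) := by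
  rw [← T.first, ← T.last]
  exact ⟨(T.strictMono i).monotone (Fin.zero_le _), (T.strictMono i).monotone (Fin.le_last _)⟩

lemma cell_subset_dom (j) : T.cell j ⊆ Q.dom := fun _ hx i hi =>
  ⟨(T.node_mem_Icc i _).1.trans_lt (hx i hi).1, (hx i hi).2.trans_le (T.node_mem_Icc i _).2⟩

/-- `C¹` functions on `Ω` that extend from each element to a smooth function. -/
def IsPiecewiseSmooth (v : (Fin (n + 1) → ℝ) → ℝ) : Prop :=
  ContDiffOn ℝ 1 v Q.dom ∧ ∀ j, ∃ P : (Fin (n + 1) → ℝ) → ℝ, ContDiff ℝ ∞ P ∧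
    ∀ x ∈ T.cell j, v x = P x

end Mesh

namespace Mesh.IsPiecewiseSmooth

variable {T : Mesh Q} {v w : (Fin (n + 1) → ℝ) → ℝ}

lemma of_contDiff (hw : ContDiff ℝ ∞ w) : T.IsPiecewiseSmooth w :=
  ⟨(hw.of_le (by exact_mod_cast le_top)).contDiffOn, fun _ => ⟨w, hw, fun _ _ => rfl⟩⟩

lemma of_mem_space {p : ℕ} (hv : v ∈ T.space p) : T.IsPiecewiseSmooth v := by
  refine ⟨hv.2.1, fun j => ?_⟩
  obtain ⟨P, -, hP⟩ := hv.2.2 j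
  exact ⟨fun x => MvPolynomial.eval x P,
    (AnalyticOnNhd.eval_mvPolynomial P).contDiff, hP⟩

lemma sub (hv : T.IsPiecewiseSmooth v) (hw : T.IsPiecewiseSmooth w) :
    T.IsPiecewiseSmooth (v - w) := by
  refine ⟨hv.1.sub hw.1, fun j => ?_⟩
  obtain ⟨P, hP, hvP⟩ := hv.2 j
  obtain ⟨R, hR, hwR⟩ := hw.2 j
  exact ⟨P - R, hP.sub hR, fun x hx => by simp [hvP x hx, hwR x hx]⟩

lemma exists_bound (j : (i : Fin (n + 1)) → Fin (T.num i)) {P : (Fin (n + 1) → ℝ) → ℝ}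
    (hP : Continuous P) : ∃ C, ∀ x ∈ T.cell j, ‖P x‖ ≤ C := by
  obtain ⟨C, hC⟩ := (isCompact_Icc (a := Q.lo) (b := Q.hi)).exists_bound_of_continuousOn
    hP.continuousOn
  exact ⟨C, fun x hx => hC x (Q.dom_subset_Icc (T.cell_subset_dom j hx))⟩

/-- A measurable function that agrees on each element with a continuous one is in `L²(Ω)`. -/
lemma memLp_of_cell {F : (Fin (n + 1) → ℝ) → ℝ} (hF : AEStronglyMeasurable F Q.vol)
    (h : ∀ j, ∃ P : (Fin (n + 1) → ℝ) → ℝ, Continuous P ∧ ∀ x ∈ T.cell j, F x = P x) :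
    MemLp (fun x => (F x : ℂ)) 2 Q.vol := by
  choose P hP hF' using h
  choose C hC using fun j => exists_bound (T := T) j (hP j)
  refine MemLp.of_bound (Complex.continuous_ofReal.comp_aestronglyMeasurable hF)
    (∑ j, |C j|) ?_
  filter_upwards [T.ae_mem_cell] with x hx
  obtain ⟨j, hj⟩ := hx
  rw [Complex.norm_real, hF' j x hj]
  exact (hC j x hj).trans ((le_abs_self _).trans
    (Finset.single_le_sum (f := fun j => |C j|) (fun _ _ => abs_nonneg _) (Finset.mem_univ j)))

lemma pderiv_eq_of_eqOn_open {U : Set (Fin (n + 1) → ℝ)} (hU : IsOpen U)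
    {F G : (Fin (n + 1) → ℝ) → ℝ} (h : ∀ x ∈ U, F x = G x) (i : Fin (n + 1)) :
    ∀ x ∈ U, pderiv i F x = pderiv i G x := fun x hx => by
  rw [pderiv, pderiv, Filter.EventuallyEq.fderiv_eq]
  filter_upwards [hU.mem_nhds hx] with z hz using h z hz

lemma hasDerivAt_comp_update {F : (Fin (n + 1) → ℝ) → ℝ} {x : Fin (n + 1) → ℝ}
    (hF : DifferentiableAt ℝ F x) (i : Fin (n + 1)) :
    HasDerivAt (fun s => ((F (Function.update x i s) : ℝ) : ℂ)) ((pderiv i F x : ℝ) : ℂ) (x i) := by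
  refine HasDerivAt.ofReal_comp ?_
  have h1 : HasFDerivAt F (fderiv ℝ F x) (Function.update x i (x i)) := by
    rw [Function.update_eq_self]; exact hF.hasFDerivAt
  exact h1.comp_hasDerivAt (x i) (hasDerivAt_update x i (x i))

/-- C¹ regularity across the element interfaces puts finite element functions in H²: the first
derivatives are continuous on Ω and differentiable off the grid, so the elementwise second
derivatives are weak derivatives. The values of `fderiv` on the grid are irrelevant, the grid being
a null set. -/
theorem exists_isH2 {r : ℝ} (hr : 0 < r) (hQ : Q.StarShapedBall r) (hv : T.IsPiecewiseSmooth v) :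
    ∃ t tg, IsH2 Q (fun x => (v x : ℂ)) (fun i x => ((pderiv i v x : ℝ) : ℂ))
      (fun i j x => ((pderiv j (pderiv i v) x : ℝ) : ℂ)) t tg := by
  have hc0 : ContinuousOn v Q.dom := hv.1.continuousOn
  have hc1 : ∀ i, ContinuousOn (pderiv i v) Q.dom := fun i =>
    (hv.1.continuousOn_fderiv_of_isOpen Q.isOpen_dom le_rfl).clm_apply continuousOn_const
  have hd0 : ∀ x ∈ Q.dom, DifferentiableAt ℝ v x := fun x hx =>
    (hv.1.differentiableOn one_ne_zero).differentiableAt (Q.isOpen_dom.mem_nhds hx)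
  choose P hP hvP using hv.2
  have hP1 := fun j i => pderiv_eq_of_eqOn_open (T.isOpen_cell j) (hvP j) i
  have hP2 := fun j i l => pderiv_eq_of_eqOn_open (T.isOpen_cell j) (hP1 j i) l
  have hd1 : ∀ i, ∀ x ∈ Q.dom, (∀ l, x l ∉ T.grid l) → DifferentiableAt ℝ (pderiv i v) x := by
    intro i x hx hx'
    obtain ⟨j, hj⟩ := T.exists_mem_cell hx hx'
    refine ((contDiff_pderiv (hP j) i).differentiable (by simp) x).congr_of_eventuallyEq ?_
    filter_upwards [(T.isOpen_cell j).mem_nhds hj] with z hz using hP1 j i z hz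
  have m0 : MemLp (fun x => (v x : ℂ)) 2 Q.vol :=
    memLp_of_cell (hc0.aestronglyMeasurable Q.measurableSet_dom) fun j =>
      ⟨P j, (hP j).continuous, hvP j⟩
  have m1 : ∀ i, MemLp (fun x => ((pderiv i v x : ℝ) : ℂ)) 2 Q.vol := fun i =>
    memLp_of_cell ((hc1 i).aestronglyMeasurable Q.measurableSet_dom) fun j =>
      ⟨_, (contDiff_pderiv (hP j) i).continuous, hP1 j i⟩
  have m2 : ∀ i l, MemLp (fun x => ((pderiv l (pderiv i v) x : ℝ) : ℂ)) 2 Q.vol := fun i l =>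
    memLp_of_cell (measurable_fderiv_apply_const ℝ (pderiv i v) _).aestronglyMeasurable fun j =>
      ⟨_, (contDiff_pderiv (contDiff_pderiv (hP j) i) l).continuous, hP2 j i l⟩
  have hcof : ∀ {F : (Fin (n + 1) → ℝ) → ℝ}, ContinuousOn F Q.dom →
      ContinuousOn (fun x => (F x : ℂ)) Q.dom := fun h =>
    Complex.continuous_ofReal.comp_continuousOn h
  obtain ⟨t, ht⟩ := exists_isH1_of_weakPartial hr hQ m0 m1 fun i =>
    weakPartial_of_hasDerivAt (Z := T.grid) T.countable_grid (hcof hc0) m0 (m1 i) fun x hx _ =>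
      hasDerivAt_comp_update (hd0 x hx) i
  choose tg htg using fun i => exists_isH1_of_weakPartial hr hQ (m1 i) (m2 i) fun l =>
    weakPartial_of_hasDerivAt (Z := T.grid) T.countable_grid (hcof (hc1 i)) (m1 i) (m2 i l)
      fun x hx hx' => hasDerivAt_comp_update (hd1 i x hx hx') l
  exact ⟨t, tg, ht, htg⟩

end Mesh.IsPiecewiseSmooth

end Piecewise

end HelmholtzMS

namespace HelmholtzMS

/-! ### The preconditioner as a Gram matrix -/

section Gram

open Set Filter Topology
open scoped InnerProductSpace

variable {n : ℕ} {Q : Box n}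

lemma IsH2.conjugate {u t : (Fin (n + 1) → ℝ) → ℂ} {d tg : Fin (n + 1) → (Fin (n + 1) → ℝ) → ℂ}
    {dd : Fin (n + 1) → Fin (n + 1) → (Fin (n + 1) → ℝ) → ℂ} (h : IsH2 Q u d dd t tg) :
    IsH2 Q (fun x => conj (u x)) (fun i x => conj (d i x)) (fun i j x => conj (dd i j x))
      (fun x => conj (t x)) (fun i x => conj (tg i x)) :=
  ⟨h.isH1.conjugate, fun i => (h.isH1_deriv i).conjugate⟩

lemma normalPart_conj (tg : Fin (n + 1) → (Fin (n + 1) → ℝ) → ℂ) (x : Fin (n + 1) → ℝ) :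
    normalPart Q (fun i x => conj (tg i x)) x = conj (normalPart Q tg x) := by
  simp [normalPart]

/-- The components of the energy norm of a real function are real. -/
lemma conj_energyOp (k : ℝ) {u : (Fin (n + 1) → ℝ) → ℂ} (hu : u ∈ H2space Q)
    (hr : ∀ x, conj (u x) = u x) (a : EnergyIndex n) :
    ∀ᵐ x ∂energyMeasure Q a, conj (energyOp Q k a u x) = energyOp Q k a u x := by
  obtain ⟨d, dd, t, tg, h⟩ := hu
  -- For real u the conjugated data again belong to u, so uniqueness makes each component equal to
  -- its conjugate.
  have h' := h.conjugate
  simp only [hr] at h'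
  match a with
  | .inl (.inl i) =>
    filter_upwards [h.isH1.grad_ae_eq i, h'.isH1.grad_ae_eq i] with x h1 h2
    simp only [energyOp]
    rw [h1, ← h2, h1]
  | .inl (.inr 0) =>
    filter_upwards [h.lap_ae_eq, h'.lap_ae_eq] with x h1 h2
    simp only [energyOp, helm, map_add, map_mul, map_pow, Complex.conj_ofReal, hr]
    congr 1
    rw [h1, map_sum, ← h2, h1]
  | .inl (.inr 1) =>
    refine Eventually.of_forall fun x => ?_
    simp only [energyOp, map_mul, Complex.conj_ofReal, hr]
  | .inr (.inl i) =>
    filter_upwards [h.surfGrad_ae_eq i, h'.surfGrad_ae_eq i] with x h1 h2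
    have e : tanPart Q (fun i x => conj (tg i x)) i x = conj (tanPart Q tg i x) := by
      simp [tanPart, normalPart_conj]
    simp only [energyOp]
    rw [h1, ← e, ← h2, h1]
  | .inr (.inr 0) =>
    filter_upwards [h.normalDeriv_ae_eq, h'.normalDeriv_ae_eq] with x h1 h2
    simp only [energyOp]
    rw [h1, ← normalPart_conj, ← h2, h1]
  | .inr (.inr 1) =>
    filter_upwards [h.isH1.trace_ae_eq, h'.isH1.trace_ae_eq] with x h1 h2
    simp only [energyOp, map_mul, Complex.conj_ofReal]
    rw [h1, ← h2, h1]

lemma inner_energyMap_of_real (k : ℝ) (u v : H2space Q) (hv : ∀ x, conj (v.1 x) = v.1 x) :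
    ⟪energyMap Q k v, energyMap Q k u⟫_ℂ =
      ∑ a, ∫ x, energyOp Q k a v x * energyOp Q k a u x ∂energyMeasure Q a := by
  rw [inner_energyMap]
  refine Finset.sum_congr rfl fun a _ => integral_congr_ae ?_
  filter_upwards [conj_energyOp k v.2 hv a] with x hx
  rw [hx, mul_comm]

/-- The preconditioner is written without conjugates. Each energy component of a real basis function
is real almost everywhere, so inserting the conjugates of the inner product changes nothing. -/
lemma precond_eq_gram {N : ℕ} (k : ℝ) (φ : Fin N → H2space Q)
    (hφ : ∀ j x, conj ((φ j).1 x) = (φ j).1 x) :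
    precond Q k (fun j => (φ j : (Fin (n + 1) → ℝ) → ℂ)) =
      Matrix.of fun i j => ⟪energyMap Q k (φ i), energyMap Q k (φ j)⟫_ℂ := by
  ext l m
  have hreal : ∀ a, ∀ j, ∀ᵐ x ∂energyMeasure Q a,
      conj (energyOp Q k a (φ j) x) = energyOp Q k a (φ j) x :=
    fun a j => conj_energyOp k (φ j).2 (hφ j) a
  have hi : ∀ a, Integrable (fun x => energyOp Q k a (φ l) x * energyOp Q k a (φ m) x)
      (energyMeasure Q a) := fun a => by
    refine ((isL2Op_energyOp Q k a).integrable (isL2Op_energyOp Q k a) (φ l) (φ m)).congr ?_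
    filter_upwards [hreal a m] with x hx
    rw [hx]
  rw [Matrix.of_apply, inner_energyMap_of_real k _ _ (hφ l)]
  simp only [Fintype.sum_sum_type, Fin.sum_univ_two]
  simp only [precond, Matrix.add_apply, Matrix.smul_apply, stiffMat, massMat, helmMat,
    bdryMassMat, bdryStiffMat, bdryNormalMat, Matrix.of_apply]
  have g1 : ∀ i, Integrable (fun x => grad Q (φ l) i x * grad Q (φ m) i x) Q.vol :=
    fun i => hi (.inl (.inl i))
  have g2 : ∀ i, Integrable (fun x => surfGrad Q (φ l) i x * surfGrad Q (φ m) i x) Q.surf :=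
    fun i => hi (.inr (.inl i))
  rw [integral_finsetSum _ fun i _ => g1 i, integral_finsetSum _ fun i _ => g2 i]
  have hk : ∀ (μ : Measure (Fin (n + 1) → ℝ)) (y z : (Fin (n + 1) → ℝ) → ℂ),
      ∫ x, (k : ℂ) * y x * ((k : ℂ) * z x) ∂μ = (k : ℂ) ^ 2 • ∫ x, y x * z x ∂μ := fun μ y z => by
    rw [smul_eq_mul, ← integral_const_mul]
    exact integral_congr_ae (Eventually.of_forall fun x => by simp only; ring)
  simp only [energyOp, energyMeasure, Sum.elim_inl, Sum.elim_inr, hk]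
  ring

variable {T : Mesh Q} {p N : ℕ}

lemma Mesh.ofReal_mem_H2space {r : ℝ} (hr : 0 < r) (hQ : Q.StarShapedBall r)
    {v : (Fin (n + 1) → ℝ) → ℝ} (hv : T.IsPiecewiseSmooth v) :
    (fun x => (v x : ℂ)) ∈ H2space Q := by
  obtain ⟨t, tg, h⟩ := hv.exists_isH2 hr hQ
  exact ⟨_, _, _, _, h⟩

/-- The basis functions as elements of `H²(Ω)`. -/
noncomputable def basisH2 {r : ℝ} (hr : 0 < r) (hQ : Q.StarShapedBall r)
    (φ : Module.Basis (Fin N) ℝ (T.space p)) (j : Fin N) : H2space Q :=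
  ⟨basisFun φ j, Mesh.ofReal_mem_H2space hr hQ (.of_mem_space (φ j).2)⟩

lemma coe_synth_basisH2 {r : ℝ} (hr : 0 < r) (hQ : Q.StarShapedBall r)
    (φ : Module.Basis (Fin N) ℝ (T.space p)) (c : Fin N → ℂ) :
    (synth (basisH2 hr hQ φ) c : (Fin (n + 1) → ℝ) → ℂ) = feFun (basisFun φ) c := by
  funext x
  rw [synth_apply, feFun]
  simp [basisH2]

lemma energyMap_eq_zero {k : ℝ} (hk : k ≠ 0) {u : H2space Q} (h : energyMap Q k u = 0) :
    u.1 =ᵐ[Q.vol] 0 := by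
  have h1 : (isL2Op_energyOp Q k (.inl (.inr 1))).toLin u = 0 := by
    rw [← energyMap_apply, h]; rfl
  have h2 : (fun x => (k : ℂ) * u.1 x) =ᵐ[Q.vol] 0 :=
    (MemLp.toLp_eq_toLp_iff ((isL2Op_energyOp Q k (.inl (.inr 1))).memLp u u.2)
      MemLp.zero').1 (h1.trans (MemLp.toLp_zero _).symm)
  filter_upwards [h2] with x hx
  have hk' : (k : ℂ) ≠ 0 := by exact_mod_cast hk
  simpa [hk'] using hx

/-- Zero energy norm makes the function vanish almost everywhere in Ω, by continuity everywhere in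
Ω, and outside by the zero extension. The basis is independent over ℝ, so real and imaginary parts
of the coefficients are treated separately. -/
lemma eq_zero_of_energyMap_synth {r : ℝ} (hr : 0 < r) (hQ : Q.StarShapedBall r) {k : ℝ}
    (hk : k ≠ 0) (φ : Module.Basis (Fin N) ℝ (T.space p)) (c : Fin N → ℂ)
    (h : energyMap Q k (synth (basisH2 hr hQ φ) c) = 0) : c = 0 := by
  have h1 := energyMap_eq_zero hk h
  rw [coe_synth_basisH2] at h1
  have hcont : ContinuousOn (feFun (basisFun φ) c) Q.dom := by
    refine continuousOn_finsetSum _ fun j _ => continuousOn_const.mul ?_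
    exact Complex.continuous_ofReal.comp_continuousOn (φ j).2.2.1.continuousOn
  have h2 : EqOn (feFun (basisFun φ) c) 0 Q.dom :=
    Measure.eqOn_open_of_ae_eq h1 Q.isOpen_dom hcont continuousOn_const
  have h3 : ∀ x, ∑ j, c j * ((φ j : (Fin (n + 1) → ℝ) → ℝ) x : ℂ) = 0 := fun x => by
    by_cases hx : x ∈ Q.dom
    · exact h2 hx
    · refine Finset.sum_eq_zero fun j _ => ?_
      rw [(φ j).2.1 x hx]
      simp
  have key : ∀ a : Fin N → ℝ, (∀ x, ∑ j, a j * (φ j : (Fin (n + 1) → ℝ) → ℝ) x = 0) → a = 0 := by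
    intro a ha
    refine funext (Fintype.linearIndependent_iff.1 φ.linearIndependent a ?_)
    ext x
    simpa using ha x
  have hre := key (fun j => (c j).re) fun x => by simpa using congrArg Complex.re (h3 x)
  have him := key (fun j => (c j).im) fun x => by simpa using congrArg Complex.im (h3 x)
  exact funext fun j => Complex.ext (congrFun hre j) (congrFun him j)

end Gram

end HelmholtzMS

namespace HelmholtzMS

/-! ### Piecewise cubic Hermite interpolation in one variable -/

section HermiteCell

open Set Filter Topology

/-- Poincaré's inequality for functions vanishing at the left end point. -/
lemma integral_sq_le_of_left_zero {a b : ℝ} (hab : a ≤ b) {g g' : ℝ → ℝ} (hg : Continuous g)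
    (hg' : Continuous g') (hd : ∀ x ∈ Ioo a b, HasDerivAt g (g' x) x) (ha : g a = 0) :
    ∫ x in a..b, g x ^ 2 ≤ (b - a) ^ 2 * ∫ x in a..b, g' x ^ 2 := by
  have ii : ∀ {f : ℝ → ℝ} (c d : ℝ), Continuous f → IntervalIntegrable f volume c d :=
    fun c d hf => hf.intervalIntegrable c d
  have hS0 : 0 ≤ ∫ x in a..b, g' x ^ 2 :=
    intervalIntegral.integral_nonneg hab fun x _ => sq_nonneg _
  have key : ∀ x ∈ Icc a b, g x ^ 2 ≤ (b - a) * ∫ x in a..b, g' x ^ 2 := by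
    intro x hx
    have hI : ∫ y in a..x, g' y = g x := by
      rw [intervalIntegral.integral_eq_sub_of_hasDerivAt_of_le hx.1 hg.continuousOn
        (fun y hy => hd y ⟨hy.1, hy.2.trans_le hx.2⟩) (ii _ _ hg'), ha, sub_zero]
    have hS : ∫ y in a..x, g' y ^ 2 ≤ ∫ y in a..b, g' y ^ 2 := by
      rw [← intervalIntegral.integral_add_adjacent_intervals (f := fun y => g' y ^ 2)
        (ii a x (by fun_prop)) (ii x b (by fun_prop))]
      have : 0 ≤ ∫ y in x..b, g' y ^ 2 :=
        intervalIntegral.integral_nonneg hx.2 fun y _ => sq_nonneg _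
      linarith
    -- Cauchy–Schwarz for g(x) as the integral of g' from a to x, read off from the nonnegative
    -- integral of ((x − a)g' − g(x))².
    have hquad : 0 ≤ (x - a) * ((x - a) * ∫ y in a..x, g' y ^ 2) - (x - a) * g x ^ 2 := by
      have h0 : 0 ≤ ∫ y in a..x, ((x - a) * g' y - g x) ^ 2 :=
        intervalIntegral.integral_nonneg hx.1 fun y _ => sq_nonneg _
      have h1 : ∫ y in a..x, ((x - a) * g' y - g x) ^ 2 =
          (x - a) ^ 2 * (∫ y in a..x, g' y ^ 2) - 2 * (x - a) * g x * (∫ y in a..x, g' y) +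
            (x - a) * g x ^ 2 := by
        have h2 : ∀ y, ((x - a) * g' y - g x) ^ 2 =
            (x - a) ^ 2 * g' y ^ 2 - 2 * (x - a) * g x * g' y + g x ^ 2 := fun y => by ring
        simp only [h2]
        rw [intervalIntegral.integral_add (ii _ _ (by fun_prop)) (ii _ _ (by fun_prop)),
          intervalIntegral.integral_sub (ii _ _ (by fun_prop)) (ii _ _ (by fun_prop)),
          intervalIntegral.integral_const_mul, intervalIntegral.integral_const_mul,
          intervalIntegral.integral_const, smul_eq_mul]
      rw [h1, hI] at h0
      linarith
    rcases hx.1.eq_or_lt with rfl | hlt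
    · have : 0 ≤ (b - a) * ∫ x in a..b, g' x ^ 2 := mul_nonneg (by linarith) hS0
      simpa [ha] using this
    · have h3 : g x ^ 2 ≤ (x - a) * ∫ y in a..x, g' y ^ 2 := by
        have hpos : 0 < x - a := by linarith
        by_contra hc
        push Not at hc
        nlinarith
      calc g x ^ 2 ≤ (x - a) * ∫ y in a..x, g' y ^ 2 := h3
        _ ≤ (b - a) * ∫ y in a..b, g' y ^ 2 := by
          refine mul_le_mul (by linarith [hx.2]) hS ?_ (by linarith)
          exact intervalIntegral.integral_nonneg hx.1 fun y _ => sq_nonneg _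
  calc ∫ x in a..b, g x ^ 2 ≤ ∫ _ in a..b, (b - a) * ∫ x in a..b, g' x ^ 2 :=
        intervalIntegral.integral_mono_on hab (ii _ _ (hg.pow 2)) (ii _ _ continuous_const) key
    _ = _ := by rw [intervalIntegral.integral_const, smul_eq_mul]; ring

variable {a b h : ℝ} {D : ℕ → ℝ → ℝ}

lemma continuous_of_derivs (hD : ∀ r x, HasDerivAt (D r) (D (r + 1) x) x) (r : ℕ) :
    Continuous (D r) :=
  continuous_iff_continuousAt.2 fun x => (hD r x).continuousAt

/-- The distance of a function to the affine functions. -/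
lemma exists_affine_approx (hab : a ≤ b) (hh : b - a ≤ h)
    (hD : ∀ r x, HasDerivAt (D r) (D (r + 1) x) x) (r s : ℕ) (hs : s ≤ 2) :
    ∃ c₀ c₁ : ℝ, ∫ x in a..b, (D r x - (c₀ + c₁ * x)) ^ 2 ≤
      h ^ (2 * s) * ∫ x in a..b, D (r + s) x ^ 2 := by
  have hc := continuous_of_derivs hD
  have hba : 0 ≤ b - a := by linarith
  have hS0 : ∀ r, 0 ≤ ∫ x in a..b, D r x ^ 2 := fun r =>
    intervalIntegral.integral_nonneg hab fun x _ => sq_nonneg _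
  have hsq : (b - a) ^ 2 ≤ h ^ 2 := by gcongr
  -- The approximant is the Taylor polynomial of degree s − 1 at a (zero for s = 0); each order of
  -- the remainder costs one Poincaré inequality.
  interval_cases s
  · exact ⟨0, 0, by simp⟩
  · refine ⟨D r a, 0, ?_⟩
    have := integral_sq_le_of_left_zero hab (g := fun x => D r x - D r a) (g' := D (r + 1))
      (by have := hc r; fun_prop) (hc _) (fun x _ => (hD r x).sub_const _) (by simp)
    simp only [zero_mul, add_zero, mul_one]
    exact this.trans (mul_le_mul_of_nonneg_right hsq (hS0 _))
  · refine ⟨D r a - D (r + 1) a * a, D (r + 1) a, ?_⟩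
    have h1 := integral_sq_le_of_left_zero hab
      (g := fun x => D r x - (D r a - D (r + 1) a * a + D (r + 1) a * x))
      (g' := fun x => D (r + 1) x - D (r + 1) a)
      (by have := hc r; fun_prop) (by have := hc (r + 1); fun_prop) (fun x _ => by
        have := (hD r x).sub (((hasDerivAt_id x).const_mul (D (r + 1) a)).const_add
          (D r a - D (r + 1) a * a))
        exact this.congr_deriv (by simp)) (by simp)
    have h2 := integral_sq_le_of_left_zero hab (g := fun x => D (r + 1) x - D (r + 1) a)
      (g' := D (r + 2)) (by have := hc (r + 1); fun_prop) (hc _)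
      (fun x _ => (hD (r + 1) x).sub_const _) (by simp)
    calc _ ≤ (b - a) ^ 2 * ∫ x in a..b, (D (r + 1) x - D (r + 1) a) ^ 2 := h1
      _ ≤ (b - a) ^ 2 * ((b - a) ^ 2 * ∫ x in a..b, D (r + 2) x ^ 2) := by gcongr
      _ ≤ h ^ 2 * (h ^ 2 * ∫ x in a..b, D (r + 2) x ^ 2) := by
        have := hS0 (r + 2)
        gcongr
      _ = _ := by ring

/-- The interpolation error on one interval: `G` is the error and its derivatives. -/
theorem integral_sq_hermite_error_le (hab : a ≤ b) (hh : b - a ≤ h)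
    (hD : ∀ r x, HasDerivAt (D r) (D (r + 1) x) x) {G : ℕ → ℝ → ℝ} (h0 : Continuous (G 0))
    (h1 : Continuous (G 1)) (h2 : Continuous (G 2)) (d0 : ∀ x ∈ Ioo a b, HasDerivAt (G 0) (G 1 x) x)
    (d1 : ∀ x ∈ Ioo a b, HasDerivAt (G 1) (G 2 x) x) {c₀ c₁ : ℝ}
    (hG : ∀ x, G 2 x = D 2 x - (c₀ + c₁ * x)) (ha0 : G 0 a = 0) (hb0 : G 0 b = 0)
    (ha1 : G 1 a = 0) (hb1 : G 1 b = 0) {r s : ℕ} (hr : r ≤ 2) (hs2 : 2 ≤ s) (hs4 : s ≤ 4) :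
    ∫ x in a..b, G r x ^ 2 ≤ h ^ (2 * (s - r)) * ∫ x in a..b, D s x ^ 2 := by
  have ii : ∀ {f : ℝ → ℝ}, Continuous f → IntervalIntegrable f volume a b :=
    fun hf => hf.intervalIntegrable a b
  have hba : 0 ≤ b - a := by linarith
  have hh0 : 0 ≤ h := hba.trans hh
  have hc := continuous_of_derivs hD
  -- Two integrations by parts: the error and its slope vanish at both end points, so the second
  -- derivative of the error is orthogonal to affine functions. Thus the second derivative of the
  -- interpolant is the L² projection of D 2 onto them.
  have horth : ∀ e₀ e₁ : ℝ, ∫ x in a..b, G 2 x * (e₀ + e₁ * x) = 0 := by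
    intro e₀ e₁
    rw [intervalIntegral.integral_eq_sub_of_hasDerivAt_of_le
      (f := fun x => G 1 x * (e₀ + e₁ * x) - e₁ * G 0 x) hab (by fun_prop) (fun x hx => ?_)
      (ii (by fun_prop))]
    · simp [ha0, hb0, ha1, hb1]
    · have := ((d1 x hx).mul (((hasDerivAt_id x).const_mul e₁).const_add e₀)).sub
        ((d0 x hx).const_mul e₁)
      refine this.congr_deriv ?_
      simp
      ring
  have key2 : ∫ x in a..b, G 2 x ^ 2 ≤ h ^ (2 * (s - 2)) * ∫ x in a..b, D s x ^ 2 := by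
    obtain ⟨e₀, e₁, he⟩ := exists_affine_approx hab hh hD 2 (s - 2) (by omega)
    rw [show 2 + (s - 2) = s by omega] at he
    refine le_trans ?_ he
    have hD2 := hc 2
    have e1 : ∫ x in a..b, G 2 x ^ 2 = ∫ x in a..b, G 2 x * (D 2 x - (e₀ + e₁ * x)) := by
      have := horth (c₀ - e₀) (c₁ - e₁)
      rw [← sub_eq_zero, ← intervalIntegral.integral_sub (ii (by fun_prop)) (ii (by fun_prop)),
        ← neg_eq_zero, ← intervalIntegral.integral_neg, ← this]
      refine intervalIntegral.integral_congr fun x _ => ?_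
      have := hG x
      change -(G 2 x ^ 2 - G 2 x * (D 2 x - (e₀ + e₁ * x))) =
        G 2 x * (c₀ - e₀ + (c₁ - e₁) * x)
      linear_combination (-G 2 x) * this
    -- Young's inequality with weights ½; half of the squared norm of G 2 is absorbed on the left,
    -- giving constant one.
    have e2 : ∫ x in a..b, G 2 x * (D 2 x - (e₀ + e₁ * x)) ≤
        ∫ x in a..b, (G 2 x ^ 2 / 2 + (D 2 x - (e₀ + e₁ * x)) ^ 2 / 2) :=
      intervalIntegral.integral_mono_on hab (ii (by fun_prop)) (ii (by fun_prop)) fun x _ => by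
        nlinarith [sq_nonneg (G 2 x - (D 2 x - (e₀ + e₁ * x)))]
    rw [intervalIntegral.integral_add (ii (by fun_prop)) (ii (by fun_prop)),
      intervalIntegral.integral_div, intervalIntegral.integral_div] at e2
    linarith
  have hS0 : ∀ {f : ℝ → ℝ}, 0 ≤ ∫ x in a..b, f x ^ 2 := fun {f} =>
    intervalIntegral.integral_nonneg hab fun x _ => sq_nonneg _
  have hsq : (b - a) ^ 2 ≤ h ^ 2 := by gcongr
  have key1 : ∫ x in a..b, G 1 x ^ 2 ≤ h ^ 2 * ∫ x in a..b, G 2 x ^ 2 :=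
    (integral_sq_le_of_left_zero hab h1 h2 d1 ha1).trans (mul_le_mul_of_nonneg_right hsq hS0)
  have key0 : ∫ x in a..b, G 0 x ^ 2 ≤ h ^ 2 * ∫ x in a..b, G 1 x ^ 2 :=
    (integral_sq_le_of_left_zero hab h0 h1 d0 ha0).trans (mul_le_mul_of_nonneg_right hsq hS0)
  interval_cases r
  · calc _ ≤ h ^ 2 * (h ^ 2 * (h ^ (2 * (s - 2)) * ∫ x in a..b, D s x ^ 2)) := by
          refine key0.trans ?_; gcongr; refine key1.trans ?_; gcongr
      _ = _ := by rw [← mul_assoc, ← mul_assoc, ← pow_add, ← pow_add]; congr 2; omega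
  · calc _ ≤ h ^ 2 * (h ^ (2 * (s - 2)) * ∫ x in a..b, D s x ^ 2) := by
          refine key1.trans ?_; gcongr
      _ = _ := by rw [← mul_assoc, ← pow_add]; congr 2; omega
  · exact key2

/-- Truncated powers of degree at least two are C¹ across their knot, so adding them corrects a
spline to the right of a node and leaves it unchanged to the left. -/
lemma hasDerivAt_max_sq (x : ℝ) : HasDerivAt (fun x : ℝ => max x 0 ^ 2) (2 * max x 0) x := by
  rcases lt_trichotomy x 0 with hx | rfl | hx
  · rw [max_eq_right hx.le, mul_zero]
    refine (hasDerivAt_const x (0 : ℝ)).congr_of_eventuallyEq ?_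
    filter_upwards [gt_mem_nhds hx] with y hy
    simp [max_eq_right hy.le]
  · rw [max_self, mul_zero, hasDerivAt_iff_isLittleO_nhds_zero]
    have h1 : (fun h : ℝ => max (0 + h) 0 ^ 2 - max (0 : ℝ) 0 ^ 2 - h • (0 : ℝ)) =O[𝓝 0]
        fun h : ℝ => h ^ 2 := by
      refine Asymptotics.isBigO_of_le _ fun h => ?_
      simp only [zero_add, max_self, smul_zero, sub_zero, norm_pow, Real.norm_eq_abs,
        ne_eq, OfNat.ofNat_ne_zero, not_false_eq_true, zero_pow]
      rcases le_total h 0 with hh | hh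
      · simp [max_eq_right hh, sq_nonneg]
      · simp [max_eq_left hh]
    refine h1.trans_isLittleO ?_
    simpa using (Asymptotics.isLittleO_pow_pow (𝕜 := ℝ) (m := 1) (n := 2) one_lt_two)
  · rw [max_eq_left hx.le]
    have : HasDerivAt (fun x : ℝ => x ^ 2) (2 * x) x := by simpa using hasDerivAt_pow 2 x
    refine this.congr_of_eventuallyEq ?_
    filter_upwards [lt_mem_nhds hx] with y hy
    simp [max_eq_left hy.le]

lemma hasDerivAt_max_cube (x : ℝ) : HasDerivAt (fun x : ℝ => max x 0 ^ 3) (3 * max x 0 ^ 2) x := by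
  have hm : ∀ x : ℝ, max x 0 * x = max x 0 ^ 2 := fun x => by
    rcases le_total x 0 with h | h
    · simp [max_eq_right h]
    · simp [max_eq_left h, sq]
  have := (hasDerivAt_max_sq x).mul (hasDerivAt_id x)
  refine (this.congr_deriv ?_).congr_of_eventuallyEq (Eventually.of_forall fun y => ?_)
  · simp only [id]; linear_combination 2 * hm x
  · simp only [Pi.mul_apply, id]; linear_combination (- max y 0) * hm y

end HermiteCell

/-! ### Nodal basis of C¹ piecewise cubics -/

section HermiteBasis

open Set Filter Topology

variable {M : ℕ} {t : Fin (M + 1) → ℝ}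

/-- A `C¹` piecewise cubic function with prescribed values and slopes at the nodes. -/
theorem exists_cubic_spline (ht : StrictMono t) (a b : Fin (M + 1) → ℝ) :
    ∃ s : ℝ → ℝ, ContDiff ℝ 1 s ∧ (∀ m, s (t m) = a m ∧ deriv s (t m) = b m) ∧
      ∀ j : Fin M, ∃ q : Polynomial ℝ, q.natDegree ≤ 3 ∧
        ∀ x ∈ Icc (t j.castSucc) (t j.succ), s x = q.eval x := by
  -- Induct on the last node at which the data are attained; beyond that node the spline is only
  -- required to be C¹ and piecewise cubic.
  suffices h : ∀ l : Fin (M + 1), ∃ s s' : ℝ → ℝ, (∀ x, HasDerivAt s (s' x) x) ∧ Continuous s' ∧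
      (∀ m ≤ l, s (t m) = a m ∧ s' (t m) = b m) ∧
      ∀ j : Fin M, ∃ q : Polynomial ℝ, q.natDegree ≤ 3 ∧
        ∀ x ∈ Icc (t j.castSucc) (t j.succ), s x = q.eval x by
    obtain ⟨s, s', h1, h2, h3, h4⟩ := h (Fin.last M)
    have hd : deriv s = s' := funext fun x => (h1 x).deriv
    refine ⟨s, contDiff_one_iff_deriv.2 ⟨fun x => (h1 x).differentiableAt, hd ▸ h2⟩,
      fun m => ?_, h4⟩
    rw [hd]
    exact h3 m (Fin.le_last m)
  intro l
  induction l using Fin.induction with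
  | zero =>
    refine ⟨fun x => a 0 + b 0 * (x - t 0), fun _ => b 0, fun x => ?_, continuous_const,
      fun m hm => ?_, fun j => ⟨Polynomial.C (a 0) + Polynomial.C (b 0) *
        (Polynomial.X - Polynomial.C (t 0)), ?_, fun x _ => by simp⟩⟩
    · simpa using (((hasDerivAt_id x).sub_const (t 0)).const_mul (b 0)).const_add (a 0)
    · obtain rfl : m = 0 := Fin.le_zero_iff.1 hm
      simp
    · compute_degree
      norm_num
  | succ l ih =>
    obtain ⟨s, s', h1, h2, h3, h4⟩ := ih
    set τ := t l.castSucc with hτ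
    set ℓ := t l.succ - τ with hℓ
    have hℓ0 : 0 < ℓ := sub_pos.2 (ht (Fin.castSucc_lt_succ))
    set A := a l.succ - s (t l.succ)
    set B := b l.succ - s' (t l.succ)
    -- The coefficients solve c₂ℓ² + c₃ℓ³ = A and 2c₂ℓ + 3c₃ℓ² = B, where A and B are the defects of
    -- value and slope at the next node.
    set c₃ := (B * ℓ - 2 * A) / ℓ ^ 3 with hc₃
    set c₂ := (3 * A - B * ℓ) / ℓ ^ 2 with hc₂
    have hdp : ∀ x, HasDerivAt (fun x => x - τ) 1 x := fun x => (hasDerivAt_id x).sub_const τ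
    refine ⟨fun x => s x + (c₂ * max (x - τ) 0 ^ 2 + c₃ * max (x - τ) 0 ^ 3),
      fun x => s' x + (c₂ * (2 * max (x - τ) 0) + c₃ * (3 * max (x - τ) 0 ^ 2)), fun x => ?_,
      by fun_prop, fun m hm => ?_, fun j => ?_⟩
    · refine (h1 x).add (HasDerivAt.add (HasDerivAt.const_mul _ ?_) (HasDerivAt.const_mul _ ?_))
      · exact ((hasDerivAt_max_sq (x - τ)).comp x (hdp x)).congr_deriv (mul_one _)
      · exact ((hasDerivAt_max_cube (x - τ)).comp x (hdp x)).congr_deriv (mul_one _)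
    · rcases hm.eq_or_lt with rfl | hlt
      · simp only [show t l.succ - τ = ℓ from rfl, max_eq_left hℓ0.le]
        constructor
        · have : c₂ * ℓ ^ 2 + c₃ * ℓ ^ 3 = A := by
            rw [hc₂, hc₃]; field_simp; ring
          rw [this]; simp [A]
        · have : c₂ * (2 * ℓ) + c₃ * (3 * ℓ ^ 2) = B := by
            rw [hc₂, hc₃]; field_simp; ring
          rw [this]; simp [B]
      · have hm' : m ≤ l.castSucc := Fin.le_castSucc_iff.2 hlt
        have : t m - τ ≤ 0 := sub_nonpos.2 (ht.monotone hm')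
        simp only [max_eq_right this]
        simpa using h3 m hm'
    · obtain ⟨q, hq, hsq⟩ := h4 j
      rcases lt_or_ge j l with hjl | hjl
      · refine ⟨q, hq, fun x hx => ?_⟩
        have : x - τ ≤ 0 := sub_nonpos.2 (hx.2.trans (ht.monotone (by
          rw [Fin.le_def]; simpa using hjl)))
        simp only [max_eq_right this, hsq x hx]
        simp
      · refine ⟨q + (Polynomial.C c₂ * (Polynomial.X - Polynomial.C τ) ^ 2 +
          Polynomial.C c₃ * (Polynomial.X - Polynomial.C τ) ^ 3), ?_, fun x hx => ?_⟩
        · refine (Polynomial.natDegree_add_le _ _).trans (max_le hq ?_)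
          compute_degree
        · have : 0 ≤ x - τ := sub_nonneg.2 ((ht.monotone (by
            rw [Fin.le_def]; simpa using hjl)).trans hx.1)
          simp only [max_eq_left this, hsq x hx]
          simp

/-- `s (m, 0)` and `s (m, 1)` are the `C¹` piecewise cubic nodal functions for the value and the
slope at the node `t m`. -/
structure IsHermiteBasis (t : Fin (M + 1) → ℝ) (s : Fin (M + 1) × Fin 2 → ℝ → ℝ) : Prop where
  contDiff : ∀ κ, ContDiff ℝ 1 (s κ)
  value : ∀ κ m, s κ (t m) = if κ = (m, 0) then 1 else 0
  slope : ∀ κ m, deriv (s κ) (t m) = if κ = (m, 1) then 1 else 0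
  cubic : ∀ κ (j : Fin M), ∃ q : Polynomial ℝ, q.natDegree ≤ 3 ∧
    ∀ x ∈ Icc (t j.castSucc) (t j.succ), s κ x = q.eval x

lemma exists_hermiteBasis (ht : StrictMono t) : ∃ s, IsHermiteBasis t s := by
  choose s h1 h2 h3 using fun κ : Fin (M + 1) × Fin 2 => exists_cubic_spline ht
    (fun m => if κ = (m, 0) then 1 else 0) (fun m => if κ = (m, 1) then 1 else 0)
  exact ⟨s, h1, fun κ m => (h2 κ m).1, fun κ m => (h2 κ m).2, h3⟩

end HermiteBasis

end HelmholtzMS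

namespace HelmholtzMS

/-! ### Hermite interpolation on a mesh in one direction -/

section HermiteMesh

open Set Filter Topology
open scoped ENNReal

lemma lintegral_Ioo_ofReal_sq {a b : ℝ} (hab : a ≤ b) {f : ℝ → ℝ} (hf : Continuous f) :
    ∫⁻ x in Ioo a b, ENNReal.ofReal (f x ^ 2) = ENNReal.ofReal (∫ x in a..b, f x ^ 2) := by
  rw [intervalIntegral.integral_of_le hab, integral_Ioc_eq_integral_Ioo,
    ofReal_integral_eq_lintegral_ofReal]
  · exact (((hf.pow 2).integrableOn_Icc (a := a) (b := b)).mono_set Ioo_subset_Icc_self)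
  · exact Eventually.of_forall fun x => sq_nonneg _

lemma iterate_deriv_eqOn {U : Set ℝ} (hU : IsOpen U) {f g : ℝ → ℝ} (h : EqOn f g U) (r : ℕ) :
    EqOn (deriv^[r] f) (deriv^[r] g) U := by
  induction r with
  | zero => exact h
  | succ r ih =>
    rw [Function.iterate_succ_apply', Function.iterate_succ_apply']
    exact ih.deriv hU

lemma iterate_deriv_eval (q : Polynomial ℝ) (r : ℕ) :
    deriv^[r] (fun x => q.eval x) = fun x => (Polynomial.derivative^[r] q).eval x := by
  induction r with
  | zero => rfl
  | succ r ih =>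
    rw [Function.iterate_succ_apply', Function.iterate_succ_apply', ih]
    funext x
    exact Polynomial.deriv _

lemma measurable_iterate_deriv {f : ℝ → ℝ} (hf : Measurable f) (r : ℕ) :
    Measurable (deriv^[r] f) := by
  cases r with
  | zero => exact hf
  | succ r => rw [Function.iterate_succ_apply']; exact measurable_deriv _

variable {M : ℕ} {t : Fin (M + 1) → ℝ} {s : Fin (M + 1) × Fin 2 → ℝ → ℝ}

namespace IsHermiteBasis

lemma measurable_iterate (hs : IsHermiteBasis t s) (κ) (r : ℕ) : Measurable (deriv^[r] (s κ)) :=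
  measurable_iterate_deriv (hs.contDiff κ).continuous.measurable r

lemma exists_eqOn_cell (hs : IsHermiteBasis t s) (κ) (j : Fin M) :
    ∃ q : Polynomial ℝ, q.natDegree ≤ 3 ∧ ∀ r, EqOn (deriv^[r] (s κ))
      (fun x => (Polynomial.derivative^[r] q).eval x) (Ioo (t j.castSucc) (t j.succ)) := by
  obtain ⟨q, hq, h⟩ := hs.cubic κ j
  refine ⟨q, hq, fun r => ?_⟩
  rw [← iterate_deriv_eval]
  exact iterate_deriv_eqOn isOpen_Ioo (fun x hx => h x (Ioo_subset_Icc_self hx)) r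

variable {D : ℕ → ℝ → ℝ} {h : ℝ} {r q : ℕ}

/-- On one element the interpolant is a cubic, so its second derivative is affine and the
one-interval estimate applies. Lower integrals avoid integrability questions for discontinuous
derivatives in the later summation and slicing. -/
lemma lintegral_cell_error_le (ht : StrictMono t) (hs : IsHermiteBasis t s)
    (hD : ∀ r x, HasDerivAt (D r) (D (r + 1) x) x) (j : Fin M)
    (hh : t j.succ - t j.castSucc ≤ h) (hr : r ≤ 2) (hq2 : 2 ≤ q) (hq4 : q ≤ 4) :
    ∫⁻ x in Ioo (t j.castSucc) (t j.succ), ENNReal.ofReal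
        ((D r x - ∑ κ, D κ.2 (t κ.1) * deriv^[r] (s κ) x) ^ 2) ≤
      ENNReal.ofReal (h ^ (2 * (q - r))) *
        ∫⁻ x in Ioo (t j.castSucc) (t j.succ), ENNReal.ofReal (D q x ^ 2) := by
  have hlt : t j.castSucc < t j.succ := ht Fin.castSucc_lt_succ
  have hc := continuous_of_derivs hD
  choose P hP hPs using fun κ => hs.exists_eqOn_cell κ j
  -- the second derivative of the interpolant is affine on the interval
  obtain ⟨c₁, c₀, hcc⟩ := Polynomial.exists_eq_X_add_C_of_natDegree_le_one
    (p := ∑ κ : Fin (M + 1) × Fin 2, Polynomial.C (D κ.2 (t κ.1)) * Polynomial.derivative^[2] (P κ))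
    (Polynomial.natDegree_sum_le_of_forall_le _ _ fun κ _ =>
      (Polynomial.natDegree_C_mul_le _ _).trans
        ((Polynomial.natDegree_iterate_derivative _ _).trans (by have := hP κ; omega)))
  have haff : ∀ x ∈ Ioo (t j.castSucc) (t j.succ),
      ∑ κ, D κ.2 (t κ.1) * deriv^[2] (s κ) x = c₀ + c₁ * x := fun x hx => by
    have := congrArg (Polynomial.eval x) hcc
    simp only [Polynomial.eval_finsetSum, Polynomial.eval_mul, Polynomial.eval_C,
      Polynomial.eval_add, Polynomial.eval_X] at this
    rw [add_comm c₀, ← this]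
    exact Finset.sum_congr rfl fun κ _ => by rw [hPs κ 2 hx]
  -- The second derivative of a C¹ spline may jump at the nodes. It is replaced by its affine
  -- continuation from this element, which keeps G 2 continuous and agrees with it inside.
  let G : ℕ → ℝ → ℝ := fun r x => if r ≤ 1 then
    D r x - ∑ κ, D κ.2 (t κ.1) * deriv^[r] (s κ) x else D 2 x - (c₀ + c₁ * x)
  have hG0 : G 0 = fun x => D 0 x - ∑ κ, D κ.2 (t κ.1) * s κ x := rfl
  have hG1 : G 1 = fun x => D 1 x - ∑ κ, D κ.2 (t κ.1) * deriv (s κ) x := rfl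
  have hG2 : G 2 = fun x => D 2 x - (c₀ + c₁ * x) := rfl
  have hGr : ∀ x ∈ Ioo (t j.castSucc) (t j.succ),
      D r x - ∑ κ, D κ.2 (t κ.1) * deriv^[r] (s κ) x = G r x := fun x hx => by
    interval_cases r
    · rfl
    · rfl
    · rw [hG2, haff x hx]
  have hsc : ∀ κ, Continuous (s κ) := fun κ => (hs.contDiff κ).continuous
  have hsd : ∀ κ, Continuous (deriv (s κ)) := fun κ => (hs.contDiff κ).continuous_deriv le_rfl
  have c0 : Continuous (G 0) := by rw [hG0]; have := hc 0; fun_prop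
  have c1 : Continuous (G 1) := by rw [hG1]; have := hc 1; fun_prop
  have c2 : Continuous (G 2) := by rw [hG2]; have := hc 2; fun_prop
  have d0 : ∀ x ∈ Ioo (t j.castSucc) (t j.succ), HasDerivAt (G 0) (G 1 x) x := fun x _ => by
    rw [hG0, hG1]
    exact (hD 0 x).sub (HasDerivAt.fun_sum fun κ _ =>
      ((((hs.contDiff κ).differentiable one_ne_zero) x).hasDerivAt).const_mul _)
  have d1 : ∀ x ∈ Ioo (t j.castSucc) (t j.succ), HasDerivAt (G 1) (G 2 x) x := fun x hx => by
    rw [hG1, hG2]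
    simp only [← haff x hx]
    refine (hD 1 x).sub (HasDerivAt.fun_sum fun κ _ => HasDerivAt.const_mul _ ?_)
    have hd : DifferentiableAt ℝ (deriv (s κ)) x := by
      refine ((Polynomial.derivative^[1] (P κ)).differentiable x).congr_of_eventuallyEq ?_
      filter_upwards [isOpen_Ioo.mem_nhds hx] with y hy using hPs κ 1 hy
    exact hd.hasDerivAt
  have hnode0 : ∀ m, G 0 (t m) = 0 := fun m => by
    simp only [hG0, hs.value]
    rw [Finset.sum_eq_single (m, 0)] <;> simp +contextual
  have hnode1 : ∀ m, G 1 (t m) = 0 := fun m => by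
    simp only [hG1, hs.slope]
    rw [Finset.sum_eq_single (m, 1)] <;> simp +contextual
  have key := integral_sq_hermite_error_le hlt.le hh hD c0 c1 c2 d0 d1 (fun x => rfl)
    (hnode0 _) (hnode0 _) (hnode1 _) (hnode1 _) hr hq2 hq4
  have cr : Continuous (G r) := by interval_cases r <;> assumption
  have hh0 : 0 ≤ h := by linarith
  rw [setLIntegral_congr_fun measurableSet_Ioo fun x hx => by rw [hGr x hx],
    lintegral_Ioo_ofReal_sq hlt.le cr, lintegral_Ioo_ofReal_sq hlt.le (hc q),
    ← ENNReal.ofReal_mul (by positivity)]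
  exact ENNReal.ofReal_le_ofReal key

/-- The open elements are disjoint and cover the interval up to the finitely many nodes, so the
element estimates add up. -/
theorem lintegral_error_le (ht : StrictMono t) (hs : IsHermiteBasis t s)
    (hD : ∀ r x, HasDerivAt (D r) (D (r + 1) x) x) (hh : ∀ j : Fin M, t j.succ - t j.castSucc ≤ h)
    (hr : r ≤ 2) (hq2 : 2 ≤ q) (hq4 : q ≤ 4) :
    ∫⁻ x in Ioo (t 0) (t (Fin.last M)), ENNReal.ofReal
        ((D r x - ∑ κ, D κ.2 (t κ.1) * deriv^[r] (s κ) x) ^ 2) ≤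
      ENNReal.ofReal (h ^ (2 * (q - r))) *
        ∫⁻ x in Ioo (t 0) (t (Fin.last M)), ENNReal.ofReal (D q x ^ 2) := by
  have hdisj : Pairwise (Function.onFun Disjoint fun j : Fin M =>
      Ioo (t j.castSucc) (t j.succ)) := by
    refine (pairwise_disjoint_on _).2 fun i j hij => ?_
    refine Set.disjoint_left.2 fun x hx hx' => ?_
    have : t i.succ ≤ t j.castSucc := ht.monotone (by rw [Fin.le_def]; simpa using hij)
    exact absurd (hx.2.trans_le this) (not_lt.2 hx'.1.le)
  have hsub : (⋃ j : Fin M, Ioo (t j.castSucc) (t j.succ)) ⊆ Ioo (t 0) (t (Fin.last M)) :=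
    iUnion_subset fun j x hx => ⟨(ht.monotone (Fin.zero_le _)).trans_lt hx.1,
      hx.2.trans_le (ht.monotone (Fin.le_last _))⟩
  have hae : (⋃ j : Fin M, Ioo (t j.castSucc) (t j.succ)) =ᵐ[volume]
      Ioo (t 0) (t (Fin.last M)) := by
    have hn : ∀ᵐ x : ℝ, x ∉ range t := (countable_range t).ae_notMem volume
    filter_upwards [hn] with x hx
    refine propext ⟨fun h => hsub h, fun h => ?_⟩
    exact mem_iUnion.2 (exists_mem_Ioo_of_notMem h hx)
  rw [← setLIntegral_congr hae, ← setLIntegral_congr hae,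
    lintegral_iUnion (fun _ => measurableSet_Ioo) hdisj,
    lintegral_iUnion (fun _ => measurableSet_Ioo) hdisj, ← ENNReal.tsum_mul_left]
  exact ENNReal.tsum_le_tsum fun j => lintegral_cell_error_le ht hs hD j (hh j) hr hq2 hq4

end IsHermiteBasis

variable {n : ℕ} {Q : Box n}

/-- Integration over the box, first in direction `i`. -/
lemma Box.lintegral_vol_eq (i : Fin (n + 1)) {F : (Fin (n + 1) → ℝ) → ℝ≥0∞} (hF : Measurable F) :
    ∫⁻ x, F x ∂Q.vol = ∫⁻ y in univ.pi fun j => Ioo (Q.lo (i.succAbove j)) (Q.hi (i.succAbove j)),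
      ∫⁻ s in Ioo (Q.lo i) (Q.hi i), F (i.insertNth s y) := by
  have hmp := (volume_preserving_piFinSuccAbove (fun _ : Fin (n + 1) => ℝ) i).symm
  set B := univ.pi fun j => Ioo (Q.lo (i.succAbove j)) (Q.hi (i.succAbove j)) with hB
  have hpre : (MeasurableEquiv.piFinSuccAbove (fun _ : Fin (n + 1) => ℝ) i).symm ⁻¹' Q.dom =
      Ioo (Q.lo i) (Q.hi i) ×ˢ B := by
    ext ⟨s, y⟩
    simp only [mem_preimage, Box.dom, mem_univ_pi, mem_prod, hB]
    change (∀ j, (i.insertNth s y : Fin (n + 1) → ℝ) j ∈ _) ↔ _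
    rw [Fin.forall_iff_succAbove i]
    simp
  rw [Box.vol, ← hmp.setLIntegral_comp_preimage Q.measurableSet_dom hF, hpre]
  have hm : Measurable fun z : ℝ × (Fin n → ℝ) => F (i.insertNth z.1 z.2) :=
    hF.comp (MeasurableEquiv.piFinSuccAbove (fun _ : Fin (n + 1) => ℝ) i).symm.measurable
  rw [Measure.volume_eq_prod, ← Measure.prod_restrict]
  exact lintegral_prod_symm _ hm.aemeasurable

/-- The interpolation error in direction `i`; `G r` is the `r`-th derivative of the function in
this direction. -/
noncomputable def dirError {M : ℕ} (i : Fin (n + 1)) (t : Fin (M + 1) → ℝ)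
    (s : Fin (M + 1) × Fin 2 → ℝ → ℝ) (r : ℕ) (G : ℕ → (Fin (n + 1) → ℝ) → ℝ)
    (x : Fin (n + 1) → ℝ) : ℝ :=
  G r x - ∑ κ, G κ.2 (Function.update x i (t κ.1)) * deriv^[r] (s κ) (x i)

lemma measurable_dirError (hs : IsHermiteBasis t s) (i : Fin (n + 1)) (r : ℕ)
    {G : ℕ → (Fin (n + 1) → ℝ) → ℝ} (hG : ∀ r, Measurable (G r)) :
    Measurable (dirError i t s r G) := by
  refine (hG r).sub (Finset.measurable_sum _ fun κ _ => Measurable.mul ?_ ?_)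
  · exact (hG _).comp measurable_update_left
  · exact (hs.measurable_iterate κ r).comp (measurable_pi_apply i)

/-- The one-dimensional estimate is applied on every line parallel to eᵢ and integrated over the
remaining variables. The function G r need not be continuous in those variables, so an interpolation
error in another direction is an admissible argument. -/
theorem lintegral_dirError_le (ht : StrictMono t) (hs : IsHermiteBasis t s) (i : Fin (n + 1))
    (h0 : t 0 = Q.lo i) (h1 : t (Fin.last M) = Q.hi i) {h : ℝ}
    (hh : ∀ j : Fin M, t j.succ - t j.castSucc ≤ h)
    {G : ℕ → (Fin (n + 1) → ℝ) → ℝ} (hGm : ∀ r, Measurable (G r))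
    (hG : ∀ r x, HasDerivAt (fun σ => G r (Function.update x i σ)) (G (r + 1) x) (x i))
    {r q : ℕ} (hr : r ≤ 2) (hq2 : 2 ≤ q) (hq4 : q ≤ 4) :
    ∫⁻ x, ENNReal.ofReal (dirError i t s r G x ^ 2) ∂Q.vol ≤
      ENNReal.ofReal (h ^ (2 * (q - r))) * ∫⁻ x, ENNReal.ofReal (G q x ^ 2) ∂Q.vol := by
  rw [Q.lintegral_vol_eq i (((measurable_dirError hs i r hGm).pow_const 2).ennreal_ofReal),
    Q.lintegral_vol_eq i (((hGm q).pow_const 2).ennreal_ofReal),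
    ← lintegral_const_mul' _ _ ENNReal.ofReal_ne_top]
  refine lintegral_mono fun y => ?_
  have hD : ∀ r x, HasDerivAt (fun σ => G r (i.insertNth σ y : Fin (n + 1) → ℝ))
      (G (r + 1) (i.insertNth x y)) x := fun r x => by
    have := hG r (i.insertNth x y)
    simpa using this
  have key := IsHermiteBasis.lintegral_error_le (D := fun r σ => G r (i.insertNth σ y)) ht hs hD hh
    hr hq2 hq4
  rw [h0, h1] at key
  simpa [dirError] using key

end HermiteMesh

end HelmholtzMS

namespace HelmholtzMS

/-! ### Tensor-product Hermite interpolation -/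

section Tensor

open Set Filter Topology
open scoped ENNReal

variable {n : ℕ} {Q : Box n}

lemma contDiff_mderiv (α : Fin (n + 1) → ℕ) {φ : (Fin (n + 1) → ℝ) → ℝ} (hφ : ContDiff ℝ ∞ φ) :
    ContDiff ℝ ∞ (mderiv α φ) :=
  (mderiv_foldr_add_single α 0 _ (List.nodup_finRange _) hφ).1

lemma pderiv_mderiv (α : Fin (n + 1) → ℕ) (j : Fin (n + 1)) {φ : (Fin (n + 1) → ℝ) → ℝ}
    (hφ : ContDiff ℝ ∞ φ) : pderiv j (mderiv α φ) = mderiv (α + Pi.single j 1) φ := by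
  rw [mderiv_add_single α j hφ]
  exact (mderiv_foldr_add_single α j _ (List.nodup_finRange _) hφ).2.1

lemma pderiv_eq_deriv_update {F : (Fin (n + 1) → ℝ) → ℝ} {x : Fin (n + 1) → ℝ}
    (hF : DifferentiableAt ℝ F x) (i : Fin (n + 1)) :
    HasDerivAt (fun s => F (Function.update x i s)) (pderiv i F x) (x i) := by
  have h1 : HasFDerivAt F (fderiv ℝ F x) (Function.update x i (x i)) := by
    rw [Function.update_eq_self]; exact hF.hasFDerivAt
  exact h1.comp_hasDerivAt (x i) (hasDerivAt_update x i (x i))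

/-- A polynomial in the variable `i`. -/
noncomputable def polyInVar (i : Fin (n + 1)) (q : Polynomial ℝ) :
    MvPolynomial (Fin (n + 1)) ℝ := Polynomial.aeval (MvPolynomial.X i) q

lemma eval_polyInVar (i : Fin (n + 1)) (q : Polynomial ℝ) (x : Fin (n + 1) → ℝ) :
    MvPolynomial.eval x (polyInVar i q) = q.eval (x i) := by
  simp [polyInVar, Polynomial.aeval_eq_sum_range, Polynomial.eval_eq_sum_range,
    MvPolynomial.smul_eval]

lemma degreeOf_polyInVar_le (i l : Fin (n + 1)) (q : Polynomial ℝ) :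
    (polyInVar i q).degreeOf l ≤ if l = i then q.natDegree else 0 := by
  rw [polyInVar, Polynomial.aeval_eq_sum_range]
  refine (MvPolynomial.degreeOf_sum_le _ _ _).trans (Finset.sup_le fun m hm => ?_)
  rw [MvPolynomial.smul_eq_C_mul]
  refine (MvPolynomial.degreeOf_C_mul_le _ _ _).trans ?_
  split_ifs with h
  · subst h
    rw [MvPolynomial.degreeOf_X_self_pow]
    exact Nat.lt_succ_iff.1 (Finset.mem_range.1 hm)
  · rw [MvPolynomial.degreeOf_X_pow_of_ne _ h]

namespace Mesh

variable (T : Mesh Q)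

/-- The index set of the tensor-product nodal functions. -/
abbrev NodalIndex := (i : Fin (n + 1)) → Fin (T.num i + 1) × Fin 2

variable {T} (S : (i : Fin (n + 1)) → Fin (T.num i + 1) × Fin 2 → ℝ → ℝ)

/-- The derivative `∂^β` of the function with nodal coefficients `c`. -/
noncomputable def tensorSum (c : T.NodalIndex → ℝ) (β : Fin (n + 1) → ℕ)
    (x : Fin (n + 1) → ℝ) : ℝ :=
  ∑ κ, c κ * ∏ i, deriv^[β i] (S i (κ i)) (x i)

variable {S}

/-- The tensor-product spline is C¹ on the whole space and of degree at most 3 ≤ p in each variable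
on each element; the indicator supplies the extension by zero demanded by the space. -/
lemma indicator_tensorSum_mem_space (hS : ∀ i, IsHermiteBasis (T.node i) (S i)) {p : ℕ}
    (hp : 3 ≤ p) (c : T.NodalIndex → ℝ) :
    Q.dom.indicator (tensorSum S c 0) ∈ T.space p := by
  refine ⟨fun x hx => indicator_of_notMem hx _, ?_, fun j => ?_⟩
  · have : ContDiff ℝ 1 (tensorSum S c 0) := by
      refine ContDiff.sum fun κ _ => contDiff_const.mul (contDiff_prod fun i _ => ?_)
      exact ((hS i).contDiff (κ i)).comp (contDiff_apply ℝ ℝ i)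
    exact this.contDiffOn.congr fun x hx => indicator_of_mem hx _
  · choose q hq hqS using fun i (κ : Fin (T.num i + 1) × Fin 2) => (hS i).exists_eqOn_cell κ (j i)
    refine ⟨∑ κ : T.NodalIndex, MvPolynomial.C (c κ) * ∏ i, polyInVar i (q i (κ i)),
      fun l => ?_, fun x hx => ?_⟩
    · refine (MvPolynomial.degreeOf_sum_le _ _ _).trans (Finset.sup_le fun κ _ => ?_)
      refine (MvPolynomial.degreeOf_C_mul_le _ _ _).trans
        ((MvPolynomial.degreeOf_prod_le _ _ _).trans ?_)
      refine (Finset.sum_le_sum fun i _ => degreeOf_polyInVar_le i l (q i (κ i))).trans ?_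
      simp only [Finset.sum_ite_eq, Finset.mem_univ, if_true]
      exact (hq l (κ l)).trans hp
    · rw [indicator_of_mem (T.cell_subset_dom j hx), tensorSum, map_sum]
      refine Finset.sum_congr rfl fun κ _ => ?_
      rw [map_mul, MvPolynomial.eval_C, map_prod]
      congr 1
      refine Finset.prod_congr rfl fun i _ => ?_
      rw [eval_polyInVar]
      exact hqS i (κ i) 0 (hx i (mem_univ i))

lemma differentiableAt_iterate_deriv (hS : ∀ i, IsHermiteBasis (T.node i) (S i)) {j}
    {x : Fin (n + 1) → ℝ} (hx : x ∈ T.cell j) (i : Fin (n + 1)) (κ) (r : ℕ) :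
    DifferentiableAt ℝ (deriv^[r] (S i κ)) (x i) := by
  obtain ⟨q, -, h⟩ := (hS i).exists_eqOn_cell κ (j i)
  refine ((Polynomial.derivative^[r] q).differentiable (x i)).congr_of_eventuallyEq ?_
  filter_upwards [isOpen_Ioo.mem_nhds (hx i (mem_univ i))] with y hy using h r hy

lemma differentiableAt_tensorSum (hS : ∀ i, IsHermiteBasis (T.node i) (S i)) {j}
    {x : Fin (n + 1) → ℝ} (hx : x ∈ T.cell j) (c : T.NodalIndex → ℝ) (β : Fin (n + 1) → ℕ) :
    DifferentiableAt ℝ (tensorSum S c β) x := by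
  refine DifferentiableAt.fun_sum fun κ _ => DifferentiableAt.const_mul ?_ _
  have h : ∀ i ∈ Finset.univ,
      DifferentiableAt ℝ (fun y : Fin (n + 1) → ℝ => deriv^[β i] (S i (κ i)) (y i)) x :=
    fun i _ => (differentiableAt_iterate_deriv hS hx i (κ i) (β i)).comp x
      (differentiableAt_apply i x)
  exact (HasFDerivAt.finsetProd fun i hi => (h i hi).hasFDerivAt).differentiableAt

/-- Inside an element every factor is a polynomial, so the iterated `deriv` behaves classically; on
the grid this may fail. -/
lemma pderiv_tensorSum (hS : ∀ i, IsHermiteBasis (T.node i) (S i)) {j}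
    {x : Fin (n + 1) → ℝ} (hx : x ∈ T.cell j) (c : T.NodalIndex → ℝ) (β : Fin (n + 1) → ℕ)
    (l : Fin (n + 1)) :
    pderiv l (tensorSum S c β) x = tensorSum S c (β + Pi.single l 1) x := by
  refine (pderiv_eq_deriv_update (differentiableAt_tensorSum hS hx c β) l).unique ?_
  refine HasDerivAt.fun_sum fun κ _ => HasDerivAt.const_mul _ ?_
  have e1 : (fun σ => ∏ i, deriv^[β i] (S i (κ i)) (Function.update x l σ i)) =
      fun σ => deriv^[β l] (S l (κ l)) σ *
        ∏ i ∈ Finset.univ.erase l, deriv^[β i] (S i (κ i)) (x i) := by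
    funext σ
    rw [← Finset.mul_prod_erase _ _ (Finset.mem_univ l), Function.update_self]
    congr 1
    refine Finset.prod_congr rfl fun i hi => ?_
    rw [Function.update_of_ne (Finset.ne_of_mem_erase hi)]
  have e2 : ∏ i, deriv^[(β + Pi.single l 1 : Fin (n + 1) → ℕ) i] (S i (κ i)) (x i) =
      deriv (deriv^[β l] (S l (κ l))) (x l) *
        ∏ i ∈ Finset.univ.erase l, deriv^[β i] (S i (κ i)) (x i) := by
    rw [← Finset.mul_prod_erase _ _ (Finset.mem_univ l)]
    congr 1
    · rw [Pi.add_apply, Pi.single_eq_same, Function.iterate_succ_apply']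
    · refine Finset.prod_congr rfl fun i hi => ?_
      rw [Pi.add_apply, Pi.single_eq_of_ne (Finset.ne_of_mem_erase hi), add_zero]
  rw [e1, e2]
  exact (differentiableAt_iterate_deriv hS hx l (κ l) (β l)).hasDerivAt.mul_const _

lemma measurable_tensorSum (hS : ∀ i, IsHermiteBasis (T.node i) (S i)) (c : T.NodalIndex → ℝ)
    (β : Fin (n + 1) → ℕ) : Measurable (tensorSum S c β) := by
  refine Finset.measurable_sum _ fun κ _ => Measurable.const_mul
    (Finset.measurable_prod _ fun i _ => ?_) _
  exact ((hS i).measurable_iterate (κ i) (β i)).comp (measurable_pi_apply i)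

/-- The nodal values of the Hermite interpolant of `w`. -/
noncomputable def nodalCoeff (T : Mesh Q) (w : (Fin (n + 1) → ℝ) → ℝ) (κ : T.NodalIndex) : ℝ :=
  mderiv (fun i => ((κ i).2 : ℕ)) w fun i => T.node i (κ i).1

/-- The derivative `∂^β` of the interpolation error. -/
noncomputable def interpError (S : (i : Fin (n + 1)) → Fin (T.num i + 1) × Fin 2 → ℝ → ℝ)
    (w : (Fin (n + 1) → ℝ) → ℝ) (β : Fin (n + 1) → ℕ) (x : Fin (n + 1) → ℝ) : ℝ :=
  mderiv β w x - tensorSum S (T.nodalCoeff w) β x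

lemma pderiv_interpError (hS : ∀ i, IsHermiteBasis (T.node i) (S i)) {w : (Fin (n + 1) → ℝ) → ℝ}
    (hw : ContDiff ℝ ∞ w) {j} {x : Fin (n + 1) → ℝ} (hx : x ∈ T.cell j) (β : Fin (n + 1) → ℕ)
    (l : Fin (n + 1)) :
    pderiv l (interpError S w β) x = interpError S w (β + Pi.single l 1) x := by
  have h1 : DifferentiableAt ℝ (mderiv β w) x :=
    (contDiff_mderiv β hw).differentiable (by simp) x
  have h2 := differentiableAt_tensorSum hS hx (T.nodalCoeff w) β
  have : pderiv l (interpError S w β) x =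
      pderiv l (mderiv β w) x - pderiv l (tensorSum S (T.nodalCoeff w) β) x := by
    simp only [pderiv]
    rw [show interpError S w β = fun x => mderiv β w x - tensorSum S (T.nodalCoeff w) β x from rfl,
      fderiv_fun_sub h1 h2]
    rfl
  rw [this, pderiv_mderiv β l hw, pderiv_tensorSum hS hx]
  rfl

lemma num_pos (T : Mesh Q) (i : Fin (n + 1)) : 0 < T.num i := by
  rcases Nat.eq_zero_or_pos (T.num i) with h | h
  · exfalso
    have h1 : (0 : Fin (T.num i + 1)) = Fin.last (T.num i) := Fin.ext (by simp [h])
    have h2 := T.first i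
    rw [h1, T.last] at h2
    exact (Q.lt i).ne' h2
  · exact h

lemma side_le_width (T : Mesh Q) (i : Fin (n + 1)) (j : Fin (T.num i)) :
    T.node i j.succ - T.node i j.castSucc ≤ T.width := by
  let J : (i : Fin (n + 1)) → Fin (T.num i) := Function.update (fun l => ⟨0, T.num_pos l⟩) i j
  have h1 : √(∑ l, (T.node l (J l).succ - T.node l (J l).castSucc) ^ 2) ≤ T.width :=
    le_ciSup (f := fun J : (i : Fin (n + 1)) → Fin (T.num i) =>
      √(∑ l, (T.node l (J l).succ - T.node l (J l).castSucc) ^ 2)) (Set.finite_range _).bddAbove J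
  refine le_trans (Real.le_sqrt_of_sq_le ?_) h1
  have h2 := Finset.single_le_sum
    (f := fun l => (T.node l (J l).succ - T.node l (J l).castSucc) ^ 2)
    (fun _ _ => sq_nonneg _) (Finset.mem_univ i)
  simpa [J] using h2

lemma width_nonneg (T : Mesh Q) : 0 ≤ T.width := by
  have := T.side_le_width 0 ⟨0, T.num_pos 0⟩
  have h2 := (T.strictMono 0) (Fin.castSucc_lt_succ (i := ⟨0, T.num_pos 0⟩))
  linarith

lemma hasDerivAt_mderiv_update {w : (Fin (n + 1) → ℝ) → ℝ} (hw : ContDiff ℝ ∞ w)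
    (β : Fin (n + 1) → ℕ) (i : Fin (n + 1)) (r : ℕ) (x : Fin (n + 1) → ℝ) :
    HasDerivAt (fun σ => mderiv (Function.update β i r) w (Function.update x i σ))
      (mderiv (Function.update β i (r + 1)) w x) (x i) := by
  have h := pderiv_eq_deriv_update
    ((contDiff_mderiv (Function.update β i r) hw).differentiable (by simp) x) i
  rw [pderiv_mderiv _ _ hw] at h
  convert h using 2
  funext l
  rcases eq_or_ne l i with rfl | hl
  · simp
  · simp [hl]

/-- The interpolation error of `w` in direction `i` only. -/
lemma lintegral_dirError_mderiv_le (hS : ∀ i, IsHermiteBasis (T.node i) (S i))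
    {w : (Fin (n + 1) → ℝ) → ℝ} (hw : ContDiff ℝ ∞ w) (β : Fin (n + 1) → ℕ) (i : Fin (n + 1))
    {r q : ℕ} (hr : r ≤ 2) (hq2 : 2 ≤ q) (hq4 : q ≤ 4) :
    ∫⁻ x, ENNReal.ofReal (dirError i (T.node i) (S i) r
        (fun r => mderiv (Function.update β i r) w) x ^ 2) ∂Q.vol ≤
      ENNReal.ofReal (T.width ^ (2 * (q - r))) *
        ∫⁻ x, ENNReal.ofReal (mderiv (Function.update β i q) w x ^ 2) ∂Q.vol :=
  lintegral_dirError_le (T.strictMono i) (hS i) i (T.first i) (T.last i) (T.side_le_width i)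
    (fun _ => (contDiff_mderiv _ hw).continuous.measurable)
    (fun r x => hasDerivAt_mderiv_update hw β i r x) hr hq2 hq4

end Mesh

end Tensor

end HelmholtzMS

namespace HelmholtzMS

/-! ### The error of tensor-product Hermite interpolation -/

section TensorError

open Set Filter Topology
open scoped ENNReal

variable {n : ℕ} {Q : Box n}

namespace Mesh

/-- Interpolation in direction j commutes with differentiation in direction i. Hence the error in
direction j is itself a family of successive derivatives in direction i to which
`lintegral_dirError_le` applies. -/
lemma hasDerivAt_dirError_mderiv {w : (Fin (n + 1) → ℝ) → ℝ} (hw : ContDiff ℝ ∞ w)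
    (β : Fin (n + 1) → ℕ) {i j : Fin (n + 1)} (hij : i ≠ j) {M : ℕ} (t : Fin (M + 1) → ℝ)
    (s : Fin (M + 1) × Fin 2 → ℝ → ℝ) (b r : ℕ) (x : Fin (n + 1) → ℝ) :
    HasDerivAt (fun σ => dirError j t s b
        (fun q => mderiv (Function.update (Function.update β i r) j q) w) (Function.update x i σ))
      (dirError j t s b
        (fun q => mderiv (Function.update (Function.update β i (r + 1)) j q) w) x) (x i) := by
  simp only [dirError, Function.update_of_ne hij.symm]
  have h1 : ∀ q y, HasDerivAt
      (fun σ => mderiv (Function.update (Function.update β i r) j q) w (Function.update y i σ))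
      (mderiv (Function.update (Function.update β i (r + 1)) j q) w y) (y i) := fun q y => by
    rw [Function.update_comm hij, Function.update_comm hij]
    exact hasDerivAt_mderiv_update hw (Function.update β j q) i r y
  refine (h1 b x).sub (HasDerivAt.fun_sum fun κ _ => HasDerivAt.mul_const ?_ _)
  have h2 := h1 κ.2 (Function.update x j (t κ.1))
  rw [Function.update_of_ne hij] at h2
  simpa only [Function.update_comm hij] using h2

/-- In one variable the tensor product has a single factor, so this is the directional estimate with
all four derivatives in that direction. -/
lemma lintegral_interpError_le_of_interval {Q : Box 0} {T : Mesh Q}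
    {S : (i : Fin 1) → Fin (T.num i + 1) × Fin 2 → ℝ → ℝ}
    (hS : ∀ i, IsHermiteBasis (T.node i) (S i)) {w : (Fin 1 → ℝ) → ℝ} (hw : ContDiff ℝ ∞ w)
    {B : ℝ≥0∞} (hB : ∀ α, ∑ i, α i = 4 → ∫⁻ x, ENNReal.ofReal (mderiv α w x ^ 2) ∂Q.vol ≤ B)
    (β : Fin 1 → ℕ) (hβ : ∑ i, β i ≤ 2) :
    ∫⁻ x, ENNReal.ofReal (interpError S w β x ^ 2) ∂Q.vol ≤
      ENNReal.ofReal (T.width ^ (2 * (4 - ∑ i, β i))) * B := by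
  have e : ∀ x, interpError S w β x =
      dirError 0 (T.node 0) (S 0) (β 0) (fun r => mderiv (Function.update β 0 r) w) x := by
    intro x
    rw [interpError, dirError, Function.update_eq_self, tensorSum]
    congr 1
    refine Fintype.sum_equiv
      (Equiv.piUnique (α := Fin 1) fun i => Fin (T.num i + 1) × Fin 2) _ _ fun κ => ?_
    rw [Fin.prod_univ_one, nodalCoeff]
    congr 2
    · funext i
      obtain rfl := Subsingleton.elim (α := Fin 1) i 0
      simp
    · funext i
      obtain rfl := Subsingleton.elim (α := Fin 1) i 0
      simp
  simp only [e]
  have hβ' : β 0 ≤ 2 := by simpa using hβ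
  refine (lintegral_dirError_mderiv_le hS hw β 0 hβ' (q := 4) (by norm_num) le_rfl).trans ?_
  rw [Fin.sum_univ_one]
  gcongr
  exact hB _ (by simp)

/-- With the directional interpolants I₀ and I₁, 1 − I₀I₁ = (1 − I₀) + (1 − I₁) − (1 − I₀)(1 − I₁).
The three pieces are F₀, F₁ and F₂, and each is bounded using derivatives of total order four. -/
lemma lintegral_interpError_le_of_rectangle {Q : Box 1} {T : Mesh Q}
    {S : (i : Fin 2) → Fin (T.num i + 1) × Fin 2 → ℝ → ℝ}
    (hS : ∀ i, IsHermiteBasis (T.node i) (S i)) {w : (Fin 2 → ℝ) → ℝ} (hw : ContDiff ℝ ∞ w)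
    {B : ℝ≥0∞} (hB : ∀ α, ∑ i, α i = 4 → ∫⁻ x, ENNReal.ofReal (mderiv α w x ^ 2) ∂Q.vol ≤ B)
    (β : Fin 2 → ℕ) (hβ : ∑ i, β i ≤ 2) :
    ∫⁻ x, ENNReal.ofReal (interpError S w β x ^ 2) ∂Q.vol ≤
      9 * (ENNReal.ofReal (T.width ^ (2 * (4 - ∑ i, β i))) * B) := by
  have h01 : (0 : Fin 2) ≠ 1 := by decide
  have hβ' : β 0 + β 1 ≤ 2 := by simpa using hβ
  set G : ℕ → (Fin 2 → ℝ) → ℝ := fun r => dirError 1 (T.node 1) (S 1) (β 1)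
    (fun q => mderiv (Function.update (Function.update β 0 r) 1 q) w) with hG
  set F₀ := dirError 0 (T.node 0) (S 0) (β 0) (fun r => mderiv (Function.update β 0 r) w) with hF₀
  set F₁ := dirError 1 (T.node 1) (S 1) (β 1) (fun r => mderiv (Function.update β 1 r) w) with hF₁
  set F₂ := dirError 0 (T.node 0) (S 0) (β 0) G with hF₂
  have mder : ∀ α, Measurable (mderiv α w) := fun α => (contDiff_mderiv α hw).continuous.measurable
  have mG : ∀ r, Measurable (G r) := fun r => measurable_dirError (hS 1) 1 _ fun _ => mder _
  have mF₀ : Measurable F₀ := measurable_dirError (hS 0) 0 _ fun _ => mder _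
  have mF₁ : Measurable F₁ := measurable_dirError (hS 1) 1 _ fun _ => mder _
  have e : ∀ x, interpError S w β x = F₀ x + F₁ x - F₂ x := by
    intro x
    have e1 : tensorSum S (T.nodalCoeff w) β x = ∑ κ₀, (∑ κ₁,
        mderiv (Function.update (Function.update β 0 κ₀.2) 1 κ₁.2) w
          (Function.update (Function.update x 0 (T.node 0 κ₀.1)) 1 (T.node 1 κ₁.1)) *
          deriv^[β 1] (S 1 κ₁) (x 1)) * deriv^[β 0] (S 0 κ₀) (x 0) := by
      simp only [Finset.sum_mul]
      rw [tensorSum, ← Fintype.sum_prod_type']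
      refine Fintype.sum_equiv (piFinTwoEquiv fun i => Fin (T.num i + 1) × Fin 2) _ _ fun κ => ?_
      rw [Fin.prod_univ_two, nodalCoeff]
      have a1 : (fun i => ((κ i).2 : ℕ)) =
          Function.update (Function.update β 0 ((κ 0).2 : ℕ)) 1 ((κ 1).2 : ℕ) := by
        funext i; fin_cases i <;> simp
      have a2 : (fun i => T.node i (κ i).1) =
          Function.update (Function.update x 0 (T.node 0 (κ 0).1)) 1 (T.node 1 (κ 1).1) := by
        funext i; fin_cases i <;> simp
      rw [a1, a2]
      simp only [piFinTwoEquiv_apply]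
      ring
    have e2 : F₂ x = F₁ x - ∑ κ₀, (mderiv (Function.update β 0 κ₀.2) w
          (Function.update x 0 (T.node 0 κ₀.1)) - ∑ κ₁,
        mderiv (Function.update (Function.update β 0 κ₀.2) 1 κ₁.2) w
          (Function.update (Function.update x 0 (T.node 0 κ₀.1)) 1 (T.node 1 κ₁.1)) *
          deriv^[β 1] (S 1 κ₁) (x 1)) * deriv^[β 0] (S 0 κ₀) (x 0) := by
      rw [hF₂, dirError]
      congr 1
    have e3 : F₀ x = mderiv β w x - ∑ κ₀, mderiv (Function.update β 0 κ₀.2) w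
          (Function.update x 0 (T.node 0 κ₀.1)) * deriv^[β 0] (S 0 κ₀) (x 0) := by
      rw [hF₀, dirError, Function.update_eq_self]
    rw [e2, e3, interpError, e1]
    simp only [sub_mul, Finset.sum_sub_distrib]
    ring
  have b0 : ∫⁻ x, ENNReal.ofReal (F₀ x ^ 2) ∂Q.vol ≤
      ENNReal.ofReal (T.width ^ (2 * (4 - ∑ i, β i))) * B := by
    refine (lintegral_dirError_mderiv_le hS hw β 0 (q := 4 - β 1) (by omega) (by omega)
      (by omega)).trans ?_
    rw [Fin.sum_univ_two, show 4 - β 1 - β 0 = 4 - (β 0 + β 1) by omega]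
    gcongr
    exact hB _ (by simp; omega)
  have b1 : ∫⁻ x, ENNReal.ofReal (F₁ x ^ 2) ∂Q.vol ≤
      ENNReal.ofReal (T.width ^ (2 * (4 - ∑ i, β i))) * B := by
    refine (lintegral_dirError_mderiv_le hS hw β 1 (q := 4 - β 0) (by omega) (by omega)
      (by omega)).trans ?_
    rw [Fin.sum_univ_two, show 4 - β 0 - β 1 = 4 - (β 0 + β 1) by omega]
    gcongr
    exact hB _ (by simp; omega)
  have b2 : ∫⁻ x, ENNReal.ofReal (F₂ x ^ 2) ∂Q.vol ≤
      ENNReal.ofReal (T.width ^ (2 * (4 - ∑ i, β i))) * B := by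
    -- For the product of the two errors, use two derivatives in each direction; the powers of h add
    -- up to 2(4 − β₀ − β₁).
    refine (lintegral_dirError_le (T.strictMono 0) (hS 0) 0 (T.first 0) (T.last 0)
      (T.side_le_width 0) mG (fun r x => hasDerivAt_dirError_mderiv hw β h01 _ _ _ r x)
      (q := 2) (by omega) le_rfl (by norm_num)).trans ?_
    have := lintegral_dirError_mderiv_le hS hw (Function.update β 0 2) 1 (r := β 1) (q := 2)
      (by omega) le_rfl (by norm_num)
    have hB' := hB (Function.update (Function.update β 0 2) 1 2) (by simp)
    have hw0 := T.width_nonneg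
    calc _ ≤ ENNReal.ofReal (T.width ^ (2 * (2 - β 0))) *
          (ENNReal.ofReal (T.width ^ (2 * (2 - β 1))) * B) := by
          gcongr
          exact this.trans (by gcongr)
      _ = _ := by
          rw [← mul_assoc, ← ENNReal.ofReal_mul (by positivity), ← pow_add, Fin.sum_univ_two]
          congr 3
          omega
  -- The square of a sum of three terms is at most three times the sum of squares; three equal
  -- bounds then give the factor 9.
  have hpt : ∀ x, ENNReal.ofReal (interpError S w β x ^ 2) ≤
      3 * (ENNReal.ofReal (F₀ x ^ 2) + ENNReal.ofReal (F₁ x ^ 2) + ENNReal.ofReal (F₂ x ^ 2)) := by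
    intro x
    have h3 : (3 : ℝ≥0∞) = ENNReal.ofReal 3 := by simp
    rw [e, ← ENNReal.ofReal_add (by positivity) (by positivity),
      ← ENNReal.ofReal_add (by positivity) (by positivity), h3,
      ← ENNReal.ofReal_mul (by norm_num)]
    refine ENNReal.ofReal_le_ofReal ?_
    nlinarith [sq_nonneg (F₀ x - F₁ x), sq_nonneg (F₀ x + F₂ x), sq_nonneg (F₁ x + F₂ x)]
  calc _ ≤ ∫⁻ x, 3 * (ENNReal.ofReal (F₀ x ^ 2) + ENNReal.ofReal (F₁ x ^ 2) +
        ENNReal.ofReal (F₂ x ^ 2)) ∂Q.vol := lintegral_mono hpt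
    _ = 3 * (∫⁻ x, ENNReal.ofReal (F₀ x ^ 2) ∂Q.vol + ∫⁻ x, ENNReal.ofReal (F₁ x ^ 2) ∂Q.vol +
        ∫⁻ x, ENNReal.ofReal (F₂ x ^ 2) ∂Q.vol) := by
      have m0 := (mF₀.pow_const 2).ennreal_ofReal
      have m1 := (mF₁.pow_const 2).ennreal_ofReal
      have m01 : Measurable fun x => ENNReal.ofReal (F₀ x ^ 2) + ENNReal.ofReal (F₁ x ^ 2) :=
        m0.add m1
      rw [lintegral_const_mul' _ _ (by simp), lintegral_add_left m01, lintegral_add_left m0]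
    _ ≤ 3 * (ENNReal.ofReal (T.width ^ (2 * (4 - ∑ i, β i))) * B +
        ENNReal.ofReal (T.width ^ (2 * (4 - ∑ i, β i))) * B +
        ENNReal.ofReal (T.width ^ (2 * (4 - ∑ i, β i))) * B) := by gcongr
    _ = _ := by ring

lemma lintegral_interpError_le (hn : n ≤ 1) {T : Mesh Q}
    {S : (i : Fin (n + 1)) → Fin (T.num i + 1) × Fin 2 → ℝ → ℝ}
    (hS : ∀ i, IsHermiteBasis (T.node i) (S i)) {w : (Fin (n + 1) → ℝ) → ℝ} (hw : ContDiff ℝ ∞ w)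
    {B : ℝ≥0∞} (hB : ∀ α, ∑ i, α i = 4 → ∫⁻ x, ENNReal.ofReal (mderiv α w x ^ 2) ∂Q.vol ≤ B)
    (β : Fin (n + 1) → ℕ) (hβ : ∑ i, β i ≤ 2) :
    ∫⁻ x, ENNReal.ofReal (interpError S w β x ^ 2) ∂Q.vol ≤
      9 * (ENNReal.ofReal (T.width ^ (2 * (4 - ∑ i, β i))) * B) := by
  obtain rfl | rfl : n = 0 ∨ n = 1 := by omega
  · refine (lintegral_interpError_le_of_interval hS hw hB β hβ).trans ?_
    exact le_mul_of_one_le_left (zero_le) (by norm_num)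
  · exact lintegral_interpError_le_of_rectangle hS hw hB β hβ

/-- Approximation of a smooth function from the finite element space. -/
theorem exists_approx (hn : n ≤ 1) (T : Mesh Q) {p : ℕ} (hp : 3 ≤ p)
    {w : (Fin (n + 1) → ℝ) → ℝ} (hw : ContDiff ℝ ∞ w) {B : ℝ} (hB0 : 0 ≤ B)
    (hB : ∀ α, ∑ i, α i = 4 → ∫ x, mderiv α w x ^ 2 ∂Q.vol ≤ B) :
    ∃ v ∈ T.space p, ∫ x, (w - v) x ^ 2 ∂Q.vol ≤ 9 * T.width ^ 8 * B ∧
      (∀ i, ∫ x, pderiv i (w - v) x ^ 2 ∂Q.vol ≤ 9 * T.width ^ 6 * B) ∧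
      ∀ i l, ∫ x, pderiv l (pderiv i (w - v)) x ^ 2 ∂Q.vol ≤ 9 * T.width ^ 4 * B := by
  choose S hS using fun i => exists_hermiteBasis (T.strictMono i)
  have hwd := T.width_nonneg
  have hB' : ∀ α, ∑ i, α i = 4 →
      ∫⁻ x, ENNReal.ofReal (mderiv α w x ^ 2) ∂Q.vol ≤ ENNReal.ofReal B := fun α hα => by
    rw [← ofReal_integral_eq_lintegral_ofReal]
    · exact ENNReal.ofReal_le_ofReal (hB α hα)
    · have := integrable_norm_sq (Q.memLp_vol_of_continuous (p := 2)
        (Complex.continuous_ofReal.comp (contDiff_mderiv α hw).continuous))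
      simpa using this
    · exact Eventually.of_forall fun x => sq_nonneg _
  -- Agreement almost everywhere suffices: the derivatives of w − v are identified only inside the
  -- elements.
  have key : ∀ (β : Fin (n + 1) → ℕ) (F : (Fin (n + 1) → ℝ) → ℝ), ∑ i, β i ≤ 2 →
      F =ᵐ[Q.vol] interpError S w β →
      ∫ x, F x ^ 2 ∂Q.vol ≤ 9 * T.width ^ (2 * (4 - ∑ i, β i)) * B := by
    intro β F hβ hF
    have hm : Measurable (interpError S w β) :=
      (contDiff_mderiv β hw).continuous.measurable.sub (measurable_tensorSum hS _ _)
    have e1 : ∫ x, F x ^ 2 ∂Q.vol = ∫ x, interpError S w β x ^ 2 ∂Q.vol := by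
      refine integral_congr_ae ?_
      filter_upwards [hF] with x hx
      rw [hx]
    rw [e1, integral_eq_lintegral_of_nonneg_ae (Eventually.of_forall fun x => sq_nonneg _)
      (hm.pow_const 2).aestronglyMeasurable]
    refine ENNReal.toReal_le_of_le_ofReal (by positivity)
      ((lintegral_interpError_le hn hS hw hB' β hβ).trans (le_of_eq ?_))
    rw [mul_assoc, ENNReal.ofReal_mul (by norm_num), ENNReal.ofReal_mul (by positivity)]
    simp
  set v := Q.dom.indicator (tensorSum S (T.nodalCoeff w) 0) with hv
  have h0 : ∀ j, ∀ x ∈ T.cell j, (w - v) x = interpError S w 0 x := fun j x hx => by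
    rw [Pi.sub_apply, hv, indicator_of_mem (T.cell_subset_dom j hx), interpError, mderiv_zero]
  have h1 : ∀ i j, ∀ x ∈ T.cell j, pderiv i (w - v) x = interpError S w (Pi.single i 1) x :=
    fun i j x hx => by
      rw [IsPiecewiseSmooth.pderiv_eq_of_eqOn_open (T.isOpen_cell j) (h0 j) i x hx,
        pderiv_interpError hS hw hx, zero_add]
  have h2 : ∀ i l j, ∀ x ∈ T.cell j,
      pderiv l (pderiv i (w - v)) x = interpError S w (Pi.single i 1 + Pi.single l 1) x :=
    fun i l j x hx => by
      rw [IsPiecewiseSmooth.pderiv_eq_of_eqOn_open (T.isOpen_cell j) (h1 i j) l x hx,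
        pderiv_interpError hS hw hx]
  refine ⟨v, indicator_tensorSum_mem_space hS hp _, ?_, fun i => ?_, fun i l => ?_⟩
  · have := key 0 (w - v) (by simp) (by
      filter_upwards [T.ae_mem_cell] with x ⟨j, hj⟩ using h0 j x hj)
    simpa using this
  · have := key (Pi.single i 1) _ (by simp) (by
      filter_upwards [T.ae_mem_cell] with x ⟨j, hj⟩ using h1 i j x hj)
    simpa using this
  · have := key (Pi.single i 1 + Pi.single l 1) _ (by simp [Finset.sum_add_distrib]) (by
      filter_upwards [T.ae_mem_cell] with x ⟨j, hj⟩ using h2 i l j x hj)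
    simpa [Finset.sum_add_distrib] using this

end Mesh

end TensorError

end HelmholtzMS

namespace HelmholtzMS

/-! ### The energy norm of functions in `H²(Ω)` -/

section EnergyBound

open Set Filter Topology

variable {n : ℕ} {Q : Box n}

lemma sq_norm_sum_le (z : Fin (n + 1) → ℂ) : ‖∑ i, z i‖ ^ 2 ≤ (n + 1) * ∑ i, ‖z i‖ ^ 2 := by
  have h := sq_sum_le_card_mul_sum_sq (s := Finset.univ) (f := fun i => ‖z i‖)
  have h' : ‖∑ i, z i‖ ^ 2 ≤ (∑ i, ‖z i‖) ^ 2 := by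
    gcongr
    exact norm_sum_le _ _
  simpa using h'.trans h

lemma sq_norm_add_le (a b : ℂ) : ‖a + b‖ ^ 2 ≤ 2 * ‖a‖ ^ 2 + 2 * ‖b‖ ^ 2 := by
  have := norm_add_le a b
  nlinarith [sq_nonneg (‖a‖ - ‖b‖), norm_nonneg (a + b), norm_nonneg a, norm_nonneg b]

lemma sq_norm_normalPart_le (tg : Fin (n + 1) → (Fin (n + 1) → ℝ) → ℂ) (x : Fin (n + 1) → ℝ) :
    ‖normalPart Q tg x‖ ^ 2 ≤ (n + 1) * ∑ i, ‖tg i x‖ ^ 2 := by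
  refine (sq_norm_sum_le _).trans ?_
  gcongr with i
  rw [norm_mul, Complex.norm_real]
  exact mul_le_of_le_one_right (norm_nonneg _) (Q.abs_normal_le x i)

lemma sq_norm_tanPart_le (tg : Fin (n + 1) → (Fin (n + 1) → ℝ) → ℂ) (i : Fin (n + 1))
    (x : Fin (n + 1) → ℝ) :
    ‖tanPart Q tg i x‖ ^ 2 ≤ 2 * ‖tg i x‖ ^ 2 + 2 * ((n + 1) * ∑ i, ‖tg i x‖ ^ 2) := by
  rw [tanPart, sub_eq_add_neg]
  refine (sq_norm_add_le _ _).trans ?_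
  gcongr
  refine le_trans ?_ (sq_norm_normalPart_le (Q := Q) tg x)
  rw [norm_neg, norm_mul, Complex.norm_real]
  gcongr
  exact mul_le_of_le_one_left (norm_nonneg _) (Q.abs_normal_le x i)

lemma integral_norm_sq_mono {μ : Measure (Fin (n + 1) → ℝ)} {F : (Fin (n + 1) → ℝ) → ℂ}
    {G : (Fin (n + 1) → ℝ) → ℝ} (hG : Integrable G μ) (h : ∀ᵐ x ∂μ, ‖F x‖ ^ 2 ≤ G x) :
    ∫ x, ‖F x‖ ^ 2 ∂μ ≤ ∫ x, G x ∂μ :=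
  integral_mono_of_nonneg (Eventually.of_forall fun _ => by positivity) hG h

/-- Bookkeeping for the energy bound, with N the dimension, K the trace constant, and A, B, D bounds
for derivatives of order 0, 1, 2. -/
lemma energy_bound_arith {N K A B D : ℝ} (hN : 1 ≤ N) (hK : 0 ≤ K) (hA : 0 ≤ A) (hB : 0 ≤ B)
    (hD : 0 ≤ D) (k : ℝ) :
    N * B + (2 * (N * (N * D)) + 2 * (k ^ 4 * A)) + k ^ 2 * A +
        (N * (2 * (K * (B + N * D)) + 2 * (N * (N * (K * (B + N * D))))) +
        N * (N * (K * (B + N * D))) + k ^ 2 * (K * (A + N * B))) ≤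
      (2 + N + 2 * N ^ 2 + K * (1 + N) * (1 + N + 2 * N + 3 * N ^ 3)) *
        ((1 + k ^ 2 + k ^ 4) * A + (1 + k ^ 2) * B + D) := by
  set E := (1 + k ^ 2 + k ^ 4) * A + (1 + k ^ 2) * B + D with hE
  have kA : 0 ≤ k ^ 2 * A := by positivity
  have kA4 : 0 ≤ k ^ 4 * A := by positivity
  have kB : 0 ≤ k ^ 2 * B := by positivity
  have hE' : E = A + k ^ 2 * A + k ^ 4 * A + B + k ^ 2 * B + D := by rw [hE]; ring
  clear_value E
  have hE0 : 0 ≤ E := by linarith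
  have eB : N * B ≤ N * E := by gcongr; linarith
  have eD : N * (N * D) ≤ N ^ 2 * E := by
    rw [← mul_assoc, ← sq]; gcongr; linarith
  set H := K * (1 + N) * E with hH
  have hH0 : 0 ≤ H := by positivity
  have eG : K * (B + N * D) ≤ H := by
    rw [hH, mul_assoc]
    gcongr
    rw [add_mul, one_mul]
    gcongr <;> linarith
  have eT : k ^ 2 * (K * (A + N * B)) ≤ H := by
    have : k ^ 2 * (K * (A + N * B)) = K * (k ^ 2 * A + N * (k ^ 2 * B)) := by ring
    rw [this, hH, mul_assoc]
    gcongr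
    rw [add_mul, one_mul]
    gcongr <;> linarith
  set G := K * (B + N * D)
  have e2 : N * (N * G) ≤ N ^ 3 * H := by
    rw [← mul_assoc, ← sq]
    have : N ^ 2 ≤ N ^ 3 := by gcongr; linarith
    gcongr
  have e3 : N * (2 * G + 2 * (N * (N * G))) ≤ 2 * N * H + 2 * N ^ 3 * H := by
    have : N * (2 * G + 2 * (N * (N * G))) = 2 * N * G + 2 * N ^ 3 * G := by ring
    rw [this]
    gcongr
  have e4 : H ≤ (1 + N) * H := le_mul_of_one_le_left hH0 (by linarith)
  have e5 : (2 + N + 2 * N ^ 2 + K * (1 + N) * (1 + N + 2 * N + 3 * N ^ 3)) * E =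
      2 * E + N * E + 2 * (N ^ 2 * E) + ((1 + N) * H + 2 * N * H + 3 * (N ^ 3 * H)) := by
    rw [hH]; ring
  rw [e5]
  linarith

/-- The energy norm is controlled by the `L²` norms of the derivatives of order at most two. -/
theorem exists_energy_bound {r : ℝ} (hr : 0 < r) (hQ : Q.StarShapedBall r) :
    ∃ C : ℝ, 0 ≤ C ∧ ∀ (k : ℝ) (u : H2space Q) (d dd t tg), IsH2 Q u d dd t tg →
      ∀ A B D : ℝ, ∫ x, ‖u.1 x‖ ^ 2 ∂Q.vol ≤ A → (∀ i, ∫ x, ‖d i x‖ ^ 2 ∂Q.vol ≤ B) →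
        (∀ i j, ∫ x, ‖dd i j x‖ ^ 2 ∂Q.vol ≤ D) →
        ‖energyMap Q k u‖ ^ 2 ≤ C * ((1 + k ^ 2 + k ^ 4) * A + (1 + k ^ 2) * B + D) := by
  obtain ⟨K, hK0, hK⟩ := exists_trace_bound Q hr hQ
  set N : ℝ := (n : ℝ) + 1 with hN
  have hN1 : 1 ≤ N := by simp [hN]
  refine ⟨2 + N + 2 * N ^ 2 + K * (1 + N) * (1 + N + 2 * N + 3 * N ^ 3), by positivity, ?_⟩
  intro k u d dd t tg h A B D hA hB hD
  have hA0 : 0 ≤ A := le_trans (integral_nonneg fun _ => by positivity) hA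
  have hB0 : 0 ≤ B := le_trans (integral_nonneg fun _ => by positivity) (hB 0)
  have hD0 : 0 ≤ D := le_trans (integral_nonneg fun _ => by positivity) (hD 0 0)
  have hsum : ∀ {f : Fin (n + 1) → ℝ} {b : ℝ}, (∀ i, f i ≤ b) → ∑ i, f i ≤ N * b := by
    intro f b hf
    have := Finset.sum_le_card_nsmul Finset.univ f b fun i _ => hf i
    simpa [hN] using this
  have hg : ∑ i, ∫ x, ‖grad Q u i x‖ ^ 2 ∂Q.vol ≤ N * B := hsum fun i => by
    rw [integral_congr_ae (g := fun x => ‖d i x‖ ^ 2)]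
    · exact hB i
    · filter_upwards [h.isH1.grad_ae_eq i] with x hx
      rw [hx]
  have hhelm : ∫ x, ‖helm Q k u x‖ ^ 2 ∂Q.vol ≤ 2 * (N * (N * D)) + 2 * (k ^ 4 * A) := by
    have i1 : ∀ i, Integrable (fun x => ‖dd i i x‖ ^ 2) Q.vol := fun i =>
      integrable_norm_sq ((h.isH1_deriv i).memLp_deriv i)
    have i2 := integrable_norm_sq h.isH1.memLp
    have i3 : Integrable (fun x => ∑ i, ‖dd i i x‖ ^ 2) Q.vol := integrable_finsetSum _ fun i _ => i1 i
    refine (integral_norm_sq_mono (G := fun x => 2 * (N * ∑ i, ‖dd i i x‖ ^ 2) +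
      2 * (k ^ 4 * ‖u.1 x‖ ^ 2)) (((i3.const_mul _).const_mul _).add
        ((i2.const_mul _).const_mul _)) ?_).trans ?_
    · filter_upwards [h.lap_ae_eq] with x hx
      rw [helm, hx]
      refine (sq_norm_add_le _ _).trans ?_
      have e : ‖(k : ℂ) ^ 2 * u.1 x‖ ^ 2 = k ^ 4 * ‖u.1 x‖ ^ 2 := by
        rw [norm_mul, norm_pow, Complex.norm_real, mul_pow, Real.norm_eq_abs, sq_abs]
        ring
      rw [e]
      gcongr
      exact sq_norm_sum_le _
    · rw [integral_add ((i3.const_mul _).const_mul _) ((i2.const_mul _).const_mul _)]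
      simp only [integral_const_mul]
      rw [integral_finsetSum _ fun i _ => i1 i]
      gcongr
      exact hsum fun i => hD i i
  -- The trace inequality is applied to each first derivative. This is how second derivatives enter
  -- the bounds for ∂ₙu and ∇_Γu.
  have htg : ∀ i, ∫ x, ‖tg i x‖ ^ 2 ∂Q.surf ≤ K * (B + N * D) := fun i =>
    (hK _ _ _ (h.isH1_deriv i)).trans (by
      gcongr
      · exact hB i
      · exact hsum fun j => hD i j)
  have itg : ∀ i, Integrable (fun x => ‖tg i x‖ ^ 2) Q.surf := fun i =>
    integrable_norm_sq (h.isH1_deriv i).memLp_trace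
  have itg' : Integrable (fun x => N * ∑ i, ‖tg i x‖ ^ 2) Q.surf :=
    (integrable_finsetSum _ fun i _ => itg i).const_mul _
  have htgs : ∫ x, N * ∑ i, ‖tg i x‖ ^ 2 ∂Q.surf ≤ N * (N * (K * (B + N * D))) := by
    rw [integral_const_mul, integral_finsetSum _ fun i _ => itg i]
    gcongr
    exact hsum htg
  have hnd : ∫ x, ‖normalDeriv Q u x‖ ^ 2 ∂Q.surf ≤ N * (N * (K * (B + N * D))) := by
    refine (integral_norm_sq_mono itg' ?_).trans htgs
    filter_upwards [h.normalDeriv_ae_eq] with x hx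
    rw [hx]
    exact sq_norm_normalPart_le tg x
  have hsg : ∑ i, ∫ x, ‖surfGrad Q u i x‖ ^ 2 ∂Q.surf ≤
      N * (2 * (K * (B + N * D)) + 2 * (N * (N * (K * (B + N * D))))) := hsum fun i => by
    refine (integral_norm_sq_mono (((itg i).const_mul 2).add (itg'.const_mul 2)) ?_).trans ?_
    · filter_upwards [h.surfGrad_ae_eq i] with x hx
      rw [hx]
      exact sq_norm_tanPart_le tg i x
    · refine (integral_add ((itg i).const_mul 2) (itg'.const_mul 2)).le.trans ?_
      rw [integral_const_mul, integral_const_mul]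
      gcongr
      exact htg i
  have ht : ∫ x, ‖trace Q u x‖ ^ 2 ∂Q.surf ≤ K * (A + N * B) := by
    rw [integral_congr_ae (g := fun x => ‖t x‖ ^ 2)]
    · refine (hK _ _ _ h.isH1).trans ?_
      gcongr
      exact hsum hB
    · filter_upwards [h.isH1.trace_ae_eq] with x hx
      rw [hx]
  rw [norm_sq_energyMap_eq]
  refine le_trans ?_ (energy_bound_arith hN1 hK0 hA0 hB0 hD0 k)
  gcongr

end EnergyBound

/-! ### Derivatives of smoothed functions -/

section SmoothApprox

open Set Filter Topology

variable {n : ℕ} {Q : Box n} {s : ℝ} {κ : (Fin (n + 1) → ℝ) → ℝ}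

lemma integral_norm_sq_smoothing_le (hκ : IsSmoothingKernel Q s κ) (hs : 1 / 2 ≤ s)
    {g : (Fin (n + 1) → ℝ) → ℂ} (hg : MemLp g 2 Q.vol) :
    ∫ x, ‖smoothing Q s κ g x‖ ^ 2 ∂Q.vol ≤ 2 ^ (n + 1) * ∫ x, ‖g x‖ ^ 2 ∂Q.vol := by
  have hs0 : 0 < s := by linarith
  have hw : MemLp (smoothing Q s κ g) 2 Q.vol :=
    Q.memLp_vol_of_continuous (contDiff_smoothing hκ hg).continuous 2
  have h := eLpNorm_smoothing_le hκ hs0 hg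
  rw [← norm_toLp_sq hw, ← norm_toLp_sq hg, Lp.norm_toLp, Lp.norm_toLp]
  have h2 : (s ^ (n + 1))⁻¹ ≤ 2 ^ (n + 1) := by
    rw [← inv_pow]
    gcongr
    rw [inv_le_comm₀ hs0 two_pos]
    linarith
  have h1 : (eLpNorm (smoothing Q s κ g) 2 Q.vol).toReal ≤
      ((s ^ (n + 1))⁻¹) ^ (1 / 2 : ℝ) * (eLpNorm g 2 Q.vol).toReal := by
    have := ENNReal.toReal_mono (ENNReal.mul_ne_top (by simp) hg.eLpNorm_lt_top.ne) h
    rwa [ENNReal.toReal_mul, ← ENNReal.toReal_rpow, ENNReal.toReal_ofReal (by positivity)] at this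
  calc _ ≤ (((s ^ (n + 1))⁻¹) ^ (1 / 2 : ℝ) * (eLpNorm g 2 Q.vol).toReal) ^ 2 := by gcongr
    _ = (s ^ (n + 1))⁻¹ * (eLpNorm g 2 Q.vol).toReal ^ 2 := by
        rw [mul_pow, ← Real.sqrt_eq_rpow, Real.sq_sqrt (by positivity)]
    _ ≤ _ := by gcongr

/-- Each derivative passes through the smoothing at the cost of one factor s. The functional ℓ is
needed because `mderiv` acts on real functions; it will be the real or the imaginary part. -/
lemma mderiv_comp_smoothing (hκ : IsSmoothingKernel Q s κ) (ℓ : ℂ →L[ℝ] ℝ) {m : ℕ}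
    {W : (Fin (n + 1) → ℕ) → (Fin (n + 1) → ℝ) → ℂ}
    (hW : ∀ α, ∑ i, α i ≤ m → MemLp (W α) 2 Q.vol)
    (hd : ∀ α j, ∑ i, α i + 1 ≤ m → WeakPartial Q j (W α) (W (α + Pi.single j 1)))
    (N : ℕ) (hN : N ≤ m) (α : Fin (n + 1) → ℕ) (hα : ∑ i, α i = N) {x : Fin (n + 1) → ℝ}
    (hx : x ∈ Q.dom) :
    mderiv α (fun y => ℓ (smoothing Q s κ (W 0) y)) x =
      ℓ ((s : ℂ) ^ N * smoothing Q s κ (W α) x) := by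
  have hsm : ∀ α, ∑ i, α i ≤ m → ContDiff ℝ ∞ (smoothing Q s κ (W α)) := fun α hα =>
    contDiff_smoothing hκ (hW α hα)
  induction N generalizing α x with
  | zero =>
    have : α = 0 := by
      funext i
      exact (Finset.sum_eq_zero_iff.1 hα) i (Finset.mem_univ i)
    subst this
    simp [mderiv_zero]
  | succ N ih =>
    obtain ⟨j, hj⟩ : ∃ j, α j ≠ 0 := by
      by_contra! h
      simp [h] at hα
    obtain ⟨α', rfl⟩ : ∃ α' : Fin (n + 1) → ℕ, α = α' + Pi.single j 1 := by
      refine ⟨α - Pi.single j 1, ?_⟩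
      funext i
      by_cases hi : i = j
      · subst hi
        simp; omega
      · simp [hi]
    have hα' : ∑ i, α' i = N := by
      simpa [Finset.sum_add_distrib] using hα
    rw [← pderiv_mderiv α' j (φ := fun y => ℓ (smoothing Q s κ (W 0) y))
        (ℓ.contDiff.comp (hsm 0 (by simp))),
      Mesh.IsPiecewiseSmooth.pderiv_eq_of_eqOn_open Q.isOpen_dom
        (fun y hy => ih (by omega) α' hα' hy) j x hx]
    have hdif : DifferentiableAt ℝ (smoothing Q s κ (W α')) x :=
      ((hsm α' (by omega)).differentiable (by simp)) x
    have h1 := ℓ.hasFDerivAt.comp x ((hdif.hasFDerivAt.const_mul ((s : ℂ) ^ N)))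
    rw [pderiv]
    erw [h1.fderiv]
    have h2 := cderiv_smoothing hκ (hW α' (by omega)) (hd α' j (by omega)) hx
    rw [cderiv] at h2
    simp only [ContinuousLinearMap.comp_apply, _root_.smul_apply, h2, smul_eq_mul]
    congr 1
    ring

end SmoothApprox

end HelmholtzMS

namespace HelmholtzMS

/-! ### Approximation of `H⁴` functions in the energy norm -/

section SobolevApprox

open Set Filter Topology

variable {n : ℕ} {Q : Box n}

lemma isWeakDeriv_zero (Q : Box n) (u : (Fin (n + 1) → ℝ) → ℂ) : IsWeakDeriv Q 0 u u := by
  intro φ _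
  simp [mderiv_zero]

/-- The weak derivatives of `u`, with `u` itself as the derivative of order zero. -/
noncomputable def weakJet (Q : Box n) (u : (Fin (n + 1) → ℝ) → ℂ) (α : Fin (n + 1) → ℕ) :
    (Fin (n + 1) → ℝ) → ℂ :=
  open Classical in if α = 0 then u else weakDeriv Q α u

lemma weakJet_zero (Q : Box n) (u : (Fin (n + 1) → ℝ) → ℂ) : weakJet Q u 0 = u := by
  simp [weakJet]

lemma MemH.weakDeriv_spec {m : ℕ} {u : (Fin (n + 1) → ℝ) → ℂ} (hu : MemH Q m u)
    {α : Fin (n + 1) → ℕ} (hα : ∑ i, α i ≤ m) :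
    MemLp (weakDeriv Q α u) 2 Q.vol ∧ IsWeakDeriv Q α u (weakDeriv Q α u) :=
  pick_spec (P := fun w => MemLp w 2 Q.vol ∧ IsWeakDeriv Q α u w) (hu.2 α hα)

lemma MemH.weakJet_spec {m : ℕ} {u : (Fin (n + 1) → ℝ) → ℂ} (hu : MemH Q m u)
    {α : Fin (n + 1) → ℕ} (hα : ∑ i, α i ≤ m) :
    MemLp (weakJet Q u α) 2 Q.vol ∧ IsWeakDeriv Q α u (weakJet Q u α) := by
  unfold weakJet
  split_ifs with h
  · subst h
    exact ⟨hu.1, isWeakDeriv_zero Q u⟩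
  · exact hu.weakDeriv_spec hα

lemma MemH.weakPartial_weakJet {m : ℕ} {u : (Fin (n + 1) → ℝ) → ℂ} (hu : MemH Q m u)
    (α : Fin (n + 1) → ℕ) (j : Fin (n + 1)) (hα : ∑ i, α i + 1 ≤ m) :
    WeakPartial Q j (weakJet Q u α) (weakJet Q u (α + Pi.single j 1)) :=
  (hu.weakJet_spec (by omega)).2.weakPartial
    (hu.weakJet_spec (by simpa [Finset.sum_add_distrib] using hα)).2

lemma MemH.weakDeriv_zero_ae_eq {m : ℕ} {u : (Fin (n + 1) → ℝ) → ℂ} (hu : MemH Q m u) :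
    weakDeriv Q 0 u =ᵐ[Q.vol] u := by
  have h := hu.weakDeriv_spec (α := 0) (by simp)
  refine ae_eq_of_forall_testFun h.1 hu.1 fun φ hφ => ?_
  have := h.2 φ hφ
  simpa [mderiv_zero] using this.symm

lemma MemH.integral_weakJet_le {m : ℕ} {u : (Fin (n + 1) → ℝ) → ℂ} (hu : MemH Q m u)
    {α : Fin (n + 1) → ℕ} (hα : ∑ i, α i ≤ m) :
    ∫ x, ‖weakJet Q u α x‖ ^ 2 ∂Q.vol ≤ normH Q m u ^ 2 := by
  have e : ∫ x, ‖weakJet Q u α x‖ ^ 2 ∂Q.vol = ∫ x, ‖weakDeriv Q α u x‖ ^ 2 ∂Q.vol := by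
    unfold weakJet
    split_ifs with h
    · subst h
      refine integral_congr_ae ?_
      filter_upwards [hu.weakDeriv_zero_ae_eq] with x hx
      rw [hx]
    · rfl
  have hnn : ∀ α : Fin (n + 1) → Fin (m + 1), 0 ≤ if ∑ i, (α i : ℕ) ≤ m then
      ∫ x, ‖weakDeriv Q (fun i => (α i : ℕ)) u x‖ ^ 2 ∂Q.vol else 0 := fun α => by
    split_ifs
    · positivity
    · exact le_rfl
  have hle : ∀ i, α i < m + 1 := fun i => Nat.lt_succ_of_le
    ((Finset.single_le_sum (fun j _ => Nat.zero_le (α j)) (Finset.mem_univ i)).trans hα)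
  rw [e, normH, Real.sq_sqrt (Finset.sum_nonneg fun α _ => hnn α)]
  have := Finset.single_le_sum (fun α _ => hnn α)
    (Finset.mem_univ fun i => (⟨α i, hle i⟩ : Fin (m + 1)))
  simpa only [if_pos hα] using this

lemma MemH.exists_isH2 {r : ℝ} (hr : 0 < r) (hQ : Q.StarShapedBall r) {m : ℕ} (hm : 2 ≤ m)
    {u : (Fin (n + 1) → ℝ) → ℂ} (hu : MemH Q m u) :
    ∃ t tg, IsH2 Q u (fun i => weakJet Q u (Pi.single i 1))
      (fun i j => weakJet Q u (Pi.single i 1 + Pi.single j 1)) t tg := by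
  have h1 : ∀ i, MemLp (weakJet Q u (Pi.single i 1)) 2 Q.vol := fun i =>
    (hu.weakJet_spec (by simp; omega)).1
  obtain ⟨t, ht⟩ := exists_isH1_of_weakPartial hr hQ hu.1 h1 fun i => by
    have := hu.weakPartial_weakJet 0 i (by simp; omega)
    rwa [weakJet_zero, zero_add] at this
  have h2 : ∀ i, ∃ tg, IsH1 Q (weakJet Q u (Pi.single i 1))
      (fun j => weakJet Q u (Pi.single i 1 + Pi.single j 1)) tg := fun i =>
    exists_isH1_of_weakPartial hr hQ (h1 i)
      (fun j => (hu.weakJet_spec (by simp [Finset.sum_add_distrib]; omega)).1)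
      fun j => hu.weakPartial_weakJet _ j (by simp; omega)
  choose tg htg using h2
  exact ⟨t, tg, ht, htg⟩

lemma IsH2.of_contDiff {w : (Fin (n + 1) → ℝ) → ℂ} (hw : ContDiff ℝ ∞ w) :
    IsH2 Q w (fun i => cderiv i w) (fun i j => cderiv j (cderiv i w)) w (fun i => cderiv i w) :=
  ⟨IsH1.of_contDiff hw, fun i => IsH1.of_contDiff (contDiff_cderiv hw i)⟩

lemma IsH2.sub {u v : (Fin (n + 1) → ℝ) → ℂ} {d d' : Fin (n + 1) → (Fin (n + 1) → ℝ) → ℂ}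
    {dd dd' : Fin (n + 1) → Fin (n + 1) → (Fin (n + 1) → ℝ) → ℂ} {t t' : (Fin (n + 1) → ℝ) → ℂ}
    {tg tg' : Fin (n + 1) → (Fin (n + 1) → ℝ) → ℂ} (h : IsH2 Q u d dd t tg)
    (h' : IsH2 Q v d' dd' t' tg') :
    IsH2 Q (fun x => u x - v x) (fun i x => d i x - d' i x) (fun i j x => dd i j x - dd' i j x)
      (fun x => t x - t' x) (fun i x => tg i x - tg' i x) :=
  ⟨h.isH1.sub h'.isH1, fun i => (h.isH1_deriv i).sub (h'.isH1_deriv i)⟩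

lemma L2Tendsto.tendsto_integral_norm_sub_sq {α : Type*} [MeasurableSpace α] {μ : Measure α}
    {w : ℕ → α → ℂ} {F : α → ℂ} (h : L2Tendsto μ w F) :
    Tendsto (fun m => ∫ x, ‖F x - w m x‖ ^ 2 ∂μ) atTop (𝓝 0) := by
  have h1 : ∀ m, ∫ x, ‖F x - w m x‖ ^ 2 ∂μ = ‖h.2.1.toLp F - (h.1 m).toLp (w m)‖ ^ 2 := fun m => by
    rw [← MemLp.toLp_sub, norm_toLp_sq]
    rfl
  simp only [h1]
  have h2 := ((tendsto_const_nhds (x := h.2.1.toLp F)).sub h.tendsto_toLp).norm.pow 2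
  simpa using h2

/-- By `exists_energy_bound` it is enough that the derivatives of order at most two converge in
L²(Ω); no separate convergence on Γ is required. -/
lemma IsH2.tendsto_energyMap {r : ℝ} (hr : 0 < r) (hQ : Q.StarShapedBall r)
    {u : (Fin (n + 1) → ℝ) → ℂ} {d : Fin (n + 1) → (Fin (n + 1) → ℝ) → ℂ}
    {dd : Fin (n + 1) → Fin (n + 1) → (Fin (n + 1) → ℝ) → ℂ} {t : (Fin (n + 1) → ℝ) → ℂ}
    {tg : Fin (n + 1) → (Fin (n + 1) → ℝ) → ℂ} (h : IsH2 Q u d dd t tg)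
    {w : ℕ → (Fin (n + 1) → ℝ) → ℂ} {d' : ℕ → Fin (n + 1) → (Fin (n + 1) → ℝ) → ℂ}
    {dd' : ℕ → Fin (n + 1) → Fin (n + 1) → (Fin (n + 1) → ℝ) → ℂ}
    {t' : ℕ → (Fin (n + 1) → ℝ) → ℂ} {tg' : ℕ → Fin (n + 1) → (Fin (n + 1) → ℝ) → ℂ}
    (h' : ∀ m, IsH2 Q (w m) (d' m) (dd' m) (t' m) (tg' m)) (hu : u ∈ H2space Q)
    (hw : ∀ m, w m ∈ H2space Q)
    (t0 : Tendsto (fun m => ∫ x, ‖u x - w m x‖ ^ 2 ∂Q.vol) atTop (𝓝 0))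
    (t1 : ∀ i, Tendsto (fun m => ∫ x, ‖d i x - d' m i x‖ ^ 2 ∂Q.vol) atTop (𝓝 0))
    (t2 : ∀ i j, Tendsto (fun m => ∫ x, ‖dd i j x - dd' m i j x‖ ^ 2 ∂Q.vol) atTop (𝓝 0))
    (k : ℝ) :
    Tendsto (fun m => ‖energyMap Q k (⟨u, hu⟩ - ⟨w m, hw m⟩)‖) atTop (𝓝 0) := by
  obtain ⟨C, -, hC⟩ := exists_energy_bound hr hQ
  have lim := ((((t0.const_mul (1 + k ^ 2 + k ^ 4)).add ((tendsto_finsetSum Finset.univ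
    fun i _ => t1 i).const_mul (1 + k ^ 2))).add (tendsto_finsetSum Finset.univ fun i _ =>
      tendsto_finsetSum Finset.univ fun j _ => t2 i j)).const_mul C)
  simp only [Finset.sum_const_zero, mul_zero, add_zero] at lim
  have hsq : Tendsto (fun m => ‖energyMap Q k (⟨u, hu⟩ - ⟨w m, hw m⟩)‖ ^ 2) atTop (𝓝 0) := by
    refine squeeze_zero (fun m => sq_nonneg _) (fun m => ?_) lim
    have hn1 : ∀ i, 0 ≤ ∫ x, ‖d i x - d' m i x‖ ^ 2 ∂Q.vol :=
      fun i => integral_nonneg fun x => sq_nonneg _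
    have hn2 : ∀ i j, 0 ≤ ∫ x, ‖dd i j x - dd' m i j x‖ ^ 2 ∂Q.vol :=
      fun i j => integral_nonneg fun x => sq_nonneg _
    have hsub : IsH2 Q ((⟨u, hu⟩ - ⟨w m, hw m⟩ : H2space Q) : (Fin (n + 1) → ℝ) → ℂ) _ _ _ _ :=
      h.sub (h' m)
    exact hC k _ _ _ _ _ hsub (∫ x, ‖u x - w m x‖ ^ 2 ∂Q.vol)
      (∑ i, ∫ x, ‖d i x - d' m i x‖ ^ 2 ∂Q.vol) (∑ i, ∑ j, ∫ x, ‖dd i j x - dd' m i j x‖ ^ 2 ∂Q.vol)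
      le_rfl (fun i => Finset.single_le_sum (fun i _ => hn1 i) (Finset.mem_univ i))
      fun i j => (Finset.single_le_sum (fun j _ => hn2 i j) (Finset.mem_univ j)).trans
        (Finset.single_le_sum (f := fun i => ∑ j, ∫ x, ‖dd i j x - dd' m i j x‖ ^ 2 ∂Q.vol)
          (fun i _ => Finset.sum_nonneg fun j _ => hn2 i j) (Finset.mem_univ i))
  have := hsq.sqrt
  simpa using this

/-- Smooth functions whose derivatives of order four stay bounded by the `H⁴` norm approximate
`u ∈ H⁴(Ω)` in the energy norm. -/
lemma MemH.exists_smooth_approx {r : ℝ} (hr : 0 < r) (hQ : Q.StarShapedBall r)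
    {u : (Fin (n + 1) → ℝ) → ℂ} (hu : MemH Q 4 u) (hu2 : u ∈ H2space Q) (k : ℝ) {δ : ℝ}
    (hδ : 0 < δ) :
    ∃ (w : (Fin (n + 1) → ℝ) → ℂ) (_ : ContDiff ℝ ∞ w) (hw2 : w ∈ H2space Q),
      ‖energyMap Q k (⟨u, hu2⟩ - ⟨w, hw2⟩)‖ ≤ δ ∧
      ∀ ℓ : ℂ →L[ℝ] ℝ, (∀ z, |ℓ z| ≤ ‖z‖) → ∀ α, ∑ i, α i = 4 →
        ∫ x, mderiv α (fun y => ℓ (w y)) x ^ 2 ∂Q.vol ≤ 2 ^ (n + 1) * normH Q 4 u ^ 2 := by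
  obtain ⟨s, κ, δ', hκ, hs, hs1, hδ', hdist⟩ := exists_smoothingKernels Q
  obtain ⟨t, tg, hH2⟩ := hu.exists_isH2 hr hQ (by norm_num)
  set W := weakJet Q u with hWdef
  have hW : ∀ α, ∑ i, α i ≤ 4 → MemLp (W α) 2 Q.vol := fun α hα => (hu.weakJet_spec hα).1
  have hW0 : W 0 = u := weakJet_zero Q u
  have hd := hu.weakPartial_weakJet
  set w := fun m => smoothing Q (s m) (κ m) u with hw
  have hws : ∀ m, ContDiff ℝ ∞ (w m) := fun m => contDiff_smoothing (hκ m) hu.1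
  have hwH2 : ∀ m, w m ∈ H2space Q := fun m => ⟨_, _, _, _, IsH2.of_contDiff (hws m)⟩
  have hL : ∀ α, ∑ i, α i ≤ 4 → L2Tendsto Q.vol (fun m => smoothing Q (s m) (κ m) (W α)) (W α) :=
    fun α hα => l2Tendsto_smoothing hκ hs hδ' hdist (hW α hα)
  have hsc : Tendsto (fun m => (s m : ℂ)) atTop (𝓝 1) := by
    have h := (Complex.continuous_ofReal.tendsto 1).comp hs1
    rwa [Complex.ofReal_one] at h
  have c1 : ∀ m i, ∀ x ∈ Q.dom,
      cderiv i (w m) x = s m * smoothing Q (s m) (κ m) (W (Pi.single i 1)) x := by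
    intro m i x hx
    have h := hd 0 i (by simp)
    rw [zero_add, weakJet_zero] at h
    exact cderiv_smoothing (hκ m) hu.1 h hx
  have c2 : ∀ m i j, ∀ x ∈ Q.dom, cderiv j (cderiv i (w m)) x =
      (s m : ℂ) ^ 2 * smoothing Q (s m) (κ m) (W (Pi.single i 1 + Pi.single j 1)) x := by
    intro m i j x hx
    have hWi := hW (Pi.single i 1) (by simp)
    have h := cderiv_smoothing (hκ m) hWi (hd (Pi.single i 1) j (by simp)) hx
    have hev : cderiv i (w m) =ᶠ[𝓝 x]
        fun y => (s m : ℂ) * smoothing Q (s m) (κ m) (W (Pi.single i 1)) y := by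
      filter_upwards [Q.isOpen_dom.mem_nhds hx] with y hy using c1 m i y hy
    have hdif : DifferentiableAt ℝ (smoothing Q (s m) (κ m) (W (Pi.single i 1))) x :=
      (contDiff_smoothing (hκ m) hWi).differentiable (by simp) x
    rw [cderiv] at h
    rw [cderiv, hev.fderiv_eq, fderiv_const_mul hdif, _root_.smul_apply, h]
    simp only [smul_eq_mul]
    ring
  have t0 : Tendsto (fun m => ∫ x, ‖u x - w m x‖ ^ 2 ∂Q.vol) atTop (𝓝 0) :=
    (l2Tendsto_smoothing hκ hs hδ' hdist hu.1).tendsto_integral_norm_sub_sq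
  have t1 : ∀ i, Tendsto (fun m => ∫ x, ‖W (Pi.single i 1) x - cderiv i (w m) x‖ ^ 2 ∂Q.vol)
      atTop (𝓝 0) := fun i => by
    have h := (hL (Pi.single i 1) (by simp)).smul_tendsto hsc
    rw [one_smul] at h
    refine (h.congr_left fun m => ?_).tendsto_integral_norm_sub_sq
    filter_upwards [Q.ae_mem_dom] with x hx
    rw [c1 m i x hx]
    rfl
  have t2 : ∀ i j, Tendsto (fun m => ∫ x, ‖W (Pi.single i 1 + Pi.single j 1) x -
      cderiv j (cderiv i (w m)) x‖ ^ 2 ∂Q.vol) atTop (𝓝 0) := fun i j => by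
    have h := (hL (Pi.single i 1 + Pi.single j 1) (by simp [Finset.sum_add_distrib])).smul_tendsto
      (hsc.pow 2)
    rw [one_pow, one_smul] at h
    refine (h.congr_left fun m => ?_).tendsto_integral_norm_sub_sq
    filter_upwards [Q.ae_mem_dom] with x hx
    rw [c2 m i j x hx]
    rfl
  obtain ⟨m, hm⟩ := (hH2.tendsto_energyMap hr hQ (fun m => IsH2.of_contDiff (hws m)) hu2 hwH2
    t0 t1 t2 k |>.eventually_lt_const hδ).exists
  refine ⟨w m, hws m, hwH2 m, ?_, ?_⟩
  · exact hm.le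
  · intro ℓ hℓ α hα
    have hmd : ∀ x ∈ Q.dom, mderiv α (fun y => ℓ (w m y)) x =
        ℓ ((s m : ℂ) ^ 4 * smoothing Q (s m) (κ m) (W α) x) := fun x hx => by
      have := mderiv_comp_smoothing (hκ m) ℓ hW hd 4 le_rfl α hα hx
      rwa [hW0] at this
    -- The factor 2^{n+1} comes from s ≥ 1/2 in the bound for the smoothing operator; the factor s⁴
    -- is at most one.
    refine le_trans ?_ ((integral_norm_sq_smoothing_le (hκ m) (hs m).1 (hW α hα.le)).trans
      (mul_le_mul_of_nonneg_left (hu.integral_weakJet_le hα.le) (by positivity)))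
    refine integral_mono_of_nonneg (Eventually.of_forall fun _ => by positivity)
      (integrable_norm_sq (Q.memLp_vol_of_continuous
        (contDiff_smoothing (hκ m) (hW α hα.le)).continuous 2)) ?_
    filter_upwards [Q.ae_mem_dom] with x hx
    rw [hmd x hx, ← sq_abs]
    have hs4 : ‖(s m : ℂ) ^ 4‖ ≤ 1 := by
      rw [norm_pow, Complex.norm_real, Real.norm_eq_abs, abs_of_nonneg (by linarith [(hs m).1])]
      exact pow_le_one₀ (by linarith [(hs m).1]) (hs m).2
    gcongr
    refine (hℓ _).trans ?_
    rw [norm_mul]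
    exact mul_le_of_le_one_left (norm_nonneg _) hs4

/-- Approximation of `u ∈ H⁴(Ω)` from the finite element space in the energy norm. -/
theorem exists_energy_approx (hn : n ≤ 1) {r : ℝ} (hr : 0 < r) (hQ : Q.StarShapedBall r) :
    ∃ C : ℝ, 0 ≤ C ∧ ∀ (k : ℝ) (u : H2space Q), MemH Q 4 u → ∀ (T : Mesh Q) (p : ℕ), 3 ≤ p →
      ∀ (N : ℕ) (φ : Module.Basis (Fin N) ℝ (T.space p)) (δ : ℝ), 0 < δ →
      ∃ a : Fin N → ℂ, ‖energyMap Q k (u - synth (basisH2 hr hQ φ) a)‖ ≤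
        δ + C * √((1 + k ^ 2 + k ^ 4) * T.width ^ 8 + (1 + k ^ 2) * T.width ^ 6 + T.width ^ 4) *
          normH Q 4 u := by
  obtain ⟨C, hC0, hC⟩ := exists_energy_bound hr hQ
  -- The factor 2 is for real and imaginary parts, C for the energy bound, 9 for interpolation and
  -- 2^{n+1} for smoothing.
  refine ⟨2 * √(C * 9 * 2 ^ (n + 1)), by positivity, ?_⟩
  intro k u hu T p hp N φ δ hδ
  obtain ⟨w, hws, hw2, hwu, hw4⟩ := hu.exists_smooth_approx hr hQ u.2 k hδ
  set E := (1 + k ^ 2 + k ^ 4) * T.width ^ 8 + (1 + k ^ 2) * T.width ^ 6 + T.width ^ 4 with hE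
  have hN0 : 0 ≤ normH Q 4 u := Real.sqrt_nonneg _
  -- The finite element space is real, so the real and imaginary parts of the smooth approximation w
  -- are interpolated separately.
  have part : ∀ ℓ : ℂ →L[ℝ] ℝ, (∀ z, |ℓ z| ≤ ‖z‖) → ∃ v ∈ T.space p,
      ∃ he : (fun x => (((fun y => ℓ (w y)) - v) x : ℂ)) ∈ H2space Q,
        ‖energyMap Q k ⟨_, he⟩‖ ≤ √(C * 9 * 2 ^ (n + 1)) * √E * normH Q 4 u := by
    intro ℓ hℓ
    have hsm : ContDiff ℝ ∞ fun y => ℓ (w y) := ℓ.contDiff.comp hws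
    obtain ⟨v, hv, b0, b1, b2⟩ := T.exists_approx hn hp hsm (by positivity) (hw4 ℓ hℓ)
    have hps : T.IsPiecewiseSmooth ((fun y => ℓ (w y)) - v) :=
      (Mesh.IsPiecewiseSmooth.of_contDiff hsm).sub (.of_mem_space hv)
    refine ⟨v, hv, Mesh.ofReal_mem_H2space hr hQ hps, ?_⟩
    obtain ⟨t, tg, hH2⟩ := hps.exists_isH2 hr hQ
    have h := hC k ⟨_, Mesh.ofReal_mem_H2space hr hQ hps⟩ _ _ _ _ hH2 _ _ _
      (by simpa only [Complex.norm_real, Real.norm_eq_abs, sq_abs] using b0)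
      (fun i => by simpa only [Complex.norm_real, Real.norm_eq_abs, sq_abs] using b1 i)
      (fun i j => by simpa only [Complex.norm_real, Real.norm_eq_abs, sq_abs] using b2 i j)
    refine le_of_sq_le_sq (h.trans (le_of_eq ?_)) (by positivity)
    have hwd := T.width_nonneg
    rw [mul_pow, mul_pow, Real.sq_sqrt (by positivity), Real.sq_sqrt (by positivity), hE]
    ring
  obtain ⟨v₁, hv₁, he₁, b₁⟩ := part Complex.reCLM Complex.abs_re_le_norm
  obtain ⟨v₂, hv₂, he₂, b₂⟩ := part Complex.imCLM Complex.abs_im_le_norm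
  refine ⟨fun j => (φ.repr ⟨v₁, hv₁⟩ j : ℂ) + (φ.repr ⟨v₂, hv₂⟩ j : ℂ) * I, ?_⟩
  have hrep : ∀ (v) (hv : v ∈ T.space p) (x),
      ∑ j, (φ.repr ⟨v, hv⟩ j : ℂ) * basisFun φ j x = (v x : ℂ) := fun v hv x => by
    have h := congrArg (fun q : T.space p => (q : (Fin (n + 1) → ℝ) → ℝ) x) (φ.sum_repr ⟨v, hv⟩)
    simp only [Submodule.coe_sum, Submodule.coe_smul, Finset.sum_apply, Pi.smul_apply,
      smul_eq_mul] at h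
    rw [← h]
    push_cast
    rfl
  have hdec : u - synth (basisH2 hr hQ φ)
        (fun j => (φ.repr ⟨v₁, hv₁⟩ j : ℂ) + (φ.repr ⟨v₂, hv₂⟩ j : ℂ) * I) =
      (⟨u, u.2⟩ - ⟨w, hw2⟩) + (⟨_, he₁⟩ + I • ⟨_, he₂⟩) := by
    refine Subtype.ext (funext fun x => ?_)
    have e1 : feFun (basisFun φ)
        (fun j => (φ.repr ⟨v₁, hv₁⟩ j : ℂ) + (φ.repr ⟨v₂, hv₂⟩ j : ℂ) * I) x =
        (v₁ x : ℂ) + I * (v₂ x : ℂ) := by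
      rw [← hrep v₁ hv₁ x, ← hrep v₂ hv₂ x, feFun, Finset.mul_sum, ← Finset.sum_add_distrib]
      exact Finset.sum_congr rfl fun j _ => by ring
    have e2 := Complex.re_add_im (w x)
    simp only [Submodule.coe_sub, Submodule.coe_add, Submodule.coe_smul, Pi.sub_apply, Pi.add_apply,
      Pi.smul_apply, coe_synth_basisH2, e1, smul_eq_mul, Complex.reCLM_apply, Complex.imCLM_apply]
    push_cast
    linear_combination -e2
  rw [hdec, map_add, map_add, map_smul]
  refine (norm_add_le _ _).trans (add_le_add hwu ((norm_add_le _ _).trans ?_))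
  rw [norm_smul, Complex.norm_I, one_mul]
  linarith

end SobolevApprox

end HelmholtzMS

namespace HelmholtzMS

/-! ### The error of the GMRES iterates -/

section Assembly

open Set Filter Topology

variable {n : ℕ} {Q : Box n}

lemma normH_zero_eq (u : (Fin (n + 1) → ℝ) → ℂ) :
    normH Q 0 u = √(∫ x, ‖weakDeriv Q 0 u x‖ ^ 2 ∂Q.vol) := by
  have hz : ∀ α : Fin (n + 1) → Fin (0 + 1), (fun i => (α i : ℕ)) = 0 := fun α => by
    funext i
    exact Nat.lt_one_iff.1 (α i).isLt
  rw [normH]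
  simp only [hz]
  simp

/-- Four oscillation steps give k⁴ times the L² norm, and one factor k is absorbed by the k-weighted
L² term of the H¹_k norm. -/
lemma Oscillatory.normH_four_le {K k : ℝ} (hk : 0 < k) {u : (Fin (n + 1) → ℝ) → ℂ}
    (h : Oscillatory Q K k u) : normH Q 4 u ≤ |K| ^ 4 * k ^ 3 * normH1k Q k u := by
  have hnn : ∀ m, 0 ≤ normH Q m u := fun m => Real.sqrt_nonneg _
  have step : ∀ m ≤ 3, normH Q (m + 1) u ≤ |K| * k * normH Q m u := fun m hm =>
    (h.2 m hm).trans (by gcongr; exacts [hnn m, le_abs_self K])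
  have h4 : normH Q 4 u ≤ (|K| * k) ^ 4 * normH Q 0 u := by
    have hK : 0 ≤ |K| * k := by positivity
    calc normH Q 4 u ≤ |K| * k * (|K| * k * (|K| * k * (|K| * k * normH Q 0 u))) := by
          refine (step 3 le_rfl).trans ?_
          gcongr
          refine (step 2 (by norm_num)).trans ?_
          gcongr
          refine (step 1 (by norm_num)).trans ?_
          gcongr
          exact step 0 (by norm_num)
      _ = _ := by ring
  have h0 : k * normH Q 0 u ≤ normH1k Q k u := by
    have e : ∫ x, ‖weakDeriv Q 0 u x‖ ^ 2 ∂Q.vol = ∫ x, ‖u x‖ ^ 2 ∂Q.vol := by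
      refine integral_congr_ae ?_
      filter_upwards [h.1.weakDeriv_zero_ae_eq] with x hx
      rw [hx]
    rw [normH_zero_eq, e, normH1k]
    refine Real.le_sqrt_of_sq_le ?_
    rw [mul_pow, Real.sq_sqrt (by positivity)]
    exact le_add_of_nonneg_left (Finset.sum_nonneg fun i _ => by positivity)
  calc normH Q 4 u ≤ |K| ^ 4 * k ^ 3 * (k * normH Q 0 u) := h4.trans (le_of_eq (by ring))
    _ ≤ _ := by gcongr

/-- The resolution condition `h k^{3/2} ≤ C` controls the approximation error. -/
lemma sqrt_approx_mul_le {k₀ k h C : ℝ} (hk₀ : 0 < k₀) (hk : k₀ ≤ k) (hh : 0 ≤ h) (hC1 : C ≤ 1)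
    (hC : h * k ^ (3 / 2 : ℝ) ≤ C) :
    √((1 + k ^ 2 + k ^ 4) * h ^ 8 + (1 + k ^ 2) * h ^ 6 + h ^ 4) * k ^ 3 ≤
      C * √(1 + (k₀⁻¹ + k₀⁻¹ ^ 3) + (k₀⁻¹ ^ 2 + k₀⁻¹ ^ 4 + k₀⁻¹ ^ 6)) := by
  have hk0 : 0 < k := hk₀.trans_le hk
  have hX0 : 0 ≤ h * k ^ (3 / 2 : ℝ) := by positivity
  have hz : (h * k ^ (3 / 2 : ℝ)) ^ 2 = h ^ 2 * k ^ 3 := by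
    rw [mul_pow, ← Real.rpow_natCast (k ^ (3 / 2 : ℝ)), ← Real.rpow_mul hk0.le]
    norm_num
  -- z = (hk^{3/2})² is the leading approximation error; as C ≤ 1, it is at most C² ≤ C.
  set z := h ^ 2 * k ^ 3 with hzdef
  have hz0 : 0 ≤ z := by positivity
  have hC0 : 0 ≤ C := hX0.trans hC
  have hzC : z ≤ C := by
    rw [← hz]
    nlinarith
  have hz1 : z ≤ 1 := hzC.trans hC1
  have hinv : k⁻¹ ≤ k₀⁻¹ := by gcongr
  have hki : k * k⁻¹ = 1 := mul_inv_cancel₀ hk0.ne'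
  -- Written in powers of z, every remaining term carries only negative powers of k, which k ≥ k₀
  -- bounds.
  have e : ((1 + k ^ 2 + k ^ 4) * h ^ 8 + (1 + k ^ 2) * h ^ 6 + h ^ 4) * (k ^ 3) ^ 2 =
      z ^ 2 * (1 + z * (k⁻¹ + k⁻¹ ^ 3) + z ^ 2 * (k⁻¹ ^ 2 + k⁻¹ ^ 4 + k⁻¹ ^ 6)) := by
    rw [hzdef]
    field_simp
    ring
  calc _ = √(((1 + k ^ 2 + k ^ 4) * h ^ 8 + (1 + k ^ 2) * h ^ 6 + h ^ 4) * (k ^ 3) ^ 2) := by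
        rw [Real.sqrt_mul (by positivity), Real.sqrt_sq (by positivity)]
    _ ≤ √(C ^ 2 * (1 + (k₀⁻¹ + k₀⁻¹ ^ 3) + (k₀⁻¹ ^ 2 + k₀⁻¹ ^ 4 + k₀⁻¹ ^ 6))) := by
        refine Real.sqrt_le_sqrt ?_
        rw [e]
        have hz2 : z ^ 2 ≤ 1 := pow_le_one₀ hz0 hz1
        have a1 : z * (k⁻¹ + k⁻¹ ^ 3) ≤ k₀⁻¹ + k₀⁻¹ ^ 3 :=
          (mul_le_of_le_one_left (by positivity) hz1).trans (by gcongr)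
        have a2 : z ^ 2 * (k⁻¹ ^ 2 + k⁻¹ ^ 4 + k⁻¹ ^ 6) ≤ k₀⁻¹ ^ 2 + k₀⁻¹ ^ 4 + k₀⁻¹ ^ 6 :=
          (mul_le_of_le_one_left (by positivity) hz2).trans (by gcongr)
        gcongr
    _ = _ := by rw [Real.sqrt_mul (by positivity), Real.sqrt_sq hC0]

/-- Combines Céa's factor q, the approximation estimate, the oscillation bound and the mesh
condition; P collects the constants so that the smallness requirement reads PC ≤ ε/2. -/
lemma quasiOptimal_error_le {q Ca τ η H κ c S C P ε δ e : ℝ} (hq : 0 < q) (hCa : 0 ≤ Ca)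
    (hκ : 0 ≤ κ) (hτ : 0 ≤ τ) (hH : 0 ≤ H) (he : e ≤ δ / q + Ca * τ * η) (hη : η ≤ κ * c * H)
    (hres : τ * c ≤ C * S) (hP : P = q * (Ca * (κ * S))) (hC : P * C ≤ ε / 2) :
    q * e ≤ δ + ε / 2 * H := by
  have h1 : τ * η ≤ κ * (C * S) * H := by
    calc τ * η ≤ τ * (κ * c * H) := by gcongr
      _ = κ * (τ * c) * H := by ring
      _ ≤ _ := by gcongr
  calc q * e ≤ q * (δ / q + Ca * τ * η) := by gcongr
    _ = δ + q * Ca * (τ * η) := by field_simp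
    _ ≤ δ + q * Ca * (κ * (C * S) * H) := by gcongr
    _ = δ + P * C * H := by rw [hP]; ring
    _ ≤ _ := by gcongr

end Assembly

end HelmholtzMS

/-! ### The main theorem -/

theorem mainTheorem2 (n : ℕ) (hn : n ≤ 1) (Q : Box n)
    (γ : ℝ) (hγ : 0 < γ) (hstar : Q.StarShapedBall (γ * Q.diameter))
    (p : ℕ) (hp : 3 ≤ p) (Kβ K₁ K₂ : ℝ)
    (ε k₀ : ℝ) (hε : 0 < ε) (hε1 : ε < 1) (hk₀ : 0 < k₀) :
    ∃ C : ℝ, 0 < C ∧ ∃ m₀ : ℕ,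
      ∀ k : ℝ, k₀ ≤ k →
      ∀ β : ℝ, Q.diameter / 2 * (1 + 4 / γ + γ / 2) ≤ β → β ≤ Kβ * Q.diameter →
      ∀ f g u : (Fin (n + 1) → ℝ) → ℂ, MemLp f 2 Q.vol → MemLp g 2 Q.surf →
        IsIIPSolution Q k f g u → Oscillatory Q K₁ k u → NormsComparable Q K₂ k u →
      ∀ T : Mesh Q, T.width * k ^ (3 / 2 : ℝ) ≤ C →
      ∀ (N : ℕ) (φ : Module.Basis (Fin N) ℝ (T.space p)),
      ∀ (B D : Matrix (Fin N) (Fin N) ℂ) (G : Fin N → ℂ),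
        B = galerkinMat Q k (basisFun φ) (k ^ 2) β →
        D = precond Q k (basisFun φ) →
        G = loadVec Q k (basisFun φ) (k ^ 2) β f g →
        D.PosDef ∧ (∃! c, B *ᵥ c = G) ∧
        ∀ m : ℕ, m₀ ≤ m →
          (∃! c, IsGMRESIterate D (D⁻¹ * B) (D⁻¹ *ᵥ G) m c) ∧
          ∀ c, IsGMRESIterate D (D⁻¹ * B) (D⁻¹ *ᵥ G) m c →
            normH1k Q k (u - feFun (basisFun φ) c) ≤ ε * normH1k Q k u := by
  have hL := Q.diameter_pos
  set L := Q.diameter with hLdef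
  have hr : 0 < γ * L := by positivity
  obtain ⟨R, hR0, hR⟩ := Q.exists_coord_bound
  obtain ⟨Ca, hCa0, hCa⟩ := exists_energy_approx hn hr hstar
  set α : ℝ := min (1 / 2) (γ * L / 4) with hα
  have hα0 : 0 < α := lt_min (by norm_num) (by positivity)
  set b : ℝ := |Kβ| * L
  set C₁ : ℝ := (n + 1) * R + (n / (2 * k₀) + b) with hC₁
  have hC₁0 : 0 ≤ C₁ := by positivity
  set M : ℝ := (n + 1) + 1 + C₁ + 1 + ((R + C₁) + C₁ + R + (n + 1) * R) with hM
  have hM0 : 0 < M := by positivity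
  set S : ℝ := √(1 + (k₀⁻¹ + k₀⁻¹ ^ 3) + (k₀⁻¹ ^ 2 + k₀⁻¹ ^ 4 + k₀⁻¹ ^ 6))
  set P : ℝ := (1 + M / α) * (Ca * (|K₁| ^ 4 * S)) with hP
  have hP0 : 0 ≤ P := by positivity
  set ρ : ℝ := √(1 - (α / M) ^ 2) with hρ
  have hρ1 : ρ < 1 := by
    rw [hρ, Real.sqrt_lt' one_pos]
    have : 0 < (α / M) ^ 2 := by positivity
    linarith
  -- The index m₀ is chosen before k and the mesh, from M/α, K₂ and ε only: it makes the algebraic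
  -- error at most ε/2 of ‖u‖_{H¹_k}.
  have hlim : Filter.Tendsto (fun m : ℕ => (M / α) ^ 2 * |K₂| * ρ ^ m) Filter.atTop (nhds 0) := by
    have := (tendsto_pow_atTop_nhds_zero_of_lt_one (Real.sqrt_nonneg _) hρ1).const_mul
      ((M / α) ^ 2 * |K₂|)
    rwa [mul_zero] at this
  obtain ⟨m₀, hm₀⟩ := Filter.eventually_atTop.1
    (hlim.eventually_le_const (by positivity : 0 < ε / 2))
  -- The bound by 1 lets powers of hk^{3/2} be estimated linearly; the second bound makes the
  -- discretisation error at most ε/2, with P + 1 in place of P in case P = 0.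
  refine ⟨min 1 (ε / (2 * (P + 1))), by positivity, m₀, ?_⟩
  intro k hk β hβ hβK f g u hf hg hsol hosc hcomp T hT N φ B D G hB hD hG
  have hk0 : 0 < k := hk₀.trans_le hk
  have hβ0 : 0 ≤ β := le_trans (by positivity) hβ
  have hβb : |β| ≤ b := by
    rw [abs_of_nonneg hβ0]
    exact hβK.trans (mul_le_mul_of_nonneg_right (le_abs_self _) hL.le)
  obtain ⟨t, tg, hH2⟩ := hosc.1.exists_isH2 hr hstar (by norm_num)
  set U : H2space Q := ⟨u, _, _, _, _, hH2⟩ with hU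
  have main := galerkin_gmres_error (energyMap Q k) (msForm Q k β) hα0 hM0
    (fun v w => norm_msForm_le β w v hk₀ hk hβb hR hC₁)
    (fun v => msForm_coercive hγ hstar hk0 hβ v) (basisH2 hr hstar φ)
    (fun c h => eq_zero_of_energyMap_synth hr hstar hk0.ne' φ c h) U B D G
    (by
      rw [hB]
      ext i j
      exact formB_eq_msForm hk0.ne' β (basisH2 hr hstar φ j) (basisH2 hr hstar φ i))
    (by
      rw [hD]
      exact precond_eq_gram k (basisH2 hr hstar φ) fun j x => Complex.conj_ofReal _)
    (by
      rw [hG]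
      funext i
      exact formG_eq_msForm hk0.ne' β hf hg U (basisH2 hr hstar φ i) hsol)
  refine ⟨main.1, main.2.1, fun m hm => ⟨(main.2.2 m).1, fun c hc => ?_⟩⟩
  have hle : normH1k Q k (u - feFun (basisFun φ) c) ≤
      ‖energyMap Q k (U - synth (basisH2 hr hstar φ) c)‖ := by
    have := normH1k_le_energy k (U - synth (basisH2 hr hstar φ) c)
    rwa [Submodule.coe_sub, coe_synth_basisH2] at this
  have hH0 : 0 ≤ normH1k Q k u := Real.sqrt_nonneg _
  have hUn : ‖energyMap Q k U‖ ≤ |K₂| * normH1k Q k u := by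
    rw [norm_energyMap_eq]
    exact hcomp.2.2.1.trans (by gcongr; exact le_abs_self _)
  -- Passing through a smooth approximation of u leaves an arbitrarily small error δ, which is
  -- removed here.
  refine le_of_forall_pos_le_add fun δ hδ => hle.trans ?_
  have hfac : 0 < 1 + M / α := by positivity
  obtain ⟨a, ha⟩ := hCa k U hosc.1 T p hp N φ (δ / (1 + M / α)) (by positivity)
  refine ((main.2.2 m).2 c hc a).trans ?_
  have hres := sqrt_approx_mul_le hk₀ hk T.width_nonneg (min_le_left _ _) hT
  set C := min 1 (ε / (2 * (P + 1)))
  have hCε : P * C ≤ ε / 2 := by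
    have h1 : C ≤ ε / (2 * (P + 1)) := min_le_right _ _
    calc P * C ≤ P * (ε / (2 * (P + 1))) := by gcongr
      _ ≤ (P + 1) * (ε / (2 * (P + 1))) := by gcongr; linarith
      _ = ε / 2 := by field_simp
  have happ := quasiOptimal_error_le hfac hCa0 (by positivity) (Real.sqrt_nonneg _) hH0 ha
    (hosc.normH_four_le hk0) hres hP hCε
  have hit : (M / α) ^ 2 * ρ ^ m * ‖energyMap Q k U‖ ≤ ε / 2 * normH1k Q k u := by
    refine (mul_le_mul_of_nonneg_left hUn (by positivity)).trans ?_
    rw [← mul_assoc]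
    refine mul_le_mul_of_nonneg_right (le_trans (le_of_eq ?_) (hm₀ m hm)) hH0
    ring
  linarith
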